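/- Let $Y$ be a complex manifold of dimension $m$ with a nowhere-vanishing holomorphic $m$-form $\Omega$, and let $X\subset Y$ be a compact connected real slice, i.e. an embedded smooth real $m$-dimensional submanifold with $\mathbb C\otimes T_xX\cong T_xY$ for all $x\in X$, such that $\mathrm{Im}\,\Omega|_X=0$. Let $N=TY|_X/TX$ be the normal bundle, and consider the supermanifolds $\mathcal Y=\Pi\Omega^1Y=(Y,\Lambda^\bullet TY)$ and $\mathcal X=\Pi N^*=(X,\Lambda^\bullet N)$, with $\mathcal X\hookrightarrow\mathcal Y$ induced by $\Lambda^\bullet TY|_X\to\Lambda^\bullet N$. For holomorphic coordinates $z^\alpha=x^\alpha+i x^{\dot\alpha}$ on $Y$ put $\psi_\alpha=\Pi\,\partial/\partial x^\alpha$, $\psi_{\dot\alpha}=\Pi\,\partial/\partial x^{\dot\alpha}$, $\zeta_\alpha=\psi_{\dot\alpha}+i\psi_\alpha$. Then $(z^\alpha,\zeta_\alpha)$ are holomorphic coordinates on $\mathcal Y$, and $\mathcal Y$ carries the real Liouville form $\theta=\sum_\alpha (dx^\alpha\psi_\alpha+dx^{\dot\alpha}\psi_{\dot\alpha})$, the odd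 symplectic form $\eta=d\theta$, the holomorphic odd symplectic form $\eta_c=d\big(\sum_\alpha dz^\alpha\zeta_\alpha\big)$ (so $\eta=\mathrm{Im}\,\eta_c$), and the holomorphic volume form $\widehat\Omega=a(z)^2D^*(dz^\alpha,d\zeta_\alpha)$, where $\Omega=a(z)\,dz^1\wedge\dots\wedge dz^m$. An $(m|m)$-dimensional sub-supermanifold $\mathcal Z\hookrightarrow\mathcal Y$ is called a real slice if $\mathbb C\otimes\mathcal T\mathcal Z\cong\mathcal T_c\mathcal Y|_{\mathcal Z}$, special if in addition $\mathrm{Im}(\widehat\Omega|_{\mathcal Z})=0$, where $\widehat\Omega|_{\mathcal Z}$ is the induced section of $\mathbb C\otimes\mathrm{Ber}(\mathcal Z)$, and exact Lagrangian if $\theta|_{\mathcal Z}$ is exact; the same terms are used for families, relatively to the base. For $\mathcal X$ itself $\eta_c|_{\mathcal X}$ is a real odd symplectic form and $\mathrm{Re}(\widehat\Omega|_{\mathcal X})$ a nowhere-vanishing volume form; the associated Batalin–Vilkovisky operator is $\Delta f=\tfrac12\,\mathrm{div}\,H_f$, where $H_f$ is the Hamiltonian vector field of $f$ with respect to $\eta_c|_{\mathcal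 X}$ and the divergence is that of $\mathrm{Re}(\widehat\Omega|_{\mathcal X})$. Let $\mathcal N=\mathcal T\mathcal Y|_{\mathcal X}/\mathcal T\mathcal X$. Sections in $H^0(\mathcal X,\mathcal N)$ of parity $p$ are the infinitesimal deformations of $\mathcal X$ inside $\mathcal Y$ over $\mathbb R[\varepsilon]/\varepsilon^2$ with $\varepsilon$ of parity $p\in\{0,1\}$. Let $T_p\subset H^0(\mathcal X,\mathcal N)$ be the set of those for which the family consists of special exact Lagrangian real slices. Then $\Delta:\Gamma(\mathcal X,\mathcal O_{\mathcal X})/\mathbb R\to\Gamma(\mathcal X,\mathcal O_{\mathcal X})$ is a well-defined linear operator, $T_0$ and $T_1$ are vector subspaces, and the Zariski tangent space $T_0\oplus T_1$ to the moduli space of deformations of $\mathcal X$ within the class of special (exact) Lagrangian real slices is isomorphic to $\ker\Delta\subset\Gamma(\mathcal X,\mathcal O_{\mathcal X})/\mathbb R$. The isomorphism sends the class of $f$ to the normal section corresponding to $df$ under $\eta$: it is represented by a vector field $v$ along $\mathcal X$ with $\eta(w,v)=w(f)$ for all vector fields $w$ on $\mathcal X$. -/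

import Mathlib

open TopologicalSpace Manifold
open scoped ContDiff TensorProduct

noncomputable section

namespace SpecialSlice

/-! ## Superalgebra

A superalgebra is an `ℝ`-algebra `B` with its parity involution `σ : B →ₐ[ℝ] B`:
even elements satisfy `σ b = b`, odd elements satisfy `σ b = -b`. -/

section Algebra

variable {A B R : Type*} [Ring A] [Algebra ℝ A] [Ring B] [Algebra ℝ B] [Ring R] [Algebra ℝ R]

/-- `D` is a homogeneous (left) superderivation of parity `p` along the morphism `r : A → B`. -/
def IsSuperDer (σA : A →ₐ[ℝ] A) (σB : B →ₐ[ℝ] B) (r : A →ₐ[ℝ] B) (p : Fin 2)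
    (D : A →ₗ[ℝ] B) : Prop :=
  (∀ a b, D (a * b) = D a * r b + (σB ^ (p : ℕ)) (r a) * D b) ∧
    ∀ a, D (σA a) = (-1 : ℝ) ^ (p : ℕ) • σB (D a)

lemma IsSuperDer.zero {σA : A →ₐ[ℝ] A} {σB : B →ₐ[ℝ] B} {r : A →ₐ[ℝ] B} {p : Fin 2} :
    IsSuperDer σA σB r p 0 :=
  ⟨fun a b => by simp, fun a => by simp⟩

lemma IsSuperDer.add {σA : A →ₐ[ℝ] A} {σB : B →ₐ[ℝ] B} {r : A →ₐ[ℝ] B} {p : Fin 2}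
    {D E : A →ₗ[ℝ] B} (hD : IsSuperDer σA σB r p D) (hE : IsSuperDer σA σB r p E) :
    IsSuperDer σA σB r p (D + E) :=
  ⟨fun a b => by simp only [LinearMap.add_apply, hD.1, hE.1, add_mul, mul_add]; abel,
    fun a => by simp only [LinearMap.add_apply, hD.2, hE.2, map_add, smul_add]⟩

lemma IsSuperDer.smul {σA : A →ₐ[ℝ] A} {σB : B →ₐ[ℝ] B} {r : A →ₐ[ℝ] B} {p : Fin 2}
    {D : A →ₗ[ℝ] B} (hD : IsSuperDer σA σB r p D) (c : ℝ) :
    IsSuperDer σA σB r p (c • D) :=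
  ⟨fun a b => by
      simp only [LinearMap.smul_apply, hD.1, smul_add, smul_mul_assoc, mul_smul_comm],
    fun a => by simp only [LinearMap.smul_apply, hD.2, map_smul]; rw [smul_comm]⟩

/-- `w` is a homogeneous vector field of parity `p`, that is a superderivation of `B`. -/
abbrev IsVF (σ : B →ₐ[ℝ] B) (p : Fin 2) (w : B →ₗ[ℝ] B) : Prop :=
  IsSuperDer σ σ (AlgHom.id ℝ B) p w

/-- `B ⊗ ℝ[ε]/ε²` with `ε` of parity `p`: the pair `⟨a, b⟩` stands for `a + ε b`, and
`a ε = (-1)^{p |a|} ε a`. -/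
@[ext] structure Thick (B : Type*) [Ring B] [Algebra ℝ B] (σ : B →ₐ[ℝ] B) (p : Fin 2) where
  /-- The value at `ε = 0`. -/
  fst : B
  /-- The coefficient of `ε`. -/
  snd : B

namespace Thick

variable {σ : B →ₐ[ℝ] B} {p : Fin 2}

instance : Zero (Thick B σ p) := ⟨⟨0, 0⟩⟩
instance : One (Thick B σ p) := ⟨⟨1, 0⟩⟩
instance : Add (Thick B σ p) := ⟨fun a b => ⟨a.fst + b.fst, a.snd + b.snd⟩⟩
instance : Neg (Thick B σ p) := ⟨fun a => ⟨-a.fst, -a.snd⟩⟩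
instance : Mul (Thick B σ p) :=
  ⟨fun a b => ⟨a.fst * b.fst, a.snd * b.fst + (σ ^ (p : ℕ)) a.fst * b.snd⟩⟩
instance : SMul ℝ (Thick B σ p) := ⟨fun c a => ⟨c • a.fst, c • a.snd⟩⟩

@[simp] lemma fst_zero : (0 : Thick B σ p).fst = 0 := rfl
@[simp] lemma snd_zero : (0 : Thick B σ p).snd = 0 := rfl
@[simp] lemma fst_one : (1 : Thick B σ p).fst = 1 := rfl
@[simp] lemma snd_one : (1 : Thick B σ p).snd = 0 := rfl
@[simp] lemma fst_add (a b : Thick B σ p) : (a + b).fst = a.fst + b.fst := rfl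
@[simp] lemma snd_add (a b : Thick B σ p) : (a + b).snd = a.snd + b.snd := rfl
@[simp] lemma fst_neg (a : Thick B σ p) : (-a).fst = -a.fst := rfl
@[simp] lemma snd_neg (a : Thick B σ p) : (-a).snd = -a.snd := rfl
@[simp] lemma fst_mul (a b : Thick B σ p) : (a * b).fst = a.fst * b.fst := rfl
@[simp] lemma snd_mul (a b : Thick B σ p) :
    (a * b).snd = a.snd * b.fst + (σ ^ (p : ℕ)) a.fst * b.snd := rfl
@[simp] lemma fst_smul (c : ℝ) (a : Thick B σ p) : (c • a).fst = c • a.fst := rfl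
@[simp] lemma snd_smul (c : ℝ) (a : Thick B σ p) : (c • a).snd = c • a.snd := rfl

instance : Ring (Thick B σ p) where
  add_assoc a b c := by ext <;> simp [add_assoc]
  zero_add a := by ext <;> simp
  add_zero a := by ext <;> simp
  add_comm a b := by ext <;> simp [add_comm]
  left_distrib a b c := by ext <;> simp [mul_add]; abel
  right_distrib a b c := by ext <;> simp [add_mul]; abel
  zero_mul a := by ext <;> simp
  mul_zero a := by ext <;> simp
  mul_assoc a b c := by ext <;> simp [mul_assoc, add_mul, mul_add, add_assoc]
  one_mul a := by ext <;> simp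
  mul_one a := by ext <;> simp
  neg_add_cancel a := by ext <;> simp
  nsmul := nsmulRec
  zsmul := zsmulRec

instance : Module ℝ (Thick B σ p) where
  one_smul a := by ext <;> simp
  mul_smul c d a := by ext <;> simp [mul_smul]
  smul_zero c := by ext <;> simp
  smul_add c a b := by ext <;> simp
  add_smul c d a := by ext <;> simp [add_smul]
  zero_smul a := by ext <;> simp

instance : Algebra ℝ (Thick B σ p) :=
  Algebra.ofModule (fun c a b => by ext <;> simp) (fun c a b => by ext <;> simp)

/-- The `ε`-linear extension of a vector field `w` of parity `s` to `B ⊗ ℝ[ε]/ε²`: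
`w (a + ε b) = w a + (-1)^{p s} ε w b`. -/
def lift (σ : B →ₐ[ℝ] B) (p s : Fin 2) (w : B →ₗ[ℝ] B) : Thick B σ p →ₗ[ℝ] Thick B σ p where
  toFun a := ⟨w a.fst, (-1 : ℝ) ^ ((p : ℕ) * (s : ℕ)) • w a.snd⟩
  map_add' a b := by ext <;> simp
  map_smul' c a := by ext <;> simp [smul_comm c]

end Thick

/-- The algebra morphism `r + ε D : A → B ⊗ ℝ[ε]/ε²` defined by a superderivation `D` along `r`. -/
def thicken {σA : A →ₐ[ℝ] A} {σB : B →ₐ[ℝ] B} {r : A →ₐ[ℝ] B} {p : Fin 2} {D : A →ₗ[ℝ] B}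
    (hD : IsSuperDer σA σB r p D) : A →ₐ[ℝ] Thick B σB p :=
  AlgHom.ofLinearMap
    { toFun := fun a => ⟨r a, D a⟩
      map_add' := fun a b => by ext <;> simp
      map_smul' := fun c a => by ext <;> simp }
    (by
      have h := hD.1 1 1
      simp only [mul_one, map_one, one_mul] at h
      have h0 : D 1 = 0 := by simpa using h
      ext <;> simp [h0])
    (fun a b => by ext <;> simp [hD.1 a b])

/-- A system of `(m|m)` supercoordinates `(x, ξ)` on the superdomain with function algebra `B`,
together with the coordinate vector fields `∂/∂x`, `∂/∂ξ`. -/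
structure SuperCoords (B : Type*) [Ring B] [Algebra ℝ B] (σ : B →ₐ[ℝ] B) (m : ℕ) where
  /-- The even coordinates. -/
  x : Fin m → B
  /-- The odd coordinates. -/
  ξ : Fin m → B
  /-- The vector fields `∂/∂x`. -/
  dx : Fin m → B →ₗ[ℝ] B
  /-- The vector fields `∂/∂ξ`. -/
  dξ : Fin m → B →ₗ[ℝ] B
  x_even : ∀ i, σ (x i) = x i
  ξ_odd : ∀ j, σ (ξ j) = -ξ j
  dx_isVF : ∀ i, IsVF σ 0 (dx i)
  dξ_isVF : ∀ j, IsVF σ 1 (dξ j)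
  dx_x : ∀ i k, dx i (x k) = if i = k then 1 else 0
  dx_ξ : ∀ i k, dx i (ξ k) = 0
  dξ_x : ∀ j k, dξ j (x k) = 0
  dξ_ξ : ∀ j k, dξ j (ξ k) = if j = k then 1 else 0
  span : ∀ (p : Fin 2) (w : B →ₗ[ℝ] B), IsVF σ p w →
    ∀ b, w b = ∑ i, w (x i) * dx i b + ∑ j, w (ξ j) * dξ j b

/-- The element `a + i b` of the complexification `ℂ ⊗ R`. -/
def cpx (a b : R) : ℂ ⊗[ℝ] R := 1 ⊗ₜ[ℝ] a + Complex.I ⊗ₜ[ℝ] b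

/-- Real part `ℂ ⊗ R → R`. -/
def rePart : ℂ ⊗[ℝ] R →ₗ[ℝ] R :=
  (TensorProduct.lid ℝ R).toLinearMap ∘ₗ LinearMap.rTensor R Complex.reLm

/-- Imaginary part `ℂ ⊗ R → R`. -/
def imPart : ℂ ⊗[ℝ] R →ₗ[ℝ] R :=
  (TensorProduct.lid ℝ R).toLinearMap ∘ₗ LinearMap.rTensor R Complex.imLm

/-- Determinant of a matrix whose entries commute with each other, written for
a ring that need not be commutative (here: a matrix of even elements). -/
def evenDet {S : Type*} [Ring S] {m : ℕ} (M : Matrix (Fin m) (Fin m) S) : S :=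
  ∑ τ : Equiv.Perm (Fin m), Equiv.Perm.sign τ • (List.ofFn fun i => M (τ i) i).prod

/-- The Berezinian `det (P - Q D⁻¹ C) (det D)⁻¹` of an invertible even supermatrix. -/
def ber {S : Type*} [Ring S] {m : ℕ} (M : Matrix (Fin m ⊕ Fin m) (Fin m ⊕ Fin m) S) : S :=
  evenDet (M.toBlocks₁₁ - M.toBlocks₁₂ * Ring.inverse M.toBlocks₂₂ * M.toBlocks₂₁) *
    Ring.inverse (evenDet M.toBlocks₂₂)

/-- The real constituents, in a superalgebra `R`, of holomorphic coordinates
`z = x + i x'`, `ζ = ψ' + i ψ` and of the coefficient `a + i a'` of the holomorphic `m`-form. -/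
structure HolData (m : ℕ) (R : Type*) where
  /-- Real parts of the even coordinates. -/
  x : Fin m → R
  /-- Imaginary parts of the even coordinates. -/
  x' : Fin m → R
  /-- The odd coordinates `Π ∂/∂x`. -/
  ψ : Fin m → R
  /-- The odd coordinates `Π ∂/∂x'`. -/
  ψ' : Fin m → R
  /-- Real part of the coefficient. -/
  a : R
  /-- Imaginary part of the coefficient. -/
  a' : R

namespace HolData

variable {m : ℕ}

/-- Transport along a map of superalgebras. -/
def map {S : Type*} (h : HolData m R) (f : R → S) : HolData m S where
  x := fun α => f (h.x α)
  x' := fun α => f (h.x' α)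
  ψ := fun α => f (h.ψ α)
  ψ' := fun α => f (h.ψ' α)
  a := f h.a
  a' := f h.a'

/-- Holomorphic even coordinates `z = x + i x'`. -/
def z (h : HolData m R) (α : Fin m) : ℂ ⊗[ℝ] R := cpx (h.x α) (h.x' α)

/-- Holomorphic odd coordinates `ζ = ψ' + i ψ`. -/
def ζ (h : HolData m R) (α : Fin m) : ℂ ⊗[ℝ] R := cpx (h.ψ' α) (h.ψ α)

/-- The coefficient of the holomorphic `m`-form. -/
def coeff (h : HolData m R) : ℂ ⊗[ℝ] R := cpx h.a h.a'

/-- The Jacobian of the holomorphic coordinates `(z, ζ)` with respect to the vector fields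
`(dx, dξ)`: rows are vector fields, columns are coordinates. -/
def jac (h : HolData m R) (dx dξ : Fin m → R →ₗ[ℝ] R) :
    Matrix (Fin m ⊕ Fin m) (Fin m ⊕ Fin m) (ℂ ⊗[ℝ] R) :=
  Matrix.fromBlocks
    (Matrix.of fun i α => (dx i).baseChange ℂ (h.z α))
    (Matrix.of fun i α => (dx i).baseChange ℂ (h.ζ α))
    (Matrix.of fun j α => (dξ j).baseChange ℂ (h.z α))
    (Matrix.of fun j α => (dξ j).baseChange ℂ (h.ζ α))

/-- The coefficient with respect to `D^*(dx, dξ)` of the restriction of the holomorphic Berezinian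
volume form `a² D^*(dz, dζ)`. -/
def density (h : HolData m R) (dx dξ : Fin m → R →ₗ[ℝ] R) : ℂ ⊗[ℝ] R :=
  h.coeff ^ 2 * ber (h.jac dx dξ)

/-- The contraction `⟨w, θ⟩` of a vector field with the Liouville form
`θ = ∑ dx ψ + dx' ψ'`. -/
def liouville (h : HolData m R) (w : R →ₗ[ℝ] R) : R :=
  ∑ α, (w (h.x α) * h.ψ α + w (h.x' α) * h.ψ' α)

/-- The value `η(w, v)` of the real odd symplectic form `η = dθ` on a vector field `w` and on a
vector field `v` along the restriction `r`. Here
`dθ(w, v) = w⟨v, θ⟩ - (-1)^{|w||v|} v⟨w, θ⟩ - ⟨[w, v], θ⟩`, which in coordinates is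
`∑ (-1)^{|w||v|} v(x) w(ψ) - w(x) v(ψ) = ∑ w(ψ) σ(v(x)) - w(x) v(ψ)`; the last form is
additive in `v`, so `v` need not be homogeneous. -/
def eta {S : Type*} [Ring S] [Algebra ℝ S] (h : HolData m S) (σ : R →ₐ[ℝ] R) (r : S → R)
    (w : R →ₗ[ℝ] R) (v : S →ₗ[ℝ] R) : R :=
  ∑ α, (w (r (h.ψ α)) * σ (v (h.x α)) - w (r (h.x α)) * v (h.ψ α)
    + (w (r (h.ψ' α)) * σ (v (h.x' α)) - w (r (h.x' α)) * v (h.ψ' α)))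

/-- The value `η_c(w, v)` of the holomorphic odd symplectic form `η_c = d (∑ dz ζ)`
on vector fields `w`, `v`; same conventions as for `eta`. -/
def etaC (h : HolData m R) (σ : R →ₐ[ℝ] R) (w v : R →ₗ[ℝ] R) : ℂ ⊗[ℝ] R :=
  ∑ α, (w.baseChange ℂ (h.ζ α) * (σ.toLinearMap.baseChange ℂ) (v.baseChange ℂ (h.z α))
    - w.baseChange ℂ (h.z α) * v.baseChange ℂ (h.ζ α))

end HolData

end Algebra

/-! ## The supermanifold `𝒴 = (Y, Λ TY)` -/

/-- The complex model space `ℂ^m`. -/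
abbrev CE (m : ℕ) := EuclideanSpace ℂ (Fin m)

/-- The real model space `ℝ^m`. -/
abbrev RE (m : ℕ) := EuclideanSpace ℝ (Fin m)

/-- The parity involution of an exterior algebra. -/
abbrev extParity (V : Type*) [AddCommGroup V] [Module ℝ V] :
    ExteriorAlgebra ℝ V →ₐ[ℝ] ExteriorAlgebra ℝ V :=
  CliffordAlgebra.involute

lemma map_extParity {V W : Type*} [AddCommGroup V] [Module ℝ V] [AddCommGroup W] [Module ℝ W]
    (f : V →ₗ[ℝ] W) (a : ExteriorAlgebra ℝ V) :
    ExteriorAlgebra.map f (extParity V a) = extParity W (ExteriorAlgebra.map f a) := by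
  have h : (ExteriorAlgebra.map f).comp (extParity V) =
      (extParity W).comp (ExteriorAlgebra.map f) := by
    apply ExteriorAlgebra.hom_ext
    ext v
    have h1 : extParity V (ExteriorAlgebra.ι ℝ v) = -ExteriorAlgebra.ι ℝ v :=
      CliffordAlgebra.involute_ι v
    have h2 : extParity W (ExteriorAlgebra.ι ℝ (f v)) = -ExteriorAlgebra.ι ℝ (f v) :=
      CliffordAlgebra.involute_ι (f v)
    simp only [LinearMap.comp_apply, AlgHom.toLinearMap_apply, AlgHom.comp_apply, h1,
      map_neg, ExteriorAlgebra.map_apply_ι, h2]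
  exact DFunLike.congr_fun h a

lemma finite_exteriorAlgebra (V : Type*) [AddCommGroup V] [Module ℝ V] [Module.Finite ℝ V] :
    Module.Finite ℝ (ExteriorAlgebra ℝ V) := by
  have hbot : ∀ n, Module.finrank ℝ V < n → ⋀[ℝ]^n V = ⊥ := by
    intro n hn
    have h := exteriorPower.finrank_eq (R := ℝ) (M := V) (n := n)
    rw [Nat.choose_eq_zero_of_lt hn] at h
    exact Submodule.finrank_eq_zero.mp h
  have htop := (DirectSum.Decomposition.isInternal
    (fun i : ℕ => ⋀[ℝ]^i V)).submodule_iSup_eq_top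
  constructor
  rw [← htop]
  have : (⨆ i : ℕ, ⋀[ℝ]^i V) = ⨆ i ∈ Finset.range (Module.finrank ℝ V + 1), ⋀[ℝ]^i V := by
    apply le_antisymm
    · refine iSup_le fun i => ?_
      by_cases hi : i < Module.finrank ℝ V + 1
      · exact le_iSup₂_of_le i (Finset.mem_range.mpr hi) le_rfl
      · rw [hbot i (by omega)]; exact bot_le
    · exact iSup₂_le fun i _ => le_iSup (fun i : ℕ => ⋀[ℝ]^i V) i
  rw [this]
  exact Submodule.fg_biSup _ _ fun i _ => Module.Finite.iff_fg.mp inferInstance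

section GeometryY

variable {m : ℕ} {Y : Type*} [TopologicalSpace Y] [ChartedSpace (CE m) Y]

/-- The real tangent space of `Y` at `y`. It is the model space, identified with the tangent
space through the preferred chart `chartAt (CE m) y`. -/
abbrev TY (m : ℕ) {Y : Type*} [TopologicalSpace Y] [ChartedSpace (CE m) Y] (y : Y) : Type :=
  TangentSpace 𝓘(ℝ, CE m) y

/-- The components, in the chart `c`, of tangent vectors at `y`. -/
def toChart (c : OpenPartialHomeomorph Y (CE m)) (y : Y) : TY m y →ₗ[ℝ] CE m :=
  (fderiv ℝ (c ∘ (chartAt (CE m) y).symm) (chartAt (CE m) y y)).toLinearMap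

/-- The tangent vector at `y` with components `e` in the chart `c`. -/
def ofChart (c : OpenPartialHomeomorph Y (CE m)) (y : Y) (e : CE m) : TY m y :=
  fderiv ℝ (chartAt (CE m) y ∘ c.symm) (c y) e

/-- Smoothness of a section of `Λ TY` over the open set `U`: in every chart all components of the
section are smooth. -/
def IsSmoothSection {U : Opens Y} (s : ∀ y : U, ExteriorAlgebra ℝ (TY m (y : Y))) : Prop :=
  ∀ c ∈ atlas (CE m) Y, ∀ l : Module.Dual ℝ (ExteriorAlgebra ℝ (CE m)),
    ContMDiffOn 𝓘(ℝ, CE m) 𝓘(ℝ, ℝ) ∞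
      (fun y : U => l (ExteriorAlgebra.map (toChart c (y : Y)) (s y))) {y : U | (y : Y) ∈ c.source}

/-- The algebra `Γ(U, Λ TY)` of smooth sections of `Λ TY` over `U`. -/
def sectionsY (m : ℕ) {Y : Type*} [TopologicalSpace Y] [ChartedSpace (CE m) Y] (U : Opens Y) :
    Subalgebra ℝ (∀ y : U, ExteriorAlgebra ℝ (TY m (y : Y))) where
  carrier := {s | IsSmoothSection s}
  mul_mem' := by
    intro s t hs ht c hc l
    have := finite_exteriorAlgebra (CE m)
    let b := Module.finBasis ℝ (ExteriorAlgebra ℝ (CE m))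
    have key : ∀ u v : ExteriorAlgebra ℝ (CE m),
        l (u * v) = ∑ i, ∑ j, (b.coord i u * b.coord j v) * l (b i * b j) := by
      intro u v
      conv_lhs => rw [← b.sum_repr u, ← b.sum_repr v]
      simp only [Finset.sum_mul, Finset.mul_sum, map_sum, smul_mul_assoc, mul_smul_comm,
        map_smul, smul_eq_mul, Module.Basis.coord_apply]
      rw [Finset.sum_comm]
      refine Finset.sum_congr rfl fun i _ => Finset.sum_congr rfl fun j _ => by ring
    have h : ContMDiffOn 𝓘(ℝ, CE m) 𝓘(ℝ, ℝ) ∞ (fun y : U => ∑ i, ∑ j,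
        (b.coord i (ExteriorAlgebra.map (toChart c (y : Y)) (s y)) *
          b.coord j (ExteriorAlgebra.map (toChart c (y : Y)) (t y))) * l (b i * b j))
        {y : U | (y : Y) ∈ c.source} :=
      contMDiffOn_finsetSum fun i _ => contMDiffOn_finsetSum fun j _ =>
        ((hs c hc (b.coord i)).mul (ht c hc (b.coord j))).mul contMDiffOn_const
    refine h.congr fun y _ => ?_
    rw [← key, ← map_mul, Pi.mul_apply]
  add_mem' := by
    intro s t hs ht c hc l
    refine ((hs c hc l).add (ht c hc l)).congr fun y _ => ?_
    rw [Pi.add_apply, map_add, map_add, Pi.add_apply]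
  algebraMap_mem' := by
    intro r c hc l
    refine (contMDiffOn_const (c := l (algebraMap ℝ _ r))).congr fun y _ => ?_
    rw [Pi.algebraMap_apply, AlgHom.commutes]

/-- The superalgebra `𝒪_𝒴(U) = Γ(U, Λ TY)` of functions on `𝒴 = Π Ω¹Y` over `U`. -/
def OY (m : ℕ) {Y : Type*} [TopologicalSpace Y] [ChartedSpace (CE m) Y] (U : Opens Y) : Type _ :=
  sectionsY m U

instance (U : Opens Y) : Ring (OY m U) := inferInstanceAs (Ring (sectionsY m U))

instance (U : Opens Y) : Algebra ℝ (OY m U) := inferInstanceAs (Algebra ℝ (sectionsY m U))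

lemma IsSmoothSection.parity {U : Opens Y}
    {s : ∀ y : U, ExteriorAlgebra ℝ (TY m (y : Y))} (hs : IsSmoothSection s) :
    IsSmoothSection (fun y : U => extParity _ (s y)) := by
  intro c hc l
  refine (hs c hc (l ∘ₗ (extParity (CE m)).toLinearMap)).congr fun y _ => ?_
  exact congrArg l (map_extParity _ _)

/-- The parity involution of `𝒪_𝒴(U)`. -/
def parityY (U : Opens Y) : OY m U →ₐ[ℝ] OY m U where
  toFun s := ⟨fun y : U => extParity _ (s.1 y), s.2.parity⟩
  map_one' := Subtype.ext (funext fun _ => map_one _)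
  map_mul' _ _ := Subtype.ext (funext fun _ => map_mul _ _ _)
  map_zero' := Subtype.ext (funext fun _ => map_zero _)
  map_add' _ _ := Subtype.ext (funext fun _ => map_add _ _ _)
  commutes' _ := Subtype.ext (funext fun _ => AlgHom.commutes _ _)

lemma IsSmoothSection.res {U U' : Opens Y} (h : U' ≤ U)
    {s : ∀ y : U, ExteriorAlgebra ℝ (TY m (y : Y))} (hs : IsSmoothSection s) :
    IsSmoothSection (fun y : U' => s (Opens.inclusion h y)) := by
  intro c hc l
  have h1 := hs c hc l
  have h2 : ContMDiff 𝓘(ℝ, CE m) 𝓘(ℝ, CE m) ∞ (Opens.inclusion h) := contMDiff_inclusion h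
  have h3 := h1.comp (s := {y : U' | (y : Y) ∈ c.source}) h2.contMDiffOn fun y hy => hy
  exact h3

/-- Restriction `𝒪_𝒴(U) → 𝒪_𝒴(U')` for `U' ⊆ U`. -/
def resY {U U' : Opens Y} (h : U' ≤ U) : OY m U →ₐ[ℝ] OY m U' where
  toFun s := ⟨fun y : U' => s.1 (Opens.inclusion h y), IsSmoothSection.res h s.2⟩
  map_one' := rfl
  map_mul' _ _ := rfl
  map_zero' := rfl
  map_add' _ _ := rfl
  commutes' _ := rfl

/-- The coefficient of an `m`-form `Ω = coef dz^1 ∧ … ∧ dz^m` in the chart `c`. -/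
def coef (Ω : ∀ y : Y, (TangentSpace 𝓘(ℂ, CE m) y) [⋀^Fin m]→ₗ[ℂ] ℂ)
    (c : OpenPartialHomeomorph Y (CE m)) (y : Y) : ℂ :=
  Ω y fun α => ofChart c y (EuclideanSpace.single α 1)

/-- `Ω` is a holomorphic `m`-form: its coefficients in charts are holomorphic. -/
def IsHolomorphicForm (Ω : ∀ y : Y, (TangentSpace 𝓘(ℂ, CE m) y) [⋀^Fin m]→ₗ[ℂ] ℂ) : Prop :=
  ∀ c ∈ atlas (CE m) Y, AnalyticOnNhd ℂ (fun e => coef Ω c (c.symm e)) c.target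

lemma contDiffOn_transition [IsManifold 𝓘(ℂ, CE m) ω Y] {c c' : OpenPartialHomeomorph Y (CE m)}
    (hc : c ∈ atlas (CE m) Y) (hc' : c' ∈ atlas (CE m) Y) :
    ContDiffOn ℝ ∞ (c' ∘ c.symm) (c.symm.trans c').source := by
  have h := HasGroupoid.compatible (G := contDiffGroupoid ω 𝓘(ℂ, CE m)) hc hc'
  rw [contDiffGroupoid, mem_groupoid_of_pregroupoid] at h
  have h2 := h.1
  simp only [contDiffPregroupoid, modelWithCornersSelf_coe, modelWithCornersSelf_coe_symm,
    Function.id_comp, Function.comp_id, Set.preimage_id, Set.range_id, Set.inter_univ] at h2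
  exact (ContDiffOn.restrict_scalars ℝ h2).of_le (by exact_mod_cast le_top)

lemma isManifold_real [IsManifold 𝓘(ℂ, CE m) ω Y] : IsManifold 𝓘(ℝ, CE m) ∞ Y := by
  apply isManifold_of_contDiffOn
  intro c c' hc hc'
  simpa using contDiffOn_transition hc hc'

/-- The domain of a chart, as an open set. -/
def dom (c : OpenPartialHomeomorph Y (CE m)) : Opens Y := ⟨c.source, c.open_source⟩

/-- A smooth real function `f` on `c.target`, in the chart `c`, as an element of
`𝒪_𝒴(c.source)`. -/
def fnY [IsManifold 𝓘(ℂ, CE m) ω Y] {c : OpenPartialHomeomorph Y (CE m)}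
    (hc : c ∈ atlas (CE m) Y) (f : CE m → ℝ) (hf : ContDiffOn ℝ ∞ f c.target) :
    OY m (dom c) :=
  ⟨fun y => algebraMap ℝ _ (f (c y)), by
    intro c' hc' l
    have := isManifold_real (m := m) (Y := Y)
    have h1 : ContMDiffOn 𝓘(ℝ, CE m) 𝓘(ℝ, CE m) ∞ c c.source :=
      contMDiffOn_of_mem_maximalAtlas (IsManifold.subset_maximalAtlas hc)
    have h2 : ContMDiffOn 𝓘(ℝ, CE m) 𝓘(ℝ, ℝ) ∞ (f ∘ c) c.source :=
      hf.contMDiffOn.comp h1 fun y hy => c.map_source hy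
    have h3 : ContMDiff 𝓘(ℝ, CE m) 𝓘(ℝ, ℝ) ∞ (fun y : dom c => f (c y)) := by
      have h4 : ContMDiff 𝓘(ℝ, CE m) 𝓘(ℝ, CE m) ∞ (Subtype.val : dom c → Y) :=
        contMDiff_subtype_val
      exact contMDiffOn_univ.mp (h2.comp h4.contMDiffOn fun y _ => y.2)
    have h5 : ContMDiffOn 𝓘(ℝ, CE m) 𝓘(ℝ, ℝ) ∞
        (fun y : dom c => f (c y) * l 1) {y : dom c | (y : Y) ∈ c'.source} :=
      h3.contMDiffOn.mul contMDiffOn_const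
    refine h5.congr fun y _ => ?_
    rw [AlgHom.commutes, Algebra.algebraMap_eq_smul_one, map_smul, smul_eq_mul]⟩

/-- The coordinate vector field with components `e` in the chart `c`, as an (odd) element of
`𝒪_𝒴(c.source)`. -/
def vecY [IsManifold 𝓘(ℂ, CE m) ω Y] {c : OpenPartialHomeomorph Y (CE m)}
    (hc : c ∈ atlas (CE m) Y) (e : CE m) : OY m (dom c) :=
  ⟨fun y => ExteriorAlgebra.ι ℝ (ofChart c (y : Y) e), by
    intro c' hc' l
    have := isManifold_real (m := m) (Y := Y)
    have hopen : IsOpen (c.symm.trans c').source := (c.symm.trans c').open_source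
    have h0 : ContDiffOn ℝ ∞ (fun z => fderiv ℝ (c' ∘ c.symm) z e) (c.symm.trans c').source :=
      ((contDiffOn_transition hc hc').fderiv_of_isOpen hopen (m := ∞) le_rfl).clm_apply
        contDiffOn_const
    have h1 : ContMDiffOn 𝓘(ℝ, CE m) 𝓘(ℝ, CE m) ∞ c c.source :=
      contMDiffOn_of_mem_maximalAtlas (IsManifold.subset_maximalAtlas hc)
    have h4 : ContMDiff 𝓘(ℝ, CE m) 𝓘(ℝ, CE m) ∞ (Subtype.val : dom c → Y) :=
      contMDiff_subtype_val
    have h5 : ContMDiffOn 𝓘(ℝ, CE m) 𝓘(ℝ, CE m) ∞ (fun y : dom c => c y)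
        {y : dom c | (y : Y) ∈ c'.source} :=
      h1.comp h4.contMDiffOn fun y _ => y.2
    have h6 := h0.contMDiffOn.comp h5 fun y hy => by
      simpa [OpenPartialHomeomorph.trans_source, c.map_source y.2, c.left_inv y.2] using hy
    let L : CE m →L[ℝ] ℝ := LinearMap.toContinuousLinearMap (l ∘ₗ ExteriorAlgebra.ι ℝ)
    have h7 := (L.contDiff (n := ∞)).contMDiff.comp_contMDiffOn h6
    refine h7.congr fun y hy => ?_
    have hy0 : (y : Y) ∈ c.source := y.2
    have hy1 : (y : Y) ∈ (chartAt (CE m) (y : Y)).source := mem_chart_source _ _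
    have hy2 : (y : Y) ∈ c'.source := hy
    set k := chartAt (CE m) (y : Y) with hk
    have hd1 : DifferentiableAt ℝ (k ∘ c.symm) (c y) :=
      (((contDiffOn_transition hc (chart_mem_atlas _ _)).contDiffAt
        ((c.symm.trans k).open_source.mem_nhds (by
          simp [c.map_source hy0, c.left_inv hy0, hy1])))
        ).differentiableAt (by simp)
    have hd2 : DifferentiableAt ℝ (c' ∘ k.symm) (k y) :=
      (((contDiffOn_transition (chart_mem_atlas _ _) hc').contDiffAt
        ((k.symm.trans c').open_source.mem_nhds (by
          simp [k.map_source hy1, k.left_inv hy1, hy2])))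
        ).differentiableAt (by simp)
    have hpt : (k ∘ c.symm) (c y) = k y := by simp [c.left_inv hy0]
    have hev : (c' ∘ c.symm) =ᶠ[nhds (c y)] ((c' ∘ k.symm) ∘ (k ∘ c.symm)) := by
      have : (c.symm.trans k).source ∈ nhds (c y) :=
        (c.symm.trans k).open_source.mem_nhds (by
          simp [c.map_source hy0, c.left_inv hy0, hy1])
      filter_upwards [this] with z hz
      rw [OpenPartialHomeomorph.trans_source] at hz
      simp [k.left_inv hz.2]
    have hchain : fderiv ℝ (c' ∘ c.symm) (c y) e =
        fderiv ℝ (c' ∘ k.symm) (k y) (fderiv ℝ (k ∘ c.symm) (c y) e) := by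
      rw [hev.fderiv_eq, fderiv_comp _ (by rw [hpt]; exact hd2) hd1, hpt]
      rfl
    rw [ExteriorAlgebra.map_apply_ι]
    exact congrArg (fun v => l (ExteriorAlgebra.ι ℝ v)) hchain.symm⟩

lemma contDiff_re (α : Fin m) : ContDiff ℝ ∞ fun e : CE m => (e α).re :=
  Complex.reCLM.contDiff.comp
    (PiLp.proj (𝕜 := ℝ) 2 (fun _ : Fin m => ℂ) α).contDiff

lemma contDiff_im (α : Fin m) : ContDiff ℝ ∞ fun e : CE m => (e α).im :=
  Complex.imCLM.contDiff.comp
    (PiLp.proj (𝕜 := ℝ) 2 (fun _ : Fin m => ℂ) α).contDiff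

lemma contDiffOn_coef {Ω : ∀ y : Y, (TangentSpace 𝓘(ℂ, CE m) y) [⋀^Fin m]→ₗ[ℂ] ℂ}
    (hΩ : IsHolomorphicForm Ω) {c : OpenPartialHomeomorph Y (CE m)} (hc : c ∈ atlas (CE m) Y) :
    ContDiffOn ℝ ∞ (fun e => coef Ω c (c.symm e)) c.target :=
  ((hΩ c hc).contDiffOn c.open_target.uniqueDiffOn).restrict_scalars ℝ

/-- The coordinates `z = x + i x'`, `ζ = ψ' + i ψ` (with `ψ = Π ∂/∂x`, `ψ' = Π ∂/∂x'`) of `𝒴`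
over the domain of the holomorphic chart `c`, and the coefficient of `Ω`, in terms of which
the induced holomorphic volume form on `𝒴` is `coef² D^*(dz, dζ)`. -/
def holData [IsManifold 𝓘(ℂ, CE m) ω Y]
    {Ω : ∀ y : Y, (TangentSpace 𝓘(ℂ, CE m) y) [⋀^Fin m]→ₗ[ℂ] ℂ} (hΩ : IsHolomorphicForm Ω)
    {c : OpenPartialHomeomorph Y (CE m)} (hc : c ∈ atlas (CE m) Y) : HolData m (OY m (dom c)) where
  x α := fnY hc (fun e => (e α).re) (contDiff_re α).contDiffOn
  x' α := fnY hc (fun e => (e α).im) (contDiff_im α).contDiffOn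
  ψ α := vecY hc (EuclideanSpace.single α 1)
  ψ' α := vecY hc (EuclideanSpace.single α Complex.I)
  a := fnY hc (fun e => (coef Ω c (c.symm e)).re)
    (Complex.reCLM.contDiff.comp_contDiffOn (contDiffOn_coef hΩ hc))
  a' := fnY hc (fun e => (coef Ω c (c.symm e)).im)
    (Complex.imCLM.contDiff.comp_contDiffOn (contDiffOn_coef hΩ hc))

end GeometryY

/-! ## The sub-supermanifold `𝒳 = ΠN^* = (X, Λ N)` -/

section GeometryX

variable {m : ℕ} {Y : Type*} [TopologicalSpace Y] [ChartedSpace (CE m) Y]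
  {X : Type*} [TopologicalSpace X] [ChartedSpace (RE m) X]

/-- The real differential of `ι : X → Y` at `x`. -/
def diff (ι : C(X, Y)) (x : X) : TangentSpace 𝓘(ℝ, RE m) x →ₗ[ℝ] TY m (ι x) :=
  (mfderiv 𝓘(ℝ, RE m) 𝓘(ℝ, CE m) ι x).toLinearMap

/-- The fibre `N_x = T_{ι x} Y / T_x X` of the normal bundle. -/
abbrev NX (ι : C(X, Y)) (x : X) : Type := TY m (ι x) ⧸ LinearMap.range (diff (m := m) ι x)

/-- The map `Λ T_{ι x} Y → Λ N_x`. -/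
def toNormal (ι : C(X, Y)) (x : X) :
    ExteriorAlgebra ℝ (TY m (ι x)) →ₐ[ℝ] ExteriorAlgebra ℝ (NX (m := m) ι x) :=
  ExteriorAlgebra.map (LinearMap.range (diff (m := m) ι x)).mkQ

/-- Smooth sections of `Λ N` over `V ⊆ X`: those which lift locally, along
`Λ TY|_X → Λ N`, to smooth sections of `Λ TY` defined on open subsets of `Y`. -/
def IsNormalSection (ι : C(X, Y)) {V : Opens X}
    (s : ∀ x : V, ExteriorAlgebra ℝ (NX (m := m) ι (x : X))) : Prop :=
  ∀ x : V, ∃ (U : Opens Y) (t : OY m U), ι x ∈ U ∧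
    ∀ (x' : V) (h : ι x' ∈ U), s x' = toNormal ι (x' : X) (t.1 ⟨ι x', h⟩)

/-- The algebra `Γ(V, Λ N)` of smooth sections of `Λ N` over `V`. -/
def sectionsX (ι : C(X, Y)) (V : Opens X) :
    Subalgebra ℝ (∀ x : V, ExteriorAlgebra ℝ (NX (m := m) ι (x : X))) where
  carrier := {s | IsNormalSection ι s}
  mul_mem' := by
    intro s s' hs hs' x
    obtain ⟨U, t, hU, ht⟩ := hs x
    obtain ⟨U', t', hU', ht'⟩ := hs' x
    exact ⟨U ⊓ U', resY inf_le_left t * resY inf_le_right t', ⟨hU, hU'⟩, fun x' h =>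
      (congrArg₂ (· * ·) (ht x' h.1) (ht' x' h.2)).trans (map_mul (toNormal ι (x' : X)) _ _).symm⟩
  add_mem' := by
    intro s s' hs hs' x
    obtain ⟨U, t, hU, ht⟩ := hs x
    obtain ⟨U', t', hU', ht'⟩ := hs' x
    exact ⟨U ⊓ U', resY inf_le_left t + resY inf_le_right t', ⟨hU, hU'⟩, fun x' h =>
      (congrArg₂ (· + ·) (ht x' h.1) (ht' x' h.2)).trans (map_add (toNormal ι (x' : X)) _ _).symm⟩
  algebraMap_mem' := fun r x => ⟨⊤, algebraMap ℝ _ r, trivial, fun x' _ =>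
    ((toNormal ι (x' : X)).commutes r).symm⟩

/-- The superalgebra `𝒪_𝒳(V) = Γ(V, Λ N)` of functions on `𝒳` over `V`. -/
def OX (ι : C(X, Y)) (V : Opens X) : Type _ := sectionsX (m := m) ι V

instance (ι : C(X, Y)) (V : Opens X) : Ring (OX (m := m) ι V) :=
  inferInstanceAs (Ring (sectionsX ι V))

instance (ι : C(X, Y)) (V : Opens X) : Algebra ℝ (OX (m := m) ι V) :=
  inferInstanceAs (Algebra ℝ (sectionsX ι V))

/-- The parity involution of `𝒪_𝒳(V)`. -/
def parityX (ι : C(X, Y)) (V : Opens X) : OX (m := m) ι V →ₐ[ℝ] OX (m := m) ι V where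
  toFun s := ⟨fun x : V => extParity _ (s.1 x), fun x => by
    obtain ⟨U, t, hU, ht⟩ := s.2 x
    refine ⟨U, parityY U t, hU, fun x' h => ?_⟩
    exact (congrArg (extParity _) (ht x' h)).trans (map_extParity _ _).symm⟩
  map_one' := Subtype.ext (funext fun _ => map_one _)
  map_mul' _ _ := Subtype.ext (funext fun _ => map_mul _ _ _)
  map_zero' := Subtype.ext (funext fun _ => map_zero _)
  map_add' _ _ := Subtype.ext (funext fun _ => map_add _ _ _)
  commutes' _ := Subtype.ext (funext fun _ => AlgHom.commutes _ _)

/-- Restriction `𝒪_𝒳(V) → 𝒪_𝒳(V')` for `V' ⊆ V`. -/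
def resX (ι : C(X, Y)) {V V' : Opens X} (h : V' ≤ V) :
    OX (m := m) ι V →ₐ[ℝ] OX (m := m) ι V' where
  toFun s := ⟨fun x : V' => s.1 (Opens.inclusion h x), fun x => by
    obtain ⟨U, t, hU, ht⟩ := s.2 (Opens.inclusion h x)
    exact ⟨U, t, hU, fun x' h' => ht (Opens.inclusion h x') h'⟩⟩
  map_one' := rfl
  map_mul' _ _ := rfl
  map_zero' := rfl
  map_add' _ _ := rfl
  commutes' _ := rfl

/-- The open set `ι⁻¹(U)`. -/
abbrev pre (ι : C(X, Y)) (U : Opens Y) : Opens X := Opens.comap ι U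

/-- The restriction morphism `𝒪_𝒴(U) → 𝒪_𝒳(ι⁻¹ U)` of the embedding `𝒳 ⊆ 𝒴`. -/
def restr (ι : C(X, Y)) (U : Opens Y) : OY m U →ₐ[ℝ] OX (m := m) ι (pre ι U) where
  toFun t := ⟨fun x => toNormal ι (x : X) (t.1 ⟨ι x, x.2⟩), fun x =>
    ⟨U, t, x.2, fun _ _ => rfl⟩⟩
  map_one' := Subtype.ext (funext fun _ => map_one _)
  map_mul' _ _ := Subtype.ext (funext fun _ => map_mul _ _ _)
  map_zero' := Subtype.ext (funext fun _ => map_zero _)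
  map_add' _ _ := Subtype.ext (funext fun _ => map_add _ _ _)
  commutes' _ := Subtype.ext (funext fun _ => AlgHom.commutes _ _)

/-! ### Infinitesimal deformations and the normal sheaf -/

/-- The space of superderivations `𝒪_𝒴 → ι_* 𝒪_𝒳` of sheaves, of parity `p`, along the restriction
morphism. -/
def vfAlong (ι : C(X, Y)) (p : Fin 2) :
    Submodule ℝ (∀ U : Opens Y, OY m U →ₗ[ℝ] OX (m := m) ι (pre ι U)) where
  carrier := {D |
    (∀ U, IsSuperDer (parityY U) (parityX ι (pre ι U)) (restr ι U) p (D U)) ∧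
    ∀ (U U' : Opens Y) (h : U' ≤ U) (t : OY m U),
      D U' (resY h t) = resX ι (Opens.comap_mono ι h) (D U t)}
  zero_mem' := ⟨fun _ => .zero, fun _ _ h _ => (map_zero (resX ι (Opens.comap_mono ι h))).symm⟩
  add_mem' := fun hD hE => ⟨fun U => (hD.1 U).add (hE.1 U), fun U U' h t =>
    (congrArg₂ (· + ·) (hD.2 U U' h t) (hE.2 U U' h t)).trans
      (map_add (resX ι (Opens.comap_mono ι h)) _ _).symm⟩
  smul_mem' := fun c _ hD => ⟨fun U => (hD.1 U).smul c, fun U U' h t =>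
    (congrArg (c • ·) (hD.2 U U' h t)).trans
      (map_smul (resX ι (Opens.comap_mono ι h)) c _).symm⟩

/-- Vector fields of parity `p` along the embedding `𝒳 ⊆ 𝒴` (global sections of `𝒯𝒴|_𝒳`).
Equivalently (see `thicken`), morphisms `r + ε D : 𝒪_𝒴 → ι_* 𝒪_𝒳[ε]/ε²` with `ε` of parity `p`,
which are the first-order families of embeddings of `𝒳` in `𝒴` that start at the given one. -/
def VFAlong (ι : C(X, Y)) (p : Fin 2) : Type _ := vfAlong (m := m) ι p

instance (ι : C(X, Y)) (p : Fin 2) : AddCommGroup (VFAlong (m := m) ι p) :=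
  inferInstanceAs (AddCommGroup (vfAlong (m := m) ι p))

instance (ι : C(X, Y)) (p : Fin 2) : Module ℝ (VFAlong (m := m) ι p) :=
  inferInstanceAs (Module ℝ (vfAlong (m := m) ι p))

/-- The vector fields along `𝒳` that are tangent to `𝒳`: they annihilate the ideal sheaf
of `𝒳 ⊆ 𝒴`. -/
def tangential (ι : C(X, Y)) (p : Fin 2) : Submodule ℝ (VFAlong (m := m) ι p) where
  carrier := {D | ∀ (U : Opens Y) (t : OY m U), restr ι U t = 0 → D.1 U t = 0}
  zero_mem' := fun _ _ _ => rfl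
  add_mem' := fun hD hE U t ht =>
    (congrArg₂ (· + ·) (hD U t ht) (hE U t ht)).trans (add_zero 0)
  smul_mem' := fun c _ hD U t ht => (congrArg (c • ·) (hD U t ht)).trans (smul_zero c)

/-- The parity `p` part of `H⁰(𝒳, 𝒩)`, where `𝒩 = 𝒯𝒴|_𝒳 / 𝒯𝒳` is the normal sheaf. Its elements
are the infinitesimal deformations of `𝒳` inside `𝒴` over `ℝ[ε]/ε²` with `ε` of parity `p`. -/
abbrev NormalSections (ι : C(X, Y)) (p : Fin 2) : Type _ :=
  VFAlong (m := m) ι p ⧸ tangential (m := m) ι p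

/-- The morphism `𝒪_𝒴(U) → 𝒪_𝒳(V)[ε]/ε²`, for `V ⊆ ι⁻¹ U`, of the family of embeddings given
by `D`. -/
def family {ι : C(X, Y)} {p : Fin 2} (D : VFAlong (m := m) ι p) {U : Opens Y} {V : Opens X}
    (h : V ≤ pre ι U) (t : OY m U) : Thick (OX (m := m) ι V) (parityX ι V) p :=
  ⟨resX ι h (restr ι U t), resX ι h (D.1 U t)⟩

/-- The deformation is exact Lagrangian: the pullback of the Liouville form `θ` to the family
is, relatively to the base, the differential of a global function `F` on the family. -/
def IsExactLagrangian [IsManifold 𝓘(ℂ, CE m) ω Y] (ι : C(X, Y))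
    {Ω : ∀ y : Y, (TangentSpace 𝓘(ℂ, CE m) y) [⋀^Fin m]→ₗ[ℂ] ℂ} (hΩ : IsHolomorphicForm Ω)
    {p : Fin 2} (D : VFAlong (m := m) ι p) : Prop :=
  ∃ F : Thick (OX (m := m) ι ⊤) (parityX ι ⊤) p,
    ∀ (c : OpenPartialHomeomorph Y (CE m)) (hc : c ∈ atlas (CE m) Y) (V : Opens X)
      (hV : V ≤ pre ι (dom c)) (s : Fin 2) (w : OX (m := m) ι V →ₗ[ℝ] OX (m := m) ι V),
      IsVF (parityX ι V) s w →
      ((holData hΩ hc).map (family D hV)).liouville (Thick.lift (parityX ι V) p s w) =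
        Thick.lift (parityX ι V) p s w ⟨resX ι le_top F.fst, resX ι le_top F.snd⟩

/-- The density, relatively to the base and with respect to supercoordinates `q` on `V`, of the
restriction to the family of the holomorphic volume form of `𝒴`. -/
def familyDensity [IsManifold 𝓘(ℂ, CE m) ω Y] {ι : C(X, Y)}
    {Ω : ∀ y : Y, (TangentSpace 𝓘(ℂ, CE m) y) [⋀^Fin m]→ₗ[ℂ] ℂ} (hΩ : IsHolomorphicForm Ω)
    {p : Fin 2} (D : VFAlong (m := m) ι p) {c : OpenPartialHomeomorph Y (CE m)}
    (hc : c ∈ atlas (CE m) Y) {V : Opens X} (hV : V ≤ pre ι (dom c))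
    (q : SuperCoords (OX (m := m) ι V) (parityX ι V) m) :
    ℂ ⊗[ℝ] Thick (OX (m := m) ι V) (parityX ι V) p :=
  ((holData hΩ hc).map (family D hV)).density
    (fun i => Thick.lift (parityX ι V) p 0 (q.dx i))
    (fun j => Thick.lift (parityX ι V) p 1 (q.dξ j))

/-- The deformation consists of real slices: the Jacobian of the holomorphic coordinates of `𝒴`
with respect to supercoordinates of the family is invertible, that is, the complexified relative
tangent sheaf of the family is mapped isomorphically to the pullback of `𝒯_c 𝒴`. -/
def IsRealSliceFamily [IsManifold 𝓘(ℂ, CE m) ω Y] (ι : C(X, Y))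
    {Ω : ∀ y : Y, (TangentSpace 𝓘(ℂ, CE m) y) [⋀^Fin m]→ₗ[ℂ] ℂ} (hΩ : IsHolomorphicForm Ω)
    {p : Fin 2} (D : VFAlong (m := m) ι p) : Prop :=
  ∀ (c : OpenPartialHomeomorph Y (CE m)) (hc : c ∈ atlas (CE m) Y) (V : Opens X)
    (hV : V ≤ pre ι (dom c)) (q : SuperCoords (OX (m := m) ι V) (parityX ι V) m),
    IsUnit (((holData hΩ hc).map (family D hV)).jac
      (fun i => Thick.lift (parityX ι V) p 0 (q.dx i))
      (fun j => Thick.lift (parityX ι V) p 1 (q.dξ j)))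

/-- The deformation is special: the imaginary part of the restricted holomorphic volume form
vanishes on the family. -/
def IsSpecialFamily [IsManifold 𝓘(ℂ, CE m) ω Y] (ι : C(X, Y))
    {Ω : ∀ y : Y, (TangentSpace 𝓘(ℂ, CE m) y) [⋀^Fin m]→ₗ[ℂ] ℂ} (hΩ : IsHolomorphicForm Ω)
    {p : Fin 2} (D : VFAlong (m := m) ι p) : Prop :=
  ∀ (c : OpenPartialHomeomorph Y (CE m)) (hc : c ∈ atlas (CE m) Y) (V : Opens X)
    (hV : V ≤ pre ι (dom c)) (q : SuperCoords (OX (m := m) ι V) (parityX ι V) m),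
    imPart (familyDensity hΩ D hc hV q) = 0

/-- The infinitesimal deformation `n ∈ H⁰(𝒳, 𝒩)` of parity `p` is a deformation within the
class of special (exact) Lagrangian real slices. -/
def IsSpecialLagrangianDeformation [IsManifold 𝓘(ℂ, CE m) ω Y] (ι : C(X, Y))
    {Ω : ∀ y : Y, (TangentSpace 𝓘(ℂ, CE m) y) [⋀^Fin m]→ₗ[ℂ] ℂ} (hΩ : IsHolomorphicForm Ω)
    {p : Fin 2} (n : NormalSections (m := m) ι p) : Prop :=
  ∃ D : VFAlong (m := m) ι p, (tangential (m := m) ι p).mkQ D = n ∧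
    IsExactLagrangian ι hΩ D ∧ IsRealSliceFamily ι hΩ D ∧ IsSpecialFamily ι hΩ D

/-! ### The Batalin–Vilkovisky operator of `𝒳` -/

/-- The holomorphic coordinates of `𝒴` restricted to `V ⊆ ι⁻¹(c.source)`. -/
def holDataX [IsManifold 𝓘(ℂ, CE m) ω Y] (ι : C(X, Y))
    {Ω : ∀ y : Y, (TangentSpace 𝓘(ℂ, CE m) y) [⋀^Fin m]→ₗ[ℂ] ℂ} (hΩ : IsHolomorphicForm Ω)
    {c : OpenPartialHomeomorph Y (CE m)} (hc : c ∈ atlas (CE m) Y) {V : Opens X}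
    (hV : V ≤ pre ι (dom c)) : HolData m (OX (m := m) ι V) :=
  (holData hΩ hc).map fun t => resX ι hV (restr ι (dom c) t)

/-- The coefficient `ρ` of the volume form `Re (Ω̂|_𝒳) = ρ D^*(dx, dξ)` of `𝒳`. -/
def rho [IsManifold 𝓘(ℂ, CE m) ω Y] (ι : C(X, Y))
    {Ω : ∀ y : Y, (TangentSpace 𝓘(ℂ, CE m) y) [⋀^Fin m]→ₗ[ℂ] ℂ} (hΩ : IsHolomorphicForm Ω)
    {c : OpenPartialHomeomorph Y (CE m)} (hc : c ∈ atlas (CE m) Y) {V : Opens X}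
    (hV : V ≤ pre ι (dom c)) (q : SuperCoords (OX (m := m) ι V) (parityX ι V) m) :
    OX (m := m) ι V :=
  rePart ((holDataX ι hΩ hc hV).density q.dx q.dξ)

/-- `H` is the Hamiltonian vector field of `f ∈ 𝒪_𝒳(V)` with respect to `η_c|_𝒳`: it is a vector
field with `η_c(w, H) = w(f)` for all vector fields `w`. -/
def IsHamiltonian [IsManifold 𝓘(ℂ, CE m) ω Y] (ι : C(X, Y))
    {Ω : ∀ y : Y, (TangentSpace 𝓘(ℂ, CE m) y) [⋀^Fin m]→ₗ[ℂ] ℂ} (hΩ : IsHolomorphicForm Ω)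
    {c : OpenPartialHomeomorph Y (CE m)} (hc : c ∈ atlas (CE m) Y) {V : Opens X}
    (hV : V ≤ pre ι (dom c)) (f : OX (m := m) ι V)
    (H : OX (m := m) ι V →ₗ[ℝ] OX (m := m) ι V) : Prop :=
  (∃ H₀ H₁, IsVF (parityX ι V) 0 H₀ ∧ IsVF (parityX ι V) 1 H₁ ∧ H = H₀ + H₁) ∧
  ∀ (s : Fin 2) (w : OX (m := m) ι V →ₗ[ℝ] OX (m := m) ι V), IsVF (parityX ι V) s w →
    (holDataX ι hΩ hc hV).etaC (parityX ι V) w H = 1 ⊗ₜ[ℝ] w f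

/-- `Γ(𝒳, 𝒪_𝒳)`. -/
abbrev GammaX (ι : C(X, Y)) : Type _ := OX (m := m) ι ⊤

/-- The line `ℝ` of constant functions in `Γ(𝒳, 𝒪_𝒳)`. -/
def constants (ι : C(X, Y)) : Submodule ℝ (GammaX (m := m) ι) := Submodule.span ℝ {1}

/-- `Δ : Γ(𝒳, 𝒪_𝒳)/ℝ → Γ(𝒳, 𝒪_𝒳)` is the Batalin–Vilkovisky operator of
`(𝒳, η_c|_𝒳, Re Ω̂|_𝒳)`: `Δ f = ½ div H_f` with
`div H = ρ⁻¹ (∑ ∂(H^x ρ)/∂x + ∑ (-1)^{1+|H|} ∂(H^ξ ρ)/∂ξ)`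
(note that `σ (H^ξ) = (-1)^{1+|H|} H^ξ`). -/
def IsBVOperator [IsManifold 𝓘(ℂ, CE m) ω Y] (ι : C(X, Y))
    {Ω : ∀ y : Y, (TangentSpace 𝓘(ℂ, CE m) y) [⋀^Fin m]→ₗ[ℂ] ℂ} (hΩ : IsHolomorphicForm Ω)
    (Δ : (GammaX (m := m) ι ⧸ constants (m := m) ι) →ₗ[ℝ] GammaX (m := m) ι) : Prop :=
  ∀ (f : GammaX (m := m) ι) (c : OpenPartialHomeomorph Y (CE m)) (hc : c ∈ atlas (CE m) Y)
    (V : Opens X) (hV : V ≤ pre ι (dom c))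
    (q : SuperCoords (OX (m := m) ι V) (parityX ι V) m)
    (H : OX (m := m) ι V →ₗ[ℝ] OX (m := m) ι V),
    IsHamiltonian ι hΩ hc hV (resX ι le_top f) H →
    rho ι hΩ hc hV q * resX ι le_top (Δ ((constants (m := m) ι).mkQ f)) =
      (1 / 2 : ℝ) • (∑ i, q.dx i (H (q.x i) * rho ι hΩ hc hV q) +
        ∑ j, q.dξ j (parityX ι V (H (q.ξ j)) * rho ι hΩ hc hV q))

/-- The vector field `D` along `𝒳` represents the image of `f` under
`i = j ∘ d : 𝒪_𝒳 / ℝ → 𝒩`: one has `η(w, D) = w(f)` for all vector fields `w` on `𝒳`. Here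
`D = D 0 + D 1` is the decomposition into homogeneous parts. -/
def RepresentsDifferential [IsManifold 𝓘(ℂ, CE m) ω Y] (ι : C(X, Y))
    {Ω : ∀ y : Y, (TangentSpace 𝓘(ℂ, CE m) y) [⋀^Fin m]→ₗ[ℂ] ℂ} (hΩ : IsHolomorphicForm Ω)
    (f : GammaX (m := m) ι) (D : ∀ p : Fin 2, VFAlong (m := m) ι p) : Prop :=
  ∀ (c : OpenPartialHomeomorph Y (CE m)) (hc : c ∈ atlas (CE m) Y) (V : Opens X)
    (hV : V ≤ pre ι (dom c)) (s : Fin 2) (w : OX (m := m) ι V →ₗ[ℝ] OX (m := m) ι V),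
    IsVF (parityX ι V) s w →
    (holData hΩ hc).eta (parityX ι V) (fun t => resX ι hV (restr ι (dom c) t)) w
      ((resX ι hV).toLinearMap ∘ₗ ((D 0).1 (dom c) + (D 1).1 (dom c))) = w (resX ι le_top f)

/-- Multiplication by `i` on the tangent space of `Y` (the complex structure). -/
def mulI (y : Y) (v : TY m y) : TY m y := (Complex.I • (show CE m from v) : CE m)

/-- `X` is a real slice of the complex manifold `Y`: `ι` is an injective immersion (an
embedding, as `X` is compact in the theorem) and the map `ℂ ⊗ T_x X → T_{ι x} Y`,
`u + i v ↦ dι u + i dι v`, is an isomorphism at every point. -/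
structure IsRealSlice (ι : C(X, Y)) : Prop where
  smooth : ContMDiff 𝓘(ℝ, RE m) 𝓘(ℝ, CE m) ∞ ι
  injective : Function.Injective ι
  bijective : ∀ x : X, Function.Bijective
    fun u : TangentSpace 𝓘(ℝ, RE m) x × TangentSpace 𝓘(ℝ, RE m) x =>
      diff (m := m) ι x u.1 + mulI (ι x) (diff (m := m) ι x u.2)

end GeometryX

end SpecialSlice

end

/-!
The proof is a local computation in charts, based on the following description of vector fields along
the slice. Since `𝒳` is a real slice, `ℂ ⊗ 𝒯𝒳` is isomorphic to the holomorphic tangent sheaf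
`𝒯_c 𝒴` restricted to `𝒳`. So every vector field `D` along the slice is locally `W₁ + i W₂` for
unique vector fields `W₁`, `W₂` on the slice (`IsSplitting`, `exists_isSplitting`): the complex
derivations `W₁ + i W₂` and `D` agree on the holomorphic coordinates `z`, `ζ`. This rests on
`exists_cder`, on the fact that the Jacobian of the holomorphic coordinates in supercoordinates of the
slice is invertible, and on the fact that superderivations along a point are determined by their
values on coordinates (`der_eq_sum`, `der_ext_hco`). Tangential vector fields are those with
`W₂ = 0`, so normal sections are the fields `W₂`, rotated by `i`.

Three conditions are then translated into conditions on `W₂`.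

* On the slice the Liouville form vanishes and `η_c` is real (`Adapted`). Because `η = Im η_c`, this
  gives `η(w, D) = η_c(w, W₂)` for vector fields `w` on the slice (`IsSplitting.eta_eq`). The
  `ε`-part of the Liouville form on the family defined by `D` is `d⟨D, θ⟩ - η(·, D)`
  (`liouville_family`), so the family is exact Lagrangian if and only if `η(·, D) = df` for a function
  `f` (`isExactLagrangian_iff`), that is, if and only if `W₂` is the Hamiltonian vector field `H_f`
  (`Represents.right_eq_ham`, `represents_of_isSplitting`).
* The Jacobian of the family is the product of the Jacobian `1 + ε (∂ W)` of the flow of `W₁ + i W₂`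
  and of the Jacobian of the slice. Hence it is invertible, so that the family always consists of
  real slices (`isRealSliceFamily`). By multiplicativity of the Berezinian (`ber_mul`) and the formula
  `Ber (1 + ε N) = 1 + ε str N` (`ber_one_add`), the restricted volume form varies by the divergence of
  `W₁ + i W₂` (`density_flow`).
* The restriction of `Ω̂` to `𝒳` is real, so the imaginary part of that variation is the divergence of
  `W₂` (`imPart_familyDensity`). For `W₂ = H_f` it vanishes if and only if `Δ f = 0`
  (`Represents.isSpecialFamily_iff`).

The operator `Δ` is given in the coordinates of a chart by `bvLoc`. It does not depend on the chart:
by `Adapted.exists_compare`, the restricted volume form and the divergence with respect to it both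
change by the Berezinian of the change of supercoordinates. That a density in other
supercoordinates yields the same divergence is again read off from `density_flow`, by computing the
variation of the density under the flow of `H` in two frames.

Conversely, each function `f` of parity `1 - p` yields a vector field along the slice `i H_f` of
parity `p`. It is constructed over charts of `Y` by prescribing its values on coordinates
(`exists_derY`), is independent of the chart because changes of holomorphic coordinates are
holomorphic (`cder_hco_transition`), and is glued to `rotated`, which represents `df`
(`represents_rotated`). As `Δ` is odd, the homogeneous components of a solution of `Δ f = 0` are again
solutions (`bvGlobal_oppPart`), and the two parities together give the map `deformKer` on all of
`ker Δ`. Its kernel consists of the functions with vanishing differential: these have no components of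
positive degree, by the Euler operator on an exterior algebra (`exists_scalar_of_contr`), and are locally
constant, hence constants because `X` is connected (`mem_constants_of_der_eq_zero`).

Smoothness of sections of `Λ N` is defined through local extensions to `Y`. In a chart it amounts to
smoothness of the components (`contDiffOn_repX`, `isNormalSection_ofRep`), which makes the sections
over a coordinate domain of `X` isomorphic to the smooth functions with values in `Λ ℝᵐ` (`trivX`).
The multiplication by `i` identifies `TX` with `N` here, so that `𝒳` has the coordinates `x`, `ξ`
adapted to `z`, `ζ`.
-/

noncomputable section

namespace SpecialSlice

open Finset (sum_congr sum_add_distrib smul_sum mul_sum sum_mul sum_sub_distrib sum_comm sum_eq_zero)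

/-- A chart of a complex manifold of dimension `m`. -/
abbrev CChart (m : ℕ) (Y : Type*) [TopologicalSpace Y] := OpenPartialHomeomorph Y (CE m)

/-- A chart of a real manifold of dimension `m`. -/
abbrev RChart (m : ℕ) (X : Type*) [TopologicalSpace X] := OpenPartialHomeomorph X (RE m)

/-! ### Supercommutative algebras and their even part -/

section SuperComm

lemma evenDet_map {S S' : Type*} [Ring S] [Ring S'] {m : ℕ} (f : S →+* S') (A : Matrix (Fin m) (Fin m) S) :
    evenDet (A.map f) = f (evenDet A) := by
  simp only [evenDet, map_sum]
  refine sum_congr rfl fun p _ => ?_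
  rw [Units.smul_def, Units.smul_def, map_zsmul, map_list_prod, List.map_ofFn]
  rfl

variable {S : Type*} [Ring S] [Algebra ℝ S]

/-- A superalgebra with parity involution `τ` is supercommutative: `a b = (-1)^{|a||b|} b a`. -/
structure IsSuperComm (τ : S →ₐ[ℝ] S) : Prop where
  invol : ∀ a, τ (τ a) = a
  even_comm : ∀ a b, τ a = a → a * b = b * a
  odd_comm : ∀ a b, τ a = -a → a * b = τ b * a

lemma IsSuperComm.odd_sq {τ : S →ₐ[ℝ] S} (h : IsSuperComm τ) {a : S} (ha : τ a = -a) :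
    a * a = 0 := by
  have h1 := h.odd_comm a a ha
  rw [ha, neg_mul] at h1
  have h2 : (2 : ℝ) • (a * a) = 0 := by
    rw [two_smul]; nth_rewrite 1 [h1]; simp
  exact (smul_eq_zero.mp h2).resolve_left two_ne_zero

/-- The even part of a supercommutative algebra, as a commutative ring. -/
def EvenPart {τ : S →ₐ[ℝ] S} (_ : IsSuperComm τ) : Type _ := AlgHom.equalizer τ (AlgHom.id ℝ S)

namespace EvenPart

variable {τ : S →ₐ[ℝ] S} (h : IsSuperComm τ)

instance : Ring (EvenPart h) :=
  inferInstanceAs (Ring (AlgHom.equalizer τ (AlgHom.id ℝ S)))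

instance : CommRing (EvenPart h) :=
  { (inferInstance : Ring (EvenPart h)) with
    mul_comm := fun a b => Subtype.ext (h.even_comm a.1 b.1 a.2) }

instance : Algebra ℝ (EvenPart h) :=
  inferInstanceAs (Algebra ℝ (AlgHom.equalizer τ (AlgHom.id ℝ S)))

/-- The inclusion of the even part. -/
def val : EvenPart h →+* S := (AlgHom.equalizer τ (AlgHom.id ℝ S)).val.toRingHom

lemma val_injective : Function.Injective (val h) := Subtype.val_injective

lemma parity_val (a : EvenPart h) : τ (val h a) = val h a := a.2

/-- An even element, as an element of the even part. -/
def mk (a : S) (ha : τ a = a) : EvenPart h := ⟨a, ha⟩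

@[simp] lemma val_mk (a : S) (ha : τ a = a) : val h (mk h a ha) = a := rfl

lemma isUnit_val {a : EvenPart h} : IsUnit (val h a) ↔ IsUnit a := by
  refine ⟨fun ha => ?_, fun ha => ha.map _⟩
  obtain ⟨b, hb, hb'⟩ := isUnit_iff_exists.mp ha
  have h1 : val h a * τ b = 1 := by
    have := congrArg τ hb
    rwa [map_mul, parity_val, map_one] at this
  have h2 : τ b = b := by
    calc τ b = b * val h a * τ b := by rw [hb', one_mul]
      _ = b := by rw [mul_assoc, h1, mul_one]
  exact IsUnit.of_mul_eq_one (mk h b h2) (val_injective h (by simpa using hb))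

end EvenPart

variable {m : ℕ} {n : Type*}

/-- All entries of the matrix are even. -/
def IsEvenMat (τ : S →ₐ[ℝ] S) (M : Matrix n n S) : Prop := ∀ i j, τ (M i j) = M i j

/-- All entries of the matrix are odd. -/
def IsOddMat (τ : S →ₐ[ℝ] S) (M : Matrix n n S) : Prop := ∀ i j, τ (M i j) = -M i j

variable {τ : S →ₐ[ℝ] S}

section Mats

variable {A B : Matrix n n S}

lemma IsEvenMat.one [DecidableEq n] : IsEvenMat τ (1 : Matrix n n S) := fun i j => by
  by_cases h : i = j <;> simp [Matrix.one_apply, h]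

lemma IsEvenMat.add (hA : IsEvenMat τ A) (hB : IsEvenMat τ B) : IsEvenMat τ (A + B) :=
  fun i j => by simp [hA i j, hB i j]

lemma IsEvenMat.sub (hA : IsEvenMat τ A) (hB : IsEvenMat τ B) : IsEvenMat τ (A - B) :=
  fun i j => by simp [hA i j, hB i j]

lemma IsOddMat.neg (hA : IsOddMat τ A) : IsOddMat τ (-A) := fun i j => by simp [hA i j]

variable [Fintype n]

lemma IsEvenMat.mul (hA : IsEvenMat τ A) (hB : IsEvenMat τ B) : IsEvenMat τ (A * B) :=
  fun i j => by simp [Matrix.mul_apply, hA i _, hB _ j]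

lemma IsEvenMat.mul_odd (hA : IsEvenMat τ A) (hB : IsOddMat τ B) : IsOddMat τ (A * B) :=
  fun i j => by simp [Matrix.mul_apply, hA i _, hB _ j]

lemma IsOddMat.mul_even (hA : IsOddMat τ A) (hB : IsEvenMat τ B) : IsOddMat τ (A * B) :=
  fun i j => by simp [Matrix.mul_apply, hA i _, hB _ j]

lemma IsOddMat.mul (hA : IsOddMat τ A) (hB : IsOddMat τ B) : IsEvenMat τ (A * B) :=
  fun i j => by simp [Matrix.mul_apply, hA i _, hB _ j]

lemma IsEvenMat.inv [DecidableEq n] (hA : IsEvenMat τ A) (h1 : A * B = 1) (h2 : B * A = 1) :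
    IsEvenMat τ B := by
  have h3 : A * B.map τ = 1 := by
    have : (A * B).map τ = (1 : Matrix n n S).map τ := by rw [h1]
    rw [Matrix.map_mul, show A.map τ = A from Matrix.ext hA, Matrix.map_one τ (map_zero _) (map_one _)] at this
    exact this
  have h4 : B.map τ = B := by
    calc B.map τ = B * A * B.map τ := by rw [h2, one_mul]
      _ = B := by rw [mul_assoc, h3, mul_one]
  exact fun i j => congrFun (congrFun h4 i) j

end Mats

section EvenDet

variable {A B : Matrix (Fin m) (Fin m) S}

lemma evenDet_eq_det {R : Type*} [CommRing R] (A : Matrix (Fin m) (Fin m) R) :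
    evenDet A = A.det := by
  simp [evenDet, Matrix.det_apply, List.prod_ofFn]

lemma IsEvenMat.exists_lift (h : IsSuperComm τ) (hA : IsEvenMat τ A) :
    ∃ A' : Matrix (Fin m) (Fin m) (EvenPart h), A = A'.map (EvenPart.val h) :=
  ⟨Matrix.of fun i j => EvenPart.mk h (A i j) (hA i j), by ext; simp⟩

lemma evenDet_val (h : IsSuperComm τ) (A : Matrix (Fin m) (Fin m) (EvenPart h)) :
    evenDet (A.map (EvenPart.val h)) = EvenPart.val h A.det := by
  rw [evenDet_map, evenDet_eq_det]

@[simp] lemma evenDet_one : evenDet (1 : Matrix (Fin m) (Fin m) S) = 1 := by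
  have h1 := evenDet_map (m := m) (algebraMap ℝ S) 1
  rw [evenDet_eq_det, Matrix.det_one, map_one,
    Matrix.map_one _ (map_zero _) (map_one _)] at h1
  exact h1

lemma evenDet_mul (h : IsSuperComm τ) (hA : IsEvenMat τ A) (hB : IsEvenMat τ B) :
    evenDet (A * B) = evenDet A * evenDet B := by
  obtain ⟨A', rfl⟩ := IsEvenMat.exists_lift h hA
  obtain ⟨B', rfl⟩ := IsEvenMat.exists_lift h hB
  rw [← Matrix.map_mul, evenDet_val, evenDet_val, evenDet_val, Matrix.det_mul, map_mul]

lemma parity_evenDet (h : IsSuperComm τ) (hA : IsEvenMat τ A) : τ (evenDet A) = evenDet A := by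
  obtain ⟨A', rfl⟩ := IsEvenMat.exists_lift h hA
  rw [evenDet_val, EvenPart.parity_val]

lemma isUnit_iff_isUnit_evenDet (h : IsSuperComm τ) (hA : IsEvenMat τ A) : IsUnit A ↔ IsUnit (evenDet A) := by
  constructor
  · intro hu
    obtain ⟨B, h1, h2⟩ := isUnit_iff_exists.mp hu
    have hB := hA.inv h1 h2
    refine isUnit_iff_exists.mpr ⟨evenDet B, ?_, ?_⟩
    · rw [← evenDet_mul h hA hB, h1, evenDet_one]
    · rw [← evenDet_mul h hB hA, h2, evenDet_one]
  · obtain ⟨A', rfl⟩ := IsEvenMat.exists_lift h hA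
    rw [evenDet_val, EvenPart.isUnit_val, ← Matrix.isUnit_iff_isUnit_det]
    exact fun hu => hu.map (EvenPart.val h).mapMatrix

lemma IsEvenMat.isUnit_of_mul_eq_one (h : IsSuperComm τ) (hA : IsEvenMat τ A) (hB : IsEvenMat τ B) (h1 : A * B = 1) :
    B * A = 1 := by
  obtain ⟨A', rfl⟩ := IsEvenMat.exists_lift h hA
  obtain ⟨B', rfl⟩ := IsEvenMat.exists_lift h hB
  have h2 : A' * B' = 1 := by
    ext i j
    apply EvenPart.val_injective h
    have := congrFun (congrFun h1 i) j
    rw [← Matrix.map_mul] at this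
    by_cases hij : i = j <;> simpa [Matrix.one_apply, hij] using this
  rw [← Matrix.map_mul, mul_eq_one_comm.mp h2, Matrix.map_one _ (map_zero _) (map_one _)]

/-- Determinant of a rank one perturbation of the identity, the perturbation being supported
in the column `j`. -/
lemma evenDet_one_add_col (h : IsSuperComm τ) (j : Fin m) (b : Fin m → S) (hb : ∀ i, τ (b i) = b i) :
    evenDet (1 + Matrix.of fun k l => if l = j then b k else 0) = 1 + b j := by
  have key : (1 + Matrix.of fun k l => if l = j then b k else 0 : Matrix (Fin m) (Fin m) S) =
      (1 + Matrix.replicateCol Unit (fun k => EvenPart.mk h (b k) (hb k)) *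
        Matrix.replicateRow Unit (Pi.single j (1 : EvenPart h)) : Matrix (Fin m) (Fin m) (EvenPart h)).map
        (EvenPart.val h) := by
    ext k l
    by_cases h1 : k = l <;> by_cases h2 : l = j <;>
      simp [Matrix.mul_apply, Matrix.one_apply, h1, h2]
  rw [key, evenDet_val, Matrix.det_one_add_replicateCol_mul_replicateRow]
  simp

/-- Determinant of a rank one perturbation of the identity, the perturbation being supported
in the row `i`. -/
lemma evenDet_one_add_row (h : IsSuperComm τ) (i : Fin m) (b : Fin m → S) (hb : ∀ i, τ (b i) = b i) :
    evenDet (1 + Matrix.of fun k l => if k = i then b l else 0) = 1 + b i := by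
  have key : (1 + Matrix.of fun k l => if k = i then b l else 0 : Matrix (Fin m) (Fin m) S) =
      (1 + Matrix.replicateCol Unit (Pi.single i (1 : EvenPart h)) *
        Matrix.replicateRow Unit (fun k => EvenPart.mk h (b k) (hb k)) :
          Matrix (Fin m) (Fin m) (EvenPart h)).map
        (EvenPart.val h) := by
    ext k l
    by_cases h1 : k = l <;> by_cases h2 : k = i <;>
      simp [Matrix.mul_apply, Matrix.one_apply, Pi.single_apply, h1, h2]
    all_goals by_cases h3 : l = i <;> simp [h3]
  rw [key, evenDet_val, Matrix.det_one_add_replicateCol_mul_replicateRow]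
  simp

/-- For matrices `B`, `C` of odd elements `det (1 + BC) det (1 + CB) = 1`; this is the identity
behind the multiplicativity of the Berezinian. It is additive in `C` after replacing `B` by
`(1 + BC)⁻¹ B`, so it is enough to know it for a matrix `C` with a single nonzero entry. -/
lemma evenDet_one_add_mul_mul_evenDet_one_add_mul (h : IsSuperComm τ) (C : Matrix (Fin m) (Fin m) S)
    (hC : IsOddMat τ C) (B : Matrix (Fin m) (Fin m) S) (hB : IsOddMat τ B) :
    evenDet (1 + B * C) * evenDet (1 + C * B) = 1 := by
  have main : ∀ (s : Finset (Fin m × Fin m)) (B : Matrix (Fin m) (Fin m) S), IsOddMat τ B →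
      evenDet (1 + B * Matrix.of fun i j => if (i, j) ∈ s then C i j else 0) *
        evenDet (1 + (Matrix.of fun i j => if (i, j) ∈ s then C i j else 0) * B) = 1 := by
    intro s
    induction s using Finset.induction_on with
    | empty =>
      intro B _
      have : (Matrix.of fun i j => if (i, j) ∈ (∅ : Finset (Fin m × Fin m)) then C i j else 0) =
        (0 : Matrix (Fin m) (Fin m) S) := by ext; simp
      rw [this]; simp
    | insert a s ha ih =>
      intro B hB
      obtain ⟨i, j⟩ := a
      set Cs : Matrix (Fin m) (Fin m) S := Matrix.of fun i j => if (i, j) ∈ s then C i j else 0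
        with hCs
      have hCsO : IsOddMat τ Cs := fun k l => by
        simp only [hCs, Matrix.of_apply]; split_ifs <;> simp [hC k l]
      set C' : Matrix (Fin m) (Fin m) S := Matrix.single i j (C i j) with hC'
      have hC'O : IsOddMat τ C' := fun k l => by
        simp only [hC', Matrix.single_apply]; split_ifs <;> simp [hC i j]
      have hsum : (Matrix.of fun k l => if (k, l) ∈ insert (i, j) s then C k l else 0) =
          Cs + C' := by
        ext k l
        simp only [hCs, hC', Matrix.of_apply, Matrix.add_apply, Matrix.single_apply,
          Finset.mem_insert, Prod.mk.injEq]
        by_cases h1 : k = i ∧ l = j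
        · obtain ⟨rfl, rfl⟩ := h1
          simp [ha]
        · have h1' : ¬ (i = k ∧ j = l) := fun h => h1 ⟨h.1.symm, h.2.symm⟩
          simp [h1, h1']
      rw [hsum]
      have hIH := ih B hB
      have e1 : IsEvenMat τ (1 + B * Cs) := IsEvenMat.one.add (hB.mul hCsO)
      have e2 : IsEvenMat τ (1 + Cs * B) := IsEvenMat.one.add (hCsO.mul hB)
      have hcomm : evenDet (1 + Cs * B) * evenDet (1 + B * Cs) = 1 := by
        rw [← hIH]; exact (h.even_comm _ _ (parity_evenDet h e2))
      obtain ⟨A, hA1, hA2⟩ := isUnit_iff_exists.mp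
        ((isUnit_iff_isUnit_evenDet h e1).mpr (isUnit_iff_exists.mpr ⟨_, hIH, hcomm⟩))
      obtain ⟨A', hA'1, hA'2⟩ := isUnit_iff_exists.mp
        ((isUnit_iff_isUnit_evenDet h e2).mpr (isUnit_iff_exists.mpr ⟨_, hcomm, hIH⟩))
      have hAB : A * B = B * A' := by
        have : (1 + B * Cs) * B = B * (1 + Cs * B) := by noncomm_ring
        calc A * B = A * (B * ((1 + Cs * B) * A')) := by rw [hA'1, mul_one]
          _ = A * ((1 + B * Cs) * B) * A' := by rw [this]; simp only [mul_assoc]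
          _ = (A * (1 + B * Cs)) * B * A' := by simp only [mul_assoc]
          _ = B * A' := by rw [hA2, one_mul]
      have hAe := e1.inv hA1 hA2
      have hB' : IsOddMat τ (A * B) := hAe.mul_odd hB
      have f1 : 1 + B * (Cs + C') = (1 + B * Cs) * (1 + (A * B) * C') := by
        rw [mul_add (1 + B * Cs), mul_one, ← mul_assoc, ← mul_assoc, hA1, one_mul, mul_add]
        abel
      have f2 : 1 + (Cs + C') * B = (1 + C' * (A * B)) * (1 + Cs * B) := by
        rw [hAB, add_mul 1, one_mul, mul_assoc, mul_assoc, hA'2, mul_one, add_mul]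
        abel
      have e3 : IsEvenMat τ (1 + (A * B) * C') := IsEvenMat.one.add (hB'.mul hC'O)
      have e4 : IsEvenMat τ (1 + C' * (A * B)) := IsEvenMat.one.add (hC'O.mul hB')
      have elem : evenDet (1 + (A * B) * C') * evenDet (1 + C' * (A * B)) = 1 := by
        set B' := A * B
        have g1 : (1 + B' * C') = 1 + Matrix.of fun k l => if l = j then B' k i * C i j else 0 := by
          congr 1
          ext k l
          rcases eq_or_ne l j with rfl | hl
          · simp [hC', Matrix.mul_apply, Matrix.single_apply]
          · simp [hC', Matrix.mul_apply, hl, hl.symm]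
        have g2 : (1 + C' * B') = 1 + Matrix.of fun k l => if k = i then C i j * B' j l else 0 := by
          congr 1
          ext k l
          rcases eq_or_ne k i with rfl | hl
          · simp [hC', Matrix.mul_apply, Matrix.single_apply]
          · simp [hC', Matrix.mul_apply, hl, hl.symm]
        rw [g1, g2, evenDet_one_add_col h j (fun k => B' k i * C i j)
            (fun k => by simp [hB' k i, hC i j]),
          evenDet_one_add_row h i (fun l => C i j * B' j l) (fun k => by simp [hB' j k, hC i j])]
        have k1 : C i j * B' j i = -(B' j i * C i j) := by
          rw [h.odd_comm _ _ (hC i j), hB' j i, neg_mul]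
        have k2 : B' j i * C i j * (B' j i * C i j) = 0 := by
          calc B' j i * C i j * (B' j i * C i j) = B' j i * (C i j * B' j i) * C i j := by
                simp only [mul_assoc]
            _ = 0 := by rw [k1]; simp only [mul_neg, neg_mul, ← mul_assoc, h.odd_sq (hB' j i)]; simp
        rw [k1, add_mul, one_mul, mul_add, mul_one, mul_neg, k2]
        abel
      rw [f1, f2, evenDet_mul h e1 e3, evenDet_mul h e4 e2]
      calc evenDet (1 + B * Cs) * evenDet (1 + A * B * C') *
            (evenDet (1 + C' * (A * B)) * evenDet (1 + Cs * B))
          = evenDet (1 + B * Cs) * (evenDet (1 + A * B * C') *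
            evenDet (1 + C' * (A * B))) * evenDet (1 + Cs * B) := by simp only [mul_assoc]
        _ = 1 := by rw [elem, mul_one, hIH]
  have := main Finset.univ B hB
  have hC2 : (Matrix.of fun i j => if (i, j) ∈ (Finset.univ : Finset (Fin m × Fin m))
      then C i j else 0) = C := by ext; simp
  rwa [hC2] at this

end EvenDet

end SuperComm

/-! ### The Berezinian -/

section Berezinian

variable {S : Type*} [Ring S] [Algebra ℝ S] {m : ℕ} {τ : S →ₐ[ℝ] S}

/-- The sign `(-1)^{|a|}` of an index of a supermatrix. -/
def sg : Fin m ⊕ Fin m → ℝ := Sum.elim (fun _ => 1) (fun _ => -1)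

@[simp] lemma sg_inl (i : Fin m) : sg (Sum.inl i) = 1 := rfl
@[simp] lemma sg_inr (i : Fin m) : sg (Sum.inr i) = -1 := rfl
@[simp] lemma sg_mul_self (a : Fin m ⊕ Fin m) : sg a * sg a = 1 := by cases a <;> simp

/-- Even supermatrices: the entry at `(a, b)` has parity `|a| + |b|`. -/
def IsEvenSM (τ : S →ₐ[ℝ] S) (M : Matrix (Fin m ⊕ Fin m) (Fin m ⊕ Fin m) S) : Prop :=
  ∀ a b, τ (M a b) = (sg a * sg b) • M a b

section

variable {M N : Matrix (Fin m ⊕ Fin m) (Fin m ⊕ Fin m) S}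

lemma IsEvenSM.inv (hM : IsEvenSM τ M) (h1 : M * N = 1) (h2 : N * M = 1) : IsEvenSM τ N := by
  have h3 : M * (Matrix.of fun a b => (sg a * sg b) • τ (N a b)) = 1 := by
    ext a b
    have := congrArg τ (congrFun (congrFun h1 a) b)
    simp only [Matrix.mul_apply, map_sum, map_mul, hM a _] at this
    have h4 : ∀ c : Fin m ⊕ Fin m, sg b * sg c * (sg a * sg c) = sg a * sg b := fun c => by
      calc _ = sg c * sg c * (sg a * sg b) := by ring
        _ = _ := by rw [sg_mul_self, one_mul]
    calc (M * (Matrix.of fun a b => (sg a * sg b) • τ (N a b))) a b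
        = (sg a * sg b) • ∑ c, (sg a * sg c) • M a c * τ (N c b) := by
          rw [Matrix.mul_apply, smul_sum]
          refine sum_congr rfl fun c _ => ?_
          simp only [Matrix.of_apply, mul_smul_comm, smul_mul_assoc, smul_smul]
          congr 1
          calc sg c * sg b = sg a * sg a * (sg c * sg b) := by rw [sg_mul_self, one_mul]
            _ = _ := by ring
      _ = (1 : Matrix (Fin m ⊕ Fin m) (Fin m ⊕ Fin m) S) a b := by
          rw [this]
          by_cases hab : a = b
          · subst hab; simp
          · simp [hab]
  have h4 : (Matrix.of fun a b => (sg a * sg b) • τ (N a b)) = N := by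
    calc _ = N * M * (Matrix.of fun a b => (sg a * sg b) • τ (N a b)) := by rw [h2, one_mul]
      _ = N := by rw [mul_assoc, h3, mul_one]
  intro a b
  have h5 : (sg a * sg b) • τ (N a b) = N a b := congrFun (congrFun h4 a) b
  nth_rewrite 2 [← h5]
  rw [smul_smul, show sg a * sg b * (sg a * sg b) = sg a * sg a * (sg b * sg b) by ring]
  simp

lemma IsEvenSM.even₁₁ (hM : IsEvenSM τ M) : IsEvenMat τ M.toBlocks₁₁ := fun i j => by
  have := hM (Sum.inl i) (Sum.inl j)
  simp at this
  exact this

lemma IsEvenSM.even₂₂ (hM : IsEvenSM τ M) : IsEvenMat τ M.toBlocks₂₂ := fun i j => by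
  have := hM (Sum.inr i) (Sum.inr j)
  simp at this
  exact this

lemma IsEvenSM.odd₁₂ (hM : IsEvenSM τ M) : IsOddMat τ M.toBlocks₁₂ := fun i j => by
  have := hM (Sum.inl i) (Sum.inr j)
  simp at this
  exact this

lemma IsEvenSM.odd₂₁ (hM : IsEvenSM τ M) : IsOddMat τ M.toBlocks₂₁ := fun i j => by
  have := hM (Sum.inr i) (Sum.inl j)
  simp at this
  exact this

end

/-- A supermatrix given by its decomposition `U Δ L` into an upper unitriangular factor `U` with
block `q`, a block diagonal factor `Δ` with blocks `s`, `d`, and a lower unitriangular factor `L`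
with block `c`. -/
def udl {S : Type*} [Ring S] {m : ℕ} (s q c d : Matrix (Fin m) (Fin m) S) : Matrix (Fin m ⊕ Fin m) (Fin m ⊕ Fin m) S :=
  Matrix.fromBlocks (s + q * d * c) (q * d) (d * c) d

lemma ber_udl {S : Type*} [Ring S] {m : ℕ} (s q c : Matrix (Fin m) (Fin m) S) {d : Matrix (Fin m) (Fin m) S} (hd : IsUnit d) :
    ber (udl s q c d) = evenDet s * Ring.inverse (evenDet d) := by
  have : q * d * Ring.inverse d * (d * c) = q * d * c := by
    calc q * d * Ring.inverse d * (d * c) = q * (d * Ring.inverse d) * (d * c) := by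
          simp only [mul_assoc]
      _ = q * d * c := by rw [Ring.mul_inverse_cancel _ hd, mul_one, mul_assoc]
  simp only [ber, udl, Matrix.toBlocks_fromBlocks₁₁, Matrix.toBlocks_fromBlocks₁₂,
    Matrix.toBlocks_fromBlocks₂₁, Matrix.toBlocks_fromBlocks₂₂, this, add_sub_cancel_right]

/-- In an invertible even supermatrix the odd-odd block is invertible. -/
lemma IsEvenSM.isUnit₂₂ (h : IsSuperComm τ) {M : Matrix (Fin m ⊕ Fin m) (Fin m ⊕ Fin m) S}
    (hM : IsEvenSM τ M) (hu : IsUnit M) : IsUnit M.toBlocks₂₂ := by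
  obtain ⟨N, h1, h2⟩ := isUnit_iff_exists.mp hu
  have hN := hM.inv h1 h2
  have h3 : M.toBlocks₂₂ * N.toBlocks₂₂ = 1 + M.toBlocks₂₁ * -N.toBlocks₁₂ := by
    have h4 : (M * N).toBlocks₂₂ = 1 := by
      rw [h1]; ext i j; simp [Matrix.toBlocks₂₂, Matrix.one_apply]
    rw [← Matrix.fromBlocks_toBlocks M, ← Matrix.fromBlocks_toBlocks N,
      Matrix.fromBlocks_multiply, Matrix.toBlocks_fromBlocks₂₂] at h4
    rw [← h4, mul_neg]; abel
  have h5 := evenDet_one_add_mul_mul_evenDet_one_add_mul h _ hN.odd₁₂.neg _ hM.odd₂₁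
  rw [← h3, evenDet_mul h hM.even₂₂ hN.even₂₂, mul_assoc] at h5
  rw [isUnit_iff_isUnit_evenDet h hM.even₂₂]
  exact isUnit_iff_exists.mpr ⟨_, h5, by
    rw [← h.even_comm _ _ (parity_evenDet h hM.even₂₂), h5]⟩

lemma IsEvenSM.exists_udl (h : IsSuperComm τ) {M : Matrix (Fin m ⊕ Fin m) (Fin m ⊕ Fin m) S}
    (hM : IsEvenSM τ M) (hu : IsUnit M) :
    ∃ s q c d : Matrix (Fin m) (Fin m) S, IsEvenMat τ s ∧ IsOddMat τ q ∧ IsOddMat τ c ∧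
      IsEvenMat τ d ∧ IsUnit d ∧ M = udl s q c d := by
  obtain ⟨e, h1, h2⟩ := isUnit_iff_exists.mp (hM.isUnit₂₂ h hu)
  have he := hM.even₂₂.inv h1 h2
  refine ⟨M.toBlocks₁₁ - M.toBlocks₁₂ * e * M.toBlocks₂₁, M.toBlocks₁₂ * e, e * M.toBlocks₂₁,
    M.toBlocks₂₂, hM.even₁₁.sub ((hM.odd₁₂.mul_even he).mul hM.odd₂₁), hM.odd₁₂.mul_even he,
    he.mul_odd hM.odd₂₁, hM.even₂₂, hM.isUnit₂₂ h hu, ?_⟩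
  conv_lhs => rw [← Matrix.fromBlocks_toBlocks M]
  rw [udl]
  congr 1
  · rw [mul_assoc _ e M.toBlocks₂₂, h2, mul_one, mul_assoc]; abel
  · rw [mul_assoc, h2, mul_one]
  · rw [← mul_assoc, h1, one_mul]

lemma IsEvenMat.exists_det (h : IsSuperComm τ) {A : Matrix (Fin m) (Fin m) S}
    (hA : IsEvenMat τ A) : ∃ a : EvenPart h, evenDet A = EvenPart.val h a :=
  ⟨EvenPart.mk h _ (parity_evenDet h hA), rfl⟩

/-- A ring homomorphism commutes with the inverse of a unit. -/
lemma map_ringInverse {R R' : Type*} [Ring R] [Ring R'] (f : R →+* R') {a : R} (ha : IsUnit a) :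
    f (Ring.inverse a) = Ring.inverse (f a) := by
  obtain ⟨u, rfl⟩ := ha
  rw [Ring.inverse_unit]
  exact (Ring.inverse_unit (Units.map (f : R →* R') u)).symm

/-- `det (1 + D) = 1 + tr D` if all products of two entries of `D` vanish. -/
lemma det_one_add_of_mul_eq_zero {R : Type*} [CommRing R] {D : Matrix (Fin m) (Fin m) R}
    (hD : ∀ i j k l, D i j * D k l = 0) : (1 + D).det = 1 + D.trace := by
  have main : ∀ s : Finset (Fin m × Fin m),
      (1 + ∑ p ∈ s, Matrix.single p.1 p.2 (D p.1 p.2)).det =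
        1 + ∑ p ∈ s, (Matrix.single p.1 p.2 (D p.1 p.2)).trace := by
    intro s
    induction s using Finset.induction_on with
    | empty => simp
    | insert a s ha ih =>
      have hz : Matrix.single a.1 a.2 (D a.1 a.2) *
          ∑ p ∈ s, Matrix.single p.1 p.2 (D p.1 p.2) = 0 := by
        rw [mul_sum]
        refine sum_eq_zero fun p _ => ?_
        by_cases hp : a.2 = p.1
        · rw [← hp, Matrix.single_mul_single_same, hp, hD, Matrix.single_zero]
        · rw [Matrix.single_mul_single_of_ne _ _ _ _ hp]
      have hsq : (Matrix.single a.1 a.2 (D a.1 a.2)).trace *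
          ∑ p ∈ s, (Matrix.single p.1 p.2 (D p.1 p.2)).trace = 0 := by
        rw [mul_sum]
        refine sum_eq_zero fun p _ => ?_
        by_cases h1 : a.1 = a.2 <;> by_cases h2 : p.1 = p.2 <;>
          simp [Matrix.trace_single_eq_of_ne, h1, h2, hD]
      have hone : (1 + Matrix.single a.1 a.2 (D a.1 a.2)).det =
          1 + (Matrix.single a.1 a.2 (D a.1 a.2)).trace := by
        have : Matrix.single a.1 a.2 (D a.1 a.2) =
            Matrix.replicateCol Unit (Pi.single a.1 (D a.1 a.2)) *
              Matrix.replicateRow Unit (Pi.single a.2 (1 : R)) := by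
          ext i j
          simp only [Matrix.single_apply, Matrix.mul_apply, Matrix.replicateCol_apply,
            Matrix.replicateRow_apply, Pi.single_apply, Finset.univ_unique, Finset.sum_singleton]
          by_cases hi : i = a.1 <;> by_cases hj : j = a.2 <;> simp [hi, hj, eq_comm]
        rw [this, Matrix.det_one_add_replicateCol_mul_replicateRow, ← this]
        by_cases h1 : a.1 = a.2
        · simp [h1]
        · simp [h1, Matrix.trace_single_eq_of_ne]
      rw [Finset.sum_insert ha, Finset.sum_insert ha]
      have : 1 + (Matrix.single a.1 a.2 (D a.1 a.2) +
          ∑ p ∈ s, Matrix.single p.1 p.2 (D p.1 p.2)) =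
          (1 + Matrix.single a.1 a.2 (D a.1 a.2)) *
            (1 + ∑ p ∈ s, Matrix.single p.1 p.2 (D p.1 p.2)) := by
        rw [add_mul, one_mul, mul_add, mul_one, hz]; abel
      rw [this, Matrix.det_mul, ih, hone, add_mul, one_mul, mul_add, mul_one, hsq]
      abel
  have h1 : ∑ p : Fin m × Fin m, Matrix.single p.1 p.2 (D p.1 p.2) = D := by
    conv_rhs => rw [Matrix.matrix_eq_sum_single D]
    rw [Fintype.sum_prod_type]
  have h2 := main Finset.univ
  rw [← Matrix.trace_sum, h1] at h2
  exact h2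

/-- The Berezinian is multiplicative. -/
lemma ber_mul (h : IsSuperComm τ) {M N : Matrix (Fin m ⊕ Fin m) (Fin m ⊕ Fin m) S}
    (hM : IsEvenSM τ M) (hMu : IsUnit M) (hN : IsEvenSM τ N) (hNu : IsUnit N) :
    ber (M * N) = ber M * ber N := by
  obtain ⟨s, q, c, d, hs, hq, hc, hd, hdu, rfl⟩ := hM.exists_udl h hMu
  obtain ⟨s', q', c', d', hs', hq', hc', hd', hdu', rfl⟩ := hN.exists_udl h hNu
  -- The product `L U'` of the inner factors is decomposed again, with diagonal blocks
  -- `(1 + q' c)⁻¹` and `1 + c q'`.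
  have e0 : IsEvenMat τ (1 + c * q') := IsEvenMat.one.add (hc.mul hq')
  have e1 : IsEvenMat τ (1 + q' * c) := IsEvenMat.one.add (hq'.mul hc)
  have hdet := evenDet_one_add_mul_mul_evenDet_one_add_mul h _ hc _ hq'
  have hdet' : evenDet (1 + c * q') * evenDet (1 + q' * c) = 1 := by
    rw [← hdet]; exact h.even_comm _ _ (parity_evenDet h e0)
  have hu0 : IsUnit (1 + c * q') := (isUnit_iff_isUnit_evenDet h e0).mpr
    (isUnit_iff_exists.mpr ⟨_, hdet', hdet⟩)
  obtain ⟨g, hg1, hg2⟩ := isUnit_iff_exists.mp hu0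
  obtain ⟨e, he1, he2⟩ := isUnit_iff_exists.mp hdu
  obtain ⟨e', he'1, he'2⟩ := isUnit_iff_exists.mp hdu'
  have hge := e0.inv hg1 hg2
  have s0e : IsEvenMat τ (1 - q' * g * c) := IsEvenMat.one.sub ((hq'.mul_even hge).mul hc)
  have hs0 : (1 + q' * c) * (1 - q' * g * c) = 1 := by
    have k : q' * c * (q' * g * c) = q' * c - q' * g * c := by
      have : c * q' * g = 1 - g := by
        rw [← hg1]; noncomm_ring
      calc q' * c * (q' * g * c) = q' * (c * q' * g) * c := by simp only [mul_assoc]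
        _ = _ := by rw [this]; noncomm_ring
    rw [add_mul, one_mul, mul_sub, mul_one, k]; abel
  have hdet0 : evenDet (1 - q' * g * c) = evenDet (1 + c * q') := by
    have k := evenDet_mul h e1 s0e
    rw [hs0, evenDet_one] at k
    calc evenDet (1 - q' * g * c) = evenDet (1 + c * q') * evenDet (1 + q' * c) *
          evenDet (1 - q' * g * c) := by rw [hdet', one_mul]
      _ = _ := by rw [mul_assoc, ← k, mul_one]
  have hprod : udl s q c d * udl s' q' c' d' =
      udl (s * (1 - q' * g * c) * s') (q + s * (q' * g) * e) (c' + e' * (g * c) * s')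
        (d * (1 + c * q') * d') := by
    have k1 : s * (q' * g) * e * (d * (1 + c * q') * d') = s * q' * d' := by
      calc _ = s * q' * g * (e * d) * (1 + c * q') * d' := by simp only [mul_assoc]
        _ = s * q' * (g * (1 + c * q')) * d' := by rw [he2, mul_one]; simp only [mul_assoc]
        _ = _ := by rw [hg2, mul_one]
    have k2 : d * (1 + c * q') * d' * (e' * (g * c) * s') = d * c * s' := by
      calc _ = d * (1 + c * q') * (d' * e') * g * c * s' := by simp only [mul_assoc]
        _ = d * ((1 + c * q') * g) * c * s' := by rw [he'1, mul_one]; simp only [mul_assoc]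
        _ = _ := by rw [hg1, mul_one]
    have k3 : s * (q' * g) * e * (d * c * s') = s * q' * g * c * s' := by
      calc _ = s * q' * g * (e * d) * c * s' := by simp only [mul_assoc]
        _ = _ := by rw [he2, mul_one]
    rw [udl, udl, udl, Matrix.fromBlocks_multiply]
    congr 1
    · rw [mul_assoc (q + _), mul_add (d * (1 + c * q') * d'), k2, add_mul q, mul_add q,
        mul_add (s * (q' * g) * e), k3, ← mul_assoc (s * (q' * g) * e), k1]
      noncomm_ring
    · rw [add_mul q, k1]; noncomm_ring
    · rw [mul_add (d * (1 + c * q') * d'), k2]; noncomm_ring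
    · noncomm_ring
  have hdu0 : IsUnit (d * (1 + c * q') * d') := (hdu.mul hu0).mul hdu'
  rw [hprod, ber_udl _ _ _ hdu0, ber_udl _ _ _ hdu, ber_udl _ _ _ hdu',
    evenDet_mul h (hd.mul e0) hd', evenDet_mul h hd e0, evenDet_mul h (hs.mul s0e) hs',
    evenDet_mul h hs s0e, hdet0]
  obtain ⟨a, ha⟩ := hs.exists_det h
  obtain ⟨a', ha'⟩ := hs'.exists_det h
  obtain ⟨b, hb⟩ := hd.exists_det h
  obtain ⟨b', hb'⟩ := hd'.exists_det h
  obtain ⟨t, ht⟩ := e0.exists_det h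
  have ub : IsUnit b := by
    rw [← EvenPart.isUnit_val h, ← hb]; exact (isUnit_iff_isUnit_evenDet h hd).mp hdu
  have ub' : IsUnit b' := by
    rw [← EvenPart.isUnit_val h, ← hb']; exact (isUnit_iff_isUnit_evenDet h hd').mp hdu'
  have ut : IsUnit t := by
    rw [← EvenPart.isUnit_val h, ← ht]; exact (isUnit_iff_isUnit_evenDet h e0).mp hu0
  rw [ha, ha', hb, hb', ht]
  simp only [← map_mul, ← map_ringInverse _ ub, ← map_ringInverse _ ub', ← map_ringInverse _ ((ub.mul ut).mul ub')]
  congr 1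
  apply ((ub.mul ut).mul ub').mul_right_cancel
  calc _ = a * t * a' := by
        rw [mul_assoc (a * t * a'), Ring.inverse_mul_cancel _ ((ub.mul ut).mul ub'), mul_one]
    _ = a * t * a' * (Ring.inverse b * b) * (Ring.inverse b' * b') := by
        rw [Ring.inverse_mul_cancel _ ub, Ring.inverse_mul_cancel _ ub', mul_one, mul_one]
    _ = _ := by ring

lemma map_ber (h : IsSuperComm τ) {S' : Type*} [Ring S'] (f : S →+* S')
    {M : Matrix (Fin m ⊕ Fin m) (Fin m ⊕ Fin m) S} (hM : IsEvenSM τ M) (hu : IsUnit M) :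
    ber (M.map f) = f (ber M) := by
  obtain ⟨s, q, c, d, hs, hq, hc, hd, hdu, rfl⟩ := hM.exists_udl h hu
  have h1 : (udl s q c d).map f = udl (s.map f) (q.map f) (c.map f) (d.map f) := by
    simp only [udl, Matrix.fromBlocks_map, Matrix.map_mul]
    rw [Matrix.map_add f (map_add f), Matrix.map_mul, Matrix.map_mul]
  have h2 : IsUnit (d.map f) := hdu.map f.mapMatrix
  rw [h1, ber_udl _ _ _ h2, ber_udl _ _ _ hdu, evenDet_map, evenDet_map, map_mul,
    map_ringInverse f ((isUnit_iff_isUnit_evenDet h hd).mp hdu)]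

/-- The Berezinian of an invertible even supermatrix is even and invertible. -/
lemma IsEvenSM.parity_ber (h : IsSuperComm τ) {M : Matrix (Fin m ⊕ Fin m) (Fin m ⊕ Fin m) S}
    (hM : IsEvenSM τ M) (hu : IsUnit M) : τ (ber M) = ber M := by
  obtain ⟨s, q, c, d, hs, hq, hc, hd, hdu, rfl⟩ := hM.exists_udl h hu
  rw [ber_udl _ _ _ hdu, map_mul, parity_evenDet h hs]
  congr 1
  have := map_ringInverse (τ : S →+* S) ((isUnit_iff_isUnit_evenDet h hd).mp hdu)
  simp only [RingHom.coe_coe, parity_evenDet h hd] at this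
  exact this

/-- First order expansion of the Berezinian at the identity. -/
lemma ber_one_add (h : IsSuperComm τ) {E : Matrix (Fin m ⊕ Fin m) (Fin m ⊕ Fin m) S}
    (hE : IsEvenSM τ E) (h0 : ∀ a b c d, E a b * E c d = 0) :
    ber (1 + E) = 1 + (∑ i, E (Sum.inl i) (Sum.inl i) - ∑ i, E (Sum.inr i) (Sum.inr i)) := by
  have hdet : ∀ D : Matrix (Fin m) (Fin m) S, IsEvenMat τ D → (∀ i j k l, D i j * D k l = 0) →
      evenDet (1 + D) = 1 + ∑ i, D i i := by
    intro D hD hD0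
    obtain ⟨D', rfl⟩ := IsEvenMat.exists_lift h hD
    have hD' : ∀ i j k l, D' i j * D' k l = 0 := fun i j k l =>
      EvenPart.val_injective h (by simpa using hD0 i j k l)
    have : (1 + D'.map (EvenPart.val h)) = (1 + D').map (EvenPart.val h) := by
      rw [Matrix.map_add _ (map_add _), Matrix.map_one _ (map_zero _) (map_one _)]
    rw [this, evenDet_val, det_one_add_of_mul_eq_zero hD']
    simp [Matrix.trace, map_add, map_sum]
  have hz : ∀ A B : Matrix (Fin m) (Fin m) S, (∀ i j k l, A i j * B k l = 0) → A * B = 0 :=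
    fun A B hAB => by ext i j; simp [Matrix.mul_apply, hAB]
  have h22 : E.toBlocks₂₂ * E.toBlocks₂₂ = 0 := hz _ _ fun _ _ _ _ => h0 _ _ _ _
  have hud : 1 + E = udl (1 + E.toBlocks₁₁) E.toBlocks₁₂ E.toBlocks₂₁ (1 + E.toBlocks₂₂) := by
    have z1 : E.toBlocks₁₂ * E.toBlocks₂₂ = 0 := hz _ _ fun _ _ _ _ => h0 _ _ _ _
    have z2 : E.toBlocks₂₂ * E.toBlocks₂₁ = 0 := hz _ _ fun _ _ _ _ => h0 _ _ _ _
    have z3 : E.toBlocks₁₂ * E.toBlocks₂₁ = 0 := hz _ _ fun _ _ _ _ => h0 _ _ _ _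
    simp only [udl, mul_add, add_mul, mul_one, one_mul, add_zero, z1, z2, z3]
    conv_lhs => rw [← Matrix.fromBlocks_toBlocks E, ← Matrix.fromBlocks_one,
      Matrix.fromBlocks_add, zero_add, zero_add]
  have hu : IsUnit (1 + E.toBlocks₂₂) := isUnit_iff_exists.mpr ⟨1 - E.toBlocks₂₂, by
    rw [add_mul, one_mul, mul_sub, mul_one, h22]; abel, by
    rw [sub_mul, one_mul, mul_add, mul_one, h22]; abel⟩
  rw [hud, ber_udl _ _ _ hu, hdet _ hE.even₁₁ fun _ _ _ _ => h0 _ _ _ _,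
    hdet _ hE.even₂₂ fun _ _ _ _ => h0 _ _ _ _]
  set A := ∑ i, E.toBlocks₁₁ i i with hA
  set D := ∑ i, E.toBlocks₂₂ i i with hD
  have hAD : A * D = 0 := by
    simp only [hA, hD, sum_mul, mul_sum]
    exact sum_eq_zero fun i _ => sum_eq_zero fun j _ => h0 _ _ _ _
  have hDD : D * D = 0 := by
    simp only [hD, sum_mul, mul_sum]
    exact sum_eq_zero fun i _ => sum_eq_zero fun j _ => h0 _ _ _ _
  have hinv : Ring.inverse (1 + D) = 1 - D := by
    refine Ring.inverse_unit (⟨1 + D, 1 - D, ?_, ?_⟩ : Sˣ)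
    · rw [add_mul, one_mul, mul_sub, mul_one, hDD]; abel
    · rw [sub_mul, one_mul, mul_add, mul_one, hDD]; abel
  rw [hinv, add_mul, one_mul, mul_sub, mul_one, hAD]
  change 1 - D + (A - 0) = 1 + (A - D)
  abel

end Berezinian

/-! ### Complexification -/

section Complexify

variable {R R' B : Type*} [Ring R] [Algebra ℝ R] [Ring R'] [Algebra ℝ R'] [Ring B] [Algebra ℝ B]

lemma tmul_eq_cpx (z : ℂ) (b : R) : z ⊗ₜ[ℝ] b = cpx (z.re • b) (z.im • b) := by
  rw [cpx, TensorProduct.tmul_smul, TensorProduct.tmul_smul, TensorProduct.smul_tmul',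
    TensorProduct.smul_tmul', ← TensorProduct.add_tmul]
  congr 1
  apply Complex.ext <;> simp

lemma cpx_add (a b c d : R) : cpx a b + cpx c d = cpx (a + c) (b + d) := by
  simp only [cpx, TensorProduct.tmul_add]; abel

lemma cpx_sub (a b c d : R) : cpx a b - cpx c d = cpx (a - c) (b - d) := by
  simp only [cpx, TensorProduct.tmul_sub]; abel

lemma smul_cpx (c : ℝ) (a b : R) : c • cpx a b = cpx (c • a) (c • b) := by simp [cpx]

lemma neg_cpx (a b : R) : -cpx a b = cpx (-a) (-b) := by
  simp only [cpx, TensorProduct.tmul_neg]; abel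

lemma cpx_mul (a b c d : R) : cpx a b * cpx c d = cpx (a * c - b * d) (a * d + b * c) := by
  simp only [cpx, mul_add, add_mul, Algebra.TensorProduct.tmul_mul_tmul, one_mul, mul_one,
    Complex.I_mul_I, TensorProduct.neg_tmul, TensorProduct.tmul_add, TensorProduct.tmul_sub]
  abel

lemma cpx_sum {ι : Type*} (s : Finset ι) (f g : ι → R) :
    ∑ i ∈ s, cpx (f i) (g i) = cpx (∑ i ∈ s, f i) (∑ i ∈ s, g i) := by
  simp only [cpx, TensorProduct.tmul_sum, sum_add_distrib]

@[simp] lemma cpx_zero_right (a : R) : cpx a 0 = 1 ⊗ₜ[ℝ] a := by simp [cpx]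

lemma I_smul_cpx (a b : R) : Complex.I • cpx a b = cpx (-b) a := by
  simp only [cpx, smul_add, TensorProduct.smul_tmul', smul_eq_mul, mul_one, Complex.I_mul_I,
    TensorProduct.neg_tmul, TensorProduct.tmul_neg]
  abel

@[simp] lemma rePart_cpx (a b : R) : rePart (cpx a b) = a := by
  simp [rePart, cpx]

@[simp] lemma imPart_cpx (a b : R) : imPart (cpx a b) = b := by
  simp [imPart, cpx]

@[simp] lemma rePart_one_tmul (a : R) : rePart (1 ⊗ₜ[ℝ] a) = a := by
  simp [rePart]

@[simp] lemma imPart_one_tmul (a : R) : imPart (1 ⊗ₜ[ℝ] a) = 0 := by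
  simp [imPart]

lemma cpx_re_im (u : ℂ ⊗[ℝ] R) : cpx (rePart u) (imPart u) = u := by
  induction u using TensorProduct.induction_on with
  | zero => simp
  | tmul z b => rw [tmul_eq_cpx]; simp
  | add u v hu hv => rw [map_add, map_add, ← cpx_add, hu, hv]

lemma cpx_inj {a b c d : R} : cpx a b = cpx c d ↔ a = c ∧ b = d := by
  constructor
  · intro h
    have h1 := congrArg rePart h
    have h2 := congrArg imPart h
    simp only [rePart_cpx, imPart_cpx] at h1 h2
    exact ⟨h1, h2⟩
  · rintro ⟨rfl, rfl⟩; rfl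

lemma one_tmul_injective : Function.Injective fun b : R => (1 : ℂ) ⊗ₜ[ℝ] b := fun a b h => by
  simpa using congrArg rePart h

lemma baseChange_cpx (f : R →ₗ[ℝ] R') (a b : R) :
    f.baseChange ℂ (cpx a b) = cpx (f a) (f b) := by
  simp [cpx]

/-- The complexification of an algebra morphism. -/
def cmap (f : R →ₐ[ℝ] R') : ℂ ⊗[ℝ] R →ₐ[ℝ] ℂ ⊗[ℝ] R' :=
  Algebra.TensorProduct.map (AlgHom.id ℝ ℂ) f

@[simp] lemma cmap_tmul (f : R →ₐ[ℝ] R') (z : ℂ) (b : R) :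
    cmap f (z ⊗ₜ[ℝ] b) = z ⊗ₜ[ℝ] f b := rfl

lemma cmap_cpx (f : R →ₐ[ℝ] R') (a b : R) : cmap f (cpx a b) = cpx (f a) (f b) := by
  simp [cpx]

lemma cmap_smul (f : R →ₐ[ℝ] R') (z : ℂ) (u : ℂ ⊗[ℝ] R) : cmap f (z • u) = z • cmap f u := by
  induction u using TensorProduct.induction_on with
  | zero => simp
  | tmul w b => simp [TensorProduct.smul_tmul']
  | add u v hu hv => simp only [smul_add, map_add, hu, hv]

lemma cmap_eq_baseChange (f : R →ₐ[ℝ] R') (u : ℂ ⊗[ℝ] R) :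
    f.toLinearMap.baseChange ℂ u = cmap f u := by
  induction u using TensorProduct.induction_on with
  | zero => simp
  | tmul z b => simp
  | add u v hu hv => rw [map_add, map_add, hu, hv]

lemma cmap_pow (f : R →ₐ[ℝ] R) (n : ℕ) (u : ℂ ⊗[ℝ] R) : cmap (f ^ n) u = (cmap f ^ n) u := by
  induction n generalizing u with
  | zero =>
    rw [pow_zero, pow_zero]
    conv_lhs => rw [← cpx_re_im u, cmap_cpx]
    exact cpx_re_im u
  | succ n ih =>
    rw [pow_succ, pow_succ, AlgHom.mul_apply, ← ih]
    conv_lhs => rw [← cpx_re_im u, cmap_cpx]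
    conv_rhs => rw [← cpx_re_im u, cmap_cpx, cmap_cpx]
    rfl

/-- The inclusion of an algebra in its complexification. -/
def ofReal : R →ₐ[ℝ] ℂ ⊗[ℝ] R := Algebra.TensorProduct.includeRight

@[simp] lemma ofReal_apply (a : R) : ofReal a = 1 ⊗ₜ[ℝ] a := rfl

lemma IsSuperComm.complexify {τ : R →ₐ[ℝ] R} (h : IsSuperComm τ) : IsSuperComm (cmap τ) where
  invol u := by
    rw [← cpx_re_im u]; simp only [cmap_cpx, h.invol]
  even_comm u v hu := by
    rw [← cpx_re_im u, cmap_cpx, cpx_inj] at hu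
    rw [← cpx_re_im u, ← cpx_re_im v, cpx_mul, cpx_mul, h.even_comm _ _ hu.1,
      h.even_comm _ _ hu.2, h.even_comm _ _ hu.1, h.even_comm _ _ hu.2, add_comm]
  odd_comm u v hu := by
    rw [← cpx_re_im u, cmap_cpx, neg_cpx, cpx_inj] at hu
    rw [← cpx_re_im u, ← cpx_re_im v, cmap_cpx, cpx_mul, cpx_mul, h.odd_comm _ _ hu.1,
      h.odd_comm _ _ hu.2, h.odd_comm _ _ hu.1, h.odd_comm _ _ hu.2, add_comm (τ (imPart v) * _)]

lemma IsSuperDer.baseChange {σR : R →ₐ[ℝ] R} {σB : B →ₐ[ℝ] B} {r : R →ₐ[ℝ] B} {p : Fin 2}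
    {D : R →ₗ[ℝ] B} (hD : IsSuperDer σR σB r p D) :
    IsSuperDer (cmap σR) (cmap σB) (cmap r) p ((D.baseChange ℂ).restrictScalars ℝ) := by
  constructor
  · intro u v
    simp only [LinearMap.coe_restrictScalars]
    induction u using TensorProduct.induction_on with
    | zero => simp
    | add u u' hu hu' => simp only [add_mul, map_add, hu, hu']; abel
    | tmul z a =>
      induction v using TensorProduct.induction_on with
      | zero => simp
      | add v v' hv hv' => simp only [mul_add, map_add, hv, hv']; abel
      | tmul w b =>
        rw [← cmap_pow]
        simp only [Algebra.TensorProduct.tmul_mul_tmul, LinearMap.baseChange_tmul, cmap_tmul,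
          hD.1, TensorProduct.tmul_add]
  · intro u
    simp only [LinearMap.coe_restrictScalars]
    rw [← cpx_re_im u, cmap_cpx, baseChange_cpx, baseChange_cpx, cmap_cpx, hD.2, hD.2]
    simp only [cpx, smul_add, TensorProduct.tmul_smul]

end Complexify

/-! ### Vector fields in supercoordinates -/

section VectorFields

variable {B : Type*} [Ring B] [Algebra ℝ B] {σ : B →ₐ[ℝ] B} {m : ℕ} {p : Fin 2}

/-- The parity of an index of a supermatrix. -/
def par : Fin m ⊕ Fin m → Fin 2 := Sum.elim (fun _ => 0) (fun _ => 1)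

lemma sg_eq_pow_par (a : Fin m ⊕ Fin m) : sg a = (-1 : ℝ) ^ (par a : ℕ) := by
  cases a <;> simp [par]

/-- The supercommutator of two vector fields is a vector field. -/
lemma IsSuperDer.supercomm (hB : IsSuperComm σ) {s : Fin 2} {W d : B →ₗ[ℝ] B} (hW : IsVF σ p W)
    (hd : IsVF σ s d) :
    IsVF σ (p + s) ((-1 : ℝ) ^ ((p : ℕ) * (s : ℕ)) • d ∘ₗ W - W ∘ₗ d) := by
  obtain ⟨hW1, hW2⟩ := hW
  obtain ⟨hd1, hd2⟩ := hd
  simp only [AlgHom.coe_id, id_eq] at hW1 hd1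
  refine ⟨fun a b => ?_, fun a => ?_⟩
  · fin_cases p <;> fin_cases s <;>
    simp_all [hB.invol, LinearMap.sub_apply, map_add] <;> noncomm_ring
  · fin_cases p <;> fin_cases s <;> simp_all
    all_goals abel

namespace SuperCoords

variable (q : SuperCoords B σ m)

/-- The coordinate vector fields, even and odd ones together. -/
def d : Fin m ⊕ Fin m → B →ₗ[ℝ] B := Sum.elim q.dx q.dξ

/-- The coordinates, even and odd ones together. -/
def co : Fin m ⊕ Fin m → B := Sum.elim q.x q.ξ

lemma d_isVF (a : Fin m ⊕ Fin m) : IsVF σ (par a) (q.d a) := by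
  cases a with
  | inl i => exact q.dx_isVF i
  | inr j => exact q.dξ_isVF j

lemma parity_co (a : Fin m ⊕ Fin m) : σ (q.co a) = sg a • q.co a := by
  cases a with
  | inl i => simpa [co] using q.x_even i
  | inr j => simpa [co] using q.ξ_odd j

lemma d_co (a b : Fin m ⊕ Fin m) : q.d a (q.co b) = if a = b then 1 else 0 := by
  cases a <;> cases b <;> simp [d, co, q.dx_x, q.dx_ξ, q.dξ_x, q.dξ_ξ]

lemma span' {w : B →ₗ[ℝ] B} (hw : IsVF σ p w) (b : B) :
    w b = ∑ a, w (q.co a) * q.d a b := by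
  rw [q.span p w hw b, Fintype.sum_sum_type]
  rfl

/-- Vector fields with the same values on coordinates agree. -/
lemma ext_vf {w w' : B →ₗ[ℝ] B} (hw : IsVF σ p w) {p' : Fin 2} (hw' : IsVF σ p' w')
    (h : ∀ a, w (q.co a) = w' (q.co a)) : w = w' := by
  ext b
  rw [q.span' hw, q.span' hw']
  simp only [h]

lemma d_comp (hB : IsSuperComm σ) {W : B →ₗ[ℝ] B} (hW : IsVF σ p W) (a : Fin m ⊕ Fin m) (b : B) :
    (-1 : ℝ) ^ ((p : ℕ) * (par a : ℕ)) • q.d a (W b) = W (q.d a b) +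
      ∑ c, ((-1 : ℝ) ^ ((p : ℕ) * (par a : ℕ)) • q.d a (W (q.co c))) * q.d c b := by
  have h := q.span' (hW.supercomm hB (q.d_isVF a)) b
  have hW1 : W 1 = 0 := by
    have h := hW.1 1 1
    simp only [mul_one, map_one, one_mul] at h
    simpa using h
  have h0 : ∀ c, W (q.d a (q.co c)) = 0 := fun c => by
    rw [q.d_co]; split_ifs <;> simp [hW1]
  simp only [LinearMap.sub_apply, LinearMap.smul_apply, LinearMap.comp_apply, h0, sub_zero] at h
  rw [← h]; abel

end SuperCoords

/-- Left multiple of a vector field by a function. -/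
lemma IsSuperDer.mul_left {A : Type*} [Ring A] [Algebra ℝ A] {σA : A →ₐ[ℝ] A} {r : A →ₐ[ℝ] B}
    (hB : IsSuperComm σ) {s : Fin 2} {w : A →ₗ[ℝ] B}
    (hw : IsSuperDer σA σ r s w) {b : B} {u : Fin 2} (hb : σ b = (-1 : ℝ) ^ (u : ℕ) • b) :
    IsSuperDer σA σ r (u + s) (LinearMap.mulLeft ℝ b ∘ₗ w) := by
  obtain ⟨h1, h2⟩ := hw
  refine ⟨fun x y => ?_, fun x => ?_⟩
  · simp only [LinearMap.comp_apply, LinearMap.mulLeft_apply, h1, mul_add, ← mul_assoc]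
    congr 2
    fin_cases u
    · have hb' : σ b = b := by simpa using hb
      rw [hB.even_comm _ _ hb']
      simp
    · have hb' : σ b = -b := by simpa using hb
      rw [hB.odd_comm _ _ hb']
      fin_cases s <;> simp [hB.invol]
  · simp only [LinearMap.comp_apply, LinearMap.mulLeft_apply, h2, map_mul, hb]
    fin_cases u <;> fin_cases s <;> simp

lemma IsSuperDer.sum {A : Type*} [Ring A] [Algebra ℝ A] {σA : A →ₐ[ℝ] A} {r : A →ₐ[ℝ] B}
    {s : Fin 2} {ι : Type*} (t : Finset ι) {w : ι → A →ₗ[ℝ] B}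
    (hw : ∀ i ∈ t, IsSuperDer σA σ r s (w i)) : IsSuperDer σA σ r s (∑ i ∈ t, w i) := by
  induction t using Finset.cons_induction with
  | empty => simpa using IsSuperDer.zero
  | cons a t ha ih =>
    rw [Finset.sum_cons]
    exact (hw a (by simp)).add (ih fun i hi => hw i (by simp [hi]))

end VectorFields

/-! ### First-order deformations of a Berezinian volume form -/

section ThickComplex

variable {B : Type*} [Ring B] [Algebra ℝ B] {σ : B →ₐ[ℝ] B} {m : ℕ} {p : Fin 2}

namespace Thick

lemma fst_sum {A : Type*} (t : Finset A) (g : A → Thick B σ p) :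
    (∑ a ∈ t, g a).fst = ∑ a ∈ t, (g a).fst :=
  map_sum (⟨⟨Thick.fst, rfl⟩, fun _ _ => rfl⟩ : Thick B σ p →+ B) g t

lemma snd_sum {A : Type*} (t : Finset A) (g : A → Thick B σ p) :
    (∑ a ∈ t, g a).snd = ∑ a ∈ t, (g a).snd :=
  map_sum (⟨⟨Thick.snd, rfl⟩, fun _ _ => rfl⟩ : Thick B σ p →+ B) g t

/-- The parity involution of `B ⊗ ℝ[ε]/ε²`. -/
def parity (σ : B →ₐ[ℝ] B) (p : Fin 2) : Thick B σ p →ₐ[ℝ] Thick B σ p :=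
  AlgHom.ofLinearMap
    { toFun := fun a => ⟨σ a.fst, (-1 : ℝ) ^ (p : ℕ) • σ a.snd⟩
      map_add' := fun a b => by ext <;> simp
      map_smul' := fun c a => by ext <;> simp [smul_comm c] }
    (by ext <;> simp)
    (fun a b => by
      ext
      · simp
      · fin_cases p <;> simp [add_comm])

@[simp] lemma fst_parity (a : Thick B σ p) : (parity σ p a).fst = σ a.fst := rfl
@[simp] lemma snd_parity (a : Thick B σ p) :
    (parity σ p a).snd = (-1 : ℝ) ^ (p : ℕ) • σ a.snd := rfl

lemma isSuperComm (hB : IsSuperComm σ) : IsSuperComm (parity σ p) where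
  invol a := by
    ext
    · simp [hB.invol]
    · fin_cases p <;> simp [hB.invol]
  even_comm a b ha := by
    have h1 := congrArg Thick.fst ha
    have h2 := congrArg Thick.snd ha
    simp only [fst_parity, snd_parity] at h1 h2
    ext
    · simp [hB.even_comm _ b.fst h1]
    · fin_cases p
      · have h2' : σ a.snd = a.snd := by simpa using h2
        simp [hB.even_comm _ b.fst h2', hB.even_comm _ b.snd h1, add_comm]
      · have h2' : σ a.snd = -a.snd := by simpa [neg_eq_iff_eq_neg] using h2
        simp [hB.odd_comm _ b.fst h2', h1, hB.even_comm _ b.snd h1, add_comm]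
  odd_comm a b ha := by
    have h1 := congrArg Thick.fst ha
    have h2 := congrArg Thick.snd ha
    simp only [fst_parity, snd_parity, fst_neg, snd_neg] at h1 h2
    ext
    · simp [hB.odd_comm _ b.fst h1]
    · fin_cases p
      · have h2' : σ a.snd = -a.snd := by simpa using h2
        simp [hB.odd_comm _ b.fst h2', hB.odd_comm _ b.snd h1, add_comm]
      · have h2' : σ a.snd = a.snd := by simpa using h2
        simp [hB.even_comm _ b.fst h2', hB.odd_comm _ b.snd h1, h1, hB.invol, add_comm]

/-- The inclusion `B → B ⊗ ℝ[ε]/ε²`. -/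
def inl (σ : B →ₐ[ℝ] B) (p : Fin 2) : B →ₐ[ℝ] Thick B σ p :=
  AlgHom.ofLinearMap
    { toFun := fun a => ⟨a, 0⟩
      map_add' := fun a b => by ext <;> simp
      map_smul' := fun c a => by ext <;> simp }
    (by ext <;> simp) (fun a b => by ext <;> simp)

/-- Left multiplication by `ε`. -/
def eps (σ : B →ₐ[ℝ] B) (p : Fin 2) : B →ₗ[ℝ] Thick B σ p where
  toFun a := ⟨0, a⟩
  map_add' a b := by ext <;> simp
  map_smul' c a := by ext <;> simp

@[simp] lemma fst_inl (a : B) : (inl σ p a).fst = a := rfl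
@[simp] lemma snd_inl (a : B) : (inl σ p a).snd = 0 := rfl
@[simp] lemma fst_eps (a : B) : (eps σ p a).fst = 0 := rfl
@[simp] lemma snd_eps (a : B) : (eps σ p a).snd = a := rfl
@[simp] lemma fst_lift (s : Fin 2) (w : B →ₗ[ℝ] B) (a : Thick B σ p) :
    (lift σ p s w a).fst = w a.fst := rfl
@[simp] lemma snd_lift (s : Fin 2) (w : B →ₗ[ℝ] B) (a : Thick B σ p) :
    (lift σ p s w a).snd = (-1 : ℝ) ^ ((p : ℕ) * (s : ℕ)) • w a.snd := rfl

end Thick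

/-- The complexified inclusion `ℂ ⊗ B → ℂ ⊗ (B ⊗ ℝ[ε]/ε²)`. -/
abbrev cInl (σ : B →ₐ[ℝ] B) (p : Fin 2) : ℂ ⊗[ℝ] B →ₐ[ℝ] ℂ ⊗[ℝ] Thick B σ p := cmap (Thick.inl σ p)

/-- The complexified left multiplication by `ε`. -/
abbrev cEps (σ : B →ₐ[ℝ] B) (p : Fin 2) : ℂ ⊗[ℝ] B →ₗ[ℂ] ℂ ⊗[ℝ] Thick B σ p :=
  (Thick.eps σ p).baseChange ℂ

lemma cInl_cpx (a b : B) : cInl σ p (cpx a b) = cpx ⟨a, 0⟩ ⟨b, 0⟩ := cmap_cpx _ _ _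

lemma cEps_cpx (a b : B) : cEps σ p (cpx a b) = cpx ⟨0, a⟩ ⟨0, b⟩ := baseChange_cpx _ _ _

lemma cpx_thick (a b : Thick B σ p) :
    cpx a b = cInl σ p (cpx a.fst b.fst) + cEps σ p (cpx a.snd b.snd) := by
  rw [cInl_cpx, cEps_cpx, cpx_add]
  congr 1 <;> ext <;> simp

lemma cEps_mul_cInl (u v : ℂ ⊗[ℝ] B) : cEps σ p u * cInl σ p v = cEps σ p (u * v) := by
  rw [← cpx_re_im u, ← cpx_re_im v, cInl_cpx, cEps_cpx, cpx_mul, cpx_mul, cEps_cpx]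
  congr 1 <;> ext <;> simp [sub_eq_add_neg]

lemma cInl_mul_cEps (u v : ℂ ⊗[ℝ] B) :
    cInl σ p u * cEps σ p v = cEps σ p ((cmap σ ^ (p : ℕ)) u * v) := by
  rw [← cpx_re_im u, ← cpx_re_im v, cInl_cpx, cEps_cpx, cpx_mul, ← cmap_pow, cmap_cpx, cpx_mul,
    cEps_cpx]
  congr 1 <;> ext <;> simp [sub_eq_add_neg]

lemma cEps_mul_cEps (u v : ℂ ⊗[ℝ] B) : cEps σ p u * cEps σ p v = 0 := by
  rw [← cpx_re_im u, ← cpx_re_im v, cEps_cpx, cEps_cpx, cpx_mul]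
  have : (0 : ℂ ⊗[ℝ] Thick B σ p) = cpx 0 0 := by simp
  rw [this]
  congr 1 <;> ext <;> simp [sub_eq_add_neg]

lemma cInl_add_cEps_inj {u v u' v' : ℂ ⊗[ℝ] B} :
    cInl σ p u + cEps σ p v = cInl σ p u' + cEps σ p v' ↔ u = u' ∧ v = v' := by
  constructor
  · intro h
    rw [← cpx_re_im u, ← cpx_re_im v, ← cpx_re_im u', ← cpx_re_im v'] at h ⊢
    simp only [cInl_cpx, cEps_cpx, cpx_add, cpx_inj, Thick.ext_iff, Thick.fst_add,
      Thick.snd_add, add_zero, zero_add] at h ⊢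
    exact ⟨⟨h.1.1, h.2.1⟩, h.1.2, h.2.2⟩
  · rintro ⟨rfl, rfl⟩; rfl

lemma lift_cInl_add_cEps (s : Fin 2) (w : B →ₗ[ℝ] B) (u v : ℂ ⊗[ℝ] B) :
    (Thick.lift σ p s w).baseChange ℂ (cInl σ p u + cEps σ p v) =
      cInl σ p (w.baseChange ℂ u) +
        cEps σ p ((-1 : ℝ) ^ ((p : ℕ) * (s : ℕ)) • w.baseChange ℂ v) := by
  rw [← cpx_re_im u, ← cpx_re_im v]
  simp only [cInl_cpx, cpx_add, baseChange_cpx, smul_cpx]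
  congr 1 <;> ext <;> simp

lemma parity_cInl (u : ℂ ⊗[ℝ] B) :
    cmap (Thick.parity σ p) (cInl σ p u) = cInl σ p (cmap σ u) := by
  rw [← cpx_re_im u]
  simp only [cmap_cpx]
  congr 1 <;> ext <;> simp

lemma parity_cEps (u : ℂ ⊗[ℝ] B) :
    cmap (Thick.parity σ p) (cEps σ p u) = (-1 : ℝ) ^ (p : ℕ) • cEps σ p (cmap σ u) := by
  rw [← cpx_re_im u]
  simp only [cEps_cpx, cmap_cpx, smul_cpx]
  congr 1 <;> ext <;> simp

/-- The complex vector field `W₁ + i W₂`. -/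
def cder {A : Type*} [Ring A] [Algebra ℝ A] (W₁ W₂ : A →ₗ[ℝ] B) : ℂ ⊗[ℝ] A →ₗ[ℂ] ℂ ⊗[ℝ] B :=
  W₁.baseChange ℂ + Complex.I • W₂.baseChange ℂ

lemma cder_cpx {A : Type*} [Ring A] [Algebra ℝ A] (W₁ W₂ : A →ₗ[ℝ] B) (a b : A) :
    cder W₁ W₂ (cpx a b) = cpx (W₁ a - W₂ b) (W₁ b + W₂ a) := by
  simp only [cder, LinearMap.add_apply, LinearMap.smul_apply, baseChange_cpx, I_smul_cpx, cpx_add,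
    sub_eq_add_neg]

lemma cder_one_tmul (W₁ W₂ : B →ₗ[ℝ] B) (a : B) :
    cder W₁ W₂ (1 ⊗ₜ a) = cpx (W₁ a) (W₂ a) := by
  rw [← cpx_zero_right, cder_cpx]; simp

lemma cder_isVF {W₁ W₂ : B →ₗ[ℝ] B} (h₁ : IsVF σ p W₁) (h₂ : IsVF σ p W₂) :
    IsVF (cmap σ) p ((cder W₁ W₂).restrictScalars ℝ) := by
  have k₁ := h₁.baseChange
  have k₂ := h₂.baseChange
  have hid : cmap (AlgHom.id ℝ B) = AlgHom.id ℝ (ℂ ⊗[ℝ] B) := by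
    ext u <;> rfl
  rw [hid] at k₁ k₂
  refine ⟨fun u v => ?_, fun u => ?_⟩
  · have e1 := k₁.1 u v
    have e2 := k₂.1 u v
    simp only [LinearMap.coe_restrictScalars, AlgHom.coe_id, id_eq] at e1 e2 ⊢
    simp only [cder, LinearMap.add_apply, LinearMap.smul_apply, e1, e2, smul_add, add_mul, mul_add,
      smul_mul_assoc, mul_smul_comm]
    abel
  · have e1 := k₁.2 u
    have e2 := k₂.2 u
    simp only [LinearMap.coe_restrictScalars] at e1 e2 ⊢
    simp only [cder, LinearMap.add_apply, LinearMap.smul_apply, e1, e2, map_add, smul_add,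
      cmap_smul]
    rw [smul_comm Complex.I]

/-- The morphism `1 + ε W : ℂ ⊗ B → ℂ ⊗ (B ⊗ ℝ[ε]/ε²)` of a complex vector field `W`. -/
def cflow {W : ℂ ⊗[ℝ] B →ₗ[ℂ] ℂ ⊗[ℝ] B} (hW : IsVF (cmap σ) p (W.restrictScalars ℝ)) :
    ℂ ⊗[ℝ] B →+* ℂ ⊗[ℝ] Thick B σ p where
  toFun u := cInl σ p u + cEps σ p (W u)
  map_zero' := by simp
  map_one' := by
    have h : W 1 = 0 := by
      have h := hW.1 1 1
      simp only [mul_one, map_one, one_mul] at h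
      simpa using h
    simp [h]
  map_add' u v := by simp only [map_add]; abel
  map_mul' u v := by
    have h : W (u * v) = W u * v + (cmap σ ^ (p : ℕ)) u * W v := hW.1 u v
    simp only [add_mul, mul_add, cEps_mul_cInl, cInl_mul_cEps, cEps_mul_cEps, map_mul, h, map_add]
    abel

lemma cflow_apply {W : ℂ ⊗[ℝ] B →ₗ[ℂ] ℂ ⊗[ℝ] B} (hW : IsVF (cmap σ) p (W.restrictScalars ℝ))
    (u : ℂ ⊗[ℝ] B) : cflow hW u = cInl σ p u + cEps σ p (W u) := rfl

end ThickComplex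

section Density

variable {R : Type*} [Ring R] [Algebra ℝ R] {τ : R →ₐ[ℝ] R} {m : ℕ}

namespace HolData

/-- The holomorphic coordinates, even and odd ones together. -/
def hco (h : HolData m R) : Fin m ⊕ Fin m → ℂ ⊗[ℝ] R := Sum.elim h.z h.ζ

/-- The coordinates `z`, `ζ` and the coefficient have their natural parities. -/
structure IsHomogeneous (τ : R →ₐ[ℝ] R) (h : HolData m R) : Prop where
  x : ∀ α, τ (h.x α) = h.x α
  x' : ∀ α, τ (h.x' α) = h.x' α
  ψ : ∀ α, τ (h.ψ α) = -h.ψ α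
  ψ' : ∀ α, τ (h.ψ' α) = -h.ψ' α
  a : τ h.a = h.a
  a' : τ h.a' = h.a'

lemma IsHomogeneous.hco {h : HolData m R} (hh : h.IsHomogeneous τ) (b : Fin m ⊕ Fin m) :
    cmap τ (h.hco b) = sg b • h.hco b := by
  cases b with
  | inl α => simp [HolData.hco, z, cmap_cpx, hh.x, hh.x']
  | inr α =>
    simp only [HolData.hco, Sum.elim_inr, ζ, cmap_cpx, hh.ψ, hh.ψ', sg_inr, neg_smul,
      one_smul, neg_cpx]

lemma IsHomogeneous.coeff {h : HolData m R} (hh : h.IsHomogeneous τ) :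
    cmap τ h.coeff = h.coeff := by
  simp [HolData.coeff, cmap_cpx, hh.a, hh.a']

lemma jac_apply (h : HolData m R) (D : Fin m ⊕ Fin m → R →ₗ[ℝ] R) (a b : Fin m ⊕ Fin m) :
    h.jac (fun i => D (Sum.inl i)) (fun j => D (Sum.inr j)) a b =
      (D a).baseChange ℂ (h.hco b) := by
  cases a <;> cases b <;> rfl

lemma isEvenSM_jac {h : HolData m R} (hh : h.IsHomogeneous τ) {D : Fin m ⊕ Fin m → R →ₗ[ℝ] R}
    (hD : ∀ a u, τ (D a u) = sg a • D a (τ u)) :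
    IsEvenSM (cmap τ) (h.jac (fun i => D (Sum.inl i)) (fun j => D (Sum.inr j))) := by
  intro a b
  have h1 : ∀ u, cmap τ ((D a).baseChange ℂ u) = sg a • (D a).baseChange ℂ (cmap τ u) := fun u => by
    rw [← cpx_re_im u, baseChange_cpx, cmap_cpx, cmap_cpx, baseChange_cpx, hD, hD, smul_cpx]
  rw [jac_apply, h1, hh.hco, LinearMap.map_smul_of_tower, smul_smul]

/-- Chain rule for the Jacobian. -/
lemma jac_eq_mul (h : HolData m R) {D D' : Fin m ⊕ Fin m → R →ₗ[ℝ] R}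
    {K : Matrix (Fin m ⊕ Fin m) (Fin m ⊕ Fin m) R} (hK : ∀ a u, D a u = ∑ c, K a c * D' c u) :
    h.jac (fun i => D (Sum.inl i)) (fun j => D (Sum.inr j)) =
      K.map ofReal * h.jac (fun i => D' (Sum.inl i)) (fun j => D' (Sum.inr j)) := by
  ext a b
  rw [Matrix.mul_apply, jac_apply]
  simp only [jac_apply]
  rw [← cpx_re_im (h.hco b)]
  simp only [baseChange_cpx, hK, Matrix.map_apply, ofReal_apply, ← cpx_zero_right, cpx_mul,
    cpx_sum, zero_mul, sub_zero, add_zero]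

/-- Transformation of a density under a change of frame. -/
lemma density_eq_mul (hR : IsSuperComm τ) {h : HolData m R} (hh : h.IsHomogeneous τ)
    {D D' : Fin m ⊕ Fin m → R →ₗ[ℝ] R} (hD' : ∀ a u, τ (D' a u) = sg a • D' a (τ u))
    {K : Matrix (Fin m ⊕ Fin m) (Fin m ⊕ Fin m) R} (hKe : IsEvenSM τ K) (hKu : IsUnit K)
    (hK : ∀ a u, D a u = ∑ c, K a c * D' c u)
    (hu : IsUnit (h.jac (fun i => D' (Sum.inl i)) (fun j => D' (Sum.inr j)))) :
    h.density (fun i => D (Sum.inl i)) (fun j => D (Sum.inr j)) =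
      1 ⊗ₜ (ber K) * h.density (fun i => D' (Sum.inl i)) (fun j => D' (Sum.inr j)) := by
  have hC := hR.complexify
  have h1 : IsEvenSM (cmap τ) (K.map (ofReal : R →ₐ[ℝ] ℂ ⊗[ℝ] R)) := fun a b => by
    simp [hKe a b]
  have h2 : IsUnit (K.map (ofReal : R →ₐ[ℝ] ℂ ⊗[ℝ] R)) :=
    hKu.map (ofReal : R →ₐ[ℝ] ℂ ⊗[ℝ] R).toRingHom.mapMatrix
  have h3 : cmap τ (h.coeff ^ 2) = h.coeff ^ 2 := by rw [map_pow, hh.coeff]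
  rw [density, density, jac_eq_mul h hK, ber_mul hC h1 h2 (isEvenSM_jac hh hD') hu,
    ← mul_assoc, hC.even_comm _ (ber (K.map ofReal)) h3, mul_assoc]
  congr 1
  exact map_ber hR (ofReal : R →ₐ[ℝ] ℂ ⊗[ℝ] R).toRingHom hKe hKu

end HolData

end Density

section Divergence

variable {B : Type*} [Ring B] [Algebra ℝ B] {σ : B →ₐ[ℝ] B} {m : ℕ} {p : Fin 2}

namespace SuperCoords

/-- The density-weighted divergence `∑ ∂(H^x ρ)/∂x + ∑ (-1)^{1+|H|} ∂(H^ξ ρ)/∂ξ`. -/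
def bvDiv (q : SuperCoords B σ m) (ρ : B) (H : B →ₗ[ℝ] B) : B :=
  ∑ i, q.dx i (H (q.x i) * ρ) + ∑ j, q.dξ j (σ (H (q.ξ j)) * ρ)

lemma bvDiv_eq (hB : IsSuperComm σ) (q : SuperCoords B σ m) {ρ : B} {H : B →ₗ[ℝ] B}
    (hH : IsVF σ p H) :
    q.bvDiv ρ H = H ρ + (∑ i, q.dx i (H (q.x i)) -
      (-1 : ℝ) ^ (p : ℕ) • ∑ j, q.dξ j (H (q.ξ j))) * ρ := by
  have h1 : ∀ j, σ (H (q.ξ j)) = -((-1 : ℝ) ^ (p : ℕ) • H (q.ξ j)) := fun j => by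
    have h := hH.2 (q.ξ j)
    rw [q.ξ_odd, map_neg] at h
    rw [← smul_neg, h, smul_smul, ← mul_pow]; simp
  have h2 : ∀ i, q.dx i (H (q.x i) * ρ) = q.dx i (H (q.x i)) * ρ + H (q.x i) * q.dx i ρ :=
    fun i => by simpa using (q.dx_isVF i).1 (H (q.x i)) ρ
  have h3 : ∀ j, q.dξ j (σ (H (q.ξ j)) * ρ) = q.dξ j (σ (H (q.ξ j))) * ρ +
      H (q.ξ j) * q.dξ j ρ := fun j => by
    simpa [hB.invol] using (q.dξ_isVF j).1 (σ (H (q.ξ j))) ρ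
  rw [bvDiv, q.span p H hH ρ]
  simp only [h2, h3, sum_add_distrib]
  simp only [h1, map_neg, map_smul, neg_mul, smul_mul_assoc,
    Finset.sum_neg_distrib, ← smul_sum, sub_mul, sum_mul]
  abel

lemma bvDiv_add (q : SuperCoords B σ m) (ρ : B) (H H' : B →ₗ[ℝ] B) :
    q.bvDiv ρ (H + H') = q.bvDiv ρ H + q.bvDiv ρ H' := by
  simp only [bvDiv, LinearMap.add_apply, add_mul, map_add, sum_add_distrib]; abel

lemma parity_d (q : SuperCoords B σ m) (a : Fin m ⊕ Fin m) (u : B) :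
    σ (q.d a u) = sg a • q.d a (σ u) := by
  rw [(q.d_isVF a).2, ← sg_eq_pow_par, smul_smul, sg_mul_self, one_smul]

end SuperCoords

lemma parity_lift (q : SuperCoords B σ m) (a : Fin m ⊕ Fin m) (u : Thick B σ p) :
    Thick.parity σ p (Thick.lift σ p (par a) (q.d a) u) =
      sg a • Thick.lift σ p (par a) (q.d a) (Thick.parity σ p u) := by
  ext
  · simp [q.parity_d]
  · simp only [Thick.snd_parity, Thick.snd_lift, map_smul, q.parity_d, Thick.snd_smul]
    simp only [smul_smul]
    congr 1
    ring

/-- Let `h'` be the deformation of the holomorphic coordinates `h` by the complex vector field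
`W = W₁ + i W₂`. The Jacobian of `h'` is the product of the Jacobian of the flow `1 + ε W` in the
coordinates `q` and of the image of the Jacobian of `h` under the flow; so the density varies by
the weighted divergence of `W`. -/
theorem density_flow (hB : IsSuperComm σ) (q : SuperCoords B σ m) {h : HolData m B}
    (hh : h.IsHomogeneous σ) (hu : IsUnit (h.jac q.dx q.dξ)) {ρ : B}
    (hρ : h.density q.dx q.dξ = 1 ⊗ₜ ρ)
    {W₁ W₂ : B →ₗ[ℝ] B} (h₁ : IsVF σ p W₁) (h₂ : IsVF σ p W₂) {h' : HolData m (Thick B σ p)}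
    (hco : ∀ b, h'.hco b = cflow (cder_isVF h₁ h₂) (h.hco b))
    (hcoeff : h'.coeff = cflow (cder_isVF h₁ h₂) h.coeff) :
    IsUnit (h'.jac (fun i => Thick.lift σ p 0 (q.dx i)) (fun j => Thick.lift σ p 1 (q.dξ j))) ∧
    h'.density (fun i => Thick.lift σ p 0 (q.dx i)) (fun j => Thick.lift σ p 1 (q.dξ j)) =
      cInl σ p (1 ⊗ₜ ρ) + cEps σ p (cpx (q.bvDiv ρ W₁) (q.bvDiv ρ W₂)) := by
  have hT : IsSuperComm (cmap (Thick.parity σ p)) := (Thick.isSuperComm hB).complexify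
  set W := cder W₁ W₂ with hWdef
  set Φ := cflow (cder_isVF h₁ h₂) with hΦ
  set e : Fin m ⊕ Fin m → ℝ := fun a => (-1 : ℝ) ^ ((p : ℕ) * (par a : ℕ)) with he
  set N : Matrix (Fin m ⊕ Fin m) (Fin m ⊕ Fin m) (ℂ ⊗[ℝ] B) := Matrix.of fun a c =>
    e a • cpx (q.d a (W₁ (q.co c))) (q.d a (W₂ (q.co c))) with hN
  -- The matrix `N` of partial derivatives of the components of `W` gives its commutators with `∂_a`.
  have hcomm : ∀ a u, e a • (q.d a).baseChange ℂ (W u) = W ((q.d a).baseChange ℂ u) +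
      ∑ c, N a c * (q.d c).baseChange ℂ u := by
    intro a u
    rw [← cpx_re_im u]
    simp only [hWdef, cder_cpx, baseChange_cpx, hN, Matrix.of_apply, smul_cpx, cpx_mul, cpx_sum, cpx_add,
      map_sub, map_add]
    have k₁ := q.d_comp hB h₁ a
    have k₂ := q.d_comp hB h₂ a
    rw [smul_sub, smul_add, k₁, k₁, k₂, k₂, sum_sub_distrib, sum_add_distrib]
    congr 1 <;> abel
  set E : Matrix (Fin m ⊕ Fin m) (Fin m ⊕ Fin m) (ℂ ⊗[ℝ] Thick B σ p) :=
    N.map (cEps σ p) with hE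
  have hjac : h'.jac (fun i => Thick.lift σ p 0 (q.dx i)) (fun j => Thick.lift σ p 1 (q.dξ j)) =
      (1 + E) * (h.jac q.dx q.dξ).map Φ := by
    ext a b
    have e1 := h'.jac_apply (fun a => Thick.lift σ p (par a) (q.d a)) a b
    have e2 : ∀ c, h.jac q.dx q.dξ c b = (q.d c).baseChange ℂ (h.hco b) :=
      fun c => h.jac_apply q.d c b
    refine e1.trans ?_
    rw [hco, hΦ, cflow_apply, lift_cInl_add_cEps, add_mul, one_mul, Matrix.add_apply,
      Matrix.mul_apply]
    simp only [Matrix.map_apply, e2, hE]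
    rw [show (-1 : ℝ) ^ ((p : ℕ) * (par a : ℕ)) = e a from rfl, hcomm, map_add, map_sum,
      ← add_assoc]
    congr 1
    refine sum_congr rfl fun c _ => ?_
    rw [cflow_apply, mul_add, cEps_mul_cInl, cEps_mul_cEps, add_zero]
  have hEsm : IsEvenSM (cmap (Thick.parity σ p)) E := by
    intro a b
    have hW : ∀ {w}, IsVF σ p w → ∀ c, σ (q.d a (w (q.co c))) =
        (sg a * (-1) ^ (p : ℕ) * sg c) • q.d a (w (q.co c)) := fun {w} hw c => by
      have k : σ (w (q.co c)) = ((-1 : ℝ) ^ (p : ℕ) * sg c) • w (q.co c) := by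
        have := hw.2 (q.co c)
        rw [q.parity_co, map_smul] at this
        rw [mul_smul, this, smul_smul, ← mul_pow]; simp
      rw [q.parity_d, k, map_smul, smul_smul, mul_assoc]
    have : (-1 : ℝ) ^ (p : ℕ) * (-1) ^ (p : ℕ) = 1 := by rw [← mul_pow]; simp
    simp only [hE, hN, Matrix.map_apply, Matrix.of_apply, parity_cEps, smul_cpx, cmap_cpx,
      map_smul, hW h₁, hW h₂, smul_smul]
    simp only [← smul_cpx, LinearMap.map_smul_of_tower, smul_smul]
    congr 1
    linear_combination (e a * sg a * sg b) * this
  -- `E` is a multiple of `ε`, so `Ber (1 + E)` is `1` plus its supertrace.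
  have hE0 : ∀ a b c d, E a b * E c d = 0 := fun a b c d => by
    simp only [hE, Matrix.map_apply, cEps_mul_cEps]
  have hE1u : IsUnit (1 + E) := by
    have : E * E = 0 := by ext a b; simp [Matrix.mul_apply, hE0]
    exact isUnit_iff_exists.mpr ⟨1 - E, by
      rw [add_mul, one_mul, mul_sub, mul_one, this]; abel, by
      rw [sub_mul, one_mul, mul_add, mul_one, this]; abel⟩
  have h1E : IsEvenSM (cmap (Thick.parity σ p)) (1 + E) := by
    intro a b
    rw [Matrix.add_apply, map_add, hEsm, smul_add]
    congr 1
    by_cases hab : a = b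
    · subst hab; simp
    · simp [hab]
  have hJe : IsEvenSM (cmap σ) (h.jac q.dx q.dξ) := HolData.isEvenSM_jac (D := q.d) hh q.parity_d
  have hΦpar : ∀ u, cmap (Thick.parity σ p) (Φ u) = Φ (cmap σ u) := fun u => by
    have := (cder_isVF h₁ h₂).2 u
    simp only [LinearMap.coe_restrictScalars] at this
    rw [hΦ, cflow_apply, cflow_apply, map_add, parity_cInl, parity_cEps, this,
      LinearMap.map_smul_of_tower]
  have hΦJ : IsEvenSM (cmap (Thick.parity σ p)) ((h.jac q.dx q.dξ).map Φ) := fun a b => by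
    have : ∀ (c : ℝ) u, Φ (c • u) = c • Φ u := fun c u => by
      simp only [hΦ, cflow_apply, LinearMap.map_smul_of_tower, smul_add, map_smul]
    rw [Matrix.map_apply, hΦpar, hJe, this]
  have hΦu : IsUnit ((h.jac q.dx q.dξ).map Φ) := hu.map Φ.mapMatrix
  refine ⟨hjac ▸ hE1u.mul hΦu, ?_⟩
  have hc2 : cmap (Thick.parity σ p) (Φ (h.coeff ^ 2)) = Φ (h.coeff ^ 2) := by
    rw [hΦpar, map_pow, hh.coeff]
  have hstr : ∑ i, E (Sum.inl i) (Sum.inl i) - ∑ i, E (Sum.inr i) (Sum.inr i) =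
      cEps σ p (cpx (∑ i, q.dx i (W₁ (q.x i)) - (-1 : ℝ) ^ (p : ℕ) • ∑ j, q.dξ j (W₁ (q.ξ j)))
        (∑ i, q.dx i (W₂ (q.x i)) - (-1 : ℝ) ^ (p : ℕ) • ∑ j, q.dξ j (W₂ (q.ξ j)))) := by
    rw [← cpx_sub, map_sub, ← smul_cpx, LinearMap.map_smul_of_tower, ← cpx_sum, ← cpx_sum, map_sum,
      map_sum, smul_sum]
    simp only [hE, hN, he, Matrix.map_apply, Matrix.of_apply, LinearMap.map_smul_of_tower,
      SuperCoords.d, SuperCoords.co, par, Sum.elim_inl, Sum.elim_inr]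
    simp
  calc _ = (1 + (∑ i, E (Sum.inl i) (Sum.inl i) - ∑ i, E (Sum.inr i) (Sum.inr i))) *
        Φ (h.density q.dx q.dξ) := by
        rw [HolData.density, HolData.density, hjac, ber_mul hT h1E hE1u hΦJ hΦu,
          map_ber hB.complexify Φ hJe hu, ber_one_add hT hEsm hE0, hcoeff, ← map_pow, ← mul_assoc,
          hT.even_comm _ _ hc2, mul_assoc, map_mul]
    _ = _ := by
        rw [hρ, hstr, hΦ, cflow_apply, cder_one_tmul, add_mul, one_mul, mul_add,
          cEps_mul_cEps, add_zero, cEps_mul_cInl, add_assoc, ← map_add, ← cpx_zero_right, cpx_mul,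
          cpx_add, q.bvDiv_eq hB h₁, q.bvDiv_eq hB h₂]
        simp

end Divergence

/-! ### Adapted supercoordinates -/

section Adapted

variable {B : Type*} [Ring B] [Algebra ℝ B] {σ : B →ₐ[ℝ] B} {m : ℕ} {p : Fin 2}

lemma IsSuperDer.map_one {A : Type*} [Ring A] [Algebra ℝ A] {σA : A →ₐ[ℝ] A} {r : A →ₐ[ℝ] B}
    {w : A →ₗ[ℝ] B} (hw : IsSuperDer σA σ r p w) : w 1 = 0 := by
  have h := hw.1 1 1
  simp only [mul_one, _root_.map_one, one_mul] at h
  simpa using h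

/-- A complexified vector field satisfies the Leibniz rule on products with an even left factor. -/
lemma IsSuperDer.baseChange_mul_of_even {w : B →ₗ[ℝ] B} (hw : IsVF σ p w) {u : ℂ ⊗[ℝ] B}
    (hu : cmap σ u = u) (v : ℂ ⊗[ℝ] B) :
    w.baseChange ℂ (u * v) = w.baseChange ℂ u * v + u * w.baseChange ℂ v := by
  have hid : cmap (AlgHom.id ℝ B) = AlgHom.id ℝ (ℂ ⊗[ℝ] B) := by
    ext u <;> rfl
  have h := hw.baseChange.1 u v
  rw [hid] at h
  simp only [LinearMap.coe_restrictScalars, AlgHom.coe_id, id_eq] at h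
  rw [h]
  congr 2
  fin_cases p <;> simp [hu]

lemma SuperCoords.span_complex (t : SuperCoords B σ m) {w : B →ₗ[ℝ] B} (hw : IsVF σ p w)
    (u : ℂ ⊗[ℝ] B) :
    w.baseChange ℂ u = ∑ a, (1 ⊗ₜ w (t.co a)) * (t.d a).baseChange ℂ u := by
  rw [← cpx_re_im u]
  simp only [baseChange_cpx, ← cpx_zero_right, cpx_mul, cpx_sum]
  rw [t.span' hw, t.span' hw]
  simp

lemma SuperCoords.parity_baseChange_d (t : SuperCoords B σ m) (a : Fin m ⊕ Fin m)
    (u : ℂ ⊗[ℝ] B) :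
    cmap σ ((t.d a).baseChange ℂ u) = sg a • (t.d a).baseChange ℂ (cmap σ u) := by
  rw [← cpx_re_im u]
  simp only [baseChange_cpx, cmap_cpx, t.parity_d, smul_cpx]

/-- The coordinate vector fields supercommute. -/
lemma SuperCoords.dx_d (t : SuperCoords B σ m) (hB : IsSuperComm σ) (i : Fin m)
    (a : Fin m ⊕ Fin m) (b : B) : t.d a (t.dx i b) = t.dx i (t.d a b) := by
  have h := t.d_comp hB (t.dx_isVF i) a b
  have h0 : ∀ c, t.d a (t.dx i (t.co c)) = 0 := fun c => by
    rw [show t.dx i (t.co c) = if Sum.inl i = c then 1 else 0 from t.d_co (Sum.inl i) c]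
    split_ifs <;> simp [(t.d_isVF a).map_one]
  simpa [h0] using h

/-- The supercoordinates `t` on the real slice are adapted to the holomorphic coordinates `(z, ζ)`:
`z` does not depend on the odd coordinates `ξ`, the restriction of `∑ dz ζ` is `∑ dx ξ`, and
`g = a det (∂z/∂x)`, the coefficient of the restriction of the holomorphic `m`-form, is real and
invertible. -/
structure Adapted (t : SuperCoords B σ m) (h : HolData m B) (g : B) : Prop where
  homog : h.IsHomogeneous σ
  dξ_x : ∀ j α, t.dξ j (h.x α) = 0
  dξ_x' : ∀ j α, t.dξ j (h.x' α) = 0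
  frame : ∀ i, ∑ α, (t.dx i).baseChange ℂ (h.z α) * h.ζ α = 1 ⊗ₜ t.ξ i
  coeff : h.coeff * evenDet (Matrix.of fun i α => (t.dx i).baseChange ℂ (h.z α)) = 1 ⊗ₜ g
  isUnit : IsUnit g

/-- The contraction of `d (∑ dx ξ)` with two vector fields. -/
def SuperCoords.canonEta (t : SuperCoords B σ m) (w v : B →ₗ[ℝ] B) : B :=
  ∑ i, (w (t.ξ i) * σ (v (t.x i)) - w (t.x i) * v (t.ξ i))

namespace Adapted

variable {t : SuperCoords B σ m} {h : HolData m B} {g : B}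

section

variable (hB : IsSuperComm σ) (ht : Adapted t h g)

lemma dξ_z (ht : Adapted t h g) (j α : Fin m) : (t.dξ j).baseChange ℂ (h.z α) = 0 := by
  rw [HolData.z, baseChange_cpx, ht.dξ_x, ht.dξ_x']; simp

lemma even_z (ht : Adapted t h g) (α : Fin m) : cmap σ (h.z α) = h.z α := by
  have := ht.homog.hco (Sum.inl α)
  simpa [HolData.hco] using this

lemma odd_ζ (ht : Adapted t h g) (α : Fin m) : cmap σ (h.ζ α) = -h.ζ α := by
  have := ht.homog.hco (Sum.inr α)
  simpa [HolData.hco] using this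

lemma even_dz (ht : Adapted t h g) (i α : Fin m) :
    cmap σ ((t.dx i).baseChange ℂ (h.z α)) = (t.dx i).baseChange ℂ (h.z α) := by
  have := t.parity_baseChange_d (Sum.inl i) (h.z α)
  rw [ht.even_z] at this
  simpa [SuperCoords.d] using this

lemma even_dζ (ht : Adapted t h g) (i α : Fin m) :
    cmap σ ((t.dξ i).baseChange ℂ (h.ζ α)) = (t.dξ i).baseChange ℂ (h.ζ α) := by
  have := t.parity_baseChange_d (Sum.inr i) (h.ζ α)
  rw [ht.odd_ζ] at this
  simpa [SuperCoords.d] using this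

lemma vf_z (ht : Adapted t h g) {w : B →ₗ[ℝ] B} (hw : IsVF σ p w) (α : Fin m) :
    w.baseChange ℂ (h.z α) = ∑ i, (1 ⊗ₜ w (t.x i)) * (t.dx i).baseChange ℂ (h.z α) := by
  rw [t.span_complex hw, Fintype.sum_sum_type]
  simp only [SuperCoords.d, SuperCoords.co, Sum.elim_inl, Sum.elim_inr, ht.dξ_z, mul_zero,
    Finset.sum_const_zero, add_zero]

lemma dξ_dz (hB : IsSuperComm σ) (ht : Adapted t h g) (i j α : Fin m) :
    (t.dξ j).baseChange ℂ ((t.dx i).baseChange ℂ (h.z α)) = 0 := by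
  have k := t.dx_d hB i (Sum.inr j)
  simp only [SuperCoords.d, Sum.elim_inr] at k
  rw [HolData.z, baseChange_cpx, baseChange_cpx, k, k, ht.dξ_x, ht.dξ_x']; simp

lemma vf_dz (hB : IsSuperComm σ) (ht : Adapted t h g) {w : B →ₗ[ℝ] B} (hw : IsVF σ p w)
    (i α : Fin m) :
    w.baseChange ℂ ((t.dx i).baseChange ℂ (h.z α)) =
      ∑ j, (1 ⊗ₜ w (t.x j)) * (t.dx j).baseChange ℂ ((t.dx i).baseChange ℂ (h.z α)) := by
  rw [t.span_complex hw, Fintype.sum_sum_type]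
  simp only [SuperCoords.d, SuperCoords.co, Sum.elim_inl, Sum.elim_inr, ht.dξ_dz hB, mul_zero,
    Finset.sum_const_zero, add_zero]

lemma vf_frame (ht : Adapted t h g) {w : B →ₗ[ℝ] B} (hw : IsVF σ p w) (i : Fin m) :
    ∑ α, (t.dx i).baseChange ℂ (h.z α) * w.baseChange ℂ (h.ζ α) = 1 ⊗ₜ w (t.ξ i) -
      ∑ α, w.baseChange ℂ ((t.dx i).baseChange ℂ (h.z α)) * h.ζ α := by
  have := congrArg (w.baseChange ℂ) (ht.frame i)
  rw [LinearMap.baseChange_tmul, map_sum] at this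
  simp only [hw.baseChange_mul_of_even (ht.even_dz _ _)] at this
  rw [← this, sum_add_distrib]; abel

/-- The restriction of the holomorphic Liouville form `∑ dz ζ` is the real form `∑ dx ξ`. -/
lemma liouville (ht : Adapted t h g) {w : B →ₗ[ℝ] B} (hw : IsVF σ p w) :
    ∑ α, w.baseChange ℂ (h.z α) * h.ζ α = 1 ⊗ₜ ∑ i, w (t.x i) * t.ξ i := by
  simp only [ht.vf_z hw, sum_mul]
  rw [sum_comm, TensorProduct.tmul_sum]
  refine sum_congr rfl fun i _ => ?_
  simp only [mul_assoc, ← mul_sum, ht.frame, Algebra.TensorProduct.tmul_mul_tmul, one_mul]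

/-- The restriction of the holomorphic symplectic form is the real form `d (∑ dx ξ)`. -/
lemma etaC_eq (hB : IsSuperComm σ) (ht : Adapted t h g) {s : Fin 2} {w v : B →ₗ[ℝ] B}
    (hw : IsVF σ s w) (hv : IsVF σ p v) : h.etaC σ w v = 1 ⊗ₜ t.canonEta w v := by
  have hC := hB.complexify
  set P := fun i α => (t.dx i).baseChange ℂ (h.z α) with hP
  have hPe : ∀ i α, cmap σ (P i α) = P i α := ht.even_dz
  have hPe' : ∀ i α, cmap σ ((t.dx i).baseChange ℂ (h.z α)) = P i α := ht.even_dz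
  set Q := fun j i α => (t.dx j).baseChange ℂ (P i α) with hQ
  have hQe : ∀ j i α, cmap σ (Q j i α) = Q j i α := fun j i α => by
    have := t.parity_baseChange_d (Sum.inl j) (P i α)
    rw [hPe] at this
    simpa [SuperCoords.d] using this
  have hQs : ∀ j i α, Q j i α = Q i j α := fun j i α => by
    have k := t.dx_d hB i (Sum.inl j)
    simp only [SuperCoords.d, Sum.elim_inl] at k
    simp only [hQ, hP, HolData.z, baseChange_cpx, k]
  have hζ : ∀ α (b : B), h.ζ α * (1 ⊗ₜ σ b) = (1 ⊗ₜ b) * h.ζ α := fun α b => by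
    rw [hC.odd_comm _ _ (ht.odd_ζ α), cmap_tmul, hB.invol]
  have e1 : ∑ α, w.baseChange ℂ (h.ζ α) * cmap σ (v.baseChange ℂ (h.z α)) =
      ∑ i, (1 ⊗ₜ w (t.ξ i)) * (1 ⊗ₜ σ (v (t.x i))) -
        ∑ i, ∑ j, ∑ α, (1 ⊗ₜ w (t.x j)) * (1 ⊗ₜ v (t.x i)) * Q j i α * h.ζ α := by
    simp only [ht.vf_z hv, map_sum, map_mul, cmap_tmul, mul_sum, hPe']
    rw [sum_comm, ← sum_sub_distrib]
    refine sum_congr rfl fun i _ => ?_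
    calc ∑ α, w.baseChange ℂ (h.ζ α) * (1 ⊗ₜ σ (v (t.x i)) * P i α)
        = (∑ α, P i α * w.baseChange ℂ (h.ζ α)) * (1 ⊗ₜ σ (v (t.x i))) := by
          rw [sum_mul]
          refine sum_congr rfl fun α _ => ?_
          rw [← hC.even_comm _ _ (hPe i α), ← mul_assoc, ← hC.even_comm _ _ (hPe i α)]
      _ = _ := by
          rw [ht.vf_frame hw, sub_mul]
          congr 1
          simp only [ht.vf_dz hB hw, sum_mul]
          rw [sum_comm]
          refine sum_congr rfl fun j _ => sum_congr rfl fun α _ => ?_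
          rw [mul_assoc _ (h.ζ α), hζ, mul_assoc, ← mul_assoc (Q j i α),
            hC.even_comm _ _ (hQe j i α)]
          simp only [mul_assoc]
  have e2 : ∑ α, w.baseChange ℂ (h.z α) * v.baseChange ℂ (h.ζ α) =
      ∑ i, (1 ⊗ₜ w (t.x i)) * (1 ⊗ₜ v (t.ξ i)) -
        ∑ i, ∑ j, ∑ α, (1 ⊗ₜ w (t.x i)) * (1 ⊗ₜ v (t.x j)) * Q j i α * h.ζ α := by
    simp only [ht.vf_z hw, sum_mul]
    rw [sum_comm, ← sum_sub_distrib]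
    refine sum_congr rfl fun i _ => ?_
    simp only [mul_assoc, ← mul_sum]
    rw [← mul_sub]
    congr 1
    rw [ht.vf_frame hv]
    congr 1
    simp only [ht.vf_dz hB hv, sum_mul, mul_sum]
    rw [sum_comm]
    simp only [mul_assoc]
    rfl
  have e3 : ∑ i, ∑ j, ∑ α, (1 ⊗ₜ[ℝ] w (t.x j)) * (1 ⊗ₜ v (t.x i)) * Q j i α * h.ζ α =
      ∑ i, ∑ j, ∑ α, (1 ⊗ₜ[ℝ] w (t.x i)) * (1 ⊗ₜ v (t.x j)) * Q j i α * h.ζ α := by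
    rw [sum_comm]
    refine sum_congr rfl fun i _ => sum_congr rfl fun j _ =>
      sum_congr rfl fun α _ => ?_
    rw [hQs]
  rw [HolData.etaC, SuperCoords.canonEta]
  simp only [cmap_eq_baseChange]
  rw [sum_sub_distrib, e1, e2, e3, sum_sub_distrib, TensorProduct.tmul_sub,
    TensorProduct.tmul_sum, TensorProduct.tmul_sum]
  simp only [Algebra.TensorProduct.tmul_mul_tmul, one_mul]
  abel

/-- The even block `∂z/∂x` of the Jacobian. -/
abbrev P (t : SuperCoords B σ m) (h : HolData m B) : Matrix (Fin m) (Fin m) (ℂ ⊗[ℝ] B) :=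
  Matrix.of fun i α => (t.dx i).baseChange ℂ (h.z α)

/-- The block `∂ζ/∂ξ` of the Jacobian. -/
abbrev D (t : SuperCoords B σ m) (h : HolData m B) : Matrix (Fin m) (Fin m) (ℂ ⊗[ℝ] B) :=
  Matrix.of fun j α => (t.dξ j).baseChange ℂ (h.ζ α)

lemma P_mul_D (hB : IsSuperComm σ) (ht : Adapted t h g) : P t h * (D t h).transpose = 1 := by
  ext i j
  rw [Matrix.mul_apply]
  have := ht.vf_frame (t.dξ_isVF j) i
  simp only [ht.dξ_dz hB, zero_mul, Finset.sum_const_zero, sub_zero, t.dξ_ξ] at this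
  simp only [Matrix.of_apply, Matrix.transpose_apply]
  rw [this]
  by_cases hij : i = j
  · subst hij; simp [Algebra.TensorProduct.one_def]
  · simp [hij, Ne.symm hij]

lemma D_mul_P (hB : IsSuperComm σ) (ht : Adapted t h g) : D t h * (P t h).transpose = 1 := by
  have h1 := congrArg Matrix.transpose (ht.P_mul_D hB)
  rw [Matrix.transpose_one] at h1
  rw [← h1]
  ext i j
  simp only [Matrix.mul_apply, Matrix.transpose_apply, Matrix.of_apply]
  exact sum_congr rfl fun α _ => (hB.complexify.even_comm _ _ (ht.even_dz j α)).symm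

lemma jac_eq (ht : Adapted t h g) : h.jac t.dx t.dξ = Matrix.fromBlocks (P t h)
    (Matrix.of fun i α => (t.dx i).baseChange ℂ (h.ζ α)) 0 (D t h) := by
  rw [HolData.jac]
  congr 1
  ext j α
  simp [ht.dξ_z]

/-- The real slice condition. -/
lemma isUnit_jac (hB : IsSuperComm σ) (ht : Adapted t h g) : IsUnit (h.jac t.dx t.dξ) := by
  have hC := hB.complexify
  have hPe : IsEvenMat (cmap σ) (P t h) := fun i α => ht.even_dz i α
  have hDe : IsEvenMat (cmap σ) (D t h) := fun i α => ht.even_dζ i α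
  have hPt : IsEvenMat (cmap σ) (P t h).transpose := fun i α => ht.even_dz α i
  have hDt : IsEvenMat (cmap σ) (D t h).transpose := fun i α => ht.even_dζ α i
  have k1 := ht.P_mul_D hB
  have k2 := hPe.isUnit_of_mul_eq_one hC hDt k1
  have k3 := ht.D_mul_P hB
  have k4 := hDe.isUnit_of_mul_eq_one hC hPt k3
  rw [ht.jac_eq]
  set Q : Matrix (Fin m) (Fin m) (ℂ ⊗[ℝ] B) :=
    Matrix.of fun i α => (t.dx i).baseChange ℂ (h.ζ α)
  refine isUnit_iff_exists.mpr ⟨Matrix.fromBlocks (D t h).transpose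
    (-((D t h).transpose * Q * (P t h).transpose)) 0 (P t h).transpose, ?_, ?_⟩
  · rw [Matrix.fromBlocks_multiply, ← Matrix.fromBlocks_one]
    congr 1
    · rw [k1]; simp
    · rw [Matrix.mul_neg, ← mul_assoc, ← mul_assoc, k1, one_mul]; simp
    · simp
    · rw [k3]; simp
  · rw [Matrix.fromBlocks_multiply, ← Matrix.fromBlocks_one]
    congr 1
    · rw [k2]; simp
    · rw [Matrix.neg_mul, mul_assoc _ _ (D t h), k4, mul_one]; simp
    · simp
    · rw [k4]; simp

/-- The restriction of the holomorphic volume form is the square of the real density `g`. -/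
lemma density_eq (hB : IsSuperComm σ) (ht : Adapted t h g) :
    h.density t.dx t.dξ = 1 ⊗ₜ (g ^ 2) := by
  have hC := hB.complexify
  have hPe : IsEvenMat (cmap σ) (P t h) := fun i α => ht.even_dz i α
  have hDe : IsEvenMat (cmap σ) (D t h) := fun i α => ht.even_dζ i α
  have hDt : IsEvenMat (cmap σ) (D t h).transpose := fun i α => ht.even_dζ α i
  have hdet : evenDet (P t h) * evenDet (D t h) = 1 := by
    have h1 : evenDet (D t h).transpose = evenDet (D t h) := by
      obtain ⟨D', hD'⟩ := hDe.exists_lift hC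
      rw [hD', ← Matrix.transpose_map, evenDet_val, evenDet_val, Matrix.det_transpose]
    rw [← h1, ← evenDet_mul hC hPe hDt, ht.P_mul_D hB, evenDet_one]
  have hcomm := hC.even_comm _ (evenDet (D t h)) (parity_evenDet hC hPe)
  have hinv : Ring.inverse (evenDet (D t h)) = evenDet (P t h) :=
    Ring.inverse_unit (⟨evenDet (D t h), evenDet (P t h), hcomm ▸ hdet, hdet⟩ : (ℂ ⊗[ℝ] B)ˣ)
  have hber : ber (h.jac t.dx t.dξ) = evenDet (P t h) * evenDet (P t h) := by
    rw [ht.jac_eq, ber]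
    simp only [Matrix.toBlocks_fromBlocks₁₁, Matrix.toBlocks_fromBlocks₁₂,
      Matrix.toBlocks_fromBlocks₂₁, Matrix.toBlocks_fromBlocks₂₂, mul_zero, sub_zero, hinv]
  have hc := ht.coeff
  rw [HolData.density, hber, pow_two, mul_assoc, ← mul_assoc h.coeff (evenDet _), hc,
    ← mul_assoc, hC.even_comm _ (1 ⊗ₜ g) ht.homog.coeff, mul_assoc, hc, pow_two]
  simp [Algebra.TensorProduct.tmul_mul_tmul]

/-- The density `g` is even. -/
lemma even_g (hB : IsSuperComm σ) (ht : Adapted t h g) : σ g = g := by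
  have hC := hB.complexify
  have hPe : IsEvenMat (cmap σ) (P t h) := fun i α => ht.even_dz i α
  have := congrArg (cmap σ) ht.coeff
  rw [map_mul, ht.homog.coeff, parity_evenDet hC hPe, ht.coeff, cmap_tmul] at this
  exact (one_tmul_injective this).symm

end

end Adapted

/-! ### Complex vector fields from their values on holomorphic coordinates -/

/-- Complex vector fields with prescribed values on `(z, ζ)` exist. -/
lemma exists_cder (hB : IsSuperComm σ) (t : SuperCoords B σ m) {h : HolData m B}
    (hh : h.IsHomogeneous σ) (hu : IsUnit (h.jac t.dx t.dξ)) {E : Fin m ⊕ Fin m → ℂ ⊗[ℝ] B}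
    (hE : ∀ b, cmap σ (E b) = ((-1 : ℝ) ^ (p : ℕ) * sg b) • E b) :
    ∃ W₁ W₂ : B →ₗ[ℝ] B, IsVF σ p W₁ ∧ IsVF σ p W₂ ∧ ∀ b, cder W₁ W₂ (h.hco b) = E b := by
  obtain ⟨J', hJ1, hJ2⟩ := isUnit_iff_exists.mp hu
  have hJe : IsEvenSM (cmap σ) (h.jac t.dx t.dξ) := HolData.isEvenSM_jac (D := t.d) hh t.parity_d
  have hJ'e := hJe.inv hJ1 hJ2
  set W : Fin m ⊕ Fin m → ℂ ⊗[ℝ] B := fun a => ∑ b, E b * J' b a with hW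
  have hWp : ∀ a, cmap σ (W a) = ((-1 : ℝ) ^ (p : ℕ) * sg a) • W a := fun a => by
    simp only [hW, map_sum, map_mul, hE, hJ'e _ _, smul_sum, smul_mul_assoc, mul_smul_comm,
      smul_smul]
    refine sum_congr rfl fun b _ => ?_
    congr 1
    linear_combination ((-1 : ℝ) ^ (p : ℕ) * sg a) * sg_mul_self b
  have hpar : ∀ a, σ (rePart (W a)) = (-1 : ℝ) ^ ((p + par a : Fin 2) : ℕ) • rePart (W a) ∧
      σ (imPart (W a)) = (-1 : ℝ) ^ ((p + par a : Fin 2) : ℕ) • imPart (W a) := fun a => by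
    have h1 := hWp a
    rw [← cpx_re_im (W a), cmap_cpx, smul_cpx, cpx_inj] at h1
    have h2 : (-1 : ℝ) ^ (p : ℕ) * sg a = (-1 : ℝ) ^ ((p + par a : Fin 2) : ℕ) := by
      rw [sg_eq_pow_par]
      generalize (par a) = s
      fin_cases p <;> fin_cases s <;> simp
    rw [h2] at h1
    exact h1
  have hadd : ∀ a : Fin m ⊕ Fin m, p + par a + par a = p := fun a => by
    generalize (par a) = s
    fin_cases p <;> fin_cases s <;> rfl
  refine ⟨∑ a, LinearMap.mulLeft ℝ (rePart (W a)) ∘ₗ t.d a,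
    ∑ a, LinearMap.mulLeft ℝ (imPart (W a)) ∘ₗ t.d a,
    IsSuperDer.sum _ fun a _ => ?_, IsSuperDer.sum _ fun a _ => ?_, fun b => ?_⟩
  · have := IsSuperDer.mul_left hB (t.d_isVF a) (hpar a).1
    rwa [hadd] at this
  · have := IsSuperDer.mul_left hB (t.d_isVF a) (hpar a).2
    rwa [hadd] at this
  · have h1 : ∀ (f : Fin m ⊕ Fin m → B) (u : ℂ ⊗[ℝ] B),
        (∑ a, LinearMap.mulLeft ℝ (f a) ∘ₗ t.d a).baseChange ℂ u =
          ∑ a, (1 ⊗ₜ f a) * (t.d a).baseChange ℂ u := fun f u => by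
      rw [← cpx_re_im u]
      simp only [baseChange_cpx, ← cpx_zero_right, cpx_mul, cpx_sum, LinearMap.sum_apply,
        LinearMap.comp_apply, LinearMap.mulLeft_apply]
      simp
    rw [cder, LinearMap.add_apply, LinearMap.smul_apply, h1, h1, smul_sum,
      ← sum_add_distrib]
    calc _ = ∑ a, W a * h.jac t.dx t.dξ a b := by
          refine sum_congr rfl fun a _ => ?_
          rw [show h.jac t.dx t.dξ a b = _ from h.jac_apply t.d a b, ← smul_mul_assoc,
            TensorProduct.smul_tmul', smul_eq_mul, mul_one, ← add_mul]
          congr 1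
          exact cpx_re_im (W a)
      _ = ∑ c, E c * (J' * h.jac t.dx t.dξ) c b := by
          simp only [hW, Matrix.mul_apply, mul_sum, sum_mul, mul_assoc]
          rw [sum_comm]
      _ = E b := by rw [hJ2]; simp [Matrix.one_apply]

/-! ### Invariance of the divergence -/

/-- The restricted volume form and its divergence in arbitrary supercoordinates `q`, compared with
adapted ones: both are multiplied by the Berezinian `κ` of the change of coordinates. -/
theorem Adapted.exists_compare (hB : IsSuperComm σ) {t : SuperCoords B σ m} {h : HolData m B}
    {g : B} (ht : Adapted t h g) (q : SuperCoords B σ m) :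
    IsUnit (h.jac q.dx q.dξ) ∧ ∃ κ : B, h.density q.dx q.dξ = 1 ⊗ₜ (κ * g ^ 2) ∧
      ∀ (p : Fin 2) (H : B →ₗ[ℝ] B), IsVF σ p H →
        q.bvDiv (κ * g ^ 2) H = κ * t.bvDiv (g ^ 2) H := by
  have hju := ht.isUnit_jac hB
  set K : Matrix (Fin m ⊕ Fin m) (Fin m ⊕ Fin m) B := Matrix.of fun a b => q.d a (t.co b) with hK
  have hKe : IsEvenSM σ K := fun a b => by
    simp only [hK, Matrix.of_apply]
    rw [q.parity_d, t.parity_co, map_smul, smul_smul]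
  have hKd : ∀ a b, q.d a b = ∑ c, K a c * t.d c b := fun a b => t.span' (q.d_isVF a) b
  have hKu : IsUnit K := by
    refine isUnit_iff_exists.mpr ⟨Matrix.of fun a b => t.d a (q.co b), ?_, ?_⟩
    · ext a b
      rw [Matrix.mul_apply]
      simp only [hK, Matrix.of_apply]
      rw [← t.span' (q.d_isVF a), q.d_co, Matrix.one_apply]
    · ext a b
      rw [Matrix.mul_apply]
      simp only [hK, Matrix.of_apply]
      rw [← q.span' (t.d_isVF a), t.d_co, Matrix.one_apply]
  have hqu : IsUnit (h.jac q.dx q.dξ) := by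
    rw [show h.jac q.dx q.dξ = _ from HolData.jac_eq_mul h (D := q.d) (D' := t.d) hKd]
    exact (hKu.map (ofReal : B →ₐ[ℝ] ℂ ⊗[ℝ] B).toRingHom.mapMatrix).mul hju
  have hdens : h.density q.dx q.dξ = 1 ⊗ₜ (ber K * g ^ 2) := by
    have := HolData.density_eq_mul hB ht.homog (D := q.d) (D' := t.d) t.parity_d hKe hKu hKd hju
    refine this.trans ?_
    rw [show h.density (fun i => t.d (Sum.inl i)) (fun j => t.d (Sum.inr j)) = _ from
      ht.density_eq hB]
    simp [Algebra.TensorProduct.tmul_mul_tmul]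
  refine ⟨hqu, ber K, hdens, fun p H hH => ?_⟩
  have hT := Thick.isSuperComm (p := p) hB
  -- The deformation of the coordinates by the flow of `H` is evaluated in both frames.
  set h' : HolData m (Thick B σ p) := h.map fun b => ⟨b, H b⟩ with hh'
  have hz : IsVF σ p (0 : B →ₗ[ℝ] B) := .zero
  have hflow : ∀ a b : B, cpx (⟨a, H a⟩ : Thick B σ p) ⟨b, H b⟩ =
      cflow (cder_isVF hH hz) (cpx a b) := fun a b => by
    rw [cflow_apply, cder_cpx, cpx_thick]; simp
  have hco : ∀ b, h'.hco b = cflow (cder_isVF hH hz) (h.hco b) := fun b => by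
    cases b <;> exact hflow _ _
  have hcoeff : h'.coeff = cflow (cder_isVF hH hz) h.coeff := hflow _ _
  have hq := (density_flow hB q ht.homog hqu hdens hH hz hco hcoeff).2
  obtain ⟨htu, htd⟩ := density_flow hB t ht.homog hju (ht.density_eq hB) hH hz hco hcoeff
  have hhom : h'.IsHomogeneous (Thick.parity σ p) := by
    have hev : ∀ b, σ b = b → Thick.parity σ p ⟨b, H b⟩ = ⟨b, H b⟩ := fun b hb => by
      ext
      · simp [hb]
      · have := hH.2 b
        rw [hb] at this
        simp only [Thick.snd_parity]; exact this.symm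
    have hod : ∀ b, σ b = -b → Thick.parity σ p ⟨b, H b⟩ = -⟨b, H b⟩ := fun b hb => by
      ext
      · simp [hb]
      · have := hH.2 b
        rw [hb, map_neg] at this
        simp only [Thick.snd_parity, Thick.snd_neg]; exact this.symm
    exact ⟨fun α => hev _ (ht.homog.x α), fun α => hev _ (ht.homog.x' α),
      fun α => hod _ (ht.homog.ψ α), fun α => hod _ (ht.homog.ψ' α),
      hev _ ht.homog.a, hev _ ht.homog.a'⟩
  have hKd' : ∀ a (u : Thick B σ p), Thick.lift σ p (par a) (q.d a) u =
      ∑ c, K.map (Thick.inl σ p) a c * Thick.lift σ p (par c) (t.d c) u := fun a u => by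
    ext
    · rw [Thick.fst_sum]; simp [hKd a]
    · rw [Thick.snd_sum, Thick.snd_lift, hKd a, smul_sum]
      refine sum_congr rfl fun c _ => ?_
      have hKpow : (σ ^ (p : ℕ)) (K a c) =
          ((-1 : ℝ) ^ ((p : ℕ) * (par a : ℕ)) * (-1 : ℝ) ^ ((p : ℕ) * (par c : ℕ))) • K a c := by
        have := hKe a c
        rw [sg_eq_pow_par, sg_eq_pow_par] at this
        fin_cases p
        · simp
        · simpa using this
      have hsq : (-1 : ℝ) ^ ((p : ℕ) * (par c : ℕ)) * (-1) ^ ((p : ℕ) * (par c : ℕ)) = 1 := by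
        rw [← mul_pow]; simp
      simp only [Thick.snd_mul, Matrix.map_apply, Thick.snd_inl, zero_mul, zero_add,
        Thick.fst_inl, Thick.snd_lift, hKpow, smul_mul_assoc, mul_smul_comm, smul_smul]
      congr 1
      linear_combination -(-1 : ℝ) ^ ((p : ℕ) * (par a : ℕ)) * hsq
  have hKe' : IsEvenSM (Thick.parity σ p) (K.map (Thick.inl σ p)) := fun a b => by
    ext
    · simp [hKe a b]
    · simp
  have hKu' : IsUnit (K.map (Thick.inl σ p)) := hKu.map (Thick.inl σ p).toRingHom.mapMatrix
  have hcmp := HolData.density_eq_mul hT hhom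
    (D := fun a => Thick.lift σ p (par a) (q.d a))
    (D' := fun a => Thick.lift σ p (par a) (t.d a)) (parity_lift t) hKe' hKu' hKd' htu
  have hber : ber (K.map (Thick.inl σ p)) = Thick.inl σ p (ber K) :=
    map_ber hB (Thick.inl σ p).toRingHom hKe hKu
  have hcmp' := (hq.symm.trans hcmp).trans (congrArg _ htd)
  rw [hber, show (1 : ℂ) ⊗ₜ[ℝ] Thick.inl σ p (ber K) = cInl σ p (1 ⊗ₜ ber K) from rfl, mul_add,
    ← map_mul, cInl_mul_cEps, cInl_add_cEps_inj, ← cmap_pow] at hcmp'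
  have hκ : (σ ^ (p : ℕ)) (ber K) = ber K := by
    have := hKe.parity_ber hB hKu
    fin_cases p <;> simp [this]
  have h2 := hcmp'.2
  rw [cmap_tmul, hκ, ← cpx_zero_right, cpx_mul, cpx_inj] at h2
  simpa using h2.1

/-- The Hamiltonian vector field of `f` in adapted supercoordinates. -/
def SuperCoords.ham (t : SuperCoords B σ m) (f : B) : B →ₗ[ℝ] B :=
  ∑ i, LinearMap.mulLeft ℝ (σ (t.dξ i f)) ∘ₗ t.dx i -
    ∑ i, LinearMap.mulLeft ℝ (t.dx i f) ∘ₗ t.dξ i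

namespace SuperCoords

variable (t : SuperCoords B σ m)

lemma ham_apply (f b : B) :
    t.ham f b = ∑ i, σ (t.dξ i f) * t.dx i b - ∑ i, t.dx i f * t.dξ i b := by
  simp [ham]

@[simp] lemma ham_x (f : B) (i : Fin m) : t.ham f (t.x i) = σ (t.dξ i f) := by
  simp [ham_apply, t.dx_x, t.dξ_x]

@[simp] lemma ham_ξ (f : B) (i : Fin m) : t.ham f (t.ξ i) = -t.dx i f := by
  simp [ham_apply, t.dx_ξ, t.dξ_ξ]

lemma ham_add (f f' : B) : t.ham (f + f') = t.ham f + t.ham f' := by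
  ext b
  simp only [ham_apply, map_add, add_mul, sum_add_distrib, LinearMap.add_apply]; abel

lemma ham_smul (c : ℝ) (f : B) : t.ham (c • f) = c • t.ham f := by
  ext b
  simp only [ham_apply, map_smul, smul_mul_assoc, ← smul_sum, LinearMap.smul_apply, smul_sub]

/-- The Hamiltonian vector field of a function of parity `1 + p` has parity `p`. -/
lemma ham_isVF (hB : IsSuperComm σ) {f : B} (hf : σ f = -((-1 : ℝ) ^ (p : ℕ) • f)) :
    IsVF σ p (t.ham f) := by
  have hx : ∀ i, σ (t.dx i f) = (-1 : ℝ) ^ ((p + 1 : Fin 2) : ℕ) • t.dx i f := fun i => by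
    have := t.parity_d (Sum.inl i) f
    simp only [d, Sum.elim_inl, sg_inl, one_smul, hf, map_neg, map_smul] at this
    rw [this]; fin_cases p <;> simp
  have hξ : ∀ i, σ (σ (t.dξ i f)) = (-1 : ℝ) ^ (p : ℕ) • σ (t.dξ i f) := fun i => by
    have := t.parity_d (Sum.inr i) f
    simp only [d, Sum.elim_inr, sg_inr, hf, map_neg, map_smul, smul_neg, neg_smul, one_smul,
      neg_neg] at this
    rw [this, map_smul, this]
  have hp : p + 1 + 1 = p := by fin_cases p <;> rfl
  have hneg : ham t f = ∑ i, LinearMap.mulLeft ℝ (σ (t.dξ i f)) ∘ₗ t.dx i +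
      (-1 : ℝ) • ∑ i, LinearMap.mulLeft ℝ (t.dx i f) ∘ₗ t.dξ i := by
    ext b; simp [ham, sub_eq_add_neg]
  rw [hneg]
  refine (IsSuperDer.sum _ fun i _ => ?_).add ((IsSuperDer.sum _ fun i _ => ?_).smul (-1))
  · simpa using IsSuperDer.mul_left hB (t.dx_isVF i) (hξ i)
  · have := IsSuperDer.mul_left hB (t.dξ_isVF i) (hx i)
    rwa [hp] at this

lemma canonEta_ham (hB : IsSuperComm σ) {s : Fin 2} {w : B →ₗ[ℝ] B} (hw : IsVF σ s w) (f : B) :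
    t.canonEta w (t.ham f) = w f := by
  rw [canonEta, t.span s w hw f]
  simp only [ham_x, ham_ξ, hB.invol, mul_neg, sub_neg_eq_add, sum_add_distrib]
  abel

lemma canonEta_add (w v v' : B →ₗ[ℝ] B) :
    t.canonEta w (v + v') = t.canonEta w v + t.canonEta w v' := by
  simp only [canonEta, ← sum_add_distrib]
  refine sum_congr rfl fun i _ => ?_
  simp only [LinearMap.add_apply, map_add, mul_add]; abel

/-- A vector field is determined by its contraction with the symplectic form. -/
lemma co_eq_of_canonEta (hB : IsSuperComm σ) {v : B →ₗ[ℝ] B} {f : B}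
    (h : ∀ (s : Fin 2) (w : B →ₗ[ℝ] B), IsVF σ s w → t.canonEta w v = w f) (a : Fin m ⊕ Fin m) :
    v (t.co a) = t.ham f (t.co a) := by
  cases a with
  | inl i =>
    have := h 1 _ (t.dξ_isVF i)
    simp only [canonEta, t.dξ_ξ, t.dξ_x, zero_mul, sub_zero, ite_mul, one_mul,
      Finset.sum_ite_eq, Finset.mem_univ, if_true] at this
    simp [co, ← this, hB.invol]
  | inr i =>
    have := h 0 _ (t.dx_isVF i)
    simp only [canonEta, t.dx_x, t.dx_ξ, zero_mul, zero_sub, ite_mul, one_mul,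
      Finset.sum_neg_distrib, Finset.sum_ite_eq, Finset.mem_univ, if_true] at this
    simp [co, ← this]

end SuperCoords

end Adapted

/-! ### Hadamard's lemma -/

section Hadamard

variable {E : Type*} [NormedAddCommGroup E] [NormedSpace ℝ E]

/-- Smoothness of an integral over `[0, 1]` depending smoothly on a parameter. The integral is
written as a convolution with an indicator function. -/
lemma contDiff_integral_unit {h : E → ℝ → ℝ} (hh : ContDiff ℝ ∞ (Function.uncurry h)) :
    ContDiff ℝ ∞ fun e => ∫ s in (0 : ℝ)..1, h e s := by
  let χ : ContDiffBump (0 : ℝ) := ⟨2, 3, by norm_num, by norm_num⟩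
  have hk : IsCompact (Metric.closedBall (0 : ℝ) 3) := isCompact_closedBall 0 3
  have hf : MeasureTheory.LocallyIntegrable
      (Set.indicator (Set.Icc (-1 : ℝ) 0) fun _ => (1 : ℝ)) MeasureTheory.volume :=
    ((MeasureTheory.locallyIntegrable_const (1 : ℝ)).indicator measurableSet_Icc)
  have key := MeasureTheory.contDiffOn_convolution_left_with_param_comp (𝕜 := ℝ) (n := (⊤ : ℕ∞))
    (ContinuousLinearMap.mul ℝ ℝ) (s := (Set.univ : Set E)) (v := fun _ : E => (0 : ℝ))
    (g := fun e s => χ s * h e s) contDiffOn_const isOpen_univ hk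
    (fun e s _ hs => by
      have : χ s = 0 := χ.zero_of_le_dist (le_of_lt (by
        simpa [Metric.mem_closedBall] using hs))
      simp [this]) hf
    ((ContDiff.mul (χ.contDiff.comp contDiff_snd) hh).contDiffOn)
  rw [contDiffOn_univ] at key
  refine (congrArg (ContDiff ℝ ∞) (funext fun e => ?_)).mp key
  rw [MeasureTheory.convolution_def, intervalIntegral.integral_of_le zero_le_one,
    ← MeasureTheory.integral_Icc_eq_integral_Ioc, ← MeasureTheory.integral_indicator
      measurableSet_Icc]
  refine MeasureTheory.integral_congr_ae (Filter.Eventually.of_forall fun s => ?_)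
  by_cases hs : s ∈ Set.Icc (0 : ℝ) 1
  · have h1 : χ s = 1 := χ.one_of_mem_closedBall (by
      rw [Metric.mem_closedBall, Real.dist_eq, sub_zero, abs_of_nonneg hs.1]
      have := hs.2
      show s ≤ 2
      linarith)
    have h2 : -s ∈ Set.Icc (-1 : ℝ) 0 := ⟨by linarith [hs.2], by linarith [hs.1]⟩
    simp [Set.indicator_of_mem hs, Set.indicator_of_mem h2, h1]
  · simp only [Set.indicator_of_notMem hs]
    have h2 : 0 - s ∉ Set.Icc (-1 : ℝ) 0 := fun h => hs ⟨by linarith [h.2], by linarith [h.1]⟩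
    rw [Set.indicator_of_notMem h2, map_zero]

lemma exists_hadamard {J : Type*} [Fintype J] (β : Module.Basis J ℝ E) [FiniteDimensional ℝ E]
    {φ : E → ℝ} (hφ : ContDiff ℝ ∞ φ) (p : E) :
    ∃ g : J → E → ℝ, (∀ j, ContDiff ℝ ∞ (g j)) ∧ (∀ j, g j p = fderiv ℝ φ p (β j)) ∧
      ∀ e, φ e = φ p + ∑ j, (β.coord j e - β.coord j p) * g j e := by
  have hD : ContDiff ℝ ∞ (fderiv ℝ φ) := hφ.fderiv_right (m := ∞) (by simp)
  have hl : ContDiff ℝ ∞ fun q : E × ℝ => p + q.2 • (q.1 - p) :=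
    contDiff_const.add (contDiff_snd.smul (contDiff_fst.sub contDiff_const))
  have hh : ∀ v, ContDiff ℝ ∞ (Function.uncurry fun (e : E) (s : ℝ) =>
      fderiv ℝ φ (p + s • (e - p)) v) := fun v =>
    (hD.comp hl).clm_apply contDiff_const
  refine ⟨fun j e => ∫ s in (0 : ℝ)..1, fderiv ℝ φ (p + s • (e - p)) (β j),
    fun j => contDiff_integral_unit (hh _), fun j => by simp, fun e => ?_⟩
  have hcont : ∀ v, Continuous fun s : ℝ => fderiv ℝ φ (p + s • (e - p)) v := fun v =>
    (hh v).continuous.comp (Continuous.prodMk_right e)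
  have h1 : ∫ s in (0 : ℝ)..1, fderiv ℝ φ (p + s • (e - p)) (e - p) = φ e - φ p := by
    rw [intervalIntegral.integral_eq_sub_of_hasDerivAt (f := fun s : ℝ => φ (p + s • (e - p)))]
    · simp
    · intro s _
      have h2 : HasDerivAt (fun s : ℝ => p + s • (e - p)) (e - p) s := by
        simpa using ((hasDerivAt_id s).smul_const (e - p)).const_add p
      exact ((hφ.differentiable (by simp)) _).hasFDerivAt.comp_hasDerivAt s h2
    · exact (hcont _).intervalIntegrable _ _
  have h2 : e - p = ∑ j, (β.coord j e - β.coord j p) • β j := by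
    conv_lhs => rw [← β.sum_repr (e - p)]
    simp
  rw [← sub_eq_iff_eq_add', ← h1]
  have h3 : ∀ s : ℝ, fderiv ℝ φ (p + s • (e - p)) (e - p) =
      ∑ j, (β.coord j e - β.coord j p) * fderiv ℝ φ (p + s • (e - p)) (β j) := fun s => by
    conv_lhs => rw [show fderiv ℝ φ (p + s • (e - p)) (e - p) =
      fderiv ℝ φ (p + s • (e - p)) (∑ j, (β.coord j e - β.coord j p) • β j) from by rw [← h2]]
    simp
  simp only [h3]
  rw [intervalIntegral.integral_finsetSum]
  · simp only [intervalIntegral.integral_const_mul]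
  · exact fun j _ => ((hcont _).const_mul _).intervalIntegrable _ _

end Hadamard

/-! ### Exterior algebras as superalgebras -/

section Exterior

variable {W : Type*} [AddCommGroup W] [Module ℝ W]

@[simp] lemma extParity_ι (w : W) : extParity W (ExteriorAlgebra.ι ℝ w) = -ExteriorAlgebra.ι ℝ w :=
  CliffordAlgebra.involute_ι w

lemma ι_mul_comm (w : W) (a : ExteriorAlgebra ℝ W) :
    ExteriorAlgebra.ι ℝ w * a = extParity W a * ExteriorAlgebra.ι ℝ w := by
  induction a using ExteriorAlgebra.induction with
  | algebraMap r => rw [AlgHom.commutes, Algebra.commutes]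
  | ι v =>
    rw [extParity_ι, neg_mul, eq_neg_iff_add_eq_zero]
    exact ExteriorAlgebra.ι_add_mul_swap w v
  | mul a b ha hb => rw [map_mul, ← mul_assoc, ha, mul_assoc, hb, mul_assoc]
  | add a b ha hb => rw [map_add, mul_add, add_mul, ha, hb]

/-- Exterior algebras are supercommutative. -/
lemma isSuperComm_ext : IsSuperComm (extParity W) := by
  have hinv : ∀ a, extParity W (extParity W a) = a := CliffordAlgebra.involute_involute
  -- The sign rule for a factor of mixed parity, in terms of its even and odd parts.
  have key : ∀ a b : ExteriorAlgebra ℝ W, (2 : ℝ) • (a * b) =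
      b * (a + extParity W a) + extParity W b * (a - extParity W a) := by
    intro a
    induction a using ExteriorAlgebra.induction with
    | algebraMap r =>
      intro b
      rw [AlgHom.commutes, sub_self, mul_zero, add_zero, mul_add, Algebra.commutes, two_smul]
    | ι w =>
      intro b
      rw [extParity_ι, add_neg_cancel, mul_zero, zero_add, sub_neg_eq_add, mul_add, ι_mul_comm,
        two_smul]
    | mul a a' ha ha' =>
      intro b
      have h1 := ha' b
      have h2 := congrArg (fun u => (2 : ℝ) • (a * u)) h1
      simp only [mul_smul_comm, mul_add, mul_sub, ← mul_assoc, smul_add, smul_sub] at h2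
      have h3 := ha b
      have h4 := ha (extParity W b)
      have h5 : (4 : ℝ) • (a * a' * b) = (4 : ℝ) •
          ((1 / 2 : ℝ) • (b * (a * a' + extParity W (a * a')) +
            extParity W b * (a * a' - extParity W (a * a')))) := by
        have h6 : (4 : ℝ) • (a * a' * b) = (2 : ℝ) • ((2 : ℝ) • (a * a' * b)) := by
          rw [smul_smul]; norm_num
        have h3' : ∀ c, (2 : ℝ) • (a * b * c) = _ * c := fun c => by rw [← smul_mul_assoc, h3]
        have h4' : ∀ c, (2 : ℝ) • (a * extParity W b * c) = _ * c := fun c => by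
          rw [← smul_mul_assoc, h4]
        rw [h6, h2, h3', h3', h4', h4', hinv, smul_smul, map_mul]
        simp only [mul_sub, mul_add, add_mul, sub_mul, smul_add, smul_sub, mul_assoc]
        norm_num
        simp only [two_smul]
        abel
      have h7 := smul_right_injective _ (four_ne_zero : (4 : ℝ) ≠ 0) h5
      rw [h7, smul_smul]; norm_num
    | add a a' ha ha' =>
      intro b
      rw [add_mul, smul_add, ha, ha', map_add]
      simp only [mul_add, mul_sub]; abel
  refine ⟨hinv, fun a b h => ?_, fun a b h => ?_⟩
  · have := key a b
    rw [h, sub_self, mul_zero, add_zero, ← two_smul ℝ a, mul_smul_comm] at this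
    exact smul_right_injective _ (two_ne_zero : (2 : ℝ) ≠ 0) this
  · have := key a b
    rw [h, add_neg_cancel, mul_zero, zero_add, sub_neg_eq_add, ← two_smul ℝ a,
      mul_smul_comm] at this
    exact smul_right_injective _ (two_ne_zero : (2 : ℝ) ≠ 0) this

/-- Contraction with a linear form. -/
abbrev contr (φ : Module.Dual ℝ W) : ExteriorAlgebra ℝ W →ₗ[ℝ] ExteriorAlgebra ℝ W :=
  CliffordAlgebra.contractLeft φ

lemma contr_parity (φ : Module.Dual ℝ W) (a : ExteriorAlgebra ℝ W) :
    contr φ (extParity W a) = -extParity W (contr φ a) := by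
  induction a using CliffordAlgebra.left_induction with
  | algebraMap r => simp [contr]
  | add a b ha hb => simp only [map_add, ha, hb, neg_add]
  | ι_mul a v ha =>
    rw [map_mul, CliffordAlgebra.involute_ι, neg_mul, map_neg, CliffordAlgebra.contractLeft_ι_mul,
      CliffordAlgebra.contractLeft_ι_mul, map_sub, map_smul, map_mul, CliffordAlgebra.involute_ι]
    rw [show CliffordAlgebra.contractLeft φ (CliffordAlgebra.involute a) = _ from ha]
    simp

lemma contr_mul (φ : Module.Dual ℝ W) (a b : ExteriorAlgebra ℝ W) :
    contr φ (a * b) = contr φ a * b + extParity W a * contr φ b := by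
  induction a using CliffordAlgebra.left_induction with
  | algebraMap r => simp [contr, ← Algebra.smul_def]
  | add a b ha hb => simp only [map_add, add_mul, ha, hb]; abel
  | ι_mul a v ha =>
    rw [mul_assoc, map_mul (extParity W), CliffordAlgebra.involute_ι]
    simp only [contr] at ha ⊢
    rw [CliffordAlgebra.contractLeft_ι_mul, CliffordAlgebra.contractLeft_ι_mul, ha]
    simp only [sub_mul, mul_add, neg_mul, smul_mul_assoc, mul_assoc]; abel

end Exterior

/-! ### Smooth functions with values in an exterior algebra -/

section Model

variable (W : Type*) [AddCommGroup W] [Module ℝ W] [Module.Finite ℝ W]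

/-- A norm on a finite-dimensional exterior algebra, used only for its topology. -/
abbrev extNorm : NormedAddCommGroup (ExteriorAlgebra ℝ W) :=
  haveI := finite_exteriorAlgebra W
  NormedAddCommGroup.induced (ExteriorAlgebra ℝ W) _
    (Module.finBasis ℝ (ExteriorAlgebra ℝ W)).equivFun.toLinearMap
    (Module.finBasis ℝ (ExteriorAlgebra ℝ W)).equivFun.injective

attribute [local instance] extNorm

/-- The corresponding normed space. -/
abbrev extNormedSpace : NormedSpace ℝ (ExteriorAlgebra ℝ W) :=
  haveI := finite_exteriorAlgebra W
  NormedSpace.induced ℝ (ExteriorAlgebra ℝ W) _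
    (Module.finBasis ℝ (ExteriorAlgebra ℝ W)).equivFun.toLinearMap

attribute [local instance] extNormedSpace finite_exteriorAlgebra

variable {W}
variable {E : Type*} [NormedAddCommGroup E] [NormedSpace ℝ E]

/-- Multiplication of the exterior algebra as a continuous bilinear map. -/
def mulB : ExteriorAlgebra ℝ W →L[ℝ] ExteriorAlgebra ℝ W →L[ℝ] ExteriorAlgebra ℝ W :=
  (LinearMap.mul ℝ (ExteriorAlgebra ℝ W)).toContinuousBilinearMap

@[simp] lemma mulB_apply (a b : ExteriorAlgebra ℝ W) : mulB a b = a * b := rfl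

/-- The extension by zero of a function on an open set. -/
def zext {O : Opens E} (s : O → ExteriorAlgebra ℝ W) (e : E) : ExteriorAlgebra ℝ W :=
  open Classical in if h : e ∈ O then s ⟨e, h⟩ else 0

lemma zext_of_mem {O : Opens E} (s : O → ExteriorAlgebra ℝ W) (e : O) : zext s e = s e := by
  simp [zext]

lemma contDiffOn_iff_dual {S : Set E} {f : E → ExteriorAlgebra ℝ W} :
    ContDiffOn ℝ ∞ f S ↔
      ∀ l : Module.Dual ℝ (ExteriorAlgebra ℝ W), ContDiffOn ℝ ∞ (fun e => l (f e)) S := by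
  refine ⟨fun h l => (LinearMap.toContinuousLinearMap l).contDiff.comp_contDiffOn h, fun h => ?_⟩
  set b := Module.finBasis ℝ (ExteriorAlgebra ℝ W)
  have h2 : ContDiffOn ℝ ∞ (fun e => ∑ i, b.coord i (f e) • b i) S :=
    ContDiffOn.sum fun i _ => (h (b.coord i)).smul contDiffOn_const
  refine h2.congr fun e _ => ?_
  conv_lhs => rw [← b.sum_repr (f e)]
  rfl

lemma ContDiffOn.ext_mul {S : Set E} {f g : E → ExteriorAlgebra ℝ W} (hf : ContDiffOn ℝ ∞ f S)
    (hg : ContDiffOn ℝ ∞ g S) : ContDiffOn ℝ ∞ (fun e => f e * g e) S :=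
  (mulB.isBoundedBilinearMap.contDiff).comp_contDiffOn (hf.prodMk hg)

lemma contDiffOn_ext_linear {S : Set E} {f : E → ExteriorAlgebra ℝ W}
    {W' : Type*} [AddCommGroup W'] [Module ℝ W'] [Module.Finite ℝ W']
    (hf : ContDiffOn ℝ ∞ f S) (L : ExteriorAlgebra ℝ W →ₗ[ℝ] ExteriorAlgebra ℝ W') :
    ContDiffOn ℝ ∞ (fun e => L (f e)) S :=
  (LinearMap.toContinuousLinearMap L).contDiff.comp_contDiffOn hf

variable (W)

/-- The algebra of smooth functions on the open set `O` with values in `Λ W`. -/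
def smoothExt (O : Opens E) : Subalgebra ℝ (O → ExteriorAlgebra ℝ W) where
  carrier := {s | ContDiffOn ℝ ∞ (zext s) O}
  mul_mem' := fun {s t} hs ht => (ContDiffOn.ext_mul hs ht).congr fun e he => by
    simp [zext, show e ∈ O from he]
  add_mem' := fun {s t} hs ht => (ContDiffOn.add hs ht).congr fun e he => by
    simp [zext, show e ∈ O from he]
  algebraMap_mem' := fun r => (contDiffOn_const (c := algebraMap ℝ _ r)).congr fun e he => by
    simp [zext, show e ∈ O from he]

variable {W} {O : Opens E}

lemma mem_smoothExt {s : O → ExteriorAlgebra ℝ W} {f : E → ExteriorAlgebra ℝ W}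
    (hf : ContDiffOn ℝ ∞ f O) (h : ∀ e : O, s e = f e) : s ∈ smoothExt W O :=
  hf.congr fun e he => by rw [← h ⟨e, he⟩, ← zext_of_mem s ⟨e, he⟩]

lemma differentiableAt_zext (s : smoothExt W O) (e : O) : DifferentiableAt ℝ (zext s.1) (e : E) :=
  (s.2.differentiableOn (by simp)).differentiableAt (O.isOpen.mem_nhds e.2)

namespace smoothExt

/-- The parity involution. -/
def parity (O : Opens E) : smoothExt W O →ₐ[ℝ] smoothExt W O where
  toFun s := ⟨fun e => extParity W (s.1 e), mem_smoothExt
    (contDiffOn_ext_linear s.2 (extParity W).toLinearMap) fun e => by simp [zext_of_mem]⟩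
  map_one' := Subtype.ext (funext fun _ => map_one _)
  map_mul' _ _ := Subtype.ext (funext fun _ => map_mul _ _ _)
  map_zero' := Subtype.ext (funext fun _ => map_zero _)
  map_add' _ _ := Subtype.ext (funext fun _ => map_add _ _ _)
  commutes' _ := Subtype.ext (funext fun _ => AlgHom.commutes _ _)

/-- A smooth real function. -/
def scalar (φ : E → ℝ) (hφ : ContDiffOn ℝ ∞ φ O) : smoothExt W O :=
  ⟨fun e => algebraMap ℝ _ (φ e), mem_smoothExt
    ((LinearMap.toContinuousLinearMap (Algebra.linearMap ℝ (ExteriorAlgebra ℝ W))).contDiff.comp_contDiffOn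
      hφ) fun _ => rfl⟩

/-- A constant function. -/
def const (O : Opens E) : ExteriorAlgebra ℝ W →ₐ[ℝ] smoothExt W O where
  toFun a := ⟨fun _ => a, mem_smoothExt (f := fun _ => a) contDiffOn_const fun _ => rfl⟩
  map_one' := rfl
  map_mul' _ _ := rfl
  map_zero' := rfl
  map_add' _ _ := rfl
  commutes' _ := rfl

/-- The directional derivative. -/
def deriv (O : Opens E) (v : E) : smoothExt W O →ₗ[ℝ] smoothExt W O where
  toFun s := ⟨fun e => fderiv ℝ (zext s.1) (e : E) v, mem_smoothExt
    ((s.2.fderiv_of_isOpen O.isOpen (m := ∞) le_rfl).clm_apply contDiffOn_const) fun _ => rfl⟩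
  map_add' s t := Subtype.ext (funext fun e => by
    have h : zext (s + t).1 = zext s.1 + zext t.1 := by
      funext x; by_cases hx : x ∈ O <;> simp [zext, hx]
    show fderiv ℝ (zext (s + t).1) (e : E) v = _
    rw [h, fderiv_add (differentiableAt_zext s e) (differentiableAt_zext t e)]
    rfl)
  map_smul' c s := Subtype.ext (funext fun e => by
    have h : zext (c • s).1 = c • zext s.1 := by
      funext x; by_cases hx : x ∈ O <;> simp [zext, hx]
    show fderiv ℝ (zext (c • s).1) (e : E) v = _
    rw [h, fderiv_const_smul (differentiableAt_zext s e)]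
    rfl)

lemma deriv_apply (v : E) (s : smoothExt W O) (e : O) :
    (deriv O v s).1 e = fderiv ℝ (zext s.1) (e : E) v := rfl

lemma deriv_eq_fderiv (v : E) (s : smoothExt W O) {f : E → ExteriorAlgebra ℝ W} (e : O)
    (h : ∀ e' : O, s.1 e' = f e') : (deriv O v s).1 e = fderiv ℝ f (e : E) v := by
  rw [deriv_apply, Filter.EventuallyEq.fderiv_eq]
  filter_upwards [O.isOpen.mem_nhds e.2] with x hx
  rw [← h ⟨x, hx⟩, ← zext_of_mem s.1 ⟨x, hx⟩]

lemma deriv_isVF (v : E) : IsVF (parity (W := W) O) 0 (deriv O v) := by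
  refine ⟨fun s t => Subtype.ext (funext fun e => ?_), fun s => Subtype.ext (funext fun e => ?_)⟩
  · have h := mulB.hasFDerivAt_of_bilinear (differentiableAt_zext s e).hasFDerivAt
      (differentiableAt_zext t e).hasFDerivAt
    rw [deriv_eq_fderiv v (s * t) (f := fun x => zext s.1 x * zext t.1 x) e fun e' => by
      simp [zext_of_mem]]
    have h' : HasFDerivAt (fun x => zext s.1 x * zext t.1 x) _ (e : E) := h
    rw [h'.fderiv]
    simp only [zext_of_mem, add_apply, ContinuousLinearMap.precompR_apply,
      ContinuousLinearMap.precompL_apply, mulB_apply, Fin.coe_ofNat_eq_mod, Nat.zero_mod, pow_zero,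
      AlgHom.one_apply, AlgHom.coe_id, id_eq]
    rw [add_comm]
    rfl
  · have h := ((LinearMap.toContinuousLinearMap (extParity W).toLinearMap).hasFDerivAt).comp (e : E)
      (differentiableAt_zext s e).hasFDerivAt
    rw [deriv_eq_fderiv v (parity O s) (f := fun x => extParity W (zext s.1 x)) e fun e' => by
      simp [zext_of_mem, parity]]
    have h' : HasFDerivAt (fun x => extParity W (zext s.1 x)) _ (e : E) := h
    rw [h'.fderiv]
    simp [parity, deriv_apply]

/-- Contraction with a linear form. -/
def contract (O : Opens E) (φ : Module.Dual ℝ W) : smoothExt W O →ₗ[ℝ] smoothExt W O where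
  toFun s := ⟨fun e => contr φ (s.1 e), mem_smoothExt
    (contDiffOn_ext_linear s.2 (contr φ)) fun e => by simp [zext_of_mem]⟩
  map_add' _ _ := Subtype.ext (funext fun _ => map_add _ _ _)
  map_smul' c s := Subtype.ext (funext fun e => (contr φ).map_smul c (s.1 e))

lemma contract_isVF (φ : Module.Dual ℝ W) : IsVF (parity (W := W) O) 1 (contract O φ) :=
  ⟨fun s t => Subtype.ext (funext fun e => contr_mul φ (s.1 e) (t.1 e)),
    fun s => Subtype.ext (funext fun e => by
      have := contr_parity φ (s.1 e)
      simp only [Fin.val_one, pow_one, neg_smul, one_smul]; exact this)⟩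

lemma deriv_scalar (v : E) {φ : E → ℝ} (hφ : ContDiffOn ℝ ∞ φ O) (e : O) :
    (deriv O v (scalar (W := W) φ hφ)).1 e = algebraMap ℝ _ (fderiv ℝ φ (e : E) v) := by
  rw [deriv_eq_fderiv v _ (f := fun x => algebraMap ℝ (ExteriorAlgebra ℝ W) (φ x)) e fun _ => rfl]
  have hd : DifferentiableAt ℝ φ (e : E) :=
    (hφ.differentiableOn (by simp)).differentiableAt (O.isOpen.mem_nhds e.2)
  have h := ((LinearMap.toContinuousLinearMap
    (Algebra.linearMap ℝ (ExteriorAlgebra ℝ W))).hasFDerivAt).comp (e : E) hd.hasFDerivAt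
  have h' : HasFDerivAt (fun x => algebraMap ℝ (ExteriorAlgebra ℝ W) (φ x)) _ (e : E) := h
  rw [h'.fderiv]
  rfl

lemma deriv_const (v : E) (a : ExteriorAlgebra ℝ W) : deriv O v (const O a) = 0 := by
  refine Subtype.ext (funext fun e => ?_)
  rw [deriv_eq_fderiv v _ (f := fun _ => a) e fun _ => rfl]
  simp

lemma contract_scalar (φ : Module.Dual ℝ W) {f : E → ℝ} (hf : ContDiffOn ℝ ∞ f O) :
    contract O φ (scalar f hf) = 0 :=
  Subtype.ext (funext fun e => CliffordAlgebra.contractLeft_algebraMap (Q := 0) φ (f e))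

/-! ### Superderivations at a point -/

section Span

variable [FiniteDimensional ℝ E] {L : Type*} [Ring L] [Algebra ℝ L] {σL : L →ₐ[ℝ] L}
  {ρ : smoothExt W O →ₐ[ℝ] L} {s : Fin 2} {δ : smoothExt W O →ₗ[ℝ] L} {p : O}

/-- A superderivation along a point is given on functions by the differential at the point. -/
lemma der_scalar (hδ : IsSuperDer (parity O) σL ρ s δ)
    (hρ : ∀ φ (hφ : ContDiffOn ℝ ∞ φ O), ρ (scalar φ hφ) = algebraMap ℝ L (φ p))
    {J : Type*} [Fintype J] (β : Module.Basis J ℝ E)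
    (hβ : ∀ j, ContDiffOn ℝ ∞ (fun e => β.coord j e) O) {φ : E → ℝ} (hφ : ContDiffOn ℝ ∞ φ O) :
    δ (scalar φ hφ) = ∑ j, fderiv ℝ φ (p : E) (β j) • δ (scalar _ (hβ j)) := by
  have hσ : ∀ c : ℝ, (σL ^ (s : ℕ)) (algebraMap ℝ L c) = algebraMap ℝ L c := fun c =>
    AlgHom.commutes _ c
  have hmul : ∀ (f g : E → ℝ) (hf : ContDiffOn ℝ ∞ f O) (hg : ContDiffOn ℝ ∞ g O),
      δ (scalar (fun e => f e * g e) (hf.mul hg)) =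
        g p • δ (scalar f hf) + f p • δ (scalar g hg) := fun f g hf hg => by
    have h1 : scalar (W := W) (fun e => f e * g e) (hf.mul hg) = scalar f hf * scalar g hg :=
      Subtype.ext (funext fun e => map_mul _ _ _)
    rw [h1, hδ.1, hρ, hρ, hσ, ← Algebra.commutes, ← Algebra.smul_def, ← Algebra.smul_def]
  have hconst : ∀ c : ℝ, δ (scalar (fun _ => c) contDiffOn_const) = 0 := fun c => by
    have h1 : scalar (W := W) (fun _ : E => c) (contDiffOn_const (s := (O : Set E))) = c • 1 :=
      Subtype.ext (funext fun e => Algebra.algebraMap_eq_smul_one c)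
    rw [h1, map_smul, hδ.map_one, smul_zero]
  have hadd : ∀ (f g : E → ℝ) (hf : ContDiffOn ℝ ∞ f O) (hg : ContDiffOn ℝ ∞ g O),
      δ (scalar (fun e => f e + g e) (hf.add hg)) = δ (scalar f hf) + δ (scalar g hg) :=
    fun f g hf hg => by
      rw [← map_add]; congr 1; exact Subtype.ext (funext fun e => map_add _ _ _)
  have hsum : ∀ (f : J → E → ℝ) (hf : ∀ j, ContDiffOn ℝ ∞ (f j) O),
      δ (scalar (fun e => ∑ j, f j e) (ContDiffOn.sum fun j _ => hf j)) =
        ∑ j, δ (scalar (f j) (hf j)) := fun f hf => by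
      rw [← map_sum]; congr 1; refine Subtype.ext (funext fun e => ?_)
      have h2 : (∑ j, scalar (W := W) (f j) (hf j)).1 = ∑ j, (scalar (W := W) (f j) (hf j)).1 :=
        map_sum (smoothExt W O).val _ _
      rw [h2, Finset.sum_apply]
      exact map_sum (algebraMap ℝ (ExteriorAlgebra ℝ W)) _ _
  -- Functions that extend smoothly to the whole space: this is Hadamard's lemma.
  have hglob : ∀ f : E → ℝ, (hf : ContDiff ℝ ∞ f) →
      δ (scalar f hf.contDiffOn) = ∑ j, fderiv ℝ f (p : E) (β j) • δ (scalar _ (hβ j)) := by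
    intro f hf
    obtain ⟨g, hg, hgp, hfg⟩ := exists_hadamard β hf (p : E)
    have hsub : ∀ j, ContDiffOn ℝ ∞ (fun e => β.coord j e - β.coord j (p : E)) O := fun j =>
      (hβ j).sub contDiffOn_const
    have h1 : scalar (W := W) f (hf.contDiffOn (s := O)) = scalar (fun e => f (p : E) +
        ∑ j, (β.coord j e - β.coord j (p : E)) * g j e) (contDiffOn_const.add
          (ContDiffOn.sum fun j _ => (hsub j).mul (hg j).contDiffOn)) :=
      Subtype.ext (funext fun e => congrArg (algebraMap ℝ (ExteriorAlgebra ℝ W)) (hfg e))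
    have h2 : ∀ j, δ (scalar _ (hsub j)) = δ (scalar _ (hβ j)) := fun j => by
      have h3 := hadd (fun e => β.coord j e - β.coord j (p : E)) (fun _ => β.coord j (p : E))
        (hsub j) contDiffOn_const
      rw [hconst, add_zero] at h3
      rw [← h3]
      congr 2
      funext e
      simp
    rw [h1, hadd _ _ contDiffOn_const (ContDiffOn.sum fun j _ => (hsub j).mul (hg j).contDiffOn),
      hconst, zero_add, hsum _ fun j => (hsub j).mul (hg j).contDiffOn]
    refine sum_congr rfl fun j _ => ?_
    rw [hmul _ _ (hsub j) (hg j).contDiffOn, sub_self, zero_smul, add_zero, h2, hgp]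
  -- The general case is reduced to the previous one by a bump function.
  obtain ⟨χ, hχO, -, hχ, -, hχp⟩ := exists_contDiff_tsupport_subset (n := (⊤ : ℕ∞))
    (O.isOpen.mem_nhds p.2)
  have hχφ : ContDiff ℝ ∞ fun e => χ e * φ e := by
    refine contDiff_iff_contDiffAt.mpr fun e => ?_
    by_cases he : e ∈ (O : Set E)
    · exact hχ.contDiffAt.mul (hφ.contDiffAt (O.isOpen.mem_nhds he))
    · have h1 : (fun e => χ e * φ e) =ᶠ[nhds e] fun _ => 0 := by
        have : (tsupport χ)ᶜ ∈ nhds e :=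
          (isClosed_tsupport χ).isOpen_compl.mem_nhds fun h => he (hχO h)
        filter_upwards [this] with x hx
        rw [image_eq_zero_of_notMem_tsupport hx, zero_mul]
      exact contDiffAt_const.congr_of_eventuallyEq h1
  have h1 := hmul χ φ hχ.contDiffOn hφ
  rw [hglob _ hχφ, hglob _ hχ, hχp, one_smul] at h1
  have hd : DifferentiableAt ℝ φ (p : E) :=
    (hφ.differentiableOn (by simp)).differentiableAt (O.isOpen.mem_nhds p.2)
  have h2 : fderiv ℝ (fun e => χ e * φ e) (p : E) = fderiv ℝ φ (p : E) +
      φ p • fderiv ℝ χ (p : E) := by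
    rw [fderiv_fun_mul (hχ.differentiable (by simp) _) hd, hχp, one_smul]
  rw [h2, ← sub_eq_iff_eq_add', smul_sum, ← sum_sub_distrib] at h1
  rw [← h1]
  refine sum_congr rfl fun j _ => ?_
  rw [smul_smul, ← sub_smul]
  congr 1
  simp

lemma der_const (hL : IsSuperComm σL) (hρσ : ∀ a, ρ (parity O a) = σL (ρ a))
    (hδ : IsSuperDer (parity O) σL ρ s δ) {K : Type*} [Fintype K] (γ : Module.Basis K ℝ W)
    (a : ExteriorAlgebra ℝ W) :
    δ (const O a) = ∑ k, δ (const O (ExteriorAlgebra.ι ℝ (γ k))) *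
      ρ (const O (contr (γ.coord k) a)) := by
  have hpar : ∀ b, parity O (const O b) = const O (extParity W b) := fun b => rfl
  have hswap : ∀ k b, (σL ^ (s : ℕ)) (ρ (const O b)) * δ (const O (ExteriorAlgebra.ι ℝ (γ k))) =
      δ (const O (ExteriorAlgebra.ι ℝ (γ k))) * ρ (const O (extParity W b)) := fun k b => by
    have h1 := hδ.2 (const O (ExteriorAlgebra.ι ℝ (γ k)))
    rw [hpar, extParity_ι, map_neg, map_neg] at h1
    rw [← hpar, hρσ]
    generalize δ (const O (ExteriorAlgebra.ι ℝ (γ k))) = d at h1 ⊢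
    fin_cases s
    · simp only [pow_zero, one_smul] at h1
      rw [hL.odd_comm d _ h1.symm, hL.invol]; rfl
    · simp only [pow_one, neg_smul, one_smul,
        neg_inj] at h1
      rw [hL.even_comm d _ h1.symm]; simp
  induction a using ExteriorAlgebra.induction with
  | algebraMap r =>
    have h0 : ∀ φ : Module.Dual ℝ W, contr φ (algebraMap ℝ (ExteriorAlgebra ℝ W) r) = 0 := fun φ =>
      CliffordAlgebra.contractLeft_algebraMap (Q := 0) φ r
    simp only [AlgHom.commutes, h0, map_zero, mul_zero, Finset.sum_const_zero]
    rw [Algebra.algebraMap_eq_smul_one, map_smul, hδ.map_one, smul_zero]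
  | ι w =>
    have h0 : ∀ φ : Module.Dual ℝ W, contr φ (ExteriorAlgebra.ι ℝ w) = algebraMap ℝ _ (φ w) :=
      fun φ => CliffordAlgebra.contractLeft_ι (Q := 0) φ w
    simp only [h0, AlgHom.commutes]
    conv_lhs => rw [← γ.sum_repr w]
    simp only [map_sum, map_smul]
    refine sum_congr rfl fun k _ => ?_
    rw [← Algebra.commutes, ← Algebra.smul_def]
    rfl
  | mul a b ha hb =>
    rw [map_mul, hδ.1, ha, hb, sum_mul, mul_sum, ← sum_add_distrib]
    refine sum_congr rfl fun k _ => ?_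
    rw [contr_mul, map_add, map_mul, map_mul, map_add, map_mul, map_mul, mul_add, ← mul_assoc,
      ← mul_assoc, ← mul_assoc, hswap]
  | add a b ha hb =>
    simp only [map_add, ha, hb, mul_add, sum_add_distrib]

/-- A superderivation along a point is determined by its values on the coordinates. -/
theorem der_eq_sum (hL : IsSuperComm σL) (hρσ : ∀ a, ρ (parity O a) = σL (ρ a))
    (hδ : IsSuperDer (parity O) σL ρ s δ)
    (hρ : ∀ φ (hφ : ContDiffOn ℝ ∞ φ O), ρ (scalar φ hφ) = algebraMap ℝ L (φ p))
    {J K : Type*} [Fintype J] [Fintype K] (β : Module.Basis J ℝ E)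
    (hβ : ∀ j, ContDiffOn ℝ ∞ (fun e => β.coord j e) O) (γ : Module.Basis K ℝ W)
    (b : smoothExt W O) :
    δ b = ∑ j, δ (scalar _ (hβ j)) * ρ (deriv O (β j) b) +
      ∑ k, δ (const O (ExteriorAlgebra.ι ℝ (γ k))) * ρ (contract O (γ.coord k) b) := by
  have hprod : ∀ (φ : E → ℝ) (hφ : ContDiffOn ℝ ∞ φ O) (a : ExteriorAlgebra ℝ W),
      δ (scalar φ hφ * const O a) =
        ∑ j, δ (scalar _ (hβ j)) * ρ (deriv O (β j) (scalar φ hφ * const O a)) +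
        ∑ k, δ (const O (ExteriorAlgebra.ι ℝ (γ k))) *
          ρ (contract O (γ.coord k) (scalar φ hφ * const O a)) := by
    intro φ hφ a
    rw [hδ.1, hρ, der_scalar hδ hρ β hβ, der_const hL hρσ hδ γ, sum_mul, mul_sum]
    congr 1
    · refine sum_congr rfl fun j _ => ?_
      have hd : ContDiffOn ℝ ∞ (fun e => fderiv ℝ φ e (β j)) O :=
        (hφ.fderiv_of_isOpen O.isOpen (m := ∞) le_rfl).clm_apply contDiffOn_const
      have h1 : deriv O (β j) (scalar φ hφ) = scalar (W := W) _ hd :=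
        Subtype.ext (funext fun e => deriv_scalar (β j) hφ e)
      rw [(deriv_isVF (β j)).1, deriv_const, mul_zero, add_zero, h1, map_mul, AlgHom.id_apply, hρ,
        ← mul_assoc, ← Algebra.commutes, ← Algebra.smul_def]
    · refine sum_congr rfl fun k _ => ?_
      have h1 : parity O (scalar φ hφ) = scalar (W := W) φ hφ :=
        Subtype.ext (funext fun e => AlgHom.commutes _ _)
      rw [(contract_isVF (γ.coord k)).1, contract_scalar, zero_mul, zero_add, map_mul,
        AlgHom.id_apply, Fin.val_one, pow_one, h1, hρ, AlgHom.commutes, ← mul_assoc, ← mul_assoc,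
        Algebra.commutes]
      rfl
  set B := Module.finBasis ℝ (ExteriorAlgebra ℝ W)
  have hc : ∀ i, ContDiffOn ℝ ∞ (fun e => B.coord i (zext b.1 e)) O := fun i =>
    contDiffOn_iff_dual.mp b.2 (B.coord i)
  have hb : b = ∑ i, scalar _ (hc i) * const O (B i) := by
    refine Subtype.ext (funext fun e => ?_)
    have h2 : (∑ i, scalar _ (hc i) * const O (B i)).1 = ∑ i, (scalar _ (hc i) * const O (B i)).1 :=
      map_sum (smoothExt W O).val _ _
    rw [h2, Finset.sum_apply]
    conv_lhs => rw [← B.sum_repr (b.1 e)]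
    refine sum_congr rfl fun i _ => ?_
    show _ = algebraMap ℝ _ (B.coord i (zext b.1 e)) * B i
    rw [zext_of_mem, ← Algebra.smul_def]
    rfl
  rw [hb]
  simp only [map_sum, hprod, mul_sum]
  rw [sum_add_distrib, sum_comm]
  congr 1
  rw [sum_comm]

end Span

end smoothExt

end Model

/-! ### Charts and tangent vectors -/

section ChartsY

variable {m : ℕ} {Y : Type*} [TopologicalSpace Y] [ChartedSpace (CE m) Y]
  [IsManifold 𝓘(ℂ, CE m) ω Y]

lemma analyticOn_transition {c c' : CChart m Y}
    (hc : c ∈ atlas (CE m) Y) (hc' : c' ∈ atlas (CE m) Y) :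
    ContDiffOn ℂ ω (c' ∘ c.symm) (c.symm.trans c').source := by
  have h := HasGroupoid.compatible (G := contDiffGroupoid ω 𝓘(ℂ, CE m)) hc hc'
  rw [contDiffGroupoid, mem_groupoid_of_pregroupoid] at h
  have h2 := h.1
  simp only [contDiffPregroupoid, modelWithCornersSelf_coe, modelWithCornersSelf_coe_symm,
    Function.id_comp, Function.comp_id, Set.preimage_id, Set.range_id, Set.inter_univ] at h2
  exact h2

lemma mem_transition_source {c c' : CChart m Y} {y : Y} (hy : y ∈ c.source)
    (hy' : y ∈ c'.source) : c y ∈ (c.symm.trans c').source := by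
  simp [c.map_source hy, c.left_inv hy, hy']

lemma contDiffAt_transition {c c' : CChart m Y}
    (hc : c ∈ atlas (CE m) Y) (hc' : c' ∈ atlas (CE m) Y) {y : Y} (hy : y ∈ c.source)
    (hy' : y ∈ c'.source) : ContDiffAt ℂ ω (c' ∘ c.symm) (c y) :=
  (analyticOn_transition hc hc').contDiffAt
    ((c.symm.trans c').open_source.mem_nhds (mem_transition_source hy hy'))

lemma hasFDerivAt_transition {c c' : CChart m Y}
    (hc : c ∈ atlas (CE m) Y) (hc' : c' ∈ atlas (CE m) Y) {y : Y} (hy : y ∈ c.source)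
    (hy' : y ∈ c'.source) : HasFDerivAt (c' ∘ c.symm)
      ((fderiv ℂ (c' ∘ c.symm) (c y)).restrictScalars ℝ) (c y) :=
  ((contDiffAt_transition hc hc' hy hy').differentiableAt (by simp)).hasFDerivAt.restrictScalars ℝ

lemma fderiv_transition_comp {c c' c'' : CChart m Y}
    (hc : c ∈ atlas (CE m) Y) (hc' : c' ∈ atlas (CE m) Y) (hc'' : c'' ∈ atlas (CE m) Y) {y : Y}
    (hy : y ∈ c.source) (hy' : y ∈ c'.source) (hy'' : y ∈ c''.source) (e : CE m) :
    fderiv ℝ (c'' ∘ c.symm) (c y) e =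
      fderiv ℝ (c'' ∘ c'.symm) (c' y) (fderiv ℝ (c' ∘ c.symm) (c y) e) := by
  have hpt : (c' ∘ c.symm) (c y) = c' y := by simp [c.left_inv hy]
  have hev : (c'' ∘ c.symm) =ᶠ[nhds (c y)] ((c'' ∘ c'.symm) ∘ (c' ∘ c.symm)) := by
    filter_upwards [(c.symm.trans c').open_source.mem_nhds (mem_transition_source hy hy')]
      with z hz
    rw [OpenPartialHomeomorph.trans_source] at hz
    simp [c'.left_inv hz.2]
  have h2 := (hasFDerivAt_transition hc' hc'' hy' hy'').differentiableAt
  rw [hev.fderiv_eq, fderiv_comp _ (by rw [hpt]; exact h2)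
    (hasFDerivAt_transition hc hc' hy hy').differentiableAt, hpt]
  rfl

lemma fderiv_transition_self {F : Type*} [NormedAddCommGroup F] [NormedSpace ℝ F] {Z : Type*}
    [TopologicalSpace Z] (c : OpenPartialHomeomorph Z F) {y : Z} (hy : y ∈ c.source)
    (e : F) : fderiv ℝ (c ∘ c.symm) (c y) e = e := by
  have hev : (c ∘ c.symm) =ᶠ[nhds (c y)] id := by
    filter_upwards [c.open_target.mem_nhds (c.map_source hy)] with z hz
    exact c.right_inv hz
  rw [hev.fderiv_eq, fderiv_id]; rfl

/-- `ofChart` as a linear map. -/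
def ofChartL (c : CChart m Y) (y : Y) : CE m →ₗ[ℝ] TY m y :=
  (fderiv ℝ (chartAt (CE m) y ∘ c.symm) (c y)).toLinearMap

@[simp] lemma ofChartL_apply (c : CChart m Y) (y : Y) (e : CE m) :
    ofChartL c y e = ofChart c y e := rfl

lemma toChart_ofChart {c c' : CChart m Y}
    (hc : c ∈ atlas (CE m) Y) (hc' : c' ∈ atlas (CE m) Y) {y : Y} (hy : y ∈ c.source)
    (hy' : y ∈ c'.source) (e : CE m) :
    toChart c' y (ofChart c y e) = fderiv ℝ (c' ∘ c.symm) (c y) e :=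
  (fderiv_transition_comp hc (chart_mem_atlas _ y) hc' hy (mem_chart_source _ y) hy' e).symm

lemma toChart_ofChart_self {c : CChart m Y} (hc : c ∈ atlas (CE m) Y) {y : Y}
    (hy : y ∈ c.source) (e : CE m) : toChart c y (ofChart c y e) = e := by
  rw [toChart_ofChart hc hc hy hy, fderiv_transition_self c hy]

lemma ofChart_toChart {c : CChart m Y} (hc : c ∈ atlas (CE m) Y) {y : Y}
    (hy : y ∈ c.source) (v : TY m y) : ofChart c y (toChart c y v) = v :=
  (fderiv_transition_comp (chart_mem_atlas _ y) hc (chart_mem_atlas _ y) (mem_chart_source _ y) hy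
    (mem_chart_source _ y) v).symm.trans (fderiv_transition_self (F := CE m) _ (mem_chart_source _ y) v)

lemma ofChart_smul {c : CChart m Y} (hc : c ∈ atlas (CE m) Y) {y : Y}
    (hy : y ∈ c.source) (a : ℂ) (e : CE m) :
    ofChart c y (a • e) = (a • (show CE m from ofChart c y e) : CE m) := by
  have h := (hasFDerivAt_transition hc (chart_mem_atlas _ y) hy (mem_chart_source _ y)).fderiv
  have h1 : ∀ w : CE m, ofChart c y w = fderiv ℂ (chartAt (CE m) y ∘ c.symm) (c y) w := fun w =>
    congrArg (fun L : CE m →L[ℝ] CE m => L w) h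
  rw [h1, map_smul]
  exact congrArg _ (h1 e).symm

lemma ofChart_I_smul {c : CChart m Y} (hc : c ∈ atlas (CE m) Y) {y : Y}
    (hy : y ∈ c.source) (e : CE m) : ofChart c y (Complex.I • e) = mulI y (ofChart c y e) :=
  ofChart_smul hc hy _ e

end ChartsY

/-! ### The exterior power of a smooth family of linear maps -/

section Families

attribute [local instance] extNorm extNormedSpace finite_exteriorAlgebra

variable {E W W' : Type*} [NormedAddCommGroup E] [NormedSpace ℝ E]
  [NormedAddCommGroup W] [NormedSpace ℝ W] [FiniteDimensional ℝ W]
  [NormedAddCommGroup W'] [NormedSpace ℝ W'] [FiniteDimensional ℝ W']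

lemma contDiffOn_map_ext {S : Set E} {A : E → W →L[ℝ] W'} (hA : ContDiffOn ℝ ∞ A S)
    {T : E → ExteriorAlgebra ℝ W} (hT : ContDiffOn ℝ ∞ T S) :
    ContDiffOn ℝ ∞ (fun e => ExteriorAlgebra.map (A e).toLinearMap (T e)) S := by
  have h1 : ∀ a : ExteriorAlgebra ℝ W,
      ContDiffOn ℝ ∞ (fun e => ExteriorAlgebra.map (A e).toLinearMap a) S := by
    intro a
    induction a using ExteriorAlgebra.induction with
    | algebraMap r => simpa only [AlgHom.commutes] using contDiffOn_const
    | ι w =>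
      simp only [ExteriorAlgebra.map_apply_ι]
      exact (LinearMap.toContinuousLinearMap (ExteriorAlgebra.ι ℝ : W' →ₗ[ℝ] _)).contDiff.comp_contDiffOn
        (hA.clm_apply contDiffOn_const)
    | mul a b ha hb => simpa only [map_mul] using ContDiffOn.ext_mul ha hb
    | add a b ha hb => simpa only [map_add] using ha.add hb
  set b := Module.finBasis ℝ (ExteriorAlgebra ℝ W)
  have h2 : ContDiffOn ℝ ∞ (fun e => ∑ i, b.coord i (T e) •
      ExteriorAlgebra.map (A e).toLinearMap (b i)) S :=
    ContDiffOn.sum fun i _ => (contDiffOn_iff_dual.mp hT (b.coord i)).smul (h1 (b i))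
  refine h2.congr fun e _ => ?_
  conv_lhs => rw [← b.sum_repr (T e)]
  simp only [map_sum, map_smul]
  rfl

end Families

/-! ### Trivialization of `Λ TY` -/

section TrivY

attribute [local instance] extNorm extNormedSpace finite_exteriorAlgebra

variable {m : ℕ} {Y : Type*} [TopologicalSpace Y] [ChartedSpace (CE m) Y]
  [IsManifold 𝓘(ℂ, CE m) ω Y]

/-- The image of the open set `U` under the chart `c`. -/
def img {Z F : Type*} [TopologicalSpace Z] [TopologicalSpace F]
    (c : OpenPartialHomeomorph Z F) (U : Opens Z) : Opens F :=
  ⟨c.target ∩ c.symm ⁻¹' U, c.symm.isOpen_inter_preimage U.isOpen⟩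

lemma mem_img {Z F : Type*} [TopologicalSpace Z] [TopologicalSpace F]
    {c : OpenPartialHomeomorph Z F} {U : Opens Z} {z : Z} (hz : z ∈ c.source) (hU : z ∈ U) :
    c z ∈ img c U := ⟨c.map_source hz, by simpa [c.left_inv hz] using hU⟩

/-- The local representative of a section of `Λ TY` in the chart `c`. -/
def repY (c : CChart m Y) {U : Opens Y}
    (t : ∀ y : U, ExteriorAlgebra ℝ (TY m (y : Y))) (e : CE m) : ExteriorAlgebra ℝ (CE m) :=
  open Classical in
  if h : c.symm e ∈ U then ExteriorAlgebra.map (toChart c (c.symm e)) (t ⟨c.symm e, h⟩) else 0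

lemma repY_chart {c : CChart m Y} {U : Opens Y}
    (t : ∀ y : U, ExteriorAlgebra ℝ (TY m (y : Y))) (y : U) (hy : (y : Y) ∈ c.source) :
    repY c t (c (y : Y)) = ExteriorAlgebra.map (toChart c (y : Y)) (t y) := by
  classical
  have h : ∀ z : Y, (hz : z = y) → (if h : z ∈ U then
      ExteriorAlgebra.map (toChart c z) (t ⟨z, h⟩) else 0) =
      ExteriorAlgebra.map (toChart c (y : Y)) (t y) := by
    rintro z rfl
    simp
  rw [repY]
  convert h _ (c.left_inv hy)

lemma contDiffOn_repY {c : CChart m Y} (hc : c ∈ atlas (CE m) Y) {U : Opens Y}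
    (t : OY m U) : ContDiffOn ℝ ∞ (repY c t.1) (img c U) := by
  have := isManifold_real (m := m) (Y := Y)
  rw [contDiffOn_iff_dual]
  intro l e he
  have hy : c.symm e ∈ c.source := c.map_target he.1
  set y : U := ⟨c.symm e, he.2⟩
  have h1 := t.2 c hc l
  have hopen : IsOpen {y : U | (y : Y) ∈ c.source} := c.open_source.preimage continuous_subtype_val
  have h2 := h1.contMDiffAt (hopen.mem_nhds (show y ∈ {y : U | (y : Y) ∈ c.source} from hy))
  set f : Y → ℝ := fun z => l (repY c t.1 (c z))
  have h3 : ContMDiffAt 𝓘(ℝ, CE m) 𝓘(ℝ, ℝ) ∞ (fun z : U => f z) y := by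
    refine h2.congr_of_eventuallyEq ?_
    filter_upwards [hopen.mem_nhds (show y ∈ {y : U | (y : Y) ∈ c.source} from hy)] with z hz
    exact congrArg l (repY_chart t.1 z hz)
  have h4 : ContMDiffAt 𝓘(ℝ, CE m) 𝓘(ℝ, ℝ) ∞ f (c.symm e) := contMDiffAt_subtype_iff.mp h3
  have h5 : ContMDiffAt 𝓘(ℝ, CE m) 𝓘(ℝ, CE m) ∞ c.symm e :=
    (contMDiffOn_symm_of_mem_maximalAtlas (IsManifold.subset_maximalAtlas hc)).contMDiffAt
      (c.open_target.mem_nhds he.1)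
  have h6 : ContDiffAt ℝ ∞ (f ∘ c.symm) e := (h4.comp e h5).contDiffAt
  refine (h6.congr_of_eventuallyEq ?_).contDiffWithinAt
  filter_upwards [c.open_target.mem_nhds he.1] with z hz
  simp [f, c.right_inv hz]

/-- The section of `Λ TY` with a given local representative. -/
def ofRepY {c : CChart m Y} (hc : c ∈ atlas (CE m) Y) {U : Opens Y}
    (hU : U ≤ dom c) (T : CE m → ExteriorAlgebra ℝ (CE m)) (hT : ContDiffOn ℝ ∞ T (img c U)) :
    OY m U :=
  ⟨fun y => ExteriorAlgebra.map (ofChartL c (y : Y)) (T (c (y : Y))), by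
    have := isManifold_real (m := m) (Y := Y)
    intro c' hc' l
    have h0 : ContDiffOn ℝ ∞ (fun z => fderiv ℝ (c' ∘ c.symm) z) (c.symm.trans c').source :=
      (contDiffOn_transition hc hc').fderiv_of_isOpen (c.symm.trans c').open_source (m := ∞) le_rfl
    have hS : ContDiffOn ℝ ∞ (fun e => ExteriorAlgebra.map
        (fderiv ℝ (c' ∘ c.symm) e).toLinearMap (T e)) ((c.symm.trans c').source ∩ img c U) :=
      contDiffOn_map_ext (h0.mono Set.inter_subset_left) (hT.mono Set.inter_subset_right)
    have hl := contDiffOn_iff_dual.mp hS l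
    have h1 : ContMDiffOn 𝓘(ℝ, CE m) 𝓘(ℝ, CE m) ∞ c c.source :=
      contMDiffOn_of_mem_maximalAtlas (IsManifold.subset_maximalAtlas hc)
    have h4 : ContMDiff 𝓘(ℝ, CE m) 𝓘(ℝ, CE m) ∞ (Subtype.val : U → Y) := contMDiff_subtype_val
    have h5 : ContMDiffOn 𝓘(ℝ, CE m) 𝓘(ℝ, CE m) ∞ (fun y : U => c y)
        {y : U | (y : Y) ∈ c'.source} := h1.comp h4.contMDiffOn fun y _ => hU y.2
    refine (hl.contMDiffOn.comp h5 fun y hy =>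
      ⟨mem_transition_source (hU y.2) hy, mem_img (hU y.2) y.2⟩).congr fun y hy => ?_
    refine congrArg l ?_
    rw [← AlgHom.comp_apply, ExteriorAlgebra.map_comp_map]
    congr 2
    ext1 e
    exact toChart_ofChart hc hc' (hU y.2) hy e⟩

lemma toChart_comp_ofChartL {c : CChart m Y} (hc : c ∈ atlas (CE m) Y) {y : Y}
    (hy : y ∈ c.source) : toChart c y ∘ₗ ofChartL c y = LinearMap.id :=
  LinearMap.ext fun e => toChart_ofChart_self hc hy e

lemma ofChartL_comp_toChart {c : CChart m Y} (hc : c ∈ atlas (CE m) Y) {y : Y}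
    (hy : y ∈ c.source) : ofChartL c y ∘ₗ toChart c y = LinearMap.id :=
  LinearMap.ext fun e => ofChart_toChart hc hy e

lemma map_toChart_map_ofChartL {c : CChart m Y} (hc : c ∈ atlas (CE m) Y) {y : Y}
    (hy : y ∈ c.source) (a : ExteriorAlgebra ℝ (CE m)) :
    ExteriorAlgebra.map (toChart c y) (ExteriorAlgebra.map (ofChartL c y) a) = a := by
  rw [← AlgHom.comp_apply, ExteriorAlgebra.map_comp_map, toChart_comp_ofChartL hc hy,
    ExteriorAlgebra.map_id]; rfl

lemma map_ofChartL_map_toChart {c : CChart m Y} (hc : c ∈ atlas (CE m) Y) {y : Y}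
    (hy : y ∈ c.source) (a : ExteriorAlgebra ℝ (TY m y)) :
    ExteriorAlgebra.map (ofChartL c y) (ExteriorAlgebra.map (toChart c y) a) = a := by
  rw [← AlgHom.comp_apply, ExteriorAlgebra.map_comp_map, ofChartL_comp_toChart hc hy,
    ExteriorAlgebra.map_id]; rfl

/-- The trivialization `𝒪_𝒴(U) ≃ C^∞(c(U)) ⊗ Λ ℂ^m` given by a chart `c`. -/
def trivY {c : CChart m Y} (hc : c ∈ atlas (CE m) Y) {U : Opens Y}
    (hU : U ≤ dom c) : OY m U ≃ₐ[ℝ] smoothExt (CE m) (img c U) where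
  toFun t := ⟨fun e => ExteriorAlgebra.map (toChart c (c.symm e)) (t.1 ⟨c.symm e, e.2.2⟩),
    mem_smoothExt (contDiffOn_repY hc t) fun e => by simp [repY, show c.symm e ∈ U from e.2.2]⟩
  invFun s := ofRepY hc hU (zext s.1) s.2
  left_inv t := Subtype.ext (funext fun y => by
    have h : ∀ e : img c U, (he : c.symm e = y) →
        ExteriorAlgebra.map (ofChartL c (y : Y)) (ExteriorAlgebra.map (toChart c (c.symm e))
          (t.1 ⟨c.symm e, e.2.2⟩)) = t.1 y := by
      intro e he
      obtain ⟨y, hy⟩ := y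
      subst he
      exact map_ofChartL_map_toChart hc (c.map_target e.2.1) _
    have h2 := h ⟨c y, mem_img (hU y.2) y.2⟩ (c.left_inv (hU y.2))
    refine Eq.trans ?_ h2
    exact congrArg _ (zext_of_mem _ (⟨c y, mem_img (hU y.2) y.2⟩ : img c U)))
  right_inv s := Subtype.ext (funext fun e => by
    have h1 := map_toChart_map_ofChartL hc (c.map_target e.2.1) (zext s.1 (c (c.symm e)))
    refine h1.trans ?_
    rw [c.right_inv e.2.1, zext_of_mem])
  map_mul' s t := Subtype.ext (funext fun e => map_mul _ _ _)
  map_add' s t := Subtype.ext (funext fun e => map_add _ _ _)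
  commutes' r := Subtype.ext (funext fun e => AlgHom.commutes _ _)

lemma trivY_symm_apply {c : CChart m Y} (hc : c ∈ atlas (CE m) Y) {U : Opens Y}
    (hU : U ≤ dom c) (s : smoothExt (CE m) (img c U)) (y : U) :
    ((trivY hc hU).symm s).1 y = ExteriorAlgebra.map (ofChartL c (y : Y))
      (s.1 ⟨c y, mem_img (hU y.2) y.2⟩) :=
  congrArg _ (zext_of_mem s.1 (⟨c y, mem_img (hU y.2) y.2⟩ : img c U))

lemma trivY_parity {c : CChart m Y} (hc : c ∈ atlas (CE m) Y) {U : Opens Y}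
    (hU : U ≤ dom c) (t : OY m U) :
    trivY hc hU (parityY U t) = smoothExt.parity _ (trivY hc hU t) :=
  Subtype.ext (funext fun _ => map_extParity _ _)

end TrivY

/-! ### The normal bundle of a real slice -/

section NormalBundle

variable {m : ℕ} {Y : Type*} [TopologicalSpace Y] [ChartedSpace (CE m) Y]
  [IsManifold 𝓘(ℂ, CE m) ω Y]
  {X : Type*} [TopologicalSpace X] [ChartedSpace (RE m) X] [IsManifold 𝓘(ℝ, RE m) ∞ X]
  {ι : C(X, Y)}

/-- Multiplication by `i` as a linear map. -/
def mulIL (y : Y) : TY m y →ₗ[ℝ] TY m y where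
  toFun := mulI y
  map_add' v w := smul_add Complex.I (show CE m from v) (show CE m from w)
  map_smul' c v := smul_comm Complex.I c (show CE m from v)

@[simp] lemma mulIL_apply (y : Y) (v : TY m y) : mulIL y v = mulI y v := rfl

/-- The domain of a chart of `X`. -/
def domX (k : RChart m X) : Opens X := ⟨k.source, k.open_source⟩

lemma contDiffAt_transitionX {k k' : RChart m X}
    (hk : k ∈ atlas (RE m) X) (hk' : k' ∈ atlas (RE m) X) {x : X} (hx : x ∈ k.source)
    (hx' : x ∈ k'.source) : ContDiffAt ℝ ∞ (k' ∘ k.symm) (k x) := by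
  have h := HasGroupoid.compatible (G := contDiffGroupoid ∞ 𝓘(ℝ, RE m)) hk hk'
  rw [contDiffGroupoid, mem_groupoid_of_pregroupoid] at h
  have h2 := h.1
  simp only [contDiffPregroupoid, modelWithCornersSelf_coe, modelWithCornersSelf_coe_symm,
    Function.id_comp, Function.comp_id, Set.preimage_id, Set.range_id, Set.inter_univ] at h2
  exact h2.contDiffAt ((k.symm.trans k').open_source.mem_nhds (by
    simp [k.map_source hx, k.left_inv hx, hx']))

lemma fderiv_transitionX_inv {k k' : RChart m X}
    (hk : k ∈ atlas (RE m) X) (hk' : k' ∈ atlas (RE m) X) {x : X} (hx : x ∈ k.source)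
    (hx' : x ∈ k'.source) (v : RE m) :
    fderiv ℝ (k' ∘ k.symm) (k x) (fderiv ℝ (k ∘ k'.symm) (k' x) v) = v := by
  have hpt : (k ∘ k'.symm) (k' x) = k x := by simp [k'.left_inv hx']
  have hev : (k' ∘ k'.symm) =ᶠ[nhds (k' x)] ((k' ∘ k.symm) ∘ (k ∘ k'.symm)) := by
    have : (k'.symm.trans k).source ∈ nhds (k' x) := (k'.symm.trans k).open_source.mem_nhds (by
      simp [k'.map_source hx', k'.left_inv hx', hx])
    filter_upwards [this] with z hz
    rw [OpenPartialHomeomorph.trans_source] at hz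
    simp [k.left_inv hz.2]
  have h1 := (contDiffAt_transitionX hk hk' hx hx').differentiableAt (by simp)
  have h2 := (contDiffAt_transitionX hk' hk hx' hx).differentiableAt (by simp)
  have h3 := fderiv_transition_self k' hx' v
  rw [hev.fderiv_eq, fderiv_comp _ (by rw [hpt]; exact h1) h2, hpt] at h3
  exact h3

/-- The embedding in local coordinates. -/
def locRep (ι : C(X, Y)) (c : CChart m Y) (k : RChart m X) :
    RE m → CE m := c ∘ ι ∘ k.symm

lemma locRep_apply {c : CChart m Y} {k : RChart m X} {x : X}
    (hx : x ∈ k.source) : locRep ι c k (k x) = c (ι x) := by simp [locRep, k.left_inv hx]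

lemma contDiffOn_locRep (hι : IsRealSlice (m := m) ι) {c : CChart m Y}
    (hc : c ∈ atlas (CE m) Y) {k : RChart m X} (hk : k ∈ atlas (RE m) X) :
    ContDiffOn ℝ ∞ (locRep ι c k) (img k (pre ι (dom c))) := by
  have := isManifold_real (m := m) (Y := Y)
  rw [← contMDiffOn_iff_contDiffOn]
  have h1 : ContMDiffOn 𝓘(ℝ, RE m) 𝓘(ℝ, RE m) ∞ k.symm (img k (pre ι (dom c))) :=
    (contMDiffOn_symm_of_mem_maximalAtlas (IsManifold.subset_maximalAtlas hk)).mono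
      Set.inter_subset_left
  have h2 : ContMDiffOn 𝓘(ℝ, CE m) 𝓘(ℝ, CE m) ∞ c c.source :=
    contMDiffOn_of_mem_maximalAtlas (IsManifold.subset_maximalAtlas hc)
  exact h2.comp (hι.smooth.comp_contMDiffOn h1) fun e he => he.2

lemma differentiableAt_locRep (hι : IsRealSlice (m := m) ι) {c : CChart m Y}
    (hc : c ∈ atlas (CE m) Y) {k : RChart m X} (hk : k ∈ atlas (RE m) X)
    {x : X} (hx : x ∈ k.source) (hy : ι x ∈ c.source) :
    DifferentiableAt ℝ (locRep ι c k) (k x) :=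
  ((contDiffOn_locRep hι hc hk).differentiableOn (by simp)).differentiableAt
    ((img k (pre ι (dom c))).isOpen.mem_nhds (mem_img hx hy))

/-- Tangent vectors of `X` with given components in the chart `k`, as tangent vectors of `Y`. -/
def tang (ι : C(X, Y)) (k : RChart m X) (x : X) : RE m →ₗ[ℝ] TY m (ι x) :=
  diff ι x ∘ₗ (fderiv ℝ (chartAt (RE m) x ∘ k.symm) (k x)).toLinearMap

lemma toChart_tang (hι : IsRealSlice (m := m) ι) {c : CChart m Y}
    (hc : c ∈ atlas (CE m) Y) {k : RChart m X} (hk : k ∈ atlas (RE m) X)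
    {x : X} (hx : x ∈ k.source) (hy : ι x ∈ c.source) (v : RE m) :
    toChart c (ι x) (tang ι k x v) = fderiv ℝ (locRep ι c k) (k x) v := by
  set k₀ := chartAt (RE m) x with hk₀
  set c₀ := chartAt (CE m) (ι x) with hc₀
  have hx₀ : x ∈ k₀.source := mem_chart_source _ x
  have hy₀ : ι x ∈ c₀.source := mem_chart_source _ (ι x)
  have h0 : ∀ w : RE m, diff (m := m) ι x w = fderiv ℝ (locRep ι c₀ k₀) (k₀ x) w := fun w => by
    have h := (hι.smooth.mdifferentiableAt (by simp) (x := x)).mfderiv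
    have h1 : writtenInExtChartAt 𝓘(ℝ, RE m) 𝓘(ℝ, CE m) x ι = locRep ι c₀ k₀ := by
      funext e; simp [locRep, writtenInExtChartAt, hk₀, hc₀]
    rw [h1] at h
    simp only [modelWithCornersSelf_coe, Set.range_id, fderivWithin_univ] at h
    exact congrArg (fun L : RE m →L[ℝ] CE m => L w) h
  have hd₀ := differentiableAt_locRep hι (chart_mem_atlas _ (ι x)) (chart_mem_atlas _ x) hx₀ hy₀
  have ht := (contDiffAt_transitionX hk (chart_mem_atlas _ x) hx hx₀).differentiableAt (by simp)
  have hcc := (hasFDerivAt_transition (chart_mem_atlas _ (ι x)) hc hy₀ hy).differentiableAt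
  have hpt : (k₀ ∘ k.symm) (k x) = k₀ x := by simp [k.left_inv hx]
  have hpt' : locRep ι c₀ k₀ (k₀ x) = c₀ (ι x) := locRep_apply hx₀
  have hev : locRep ι c k =ᶠ[nhds (k x)]
      (c ∘ c₀.symm) ∘ (locRep ι c₀ k₀) ∘ (k₀ ∘ k.symm) := by
    have h1 : (img k (domX k₀ ⊓ pre ι (dom c₀)) : Set (RE m)) ∈ nhds (k x) :=
      (img k _).isOpen.mem_nhds (mem_img hx ⟨hx₀, hy₀⟩)
    filter_upwards [h1] with z hz
    have h2 : k.symm z ∈ k₀.source := hz.2.1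
    have h3 : ι (k.symm z) ∈ c₀.source := hz.2.2
    simp [locRep, k₀.left_inv h2, c₀.left_inv h3]
  have hcomp := fderiv_comp (k x) (g := (locRep ι c₀ k₀)) (f := k₀ ∘ k.symm) (by rw [hpt]; exact hd₀) ht
  have hcomp2 := fderiv_comp (k x) (g := c ∘ c₀.symm) (f := locRep ι c₀ k₀ ∘ (k₀ ∘ k.symm))
    (by simp only [Function.comp_apply] at hpt ⊢; rw [hpt, hpt']; exact hcc)
    (DifferentiableAt.comp _ (by rw [hpt]; exact hd₀) ht)
  rw [hev.fderiv_eq, hcomp2, hcomp]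
  simp only [Function.comp_apply] at hpt ⊢
  rw [hpt, hpt']
  exact congrArg (toChart c (ι x)) (h0 _)

lemma range_tang {k : RChart m X} (hk : k ∈ atlas (RE m) X)
    {x : X} (hx : x ∈ k.source) :
    LinearMap.range (tang (m := m) ι k x) = LinearMap.range (diff (m := m) ι x) := by
  refine le_antisymm (LinearMap.range_comp_le_range _ _) ?_
  rintro _ ⟨w, rfl⟩
  exact ⟨fderiv ℝ (k ∘ (chartAt (RE m) x).symm) (chartAt (RE m) x x) w,
    congrArg (diff (m := m) ι x) (fderiv_transitionX_inv hk (chart_mem_atlas _ x) hx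
      (mem_chart_source _ x) w)⟩

lemma bijective_tang (hι : IsRealSlice (m := m) ι) {k : RChart m X}
    (hk : k ∈ atlas (RE m) X) {x : X} (hx : x ∈ k.source) :
    Function.Bijective fun u : RE m × RE m => tang (m := m) ι k x u.1 + mulI (ι x) (tang ι k x u.2) := by
  set T : RE m → RE m := fun v => fderiv ℝ (chartAt (RE m) x ∘ k.symm) (k x) v
  have hT : Function.Bijective T := by
    refine Function.bijective_iff_has_inverse.mpr
      ⟨fderiv ℝ (k ∘ (chartAt (RE m) x).symm) (chartAt (RE m) x x), fun v => ?_, fun v => ?_⟩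
    · exact fderiv_transitionX_inv (chart_mem_atlas _ x) hk (mem_chart_source _ x) hx v
    · exact fderiv_transitionX_inv hk (chart_mem_atlas _ x) hx (mem_chart_source _ x) v
  exact (hι.bijective x).comp (hT.prodMap hT)

/-- The isomorphism `ℝ^m ≃ N_x` sending `v` to the class of `i dι(v)`. -/
def normalFrame (hι : IsRealSlice (m := m) ι) {k : RChart m X}
    (hk : k ∈ atlas (RE m) X) {x : X} (hx : x ∈ k.source) : RE m ≃ₗ[ℝ] NX (m := m) ι x :=
  LinearEquiv.ofBijective
    ((LinearMap.range (diff (m := m) ι x)).mkQ ∘ₗ mulIL (ι x) ∘ₗ tang ι k x) <| by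
    have hb := bijective_tang hι hk hx
    refine ⟨(injective_iff_map_eq_zero _).mpr fun v hv => ?_, fun n => ?_⟩
    · simp only [LinearMap.comp_apply, Submodule.mkQ_apply, Submodule.Quotient.mk_eq_zero] at hv
      rw [← range_tang hk hx] at hv
      obtain ⟨w, hw⟩ := hv
      have h1 : (fun u : RE m × RE m => tang (m := m) ι k x u.1 + mulI (ι x) (tang ι k x u.2)) (-w, v) =
          (fun u : RE m × RE m => tang (m := m) ι k x u.1 + mulI (ι x) (tang ι k x u.2)) (0, 0) := by
        simp only [map_neg, map_zero, hw, mulIL_apply, neg_add_cancel]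
        rw [← mulIL_apply, map_zero, add_zero]
      exact (Prod.ext_iff.mp (hb.1 h1)).2
    · obtain ⟨y, rfl⟩ := Submodule.mkQ_surjective _ n
      obtain ⟨⟨a, b⟩, hab⟩ := hb.2 y
      refine ⟨b, ?_⟩
      have h1 : (LinearMap.range (diff (m := m) ι x)).mkQ (tang ι k x a) = 0 := by
        rw [Submodule.mkQ_apply, Submodule.Quotient.mk_eq_zero, ← range_tang hk hx]
        exact ⟨a, rfl⟩
      rw [← hab]
      simp only [map_add, h1, zero_add]
      rfl

lemma normalFrame_apply (hι : IsRealSlice (m := m) ι) {k : RChart m X}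
    (hk : k ∈ atlas (RE m) X) {x : X} (hx : x ∈ k.source) (v : RE m) :
    normalFrame hι hk hx v = (LinearMap.range (diff (m := m) ι x)).mkQ (mulI (ι x) (tang ι k x v)) :=
  rfl

lemma mkQ_tang {k : RChart m X} (hk : k ∈ atlas (RE m) X) {x : X}
    (hx : x ∈ k.source) (a : RE m) :
    (LinearMap.range (diff (m := m) ι x)).mkQ (tang ι k x a) = 0 := by
  rw [Submodule.mkQ_apply, Submodule.Quotient.mk_eq_zero, ← range_tang hk hx]
  exact ⟨a, rfl⟩

/-- The decomposition `(a, b) ↦ du(a) + i du(b)` of `ℂ^m` along the slice, in local coordinates. -/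
def split (ι : C(X, Y)) (c : CChart m Y) (k : RChart m X)
    (e : RE m) : (RE m × RE m) →L[ℝ] CE m :=
  (fderiv ℝ (locRep ι c k) e).comp (ContinuousLinearMap.fst ℝ (RE m) (RE m)) +
    (Complex.I • ContinuousLinearMap.id ℝ (CE m)).comp
      ((fderiv ℝ (locRep ι c k) e).comp (ContinuousLinearMap.snd ℝ (RE m) (RE m)))

lemma split_apply (c : CChart m Y) (k : RChart m X)
    (e : RE m) (u : RE m × RE m) : split ι c k e u =
      fderiv ℝ (locRep ι c k) e u.1 + Complex.I • fderiv ℝ (locRep ι c k) e u.2 := by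
  simp [split]

lemma ofChart_split (hι : IsRealSlice (m := m) ι) {c : CChart m Y}
    (hc : c ∈ atlas (CE m) Y) {k : RChart m X} (hk : k ∈ atlas (RE m) X)
    {x : X} (hx : x ∈ k.source) (hy : ι x ∈ c.source) (u : RE m × RE m) :
    ofChartL c (ι x) (split ι c k (k x) u) = tang ι k x u.1 + mulI (ι x) (tang ι k x u.2) := by
  rw [split_apply, map_add, ← toChart_tang hι hc hk hx hy, ← toChart_tang hι hc hk hx hy]
  simp only [ofChartL_apply, ofChart_I_smul hc hy, ofChart_toChart hc hy]

lemma isInvertible_split (hι : IsRealSlice (m := m) ι) {c : CChart m Y}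
    (hc : c ∈ atlas (CE m) Y) {k : RChart m X} (hk : k ∈ atlas (RE m) X)
    {e : RE m} (he : e ∈ img k (pre ι (dom c))) : (split ι c k e).IsInvertible := by
  have hx : k.symm e ∈ k.source := k.map_target he.1
  have hy : ι (k.symm e) ∈ c.source := he.2
  have hb := bijective_tang hι hk hx
  have h1 : ∀ u, split ι c k e u = toChart c (ι (k.symm e))
      (tang ι k (k.symm e) u.1 + mulI (ι (k.symm e)) (tang ι k (k.symm e) u.2)) := fun u => by
    rw [← ofChart_split hι hc hk hx hy, ofChartL_apply, toChart_ofChart_self hc hy,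
      k.right_inv he.1]
  have hbij : Function.Bijective (split ι c k e) := by
    have h2 : Function.Bijective (toChart c (ι (k.symm e))) := Function.bijective_iff_has_inverse.mpr
      ⟨ofChart c (ι (k.symm e)), ofChart_toChart hc hy, toChart_ofChart_self hc hy⟩
    have := h2.comp hb
    refine (Function.Bijective.of_comp_iff' Function.bijective_id _).mp ?_
    convert this using 1
    funext u
    exact h1 u
  exact ⟨(LinearEquiv.ofBijective (split ι c k e).toLinearMap hbij).toContinuousLinearEquiv,
    ContinuousLinearMap.ext fun _ => rfl⟩

lemma contDiffOn_split (hι : IsRealSlice (m := m) ι) {c : CChart m Y}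
    (hc : c ∈ atlas (CE m) Y) {k : RChart m X} (hk : k ∈ atlas (RE m) X) :
    ContDiffOn ℝ ∞ (split ι c k) (img k (pre ι (dom c))) := by
  have h1 : ContDiffOn ℝ ∞ (fderiv ℝ (locRep ι c k)) (img k (pre ι (dom c))) :=
    (contDiffOn_locRep hι hc hk).fderiv_of_isOpen (img k _).isOpen (m := ∞) le_rfl
  exact (h1.clm_comp contDiffOn_const).add
    (contDiffOn_const.clm_comp (h1.clm_comp contDiffOn_const))

/-- The projection of `ℂ^m` to the normal directions, in local coordinates. -/
def normProj (ι : C(X, Y)) (c : CChart m Y)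
    (k : RChart m X) (e : RE m) : CE m →L[ℝ] RE m :=
  (ContinuousLinearMap.snd ℝ (RE m) (RE m)).comp (split ι c k e).inverse

lemma contDiffOn_normProj (hι : IsRealSlice (m := m) ι) {c : CChart m Y}
    (hc : c ∈ atlas (CE m) Y) {k : RChart m X} (hk : k ∈ atlas (RE m) X) :
    ContDiffOn ℝ ∞ (normProj ι c k) (img k (pre ι (dom c))) := by
  refine contDiffOn_const.clm_comp fun e he => ?_
  obtain ⟨L, hL⟩ := isInvertible_split hι hc hk he
  have h1 : ContDiffAt ℝ ∞ ContinuousLinearMap.inverse (split ι c k e) := by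
    rw [← hL]; exact contDiffAt_map_inverse L
  exact h1.comp_contDiffWithinAt e (contDiffOn_split hι hc hk e he)

lemma normalFrame_normProj (hι : IsRealSlice (m := m) ι) {c : CChart m Y}
    (hc : c ∈ atlas (CE m) Y) {k : RChart m X} (hk : k ∈ atlas (RE m) X)
    {x : X} (hx : x ∈ k.source) (hy : ι x ∈ c.source) (w : CE m) :
    normalFrame hι hk hx (normProj ι c k (k x) w) =
      (LinearMap.range (diff (m := m) ι x)).mkQ (ofChart c (ι x) w) := by
  obtain ⟨L, hL⟩ := isInvertible_split hι hc hk (mem_img hx hy)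
  obtain ⟨u, rfl⟩ : ∃ u, split ι c k (k x) u = w := ⟨L.symm w, by rw [← hL]; simp⟩
  have h1 : (split ι c k (k x)).inverse (split ι c k (k x) u) = u := by rw [← hL]; simp
  rw [← ofChartL_apply, ofChart_split hι hc hk hx hy, map_add, mkQ_tang hk hx, zero_add,
    normalFrame_apply, normProj, ContinuousLinearMap.comp_apply, h1]
  rfl

lemma normalFrame_eq (hι : IsRealSlice (m := m) ι) {c : CChart m Y}
    (hc : c ∈ atlas (CE m) Y) {k : RChart m X} (hk : k ∈ atlas (RE m) X)
    {x : X} (hx : x ∈ k.source) (hy : ι x ∈ c.source) (v : RE m) :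
    normalFrame hι hk hx v = (LinearMap.range (diff (m := m) ι x)).mkQ
      (ofChart c (ι x) (Complex.I • fderiv ℝ (locRep ι c k) (k x) v)) := by
  rw [ofChart_I_smul hc hy, ← toChart_tang hι hc hk hx hy, ofChart_toChart hc hy]
  rfl

end NormalBundle

/-! ### Trivialization of `Λ N` -/

section TrivX

attribute [local instance] extNorm extNormedSpace finite_exteriorAlgebra

variable {m : ℕ} {Y : Type*} [TopologicalSpace Y] [T2Space Y] [ChartedSpace (CE m) Y]
  [IsManifold 𝓘(ℂ, CE m) ω Y]
  {X : Type*} [TopologicalSpace X] [CompactSpace X] [ChartedSpace (RE m) X]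
  {ι : C(X, Y)}

/-- Every open subset of `X` is cut out by an open subset of `Y`. -/
lemma exists_pre_eq (hι : IsRealSlice (m := m) ι) (V : Opens X) : ∃ U : Opens Y, pre ι U = V := by
  have h := (ι.continuous.isClosedEmbedding hι.injective).isInducing
  obtain ⟨U, hU, hUV⟩ := h.isOpen_iff.mp V.isOpen
  exact ⟨⟨U, hU⟩, Opens.ext hUV⟩

/-- Being a smooth section of `Λ N` is a local property. -/
lemma isNormalSection_of_local (hι : IsRealSlice (m := m) ι) {V : Opens X}
    {s : ∀ x : V, ExteriorAlgebra ℝ (NX (m := m) ι (x : X))}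
    (h : ∀ x : V, ∃ V' : Opens X, (x : X) ∈ V' ∧ ∃ s' : OX (m := m) ι V',
      ∀ (x' : V) (hx' : (x' : X) ∈ V'), s x' = s'.1 ⟨x', hx'⟩) : IsNormalSection ι s := by
  intro x
  obtain ⟨V', hxV', s', hs'⟩ := h x
  obtain ⟨U, t, hU, ht⟩ := s'.2 ⟨x, hxV'⟩
  obtain ⟨U₁, hU₁⟩ := exists_pre_eq hι V'
  have hmem : ∀ x' : X, ι x' ∈ U₁ ↔ x' ∈ V' := fun x' => by rw [← hU₁]; rfl
  refine ⟨U ⊓ U₁, resY inf_le_left t, ⟨hU, (hmem _).mpr hxV'⟩, fun x' hx' => ?_⟩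
  rw [hs' x' ((hmem _).mp hx'.2), ht ⟨x', (hmem _).mp hx'.2⟩ hx'.1]
  rfl

variable [IsManifold 𝓘(ℝ, RE m) ∞ X]

/-- The local representative of a section of `Λ N` is smooth. -/
lemma contDiffOn_repX (hι : IsRealSlice (m := m) ι) {k : RChart m X}
    (hk : k ∈ atlas (RE m) X) {V : Opens X} (s : OX (m := m) ι V) {f : RE m → ExteriorAlgebra ℝ (RE m)}
    (hf : ∀ (e : RE m) (he : e ∈ img k V), ExteriorAlgebra.map
      (normalFrame hι hk (k.map_target he.1)).toLinearMap (f e) = s.1 ⟨k.symm e, he.2⟩) :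
    ContDiffOn ℝ ∞ f (img k V) := by
  intro e₀ he₀
  obtain ⟨U, t, hU, ht⟩ := s.2 ⟨k.symm e₀, he₀.2⟩
  set c := chartAt (CE m) (ι (k.symm e₀))
  have hc : c ∈ atlas (CE m) Y := chart_mem_atlas _ _
  have hy₀ : ι (k.symm e₀) ∈ c.source := mem_chart_source _ _
  set S := img k (V ⊓ pre ι (U ⊓ dom c))
  have hS₀ : e₀ ∈ S := ⟨he₀.1, he₀.2, hU, hy₀⟩
  have hu : ContDiffOn ℝ ∞ (locRep ι c k) S := (contDiffOn_locRep hι hc hk).mono fun e he =>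
    ⟨he.1, he.2.2.2⟩
  have h1 : ContDiffOn ℝ ∞ (fun e => repY c t.1 (locRep ι c k e)) S := by
    refine (contDiffOn_repY hc t).comp hu fun e he => ?_
    have h2 := mem_img (c := c) he.2.2.2 he.2.2.1
    exact h2
  have h2 : ContDiffOn ℝ ∞ (fun e => ExteriorAlgebra.map (normProj ι c k e).toLinearMap
      (repY c t.1 (locRep ι c k e))) S :=
    contDiffOn_map_ext ((contDiffOn_normProj hι hc hk).mono fun e he => ⟨he.1, he.2.2.2⟩) h1
  have h3 : ∀ e ∈ S, f e = ExteriorAlgebra.map (normProj ι c k e).toLinearMap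
      (repY c t.1 (locRep ι c k e)) := by
    intro e he
    have hx : k.symm e ∈ k.source := k.map_target he.1
    have hy : ι (k.symm e) ∈ c.source := he.2.2.2
    have hinj : Function.Injective (ExteriorAlgebra.map (normalFrame hι hk hx).toLinearMap) := by
      refine Function.LeftInverse.injective
        (g := ExteriorAlgebra.map (normalFrame hι hk hx).symm.toLinearMap) fun a => ?_
      rw [← AlgHom.comp_apply, ExteriorAlgebra.map_comp_map]
      simp
    apply hinj
    rw [hf e ⟨he.1, he.2.1⟩, ht ⟨k.symm e, he.2.1⟩ he.2.2.1]
    rw [show locRep ι c k e = c (ι (k.symm e)) from rfl,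
      repY_chart t.1 ⟨ι (k.symm e), he.2.2.1⟩ hy, ← AlgHom.comp_apply, ← AlgHom.comp_apply,
      ExteriorAlgebra.map_comp_map, ExteriorAlgebra.map_comp_map]
    refine congrArg (fun L => ExteriorAlgebra.map L _) (LinearMap.ext fun v => ?_)
    have h4 := normalFrame_normProj hι hc hk hx hy (toChart c (ι (k.symm e)) v)
    rw [ofChart_toChart hc hy, k.right_inv he.1] at h4
    exact h4.symm
  have h4 := ((h2.congr h3).contDiffAt (S.isOpen.mem_nhds hS₀))
  exact h4.contDiffWithinAt

/-- Sections with smooth local representative are smooth: they are lifted to `Y` along a local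
smooth retraction to the slice. -/
lemma isNormalSection_ofRep (hι : IsRealSlice (m := m) ι) {k : RChart m X}
    (hk : k ∈ atlas (RE m) X) {V : Opens X} (hV : V ≤ domX k)
    {f : RE m → ExteriorAlgebra ℝ (RE m)} (hf : ContDiffOn ℝ ∞ f (img k V)) :
    IsNormalSection ι fun x : V => ExteriorAlgebra.map
      (normalFrame hι hk (hV x.2)).toLinearMap (f (k (x : X))) := by
  intro x₀
  set c := chartAt (CE m) (ι (x₀ : X))
  have hc : c ∈ atlas (CE m) Y := chart_mem_atlas _ _
  have hy₀ : ι (x₀ : X) ∈ c.source := mem_chart_source _ _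
  have hx₀ : (x₀ : X) ∈ k.source := hV x₀.2
  set u := locRep ι c k with hu
  set e₀ := k (x₀ : X) with he₀
  set S₁ := img k (V ⊓ pre ι (dom c)) with hS₁
  have hS₁₀ : e₀ ∈ S₁ := mem_img hx₀ ⟨x₀.2, hy₀⟩
  have hS₁' : ∀ e ∈ S₁, e ∈ img k (pre ι (dom c)) := fun e he => ⟨he.1, he.2.2⟩
  have huS : ContDiffOn ℝ ∞ u S₁ := (contDiffOn_locRep hι hc hk).mono hS₁'
  -- A linear projection restricting to a local diffeomorphism on the slice.
  obtain ⟨L, hL⟩ := isInvertible_split hι hc hk (hS₁' _ hS₁₀)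
  set π : CE m →L[ℝ] RE m :=
    (ContinuousLinearMap.fst ℝ (RE m) (RE m)).comp (L.symm : CE m →L[ℝ] RE m × RE m) with hπ
  set φ : RE m → RE m := fun e => π (u e) with hφ
  have hφS : ContDiffOn ℝ ∞ φ S₁ := π.contDiff.comp_contDiffOn huS
  have hDφ : ∀ e ∈ S₁, fderiv ℝ φ e = π.comp (fderiv ℝ u e) := fun e he => by
    have hd : DifferentiableAt ℝ u e :=
      (huS.differentiableOn (by simp)).differentiableAt (S₁.isOpen.mem_nhds he)
    exact (π.hasFDerivAt.comp e hd.hasFDerivAt).fderiv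
  have hDφ₀ : fderiv ℝ φ e₀ = ContinuousLinearEquiv.refl ℝ (RE m) := by
    rw [hDφ _ hS₁₀]
    refine ContinuousLinearMap.ext fun v => ?_
    have h1 : fderiv ℝ u e₀ v = L (v, 0) := by
      have : (L : (RE m × RE m) →L[ℝ] CE m) (v, 0) = _ := congrArg (fun M => M (v, 0)) hL
      rw [split_apply] at this
      simpa using this.symm
    simp [hπ, h1]
  have hφat : ContDiffAt ℝ ∞ φ e₀ := hφS.contDiffAt (S₁.isOpen.mem_nhds hS₁₀)
  have hφ' : HasFDerivAt φ ((ContinuousLinearEquiv.refl ℝ (RE m) : RE m ≃L[ℝ] RE m) :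
      RE m →L[ℝ] RE m) e₀ := by
    rw [← hDφ₀]; exact (hφat.differentiableAt (by simp)).hasFDerivAt
  set Φ := hφat.toOpenPartialHomeomorph φ hφ' (by simp) with hΦ
  have hΦe₀ : e₀ ∈ Φ.source := hφat.mem_toOpenPartialHomeomorph_source hφ' (by simp)
  have hΦc : (Φ : RE m → RE m) = φ := rfl
  -- The points near which the projection is a local diffeomorphism.
  have hopen : IsOpen {e | e ∈ (S₁ : Set (RE m)) ∧ e ∈ Φ.source ∧ IsUnit (fderiv ℝ φ e)} := by
    have h1 : ContinuousOn (fderiv ℝ φ) S₁ :=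
      (hφS.fderiv_of_isOpen S₁.isOpen (m := ∞) le_rfl).continuousOn
    have h2 := (h1.isOpen_inter_preimage S₁.isOpen
      (Units.isOpen (R := RE m →L[ℝ] RE m))).inter Φ.open_source
    convert h2 using 1
    ext e; simp only [Set.mem_ofPred_eq, Set.mem_inter_iff, Set.mem_preimage]; tauto
  set S : Opens (RE m) := ⟨_, hopen⟩ with hS
  have hS₀ : e₀ ∈ S := ⟨hS₁₀, hΦe₀, by rw [hDφ₀]; exact isUnit_one⟩
  set N : Set (CE m) := π ⁻¹' (Φ.target ∩ Φ.symm ⁻¹' S) with hN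
  have hNopen : IsOpen N := (Φ.symm.isOpen_inter_preimage S.isOpen).preimage π.continuous
  set r : CE m → RE m := fun w => Φ.symm (π w) with hr
  have hrS : ∀ w ∈ N, r w ∈ S := fun w hw => hw.2
  have hrN : ContDiffOn ℝ ∞ r N := by
    intro w hw
    have h1 := hrS w hw
    have h2 : ContDiffAt ℝ ∞ Φ (Φ.symm (π w)) := hφS.contDiffAt (S₁.isOpen.mem_nhds h1.1)
    obtain ⟨v, hv⟩ := h1.2.2
    have h3 : HasFDerivAt Φ ((ContinuousLinearEquiv.ofUnit v : RE m ≃L[ℝ] RE m) :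
        RE m →L[ℝ] RE m) (Φ.symm (π w)) := by
      have : ((ContinuousLinearEquiv.ofUnit v : RE m ≃L[ℝ] RE m) : RE m →L[ℝ] RE m) =
          fderiv ℝ φ (Φ.symm (π w)) := by rw [← hv]; ext x; rfl
      rw [this]
      exact (h2.differentiableAt (by simp)).hasFDerivAt
    have h4 := Φ.contDiffAt_symm hw.1 h3 h2
    exact (h4.comp w π.contDiff.contDiffAt).contDiffWithinAt
  have hru : ∀ e ∈ S, u e ∈ N ∧ r (u e) = e := fun e he => by
    have h1 : Φ.symm (φ e) = e := Φ.left_inv he.2.1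
    refine ⟨⟨Φ.map_source he.2.1, ?_⟩, h1⟩
    show Φ.symm (φ e) ∈ S
    rw [h1]; exact he
  have hD : ContDiffOn ℝ ∞ (fun w => (Complex.I • ContinuousLinearMap.id ℝ (CE m)).comp
      (fderiv ℝ u (r w))) N := by
    refine contDiffOn_const.clm_comp ?_
    exact (huS.fderiv_of_isOpen S₁.isOpen (m := ∞) le_rfl).comp hrN fun w hw => (hrS w hw).1
  have hT : ContDiffOn ℝ ∞ (fun w => ExteriorAlgebra.map ((Complex.I • ContinuousLinearMap.id ℝ
      (CE m)).comp (fderiv ℝ u (r w))).toLinearMap (f (r w))) N :=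
    contDiffOn_map_ext hD (hf.comp hrN fun w hw =>
      ⟨(hrS w hw).1.1, (hrS w hw).1.2.1⟩)
  set U₀ : Opens Y := ⟨c.source ∩ c ⁻¹' N, c.isOpen_inter_preimage hNopen⟩ with hU₀
  have hU₀c : U₀ ≤ dom c := fun y hy => hy.1
  have hTU : ContDiffOn ℝ ∞ _ (img c U₀ : Set (CE m)) := hT.mono fun w hw => by
    have := hw.2.2
    simpa [c.right_inv hw.1] using this
  set t := ofRepY hc hU₀c _ hTU with ht
  set V₁ : Opens X := ⟨k.source ∩ k ⁻¹' S, k.isOpen_inter_preimage S.isOpen⟩ with hV₁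
  obtain ⟨U₁, hU₁⟩ := exists_pre_eq hι V₁
  have hmem : ∀ x' : X, ι x' ∈ U₁ ↔ x' ∈ V₁ := fun x' => by rw [← hU₁]; rfl
  have huc : ∀ x ∈ k.source, u (k x) = c (ι x) := fun x hx => locRep_apply hx
  refine ⟨U₀ ⊓ U₁, resY inf_le_left t, ⟨⟨hy₀, ?_⟩, (hmem _).mpr ⟨hx₀, hS₀⟩⟩, fun x' h => ?_⟩
  · show c (ι (x₀ : X)) ∈ N
    rw [← huc _ hx₀]; exact (hru _ hS₀).1
  · have hx' : (x' : X) ∈ k.source := hV x'.2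
    have hxS : k (x' : X) ∈ S := ((hmem _).mp h.2).2
    have hyc : ι (x' : X) ∈ c.source := h.1.1
    have h1 : r (c (ι (x' : X))) = k (x' : X) := by rw [← huc _ hx']; exact (hru _ hxS).2
    show _ = toNormal ι (x' : X) (ExteriorAlgebra.map (ofChartL c (ι (x' : X)))
      (ExteriorAlgebra.map ((Complex.I • ContinuousLinearMap.id ℝ (CE m)).comp
        (fderiv ℝ u (r (c (ι (x' : X)))))).toLinearMap (f (r (c (ι (x' : X)))))))
    rw [h1, toNormal, ← AlgHom.comp_apply, ← AlgHom.comp_apply, ExteriorAlgebra.map_comp_map,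
      ExteriorAlgebra.map_comp_map]
    refine congrArg (fun L => ExteriorAlgebra.map L _) (LinearMap.ext fun v => ?_)
    exact normalFrame_eq hι hc hk hx' hyc v

/-- The trivialization `𝒪_𝒳(V) ≃ C^∞(k(V)) ⊗ Λ ℝ^m` given by a chart `k` of `X`: the normal bundle
is identified with `TX` by multiplication by `i`. -/
def trivX (hι : IsRealSlice (m := m) ι) {k : RChart m X}
    (hk : k ∈ atlas (RE m) X) {V : Opens X} (hV : V ≤ domX k) :
    OX (m := m) ι V ≃ₐ[ℝ] smoothExt (RE m) (img k V) where
  toFun s := ⟨fun e => ExteriorAlgebra.map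
      (normalFrame hι hk (k.map_target e.2.1)).symm.toLinearMap (s.1 ⟨k.symm e, e.2.2⟩), by
    refine contDiffOn_repX hι hk s fun e he => ?_
    rw [zext_of_mem _ (⟨e, he⟩ : img k V), ← AlgHom.comp_apply, ExteriorAlgebra.map_comp_map]
    simp⟩
  invFun g := ⟨fun x => ExteriorAlgebra.map (normalFrame hι hk (hV x.2)).toLinearMap
    (zext g.1 (k (x : X))), isNormalSection_ofRep hι hk hV g.2⟩
  left_inv s := Subtype.ext (funext fun x => by
    have h : ∀ (e : img k V) (x : V), (he : k.symm e = x) →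
        ExteriorAlgebra.map (normalFrame hι hk (hV x.2)).toLinearMap (ExteriorAlgebra.map
          (normalFrame hι hk (k.map_target e.2.1)).symm.toLinearMap
            (s.1 ⟨k.symm e, e.2.2⟩)) = s.1 x := by
      rintro e ⟨x, hx⟩ he
      simp only at he
      subst he
      rw [← AlgHom.comp_apply, ExteriorAlgebra.map_comp_map]
      simp
    refine Eq.trans ?_ (h ⟨k x, mem_img (hV x.2) x.2⟩ x (k.left_inv (hV x.2)))
    exact congrArg _ (zext_of_mem _ (⟨k x, mem_img (hV x.2) x.2⟩ : img k V)))
  right_inv g := Subtype.ext (funext fun e => by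
    show ExteriorAlgebra.map _ (ExteriorAlgebra.map _ (zext g.1 (k (k.symm e)))) = _
    rw [← AlgHom.comp_apply, ExteriorAlgebra.map_comp_map, k.right_inv e.2.1, zext_of_mem]
    simp)
  map_mul' s t := Subtype.ext (funext fun e => map_mul _ _ _)
  map_add' s t := Subtype.ext (funext fun e => map_add _ _ _)
  commutes' r := Subtype.ext (funext fun e => AlgHom.commutes _ _)

lemma trivX_symm_apply (hι : IsRealSlice (m := m) ι) {k : RChart m X}
    (hk : k ∈ atlas (RE m) X) {V : Opens X} (hV : V ≤ domX k) (g : smoothExt (RE m) (img k V))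
    (x : V) : ((trivX hι hk hV).symm g).1 x = ExteriorAlgebra.map
      (normalFrame hι hk (hV x.2)).toLinearMap (g.1 ⟨k x, mem_img (hV x.2) x.2⟩) :=
  congrArg _ (zext_of_mem g.1 (⟨k x, mem_img (hV x.2) x.2⟩ : img k V))

lemma trivX_parity (hι : IsRealSlice (m := m) ι) {k : RChart m X}
    (hk : k ∈ atlas (RE m) X) {V : Opens X} (hV : V ≤ domX k) (s : OX (m := m) ι V) :
    trivX hι hk hV (parityX ι V s) = smoothExt.parity _ (trivX hι hk hV s) :=
  Subtype.ext (funext fun _ => map_extParity _ _)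

end TrivX

/-! ### Supercoordinates on a real slice -/

section Transport

variable {B B' : Type*} [Ring B] [Algebra ℝ B] [Ring B'] [Algebra ℝ B'] {σ : B →ₐ[ℝ] B}
  {σ' : B' →ₐ[ℝ] B'} {m : ℕ}

lemma IsSuperDer.conj (φ : B ≃ₐ[ℝ] B') (hφ : ∀ b, φ (σ b) = σ' (φ b)) {p : Fin 2}
    {w : B' →ₗ[ℝ] B'} (hw : IsVF σ' p w) :
    IsVF σ p (φ.symm.toLinearMap ∘ₗ w ∘ₗ φ.toLinearMap) := by
  have hφ' : ∀ b, φ.symm (σ' b) = σ (φ.symm b) := fun b => by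
    apply φ.injective; rw [hφ]; simp
  have hpow : ∀ b, φ.symm ((σ' ^ (p : ℕ)) (φ b)) = (σ ^ (p : ℕ)) b := fun b => by
    fin_cases p <;> simp [hφ']
  refine ⟨fun a b => ?_, fun a => ?_⟩
  · show φ.symm (w (φ (a * b))) = φ.symm (w (φ a)) * b + (σ ^ (p : ℕ)) a * φ.symm (w (φ b))
    rw [map_mul φ, hw.1, map_add, map_mul φ.symm, map_mul φ.symm]
    simp only [AlgHom.id_apply, hpow, AlgEquiv.symm_apply_apply]
  · simp [hφ, hw.2, hφ']

/-- Transport of supercoordinates along an isomorphism. -/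
def SuperCoords.ofEquiv (φ : B ≃ₐ[ℝ] B') (hφ : ∀ b, φ (σ b) = σ' (φ b))
    (q : SuperCoords B' σ' m) : SuperCoords B σ m where
  x i := φ.symm (q.x i)
  ξ i := φ.symm (q.ξ i)
  dx i := φ.symm.toLinearMap ∘ₗ q.dx i ∘ₗ φ.toLinearMap
  dξ i := φ.symm.toLinearMap ∘ₗ q.dξ i ∘ₗ φ.toLinearMap
  x_even i := by apply φ.injective; rw [hφ]; simp [q.x_even]
  ξ_odd i := by apply φ.injective; rw [hφ]; simp [q.ξ_odd]
  dx_isVF i := (q.dx_isVF i).conj φ hφ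
  dξ_isVF i := (q.dξ_isVF i).conj φ hφ
  dx_x i k := by simp [q.dx_x, apply_ite φ.symm]
  dx_ξ i k := by simp [q.dx_ξ]
  dξ_x i k := by simp [q.dξ_x]
  dξ_ξ i k := by simp [q.dξ_ξ, apply_ite φ.symm]
  span p w hw b := by
    have hφ' : ∀ b, φ.symm (σ' b) = σ (φ.symm b) := fun b => by
      apply φ.injective; rw [hφ]; simp
    have h := q.span p _ (hw.conj φ.symm hφ') (φ b)
    have h2 := congrArg φ.symm h
    simpa using h2

end Transport

section ModelCoords

variable {m : ℕ}

/-- Evaluation at a point. -/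
def smoothExt.eval {E W : Type*} [NormedAddCommGroup E] [NormedSpace ℝ E] [AddCommGroup W]
    [Module ℝ W] [Module.Finite ℝ W] {O : Opens E} (e : O) :
    smoothExt W O →ₐ[ℝ] ExteriorAlgebra ℝ W :=
  (Pi.evalAlgHom ℝ (fun _ : O => ExteriorAlgebra ℝ W) e).comp (smoothExt W O).val

@[simp] lemma smoothExt.eval_apply {E W : Type*} [NormedAddCommGroup E] [NormedSpace ℝ E]
    [AddCommGroup W] [Module ℝ W] [Module.Finite ℝ W] {O : Opens E} (e : O) (s : smoothExt W O) :
    smoothExt.eval e s = s.1 e := rfl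

/-- The standard basis of `ℝ^m`. -/
abbrev stdBasis (m : ℕ) : Module.Basis (Fin m) ℝ (RE m) := (EuclideanSpace.basisFun (Fin m) ℝ).toBasis

lemma contDiff_coord {E : Type*} [NormedAddCommGroup E] [NormedSpace ℝ E] [FiniteDimensional ℝ E]
    {J : Type*} (β : Module.Basis J ℝ E) (j : J) : ContDiff ℝ ∞ fun e => β.coord j e :=
  (LinearMap.toContinuousLinearMap (β.coord j)).contDiff

/-- The standard supercoordinates on an open subset of `ℝ^{m|m}`. -/
def modelCoords (O : Opens (RE m)) : SuperCoords (smoothExt (RE m) O) (smoothExt.parity O) m where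
  x i := smoothExt.scalar _ (contDiff_coord (stdBasis m) i).contDiffOn
  ξ i := smoothExt.const O (ExteriorAlgebra.ι ℝ (stdBasis m i))
  dx i := smoothExt.deriv O (stdBasis m i)
  dξ i := smoothExt.contract O ((stdBasis m).coord i)
  x_even i := Subtype.ext (funext fun e => AlgHom.commutes _ _)
  ξ_odd i := Subtype.ext (funext fun e => extParity_ι _)
  dx_isVF i := smoothExt.deriv_isVF _
  dξ_isVF i := smoothExt.contract_isVF _
  dx_x i k := Subtype.ext (funext fun e => by
    rw [smoothExt.deriv_scalar]
    have h : fderiv ℝ (fun e => (stdBasis m).coord k e) (e : RE m) (stdBasis m i) =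
        (stdBasis m).coord k (stdBasis m i) := by
      rw [show (fun e => (stdBasis m).coord k e) =
        LinearMap.toContinuousLinearMap ((stdBasis m).coord k) from rfl, ContinuousLinearMap.fderiv]
      rfl
    rw [h, Module.Basis.coord_apply, Module.Basis.repr_self, Finsupp.single_apply]
    split_ifs
    · exact map_one _
    · exact map_zero _)
  dx_ξ i k := smoothExt.deriv_const _ _
  dξ_x i k := smoothExt.contract_scalar _ _
  dξ_ξ i k := Subtype.ext (funext fun e => by
    refine (CliffordAlgebra.contractLeft_ι (Q := 0) _ _).trans ?_
    rw [Module.Basis.coord_apply, Module.Basis.repr_self, Finsupp.single_apply]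
    by_cases h : i = k
    · rw [if_pos h, if_pos h.symm]; exact map_one _
    · rw [if_neg h, if_neg (Ne.symm h)]; exact map_zero _)
  span p w hw b := Subtype.ext (funext fun e => by
    have hδ : IsSuperDer (smoothExt.parity O) (extParity (RE m)) (smoothExt.eval e) p
        ((smoothExt.eval e).toLinearMap ∘ₗ w) := by
      refine ⟨fun a b => ?_, fun a => ?_⟩
      · have h := congrArg (smoothExt.eval e) (hw.1 a b)
        rw [map_add, map_mul (smoothExt.eval e), map_mul (smoothExt.eval e)] at h
        refine h.trans ?_
        fin_cases p <;> rfl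
      · have h := congrArg (smoothExt.eval e) (hw.2 a)
        rw [map_smul] at h
        exact h
    have h := smoothExt.der_eq_sum (p := e) isSuperComm_ext (fun _ => rfl) hδ (fun _ _ => rfl)
      (stdBasis m) (fun j => (contDiff_coord (stdBasis m) j).contDiffOn) (stdBasis m) b
    refine h.trans ?_
    change _ = smoothExt.eval e (_ + _)
    rw [map_add, map_sum, map_sum]
    simp only [map_mul]
    rfl)

end ModelCoords

section SliceCoords

variable {m : ℕ} {Y : Type*} [TopologicalSpace Y] [T2Space Y] [ChartedSpace (CE m) Y]
  [IsManifold 𝓘(ℂ, CE m) ω Y]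
  {X : Type*} [TopologicalSpace X] [CompactSpace X] [ChartedSpace (RE m) X]
  [IsManifold 𝓘(ℝ, RE m) ∞ X] {ι : C(X, Y)}

/-- Evaluation of a section at a point. -/
def evX (ι : C(X, Y)) (V : Opens X) (x : V) :
    OX (m := m) ι V →ₐ[ℝ] ExteriorAlgebra ℝ (NX (m := m) ι (x : X)) :=
  (Pi.evalAlgHom ℝ (fun x : V => ExteriorAlgebra ℝ (NX (m := m) ι (x : X))) x).comp
    (sectionsX (m := m) ι V).val

lemma evX_apply {V : Opens X} (x : V) (s : OX (m := m) ι V) : evX ι V x s = s.1 x := rfl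

lemma ext_evX {V : Opens X} {s t : OX (m := m) ι V} (h : ∀ x, evX ι V x s = evX ι V x t) : s = t :=
  Subtype.ext (funext h)

lemma evX_parity {V : Opens X} (x : V) (s : OX (m := m) ι V) :
    evX ι V x (parityX ι V s) = extParity _ (evX ι V x s) := rfl

lemma ext_cmap_evX {V : Opens X} {u v : ℂ ⊗[ℝ] OX (m := m) ι V}
    (h : ∀ x, cmap (evX ι V x) u = cmap (evX ι V x) v) : u = v := by
  rw [← cpx_re_im u, ← cpx_re_im v] at h ⊢
  simp only [cmap_cpx, cpx_inj] at h ⊢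
  exact ⟨ext_evX fun x => (h x).1, ext_evX fun x => (h x).2⟩

/-- The function algebra of the slice is supercommutative. -/
lemma isSuperCommX (ι : C(X, Y)) (V : Opens X) : IsSuperComm (parityX (m := m) ι V) where
  invol s := ext_evX fun x => isSuperComm_ext.invol (evX ι V x s)
  even_comm s t h := ext_evX fun x => by
    rw [map_mul, map_mul]
    exact isSuperComm_ext.even_comm _ _ (by rw [← evX_parity, h])
  odd_comm s t h := ext_evX fun x => by
    rw [map_mul, map_mul, evX_parity]
    exact isSuperComm_ext.odd_comm _ _ (by rw [← evX_parity, h, map_neg])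

variable (hι : IsRealSlice (m := m) ι) {k : RChart m X}
  (hk : k ∈ atlas (RE m) X) {V : Opens X} (hV : V ≤ domX k)

/-- The supercoordinates `(x, ξ)` on the slice: `x` are the coordinates of the chart `k` of `X`, and
`ξ_i` is the class of `i ∂/∂x_i` in the normal bundle. -/
def sliceCoords : SuperCoords (OX (m := m) ι V) (parityX ι V) m :=
  (modelCoords (img k V)).ofEquiv (trivX hι hk hV) (trivX_parity hι hk hV)

/-- A smooth function of the coordinates of the chart `k`. -/
def scalX (φ : RE m → ℝ) (hφ : ContDiffOn ℝ ∞ φ (img k V)) : OX (m := m) ι V :=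
  (trivX hι hk hV).symm (smoothExt.scalar φ hφ)

lemma evX_scalX (φ : RE m → ℝ) (hφ : ContDiffOn ℝ ∞ φ (img k V)) (x : V) :
    evX ι V x (scalX hι hk hV φ hφ) = algebraMap ℝ _ (φ (k (x : X))) := by
  rw [evX_apply, scalX, trivX_symm_apply]
  exact AlgHom.commutes _ _

lemma evX_dx_scalX (φ : RE m → ℝ) (hφ : ContDiffOn ℝ ∞ φ (img k V)) (i : Fin m) (x : V) :
    evX ι V x ((sliceCoords hι hk hV).dx i (scalX hι hk hV φ hφ)) =
      algebraMap ℝ _ (fderiv ℝ φ (k (x : X)) (stdBasis m i)) := by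
  show ((trivX hι hk hV).symm (smoothExt.deriv _ _ (trivX hι hk hV ((trivX hι hk hV).symm _)))).1 x = _
  rw [AlgEquiv.apply_symm_apply, trivX_symm_apply, smoothExt.deriv_scalar, AlgHom.commutes]

lemma dξ_scalX (φ : RE m → ℝ) (hφ : ContDiffOn ℝ ∞ φ (img k V)) (i : Fin m) :
    (sliceCoords hι hk hV).dξ i (scalX hι hk hV φ hφ) = 0 := by
  show (trivX hι hk hV).symm (smoothExt.contract _ _ (trivX hι hk hV ((trivX hι hk hV).symm _))) = _
  rw [AlgEquiv.apply_symm_apply, smoothExt.contract_scalar, map_zero]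

lemma evX_sliceCoords_ξ (i : Fin m) (x : V) :
    evX ι V x ((sliceCoords hι hk hV).ξ i) =
      ExteriorAlgebra.ι ℝ (normalFrame hι hk (hV x.2) (stdBasis m i)) := by
  show ((trivX hι hk hV).symm _).1 x = _
  rw [trivX_symm_apply]
  exact ExteriorAlgebra.map_apply_ι _ _

end SliceCoords

/-! ### The slice coordinates are adapted to the holomorphic coordinates -/

section AdaptedSlice

variable {m : ℕ} {Y : Type*} [TopologicalSpace Y] [T2Space Y] [ChartedSpace (CE m) Y]
  [IsManifold 𝓘(ℂ, CE m) ω Y]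
  {X : Type*} [TopologicalSpace X] [CompactSpace X] [ChartedSpace (RE m) X]
  [IsManifold 𝓘(ℝ, RE m) ∞ X] {ι : C(X, Y)}
  {Ω : ∀ y : Y, (TangentSpace 𝓘(ℂ, CE m) y) [⋀^Fin m]→ₗ[ℂ] ℂ} (hΩ : IsHolomorphicForm Ω)
  {c : CChart m Y} (hc : c ∈ atlas (CE m) Y)

section HolDataX

variable {V : Opens X} (hVc : V ≤ pre ι (dom c))

lemma evX_x (α : Fin m) (x : V) : evX ι V x ((holDataX ι hΩ hc hVc).x α) =
    algebraMap ℝ _ (c (ι (x : X)) α).re := AlgHom.commutes (toNormal ι (x : X)) _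

lemma evX_x' (α : Fin m) (x : V) : evX ι V x ((holDataX ι hΩ hc hVc).x' α) =
    algebraMap ℝ _ (c (ι (x : X)) α).im := AlgHom.commutes (toNormal ι (x : X)) _

lemma evX_a (x : V) : evX ι V x ((holDataX ι hΩ hc hVc).a) =
    algebraMap ℝ _ (coef Ω c (c.symm (c (ι (x : X))))).re := AlgHom.commutes (toNormal ι (x : X)) _

lemma evX_a' (x : V) : evX ι V x ((holDataX ι hΩ hc hVc).a') =
    algebraMap ℝ _ (coef Ω c (c.symm (c (ι (x : X))))).im := AlgHom.commutes (toNormal ι (x : X)) _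

lemma evX_ψ (α : Fin m) (x : V) : evX ι V x ((holDataX ι hΩ hc hVc).ψ α) =
    ExteriorAlgebra.ι ℝ ((LinearMap.range (diff (m := m) ι (x : X))).mkQ
      (ofChart c (ι (x : X)) (EuclideanSpace.single α 1))) := ExteriorAlgebra.map_apply_ι _ _

lemma evX_ψ' (α : Fin m) (x : V) : evX ι V x ((holDataX ι hΩ hc hVc).ψ' α) =
    ExteriorAlgebra.ι ℝ ((LinearMap.range (diff (m := m) ι (x : X))).mkQ
      (ofChart c (ι (x : X)) (EuclideanSpace.single α Complex.I))) := ExteriorAlgebra.map_apply_ι _ _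

lemma isHomogeneous_holDataX : (holDataX ι hΩ hc hVc).IsHomogeneous (parityX ι V) where
  x α := ext_evX fun x => by rw [evX_parity, evX_x, AlgHom.commutes]
  x' α := ext_evX fun x => by rw [evX_parity, evX_x', AlgHom.commutes]
  ψ α := ext_evX fun x => by rw [evX_parity, map_neg, evX_ψ, extParity_ι]
  ψ' α := ext_evX fun x => by rw [evX_parity, map_neg, evX_ψ', extParity_ι]
  a := ext_evX fun x => by rw [evX_parity, evX_a, AlgHom.commutes]
  a' := ext_evX fun x => by rw [evX_parity, evX_a', AlgHom.commutes]

end HolDataX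

/-- The expansion of a vector in the real basis `∂/∂x^α`, `∂/∂x'^α`. -/
lemma sum_re_im (w : CE m) : ∑ α, ((w α).re • (EuclideanSpace.single α (1 : ℂ) : CE m) +
    (w α).im • EuclideanSpace.single α Complex.I) = w := by
  ext β
  simp only [PiLp.add_apply, PiLp.single_apply, smul_ite, smul_zero,
    WithLp.ofLp_sum, WithLp.ofLp_smul, Finset.sum_apply, Pi.smul_apply,
    sum_add_distrib, Finset.sum_ite_eq, Finset.mem_univ, if_true]
  simp only [Complex.real_smul, mul_one, Complex.re_add_im]

/-- The complex Jacobian of the embedding in local coordinates. -/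
def jacC (ι : C(X, Y)) (c : CChart m Y) (k : RChart m X)
    (e : RE m) : Matrix (Fin m) (Fin m) ℂ :=
  Matrix.of fun i α => fderiv ℝ (locRep ι c k) e (stdBasis m i) α

/-- An alternating form on `Y` in terms of its coefficient in a chart. -/
lemma form_eq_coef (hc : c ∈ atlas (CE m) Y) {y : Y} (hy : y ∈ c.source) (v : Fin m → CE m) :
    Ω y (fun i => ofChart c y (v i)) = coef Ω c y * (Matrix.of fun i α => v i α).det := by
  let L : CE m →ₗ[ℂ] TangentSpace 𝓘(ℂ, CE m) y :=
    { toFun := fun e => ofChart c y e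
      map_add' := fun e f => map_add (ofChartL c y) e f
      map_smul' := fun a e => ofChart_smul hc hy a e }
  set b := (EuclideanSpace.basisFun (Fin m) ℂ).toBasis
  have h := AlternatingMap.eq_smul_basis_det b ((Ω y).compLinearMap L)
  have h1 := congrArg (fun f => f v) h
  simp only [AlternatingMap.smul_apply, smul_eq_mul] at h1
  have h2 : ((Ω y).compLinearMap L) b = coef Ω c y := by
    show Ω y _ = Ω y _
    congr 1
    funext α
    show ofChart c y (b α) = _
    simp [b]
  rw [h2] at h1
  refine Eq.trans (Eq.trans rfl h1) ?_
  congr 1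
  rw [Module.Basis.det_apply, ← Matrix.det_transpose]
  rfl

lemma coef_ne_zero (hc : c ∈ atlas (CE m) Y) {y : Y} (hy : y ∈ c.source) (hΩ0 : Ω y ≠ 0) :
    coef Ω c y ≠ 0 := fun h => hΩ0 <| by
  ext v
  have h1 := form_eq_coef (Ω := Ω) hc hy fun i => toChart c y (v i)
  rw [h, zero_mul] at h1
  have h2 : (fun i => ofChart c y (toChart c y (v i))) = v := funext fun i => ofChart_toChart hc hy _
  rw [h2] at h1
  exact h1

variable (hι : IsRealSlice (m := m) ι) {k : RChart m X}
  (hk : k ∈ atlas (RE m) X)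

lemma det_jacC_ne_zero (hι : IsRealSlice (m := m) ι) (hc : c ∈ atlas (CE m) Y)
    (hk : k ∈ atlas (RE m) X) {e : RE m} (he : e ∈ img k (pre ι (dom c))) :
    (jacC ι c k e).det ≠ 0 := by
  intro h
  obtain ⟨v, hv, hv0⟩ := Matrix.exists_vecMul_eq_zero_iff.mpr h
  obtain ⟨L, hL⟩ := isInvertible_split hι hc hk he
  set a : RE m := ∑ i, (v i).re • stdBasis m i with ha
  set b : RE m := ∑ i, (v i).im • stdBasis m i with hb
  have h1 : split ι c k e (a, b) = 0 := by
    rw [split_apply]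
    ext α
    have h2 := congrFun hv0 α
    rw [Matrix.vecMul, dotProduct] at h2
    simp only [jacC, Matrix.of_apply, Pi.zero_apply] at h2
    simp only [ha, hb, map_sum, map_smul, PiLp.add_apply, PiLp.smul_apply, PiLp.zero_apply,
      WithLp.ofLp_sum, WithLp.ofLp_smul, Finset.sum_apply, Pi.smul_apply, smul_eq_mul,
      mul_sum, ← sum_add_distrib]
    rw [← h2]
    refine sum_congr rfl fun i _ => ?_
    conv_rhs => rw [← Complex.re_add_im (v i)]
    simp only [Complex.real_smul]
    ring
  have h2 : (a, b) = 0 := by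
    have h3 : L (a, b) = 0 := by
      have : (L : (RE m × RE m) →L[ℝ] CE m) (a, b) = 0 := by rw [hL]; exact h1
      exact this
    simpa using h3
  apply hv
  have hcoord : ∀ (w : Fin m → ℝ) (j : Fin m), (∑ i, w i • stdBasis m i) = 0 → w j = 0 :=
    fun w j hw => by
      have := Fintype.linearIndependent_iff.mp (stdBasis m).linearIndependent w hw j
      exact this
  funext j
  refine Complex.ext ?_ ?_
  · exact hcoord (fun i => (v i).re) j (Prod.ext_iff.mp h2).1
  · exact hcoord (fun i => (v i).im) j (Prod.ext_iff.mp h2).2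

/-- The density of the real form `Ω|_X` in the chart `k`. -/
def formDensity (Ω : ∀ y : Y, (TangentSpace 𝓘(ℂ, CE m) y) [⋀^Fin m]→ₗ[ℂ] ℂ) (ι : C(X, Y))
    (k : RChart m X) (e : RE m) : ℝ :=
  (Ω (ι (k.symm e)) fun i => tang ι k (k.symm e) (stdBasis m i)).re

lemma formDensity_eq (hι : IsRealSlice (m := m) ι) (hc : c ∈ atlas (CE m) Y)
    (hk : k ∈ atlas (RE m) X) {e : RE m} (he : e ∈ img k (pre ι (dom c))) :
    Ω (ι (k.symm e)) (fun i => tang ι k (k.symm e) (stdBasis m i)) =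
      coef Ω c (c.symm (locRep ι c k e)) * (jacC ι c k e).det := by
  have hx : k.symm e ∈ k.source := k.map_target he.1
  have hy : ι (k.symm e) ∈ c.source := he.2
  have h1 := form_eq_coef (Ω := Ω) hc hy fun i =>
    fderiv ℝ (locRep ι c k) (k (k.symm e)) (stdBasis m i)
  have h2 : c.symm (locRep ι c k e) = ι (k.symm e) := c.left_inv hy
  rw [h2]
  refine Eq.trans ?_ (h1.trans ?_)
  · congr 1
    funext i
    rw [← toChart_tang hι hc hk hx hy]
    exact (ofChart_toChart hc hy _).symm
  · rw [k.right_inv he.1]; rfl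

lemma contDiffOn_formDensity (hΩ : IsHolomorphicForm Ω) (hι : IsRealSlice (m := m) ι)
    (hk : k ∈ atlas (RE m) X) :
    ContDiffOn ℝ ∞ (formDensity Ω ι k) k.target := by
  intro e he
  set c := chartAt (CE m) (ι (k.symm e))
  have hc : c ∈ atlas (CE m) Y := chart_mem_atlas _ _
  have he' : e ∈ img k (pre ι (dom c)) := ⟨he, mem_chart_source (CE m) (ι (k.symm e))⟩
  have hu := contDiffOn_locRep hι hc hk
  have h1 : ContDiffOn ℝ ∞ (fun e => coef Ω c (c.symm (locRep ι c k e)))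
      (img k (pre ι (dom c))) :=
    (contDiffOn_coef hΩ hc).comp hu fun z hz => c.map_source hz.2
  have h2 : ContDiffOn ℝ ∞ (fun e => (jacC ι c k e).det) (img k (pre ι (dom c))) := by
    have h3 : ∀ i α, ContDiffOn ℝ ∞ (fun e => jacC ι c k e i α) (img k (pre ι (dom c))) := by
      intro i α
      have h4 := ((hu.fderiv_of_isOpen (img k _).isOpen (m := ∞) le_rfl).clm_apply
        (contDiffOn_const (c := stdBasis m i)))
      exact (PiLp.proj (𝕜 := ℝ) 2 (fun _ : Fin m => ℂ) α).contDiff.comp_contDiffOn h4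
    simp only [Matrix.det_apply]
    refine ContDiffOn.sum fun σ _ => ?_
    simp only [Units.smul_def, zsmul_eq_mul]
    exact contDiffOn_const.mul (contDiffOn_prod fun i _ => h3 _ _)
  have h3 : ContDiffOn ℝ ∞ (formDensity Ω ι k) (img k (pre ι (dom c))) :=
    (Complex.reCLM.contDiff.comp_contDiffOn (h1.mul h2)).congr fun z hz =>
      congrArg Complex.re (formDensity_eq hι hc hk hz)
  exact (h3.contDiffAt ((img k _).isOpen.mem_nhds he')).contDiffWithinAt

variable {V : Opens X} (hVk : V ≤ domX k) (hVc : V ≤ pre ι (dom c))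

/-- The density of `Ω|_X` as a function on the slice. -/
def densX : OX (m := m) ι V :=
  scalX hι hk hVk (formDensity Ω ι k) ((contDiffOn_formDensity hΩ hι hk).mono fun _ he => he.1)

lemma contDiffOn_locRep_re (hVc : V ≤ pre ι (dom c)) (hι : IsRealSlice (m := m) ι)
    (hc : c ∈ atlas (CE m) Y) (hk : k ∈ atlas (RE m) X) (α : Fin m) :
    ContDiffOn ℝ ∞ (fun e => (locRep ι c k e α).re) (img k V) ∧
    ContDiffOn ℝ ∞ (fun e => (locRep ι c k e α).im) (img k V) := by
  have h := (contDiffOn_locRep hι hc hk).mono fun e (he : e ∈ img k V) => ⟨he.1, hVc he.2⟩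
  exact ⟨(contDiff_re α).comp_contDiffOn h, (contDiff_im α).comp_contDiffOn h⟩

lemma x_eq_scalX (α : Fin m) : (holDataX ι hΩ hc hVc).x α =
    scalX hι hk hVk _ (contDiffOn_locRep_re hVc hι hc hk α).1 := ext_evX fun x => by
  rw [evX_x, evX_scalX, locRep_apply (hVk x.2)]

lemma x'_eq_scalX (α : Fin m) : (holDataX ι hΩ hc hVc).x' α =
    scalX hι hk hVk _ (contDiffOn_locRep_re hVc hι hc hk α).2 := ext_evX fun x => by
  rw [evX_x', evX_scalX, locRep_apply (hVk x.2)]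

lemma evX_dx_x (i α : Fin m) (x : V) :
    evX ι V x ((sliceCoords hι hk hVk).dx i ((holDataX ι hΩ hc hVc).x α)) =
      algebraMap ℝ _ (jacC ι c k (k (x : X)) i α).re ∧
    evX ι V x ((sliceCoords hι hk hVk).dx i ((holDataX ι hΩ hc hVc).x' α)) =
      algebraMap ℝ _ (jacC ι c k (k (x : X)) i α).im := by
  have hd := differentiableAt_locRep hι hc hk (hVk x.2) (hVc x.2)
  have hp : HasFDerivAt (fun e => locRep ι c k e α) _ (k (x : X)) :=
    (PiLp.proj (𝕜 := ℝ) 2 (fun _ : Fin m => ℂ) α).hasFDerivAt.comp (k (x : X)) hd.hasFDerivAt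
  have hre : HasFDerivAt (fun e => (locRep ι c k e α).re) _ (k (x : X)) :=
    Complex.reCLM.hasFDerivAt.comp (k (x : X)) hp
  have him : HasFDerivAt (fun e => (locRep ι c k e α).im) _ (k (x : X)) :=
    Complex.imCLM.hasFDerivAt.comp (k (x : X)) hp
  rw [x_eq_scalX hΩ hc hι hk hVk hVc, x'_eq_scalX hΩ hc hι hk hVk hVc, evX_dx_scalX, evX_dx_scalX,
    hre.fderiv, him.fderiv]
  exact ⟨rfl, rfl⟩

/-- On a real slice the holomorphic Liouville form `∑ dz ζ` restricts to the real form `∑ dx ξ`. -/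
lemma frame_slice (i : Fin m) :
    ∑ α, ((sliceCoords hι hk hVk).dx i).baseChange ℂ ((holDataX ι hΩ hc hVc).z α) *
      (holDataX ι hΩ hc hVc).ζ α = 1 ⊗ₜ (sliceCoords hι hk hVk).ξ i := by
  simp only [HolData.z, HolData.ζ, baseChange_cpx, cpx_mul, cpx_sum]
  rw [← cpx_zero_right, cpx_inj]
  constructor
  · refine ext_evX fun x => ?_
    rw [map_sum, evX_sliceCoords_ξ, normalFrame_eq hι hc hk (hVk x.2) (hVc x.2)]
    simp only [map_sub, map_mul, (evX_dx_x hΩ hc hι hk hVk hVc i _ x).1,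
      (evX_dx_x hΩ hc hι hk hVk hVc i _ x).2, evX_ψ, evX_ψ']
    simp only [← Algebra.smul_def, ← map_smul, ← map_sub, ← map_sum]
    congr 2
    rw [← sum_re_im (Complex.I • fderiv ℝ (locRep ι c k) (k (x : X)) (stdBasis m i))]
    have hmap : ∀ w, ofChart c (ι (x : X)) w = ofChartL c (ι (x : X)) w := fun _ => rfl
    simp only [hmap, ← map_smul, ← map_sub, ← map_sum]
    congr 1
    refine sum_congr rfl fun α _ => ?_
    simp only [jacC, Matrix.of_apply, PiLp.smul_apply, smul_eq_mul, Complex.I_mul_re,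
      Complex.I_mul_im, neg_smul]
    abel
  · refine ext_evX fun x => ?_
    rw [map_sum, map_zero]
    simp only [map_add, map_mul, (evX_dx_x hΩ hc hι hk hVk hVc i _ x).1,
      (evX_dx_x hΩ hc hι hk hVk hVc i _ x).2, evX_ψ, evX_ψ']
    simp only [← Algebra.smul_def, ← map_smul, ← map_add, ← map_sum]
    have hmap : ∀ w, ofChart c (ι (x : X)) w = ofChartL c (ι (x : X)) w := fun _ => rfl
    simp only [hmap, ← map_smul, ← map_add, ← map_sum]
    have h1 : ∑ α, ((jacC ι c k (k (x : X)) i α).re • (EuclideanSpace.single α (1 : ℂ) : CE m) +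
        (jacC ι c k (k (x : X)) i α).im • EuclideanSpace.single α Complex.I) =
        fderiv ℝ (locRep ι c k) (k (x : X)) (stdBasis m i) := sum_re_im _
    rw [h1, ← toChart_tang hι hc hk (hVk x.2) (hVc x.2), ofChartL_apply,
      ofChart_toChart hc (hVc x.2), mkQ_tang hk (hVk x.2), map_zero]

lemma cpx_algebraMap {L : Type*} [Ring L] [Algebra ℝ L] (z : ℂ) :
    cpx (algebraMap ℝ L z.re) (algebraMap ℝ L z.im) = algebraMap ℂ (ℂ ⊗[ℝ] L) z := by
  rw [Algebra.algebraMap_eq_smul_one, Algebra.algebraMap_eq_smul_one, ← tmul_eq_cpx]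
  rfl

lemma cmap_evX_coeff (x : V) : cmap (evX ι V x) (holDataX ι hΩ hc hVc).coeff =
    algebraMap ℂ _ (coef Ω c (c.symm (c (ι (x : X))))) := by
  rw [HolData.coeff, cmap_cpx, evX_a, evX_a', cpx_algebraMap]

lemma evenDet_map_algHom {S S' : Type*} [Ring S] [Ring S'] [Algebra ℝ S] [Algebra ℝ S']
    (f : S →ₐ[ℝ] S') (A : Matrix (Fin m) (Fin m) S) : evenDet (A.map f) = f (evenDet A) :=
  evenDet_map f.toRingHom A

lemma cmap_evX_det (x : V) :
    cmap (evX ι V x) (evenDet (Matrix.of fun i α =>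
      ((sliceCoords hι hk hVk).dx i).baseChange ℂ ((holDataX ι hΩ hc hVc).z α))) =
        algebraMap ℂ _ (jacC ι c k (k (x : X))).det := by
  rw [← evenDet_map_algHom, ← evenDet_eq_det, ← evenDet_map (algebraMap ℂ _)]
  congr 1
  ext i α
  simp only [Matrix.map_apply, Matrix.of_apply]
  rw [HolData.z, baseChange_cpx, cmap_cpx, (evX_dx_x hΩ hc hι hk hVk hVc i α x).1,
    (evX_dx_x hΩ hc hι hk hVk hVc i α x).2, cpx_algebraMap]

lemma im_form_eq_zero (hIm : ∀ (x : X) (u : Fin m → TangentSpace 𝓘(ℝ, RE m) x),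
      (Ω (ι x) fun k => diff (m := m) ι x (u k)).im = 0) (e : RE m) :
    (Ω (ι (k.symm e)) fun i => tang ι k (k.symm e) (stdBasis m i)).im = 0 :=
  hIm (k.symm e) fun i => fderiv ℝ (chartAt (RE m) (k.symm e) ∘ k.symm) (k (k.symm e)) (stdBasis m i)

/-- The form `Ω` restricts to a real density. -/
lemma coeff_slice (hIm : ∀ (x : X) (u : Fin m → TangentSpace 𝓘(ℝ, RE m) x),
      (Ω (ι x) fun k => diff (m := m) ι x (u k)).im = 0) :
    (holDataX ι hΩ hc hVc).coeff * evenDet (Matrix.of fun i α =>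
      ((sliceCoords hι hk hVk).dx i).baseChange ℂ ((holDataX ι hΩ hc hVc).z α)) =
        1 ⊗ₜ densX hΩ hι hk hVk := by
  refine ext_cmap_evX fun x => ?_
  have he : k (x : X) ∈ img k (pre ι (dom c)) := mem_img (hVk x.2) (hVc x.2)
  have h6 := formDensity_eq (Ω := Ω) hι hc hk he
  rw [locRep_apply (hVk x.2)] at h6
  rw [map_mul, cmap_evX_coeff, cmap_evX_det, ← map_mul, ← h6, cmap_tmul, densX, evX_scalX,
    ← cpx_zero_right, ← cpx_algebraMap, im_form_eq_zero hIm, map_zero]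
  rfl

lemma isUnit_densX (hΩ0 : ∀ y, Ω y ≠ 0)
    (hIm : ∀ (x : X) (u : Fin m → TangentSpace 𝓘(ℝ, RE m) x),
      (Ω (ι x) fun k => diff (m := m) ι x (u k)).im = 0) :
    IsUnit (densX hΩ hι hk hVk) := by
  have h0 : ∀ e ∈ img k V, formDensity Ω ι k e ≠ 0 := fun e he => by
    set c := chartAt (CE m) (ι (k.symm e))
    have hc : c ∈ atlas (CE m) Y := chart_mem_atlas _ _
    have he' : e ∈ img k (pre ι (dom c)) := ⟨he.1, mem_chart_source (CE m) (ι (k.symm e))⟩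
    have h1 := formDensity_eq (Ω := Ω) hι hc hk he'
    have h2 := im_form_eq_zero (k := k) hIm e
    have hy : c.symm (locRep ι c k e) = ι (k.symm e) := c.left_inv he'.2
    have h3 : coef Ω c (c.symm (locRep ι c k e)) * (jacC ι c k e).det ≠ 0 :=
      mul_ne_zero (by rw [hy]; exact coef_ne_zero hc he'.2 (hΩ0 _)) (det_jacC_ne_zero hι hc hk he')
    rw [← h1] at h3
    intro h4
    exact h3 (Complex.ext h4 h2)
  have hsm : ContDiffOn ℝ ∞ (formDensity Ω ι k) (img k V) :=
    (contDiffOn_formDensity hΩ hι hk).mono fun _ he => he.1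
  refine isUnit_iff_exists.mpr ⟨scalX hι hk hVk (fun e => (formDensity Ω ι k e)⁻¹)
    (hsm.inv h0), ext_evX fun x => ?_, ext_evX fun x => ?_⟩
  · rw [map_mul, densX, evX_scalX, evX_scalX, ← map_mul,
      mul_inv_cancel₀ (h0 _ (mem_img (hVk x.2) x.2)), map_one, map_one]
  · rw [map_mul, densX, evX_scalX, evX_scalX, ← map_mul,
      inv_mul_cancel₀ (h0 _ (mem_img (hVk x.2) x.2)), map_one, map_one]

/-- The slice coordinates are adapted to the holomorphic coordinates of `𝒴`. -/
lemma adapted_slice (hΩ0 : ∀ y, Ω y ≠ 0)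
    (hIm : ∀ (x : X) (u : Fin m → TangentSpace 𝓘(ℝ, RE m) x),
      (Ω (ι x) fun k => diff (m := m) ι x (u k)).im = 0) :
    Adapted (sliceCoords hι hk hVk) (holDataX ι hΩ hc hVc) (densX hΩ hι hk hVk) where
  homog := isHomogeneous_holDataX hΩ hc hVc
  dξ_x j α := by rw [x_eq_scalX hΩ hc hι hk hVk hVc, dξ_scalX]
  dξ_x' j α := by rw [x'_eq_scalX hΩ hc hι hk hVk hVc, dξ_scalX]
  frame := frame_slice hΩ hc hι hk hVk hVc
  coeff := coeff_slice hΩ hc hι hk hVk hVc hIm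
  isUnit := isUnit_densX hΩ hι hk hVk hΩ0 hIm

end AdaptedSlice

section Slice

variable {m : ℕ} {Y : Type*} [TopologicalSpace Y] [T2Space Y] [ChartedSpace (CE m) Y]
  [IsManifold 𝓘(ℂ, CE m) ω Y]
  {X : Type*} [TopologicalSpace X] [T2Space X] [CompactSpace X] [ChartedSpace (RE m) X]
  [IsManifold 𝓘(ℝ, RE m) ∞ X] {ι : C(X, Y)}
  {Ω : ∀ y : Y, (TangentSpace 𝓘(ℂ, CE m) y) [⋀^Fin m]→ₗ[ℂ] ℂ}

local notation "𝒪" => OX (m := m) ι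

/-! ### Gluing, bump functions and locality -/

section CompSuperDer

variable {A A' B B' : Type*} [Ring A] [Algebra ℝ A] [Ring A'] [Algebra ℝ A'] [Ring B] [Algebra ℝ B]
  [Ring B'] [Algebra ℝ B'] {σA : A →ₐ[ℝ] A} {σA' : A' →ₐ[ℝ] A'} {σB : B →ₐ[ℝ] B}
  {σB' : B' →ₐ[ℝ] B'} {s : Fin 2}

lemma IsSuperDer.comp_left {r : A →ₐ[ℝ] B} {D : A →ₗ[ℝ] B} (hD : IsSuperDer σA σB r s D)
    (φ : B →ₐ[ℝ] B') (hφ : ∀ b, φ (σB b) = σB' (φ b)) :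
    IsSuperDer σA σB' (φ.comp r) s (φ.toLinearMap ∘ₗ D) := by
  have hpow : ∀ b, φ ((σB ^ (s : ℕ)) b) = (σB' ^ (s : ℕ)) (φ b) := fun b => by
    fin_cases s
    · rfl
    · exact hφ b
  refine ⟨fun a b => ?_, fun a => ?_⟩
  · show φ (D (a * b)) = φ (D a) * φ (r b) + (σB' ^ (s : ℕ)) (φ (r a)) * φ (D b)
    rw [hD.1, map_add, map_mul φ, map_mul φ, hpow]
  · show φ (D (σA a)) = (-1 : ℝ) ^ (s : ℕ) • σB' (φ (D a))
    rw [hD.2, map_smul, hφ]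

lemma IsSuperDer.comp_right {r : A →ₐ[ℝ] B} {D : A →ₗ[ℝ] B} (hD : IsSuperDer σA σB r s D)
    (φ : A' →ₐ[ℝ] A) (hφ : ∀ a, φ (σA' a) = σA (φ a)) :
    IsSuperDer σA' σB (r.comp φ) s (D ∘ₗ φ.toLinearMap) := by
  refine ⟨fun a b => ?_, fun a => ?_⟩
  · show D (φ (a * b)) = D (φ a) * r (φ b) + (σB ^ (s : ℕ)) (r (φ a)) * D (φ b)
    rw [map_mul φ, hD.1]
  · show D (φ (σA' a)) = (-1 : ℝ) ^ (s : ℕ) • σB (D (φ a))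
    rw [hφ, hD.2]

end CompSuperDer

section Sheaf

variable (hι : IsRealSlice (m := m) ι)

lemma evX_resX {V V' : Opens X} (h : V' ≤ V) (x : V') (b : 𝒪 V) :
    evX ι V' x (resX ι h b) = evX ι V ⟨x, h x.2⟩ b := rfl

lemma evX_smul {V : Opens X} (x : V) (r : ℝ) (b : 𝒪 V) :
    evX ι V x (r • b) = r • evX ι V x b := rfl

lemma resX_parity {V V' : Opens X} (h : V' ≤ V) (b : 𝒪 V) :
    resX ι h (parityX ι V b) = parityX ι V' (resX ι h b) := rfl

/-- Sections agree if their restrictions to the members of an open cover do. -/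
lemma evX_mul {V : Opens X} (x : V) (a b : 𝒪 V) :
    evX ι V x (a * b) = evX ι V x a * evX ι V x b := map_mul _ _ _

lemma evX_add {V : Opens X} (x : V) (a b : 𝒪 V) :
    evX ι V x (a + b) = evX ι V x a + evX ι V x b := map_add _ _ _

lemma ext_resX {V : Opens X} {s t : 𝒪 V}
    (h : ∀ x ∈ V, ∃ V' : Opens X, x ∈ V' ∧ ∃ hV : V' ≤ V, resX ι hV s = resX ι hV t) : s = t :=
  ext_evX fun x => by
    obtain ⟨V', hx, hV, h'⟩ := h x x.2
    exact congrArg (evX ι V' ⟨x, hx⟩) h'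

lemma ext_resX_chart {V : Opens X} {s t : 𝒪 V} (h : ∀ k ∈ atlas (RE m) X, ∀ (V' : Opens X)
    (hV : V' ≤ V), V' ≤ domX k → resX ι hV s = resX ι hV t) : s = t :=
  ext_resX fun x hx => ⟨V ⊓ domX (chartAt (RE m) x), ⟨hx, mem_chart_source _ _⟩, inf_le_left,
    h _ (chart_mem_atlas _ _) _ inf_le_left inf_le_right⟩

lemma ext_resX_charts {s t : GammaX (m := m) ι} (h : ∀ c ∈ atlas (CE m) Y, ∀ k ∈ atlas (RE m) X,
    ∀ V : Opens X, V ≤ pre ι (dom c) → V ≤ domX k →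
      resX ι (le_top : V ≤ ⊤) s = resX ι le_top t) : s = t :=
  ext_resX fun x _ => ⟨pre ι (dom (chartAt (CE m) (ι x))) ⊓ domX (chartAt (RE m) x),
    ⟨mem_chart_source _ _, mem_chart_source _ _⟩, le_top,
    h _ (chart_mem_atlas _ _) _ (chart_mem_atlas _ _) _ inf_le_left inf_le_right⟩

/-- A smooth real function on `X` as a section. -/
def scalarX (χ : X → ℝ) (hχ : ContMDiff 𝓘(ℝ, RE m) 𝓘(ℝ, ℝ) ∞ χ) (V : Opens X) : 𝒪 V :=
  ⟨fun x => algebraMap ℝ _ (χ x), isNormalSection_of_local hι fun x => by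
    have hk : chartAt (RE m) (x : X) ∈ atlas (RE m) X := chart_mem_atlas _ _
    have h1 : ContMDiffOn 𝓘(ℝ, RE m) 𝓘(ℝ, RE m) ∞ (chartAt (RE m) (x : X)).symm
        (chartAt (RE m) (x : X)).target :=
      contMDiffOn_symm_of_mem_maximalAtlas (IsManifold.subset_maximalAtlas hk)
    have h2 : ContDiffOn ℝ ∞ (χ ∘ (chartAt (RE m) (x : X)).symm)
        (img (chartAt (RE m) (x : X)) (domX (chartAt (RE m) (x : X)))) :=
      contMDiffOn_iff_contDiffOn.mp (hχ.comp_contMDiffOn (h1.mono Set.inter_subset_left))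
    refine ⟨domX (chartAt (RE m) (x : X)), mem_chart_source _ _,
      scalX hι hk le_rfl _ h2, fun x' hx' => ?_⟩
    have h3 := evX_scalX hι hk le_rfl _ h2 ⟨x', hx'⟩
    rw [Function.comp_apply, (chartAt (RE m) (x : X)).left_inv hx'] at h3
    exact h3.symm⟩

lemma evX_scalarX (χ : X → ℝ) (hχ : ContMDiff 𝓘(ℝ, RE m) 𝓘(ℝ, ℝ) ∞ χ) {V : Opens X} (x : V) :
    evX ι V x (scalarX hι χ hχ V) = algebraMap ℝ _ (χ x) := rfl

open Classical in
/-- Extension by zero, as a function. -/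
def extFun {V' : Opens X} (b : 𝒪 V') (x : X) : ExteriorAlgebra ℝ (NX (m := m) ι x) :=
  if h : x ∈ V' then b.1 ⟨x, h⟩ else 0

lemma extFun_of_mem {V' : Opens X} (b : 𝒪 V') {x : X} (h : x ∈ V') :
    extFun b x = evX ι V' ⟨x, h⟩ b := dif_pos h

lemma extFun_of_notMem {V' : Opens X} (b : 𝒪 V') {x : X} (h : x ∉ V') :
    extFun b x = 0 := dif_neg h

/-- Extension by zero after multiplication by a cutoff function. -/
def extX (χ : X → ℝ) (hχ : ContMDiff 𝓘(ℝ, RE m) 𝓘(ℝ, ℝ) ∞ χ) {V' : Opens X}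
    (hsupp : tsupport χ ⊆ V') (V : Opens X) : 𝒪 V' →ₗ[ℝ] 𝒪 V where
  toFun b := ⟨fun x => χ x • extFun b x, isNormalSection_of_local hι fun x => by
      by_cases h : (x : X) ∈ V'
      · refine ⟨V', h, scalarX hι χ hχ V' * b, fun x' hx' => ?_⟩
        rw [extFun_of_mem b hx', Algebra.smul_def]
        rfl
      · refine ⟨⟨(tsupport χ)ᶜ, (isClosed_tsupport χ).isOpen_compl⟩, fun h' => h (hsupp h'), 0,
          fun x' hx' => ?_⟩
        have h0 : χ x' = 0 := image_eq_zero_of_notMem_tsupport hx'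
        rw [h0, zero_smul]
        rfl⟩
  map_add' a b := Subtype.ext (funext fun x => by
    show χ x • extFun (a + b) (x : X) = χ x • extFun a (x : X) + χ x • extFun b (x : X)
    by_cases h : (x : X) ∈ V'
    · rw [extFun_of_mem _ h, extFun_of_mem _ h, extFun_of_mem _ h, map_add, smul_add]
    · rw [extFun_of_notMem _ h, extFun_of_notMem _ h, extFun_of_notMem _ h, smul_zero, add_zero])
  map_smul' r b := Subtype.ext (funext fun x => by
    show χ x • extFun (r • b) (x : X) = r • (χ x • extFun b (x : X))
    by_cases h : (x : X) ∈ V'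
    · rw [extFun_of_mem _ h, extFun_of_mem _ h, map_smul, smul_comm]
    · rw [extFun_of_notMem _ h, extFun_of_notMem _ h, smul_zero, smul_zero])

lemma evX_extX {χ : X → ℝ} (hχ : ContMDiff 𝓘(ℝ, RE m) 𝓘(ℝ, ℝ) ∞ χ) {V' : Opens X}
    (hsupp : tsupport χ ⊆ V') {V : Opens X} (b : 𝒪 V') (x : V) (h : (x : X) ∈ V') :
    evX ι V x (extX hι χ hχ hsupp V b) = χ x • evX ι V' ⟨x, h⟩ b :=
  congrArg (χ x • ·) (extFun_of_mem b h)

lemma evX_extX_of_notMem {χ : X → ℝ} (hχ : ContMDiff 𝓘(ℝ, RE m) 𝓘(ℝ, ℝ) ∞ χ) {V' : Opens X}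
    (hsupp : tsupport χ ⊆ V') {V : Opens X} (b : 𝒪 V') (x : V) (h : (x : X) ∉ V') :
    evX ι V x (extX hι χ hχ hsupp V b) = 0 :=
  (congrArg (χ x • ·) (extFun_of_notMem b h)).trans (smul_zero _)

/-- Bump functions. -/
lemma exists_bump {V : Opens X} {x : X} (hx : x ∈ V) :
    ∃ χ : X → ℝ, ContMDiff 𝓘(ℝ, RE m) 𝓘(ℝ, ℝ) ∞ χ ∧ tsupport χ ⊆ V ∧ ∃ W : Opens X, x ∈ W ∧
      ∀ x' ∈ W, χ x' = 1 := by
  obtain ⟨f, -, hf⟩ := (SmoothBumpFunction.nhds_basis_tsupport (I := 𝓘(ℝ, RE m)) x).mem_iff.mp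
    (V.isOpen.mem_nhds hx)
  obtain ⟨W, hW, hWo, hxW⟩ := mem_nhds_iff.mp f.eventuallyEq_one
  exact ⟨f, f.contMDiff, hf, ⟨W, hWo⟩, hxW, fun x' hx' => hW hx'⟩

/-- Two sections agree near a point. -/
def EqNear (x : X) {V V' : Opens X} (b : 𝒪 V) (b' : 𝒪 V') : Prop :=
  ∃ W : Opens X, x ∈ W ∧ ∀ x' ∈ W, ∀ (h : x' ∈ V) (h' : x' ∈ V'),
    evX ι V ⟨x', h⟩ b = evX ι V' ⟨x', h'⟩ b'

lemma eqNear_resX (x : X) {V V' : Opens X} (h : V' ≤ V) (b : 𝒪 V) :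
    EqNear x b (resX ι h b) := ⟨⊤, trivial, fun _ _ _ _ => rfl⟩

/-- A cutoff extension agrees with the original section where the cutoff function is `1`. -/
lemma eqNear_extX {χ : X → ℝ} (hχ : ContMDiff 𝓘(ℝ, RE m) 𝓘(ℝ, ℝ) ∞ χ) {V' : Opens X}
    (hsupp : tsupport χ ⊆ V') (V : Opens X) (b : 𝒪 V') {W : Opens X} {x : X} (hx : x ∈ W)
    (hW : ∀ x' ∈ W, χ x' = 1) : EqNear x (extX hι χ hχ hsupp V b) b :=
  ⟨W, hx, fun x' hx' h h' => by rw [evX_extX hι hχ hsupp b ⟨x', h⟩ h', hW x' hx', one_smul]⟩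

/-- A superderivation at a point only depends on the germ. -/
lemma der_congr (hι : IsRealSlice (m := m) ι) {V : Opens X} {x : V} {s : Fin 2}
    {δ : 𝒪 V →ₗ[ℝ] ExteriorAlgebra ℝ (NX (m := m) ι (x : X))}
    (hδ : IsSuperDer (parityX ι V) (extParity _) (evX ι V x) s δ) {b b' : 𝒪 V}
    (h : EqNear (x : X) b b') : δ b = δ b' := by
  obtain ⟨W, hxW, hW⟩ := h
  obtain ⟨χ, hχ, hsupp, W', hxW', hW'⟩ := exists_bump (m := m) (X := X) hxW
  have h0 : scalarX hι χ hχ V * (b - b') = 0 := ext_evX fun x' => by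
    rw [evX_mul, map_zero, evX_scalarX, map_sub (evX ι V x')]
    by_cases hx' : (x' : X) ∈ W
    · rw [hW x' hx' x'.2 x'.2, sub_self, mul_zero]
    · rw [image_eq_zero_of_notMem_tsupport fun h' => hx' (hsupp h'), map_zero, zero_mul]
  have h1 := hδ.1 (scalarX hι χ hχ V) (b - b')
  rw [h0, map_zero, map_sub (evX ι V x), hW x hxW x.2 x.2, sub_self, mul_zero, zero_add,
    evX_scalarX, hW' _ hxW', map_one, map_one, one_mul, map_sub] at h1
  exact sub_eq_zero.mp h1.symm

lemma IsSuperDer.evX {V : Opens X} {s : Fin 2} {w : 𝒪 V →ₗ[ℝ] 𝒪 V}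
    (hw : IsVF (parityX ι V) s w) (x : V) : IsSuperDer (parityX ι V) (extParity _) (evX ι V x) s
      ((SpecialSlice.evX ι V x).toLinearMap ∘ₗ w) :=
  IsSuperDer.comp_left hw (SpecialSlice.evX ι V x) fun _ => rfl

/-- Vector fields restrict to open subsets. -/
lemma exists_resDer (hι : IsRealSlice (m := m) ι) {V V' : Opens X} (hV : V' ≤ V) {s : Fin 2}
    {w : 𝒪 V →ₗ[ℝ] 𝒪 V} (hw : IsVF (parityX ι V) s w) :
    ∃ w' : 𝒪 V' →ₗ[ℝ] 𝒪 V', IsVF (parityX ι V') s w' ∧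
      (∀ b, w' (resX ι hV b) = resX ι hV (w b)) ∧
      ∀ (x : V') (b : 𝒪 V') (b' : 𝒪 V), EqNear (x : X) b' b →
        evX ι V' x (w' b) = evX ι V ⟨x, hV x.2⟩ (w b') := by
  have hbump := fun x : V' => exists_bump (m := m) (X := X) x.2
  choose χ hχ hsupp W hxW hW using hbump
  set E : ∀ x : V', 𝒪 V' →ₗ[ℝ] 𝒪 V := fun x => extX hι (χ x) (hχ x) (hsupp x) V
  have hE : ∀ (x x' : V') b, (x' : X) ∈ W x → EqNear (x' : X) (E x b) b := fun x x' b hx' =>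
    eqNear_extX hι (hχ x) (hsupp x) V b hx' (hW x)
  have hcongr : ∀ (x : V') (b b' : 𝒪 V), EqNear (x : X) b b' →
      evX ι V ⟨x, hV x.2⟩ (w b) = evX ι V ⟨x, hV x.2⟩ (w b') := fun x b b' h =>
    der_congr hι (hw.evX ⟨x, hV x.2⟩) h
  have htrans : ∀ (x : V') (b b' : 𝒪 V) (d : 𝒪 V'), EqNear (x : X) b d →
      EqNear (x : X) b' d → EqNear (x : X) b b' := by
    rintro x b b' d ⟨W₁, h1, h1'⟩ ⟨W₂, h2, h2'⟩
    refine ⟨W₁ ⊓ W₂ ⊓ V', ⟨⟨h1, h2⟩, x.2⟩, fun x' hx' h h' => ?_⟩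
    exact (h1' x' hx'.1.1 h hx'.2).trans (h2' x' hx'.1.2 h' hx'.2).symm
  have hsec : ∀ b, IsNormalSection ι fun x : V' => (evX ι V ⟨x, hV x.2⟩ (w (E x b)) :
      ExteriorAlgebra ℝ (NX (m := m) ι (x : X))) := fun b =>
    isNormalSection_of_local hι fun x => ⟨W x ⊓ V', ⟨hxW x, x.2⟩,
      resX ι (inf_le_right.trans hV) (w (E x b)), fun x' hx' =>
        hcongr x' _ _ (htrans x' _ _ b (hE x' x' b (hxW x')) (hE x x' b hx'.1))⟩
  let w' : 𝒪 V' →ₗ[ℝ] 𝒪 V' :=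
    { toFun := fun b => ⟨_, hsec b⟩
      map_add' := fun a b => Subtype.ext (funext fun x => by
        show evX ι V _ (w (E x (a + b))) = evX ι V _ (w (E x a)) + evX ι V _ (w (E x b))
        rw [map_add, map_add, map_add])
      map_smul' := fun r b => Subtype.ext (funext fun x => by
        show evX ι V _ (w (E x (r • b))) = r • evX ι V _ (w (E x b))
        rw [map_smul, map_smul, map_smul]) }
  have key : ∀ (x : V') (b : 𝒪 V') (b' : 𝒪 V), EqNear (x : X) b' b →
      evX ι V' x (w' b) = evX ι V ⟨x, hV x.2⟩ (w b') := fun x b b' h =>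
    hcongr x _ _ (htrans x _ _ b (hE x x b (hxW x)) h)
  clear_value w'
  refine ⟨w', ⟨fun a b => ext_evX fun x => ?_, fun a => ext_evX fun x => ?_⟩, fun b => ext_evX fun x =>
    key x _ b (eqNear_resX _ hV b), key⟩
  · have hab : EqNear (x : X) (E x a * E x b) (a * b) := by
      obtain ⟨W₁, h1, h1'⟩ := hE x x a (hxW x)
      obtain ⟨W₂, h2, h2'⟩ := hE x x b (hxW x)
      exact ⟨W₁ ⊓ W₂, ⟨h1, h2⟩, fun x' hx' h h' => by
        rw [evX_mul, evX_mul, h1' x' hx'.1, h2' x' hx'.2]⟩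
    have hva : ∀ d, evX ι V ⟨x, hV x.2⟩ (E x d) = evX ι V' x d := fun d => by
      obtain ⟨W₁, h1, h1'⟩ := hE x x d (hxW x)
      exact h1' x h1 _ _
    rw [key x _ _ hab, hw.1, evX_add, evX_add, evX_mul, evX_mul, evX_mul, evX_mul, key x a _ (hE x x a (hxW x)),
      key x b _ (hE x x b (hxW x))]
    congr 2
    · exact hva b
    · fin_cases s
      · exact hva a
      · exact congrArg (extParity _) (hva a)
  · have ha : EqNear (x : X) (parityX ι V (E x a)) (parityX ι V' a) := by
      obtain ⟨W₁, h1, h1'⟩ := hE x x a (hxW x)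
      exact ⟨W₁, h1, fun x' hx' h h' => by rw [evX_parity, evX_parity, h1' x' hx']⟩
    refine (key x _ _ ha).trans ((congrArg _ (hw.2 _)).trans ?_)
    rw [evX_smul, evX_smul, evX_parity, evX_parity]
    exact congrArg (fun d => (-1 : ℝ) ^ (s : ℕ) • extParity _ d) (key x a _ (hE x x a (hxW x))).symm

/-- A vector field on an open subset, cut off and extended by zero. -/
lemma isVF_extX {χ : X → ℝ} (hχ : ContMDiff 𝓘(ℝ, RE m) 𝓘(ℝ, ℝ) ∞ χ) {V V' : Opens X}
    (hsupp : tsupport χ ⊆ V') (hV : V' ≤ V) {p : Fin 2} {w : 𝒪 V' →ₗ[ℝ] 𝒪 V'}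
    (hw : IsVF (parityX ι V') p w) :
    IsVF (parityX ι V) p (extX hι χ hχ hsupp V ∘ₗ w ∘ₗ (resX ι hV).toLinearMap) := by
  refine ⟨fun a d => ext_evX fun x => ?_, fun a => ext_evX fun x => ?_⟩
  · show evX ι V x (extX hι χ hχ hsupp V (w (resX ι hV (a * d)))) =
      evX ι V x (extX hι χ hχ hsupp V (w (resX ι hV a)) * d +
        (parityX ι V ^ (p : ℕ)) a * extX hι χ hχ hsupp V (w (resX ι hV d)))
    rw [map_mul (resX ι hV), hw.1, evX_add, evX_mul, evX_mul]
    by_cases h : (x : X) ∈ V'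
    · rw [evX_extX hι hχ hsupp _ x h, evX_extX hι hχ hsupp _ x h, evX_extX hι hχ hsupp _ x h,
        evX_add, evX_mul, evX_mul, smul_add, smul_mul_assoc, mul_smul_comm]
      congr 2
      fin_cases p <;> rfl
    · rw [evX_extX_of_notMem hι hχ hsupp _ x h, evX_extX_of_notMem hι hχ hsupp _ x h,
        evX_extX_of_notMem hι hχ hsupp _ x h, zero_mul, mul_zero, add_zero]
  · show evX ι V x (extX hι χ hχ hsupp V (w (resX ι hV (parityX ι V a)))) =
      evX ι V x ((-1 : ℝ) ^ (p : ℕ) • parityX ι V (extX hι χ hχ hsupp V (w (resX ι hV a))))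
    rw [resX_parity, hw.2, LinearMap.map_smul, evX_smul, evX_smul, evX_parity]
    congr 1
    by_cases h : (x : X) ∈ V'
    · rw [evX_extX hι hχ hsupp _ x h, evX_extX hι hχ hsupp _ x h, evX_parity]
      exact (LinearMap.map_smul (extParity _).toLinearMap _ _).symm
    · rw [evX_extX_of_notMem hι hχ hsupp _ x h, evX_extX_of_notMem hι hχ hsupp _ x h, map_zero]

/-- The spanning property of coordinate vector fields is local. -/
lemma span_resX (hι : IsRealSlice (m := m) ι) {V V' : Opens X} (hV : V' ≤ V)
    (q : SuperCoords (𝒪 V) (parityX ι V) m)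
    {dx dξ : Fin m → 𝒪 V' →ₗ[ℝ] 𝒪 V'}
    (hdx : ∀ (i) (x : V') (b : 𝒪 V') (b' : 𝒪 V), EqNear (x : X) b' b →
        evX ι V' x (dx i b) = evX ι V ⟨x, hV x.2⟩ (q.dx i b'))
    (hdξ : ∀ (i) (x : V') (b : 𝒪 V') (b' : 𝒪 V), EqNear (x : X) b' b →
        evX ι V' x (dξ i b) = evX ι V ⟨x, hV x.2⟩ (q.dξ i b'))
    {p : Fin 2} {w : 𝒪 V' →ₗ[ℝ] 𝒪 V'} (hw : IsVF (parityX ι V') p w)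
    (b : 𝒪 V') :
    w b = ∑ i, w (resX ι hV (q.x i)) * dx i b + ∑ j, w (resX ι hV (q.ξ j)) * dξ j b := by
  refine ext_evX fun x => ?_
  -- The vector field is cut off and extended by zero, so that the coordinates on `V` apply.
  obtain ⟨χ, hχ, hsupp, W, hxW, hW⟩ := exists_bump (m := m) (X := X) x.2
  have hEx : ∀ d, evX ι V ⟨x, hV x.2⟩ (extX hι χ hχ hsupp V d) = evX ι V' x d := fun d => by
    rw [evX_extX hι hχ hsupp d ⟨x, hV x.2⟩ x.2]
    exact (congrArg (· • evX ι V' x d) (hW _ hxW)).trans (one_smul _ _)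
  have hnear : EqNear (x : X) (extX hι χ hχ hsupp V b) b := eqNear_extX hι hχ hsupp V b hxW hW
  have hres : EqNear (x : X) (resX ι hV (extX hι χ hχ hsupp V b)) b := by
    obtain ⟨W₁, h3, h4⟩ := hnear
    exact ⟨W₁, h3, fun x' hx' h h' => h4 x' hx' (hV h) h'⟩
  have h1 := q.span p _ (isVF_extX hι hχ hsupp hV hw) (extX hι χ hχ hsupp V b)
  have h2 := congrArg (evX ι V ⟨x, hV x.2⟩) h1
  have h3 : evX ι V' x (w b) = evX ι V ⟨x, hV x.2⟩
      (extX hι χ hχ hsupp V (w (resX ι hV (extX hι χ hχ hsupp V b)))) := by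
    rw [hEx]
    exact (der_congr hι (hw.evX x) hres).symm
  rw [h3]
  refine h2.trans ?_
  rw [evX_add, evX_add, map_sum (evX ι V' x), map_sum (evX ι V' x),
    map_sum (evX ι V ⟨x, hV x.2⟩), map_sum (evX ι V ⟨x, hV x.2⟩)]
  congr 1
  · refine sum_congr rfl fun i _ => ?_
    rw [evX_mul, evX_mul, hdx i x b _ hnear]
    exact congrArg (· * _) (hEx _)
  · refine sum_congr rfl fun i _ => ?_
    rw [evX_mul, evX_mul, hdξ i x b _ hnear]
    exact congrArg (· * _) (hEx _)

/-- Supercoordinates restrict to open subsets. -/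
lemma exists_resCoords (hι : IsRealSlice (m := m) ι) {V V' : Opens X} (hV : V' ≤ V)
    (q : SuperCoords (𝒪 V) (parityX ι V) m) :
    ∃ q' : SuperCoords (𝒪 V') (parityX ι V') m,
      (∀ a, q'.co a = resX ι hV (q.co a)) ∧ ∀ a b, q'.d a (resX ι hV b) = resX ι hV (q.d a b) := by
  have hdx := fun i => exists_resDer hι hV (q.dx_isVF i)
  have hdξ := fun i => exists_resDer hι hV (q.dξ_isVF i)
  choose dx hdx hdxr hdxn using hdx
  choose dξ hdξ hdξr hdξn using hdξ
  refine ⟨{ x := fun i => resX ι hV (q.x i)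
            ξ := fun i => resX ι hV (q.ξ i)
            dx := dx
            dξ := dξ
            x_even := fun i => by rw [← resX_parity, q.x_even]
            ξ_odd := fun i => by rw [← resX_parity, q.ξ_odd, map_neg]
            dx_isVF := hdx
            dξ_isVF := hdξ
            dx_x := fun i k => by rw [hdxr, q.dx_x]; split_ifs <;> simp
            dx_ξ := fun i k => by rw [hdxr, q.dx_ξ, map_zero]
            dξ_x := fun i k => by rw [hdξr, q.dξ_x, map_zero]
            dξ_ξ := fun i k => by rw [hdξr, q.dξ_ξ]; split_ifs <;> simp
            span := fun p w hw b => span_resX hι hV q hdxn hdξn hw b }, fun a => ?_, fun a b => ?_⟩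
  · cases a <;> rfl
  · cases a
    · exact hdxr _ b
    · exact hdξr _ b

end Sheaf

/-! ### Locality of the restricted volume form -/

section CmapNat

variable {R₁ R₂ R₃ R₄ S : Type*} [Ring R₁] [Algebra ℝ R₁] [Ring R₂] [Algebra ℝ R₂] [Ring R₃]
  [Algebra ℝ R₃] [Ring R₄] [Algebra ℝ R₄] [Ring S] [Algebra ℝ S]

lemma cmap_cmap (f : R₁ →ₐ[ℝ] R₂) (g : R₂ →ₐ[ℝ] R₃) (u : ℂ ⊗[ℝ] R₁) :
    cmap g (cmap f u) = cmap (g.comp f) u := by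
  rw [← cpx_re_im u, cmap_cpx, cmap_cpx, cmap_cpx]; rfl

lemma cmap_baseChange {φ : R₂ →ₐ[ℝ] S} {w : R₁ →ₗ[ℝ] R₂} {φ' : R₃ →ₐ[ℝ] S} {w' : R₄ →ₗ[ℝ] R₃}
    {ψ : R₁ →ₐ[ℝ] R₄} (h : ∀ b, φ (w b) = φ' (w' (ψ b))) (u : ℂ ⊗[ℝ] R₁) :
    cmap φ (w.baseChange ℂ u) = cmap φ' (w'.baseChange ℂ (cmap ψ u)) := by
  rw [← cpx_re_im u]
  simp only [baseChange_cpx, cmap_cpx, h]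

lemma rePart_cmap (φ : R₁ →ₐ[ℝ] R₂) (u : ℂ ⊗[ℝ] R₁) : rePart (cmap φ u) = φ (rePart u) := by
  conv_lhs => rw [← cpx_re_im u, cmap_cpx, rePart_cpx]

lemma imPart_cmap (φ : R₁ →ₐ[ℝ] R₂) (u : ℂ ⊗[ℝ] R₁) : imPart (cmap φ u) = φ (imPart u) := by
  conv_lhs => rw [← cpx_re_im u, cmap_cpx, imPart_cpx]

/-- The even part of an element. -/
lemma exists_even_add_odd {τ : R₁ →ₐ[ℝ] R₁} (h : IsSuperComm τ) (f : R₁) :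
    ∃ f₀ f₁, τ f₀ = f₀ ∧ τ f₁ = -f₁ ∧ f = f₀ + f₁ := by
  refine ⟨(1 / 2 : ℝ) • (f + τ f), (1 / 2 : ℝ) • (f - τ f), ?_, ?_, ?_⟩
  · rw [map_smul, map_add, h.invol, add_comm]
  · rw [map_smul, map_sub, h.invol, ← smul_neg, neg_sub]
  · rw [← smul_add, add_add_sub_cancel, ← two_smul ℝ, smul_smul]; norm_num

end CmapNat

section Local

/-- Complex functions on the slice can be glued. -/
lemma exists_glue_complex (hι : IsRealSlice (m := m) ι) {V : Opens X}
    (s : ∀ x : V, ℂ ⊗[ℝ] ExteriorAlgebra ℝ (NX (m := m) ι (x : X)))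
    (h : ∀ x : V, ∃ V' : Opens X, (x : X) ∈ V' ∧ ∃ hV : V' ≤ V, ∃ u : ℂ ⊗[ℝ] 𝒪 V',
      ∀ x' : V', s ⟨x', hV x'.2⟩ = cmap (evX ι V' x') u) :
    ∃ t : ℂ ⊗[ℝ] 𝒪 V, ∀ x, cmap (evX ι V x) t = s x := by
  have hre : IsNormalSection ι fun x : V => rePart (s x) := isNormalSection_of_local hι fun x => by
    obtain ⟨V', hx, hV, u, hu⟩ := h x
    exact ⟨V', hx, rePart u, fun x' hx' =>
      (congrArg rePart (hu ⟨x', hx'⟩)).trans (rePart_cmap _ _)⟩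
  have him : IsNormalSection ι fun x : V => imPart (s x) := isNormalSection_of_local hι fun x => by
    obtain ⟨V', hx, hV, u, hu⟩ := h x
    exact ⟨V', hx, imPart u, fun x' hx' =>
      (congrArg imPart (hu ⟨x', hx'⟩)).trans (imPart_cmap _ _)⟩
  refine ⟨cpx (R := 𝒪 V) ⟨_, hre⟩ ⟨_, him⟩, fun x => ?_⟩
  exact (cmap_cpx (evX ι V x) _ _).trans (cpx_re_im (s x))

lemma map_mul_eq_one {S S' : Type*} [Ring S] [Ring S'] {n : Type*} [Fintype n] [DecidableEq n]
    (f : S →+* S') {A B : Matrix n n S} (h : A * B = 1) : A.map f * B.map f = 1 := by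
  rw [← Matrix.map_mul, h, Matrix.map_one _ (map_zero _) (map_one _)]

lemma map_cmap_resX {n : Type*} {V V' : Opens X} (hV : V' ≤ V) (x : V')
    (M : Matrix n n (ℂ ⊗[ℝ] 𝒪 V)) :
    (M.map (cmap (resX ι hV)).toRingHom).map (cmap (evX ι V' x)).toRingHom =
      M.map (cmap (evX ι V ⟨x, hV x.2⟩)).toRingHom := by
  ext a b
  exact cmap_cmap (resX ι hV) (evX ι V' x) (M a b)

/-- Invertibility of a matrix of complex functions on the slice is a local property. -/
lemma isUnit_matrix_of_local (hι : IsRealSlice (m := m) ι) {n : Type*} [Fintype n] [DecidableEq n]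
    {V : Opens X} (M : Matrix n n (ℂ ⊗[ℝ] 𝒪 V))
    (h : ∀ x ∈ V, ∃ V' : Opens X, x ∈ V' ∧ ∃ hV : V' ≤ V,
      IsUnit (M.map (cmap (resX ι hV)).toRingHom)) :
    IsUnit M := by
  have hloc : ∀ x : V, ∃ V' : Opens X, (x : X) ∈ V' ∧ ∃ hV : V' ≤ V,
      ∃ U : Matrix n n (ℂ ⊗[ℝ] 𝒪 V'), ∀ x' : V',
      M.map (cmap (evX ι V ⟨x', hV x'.2⟩)).toRingHom * U.map (cmap (evX ι V' x')).toRingHom = 1 ∧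
      U.map (cmap (evX ι V' x')).toRingHom * M.map (cmap (evX ι V ⟨x', hV x'.2⟩)).toRingHom = 1 := by
    intro x
    obtain ⟨V', hx, hV, hU⟩ := h x x.2
    obtain ⟨U, h1, h2⟩ := isUnit_iff_exists.mp hU
    refine ⟨V', hx, hV, U, fun x' => ?_⟩
    rw [← map_cmap_resX hV x' M]
    exact ⟨map_mul_eq_one _ h1, map_mul_eq_one _ h2⟩
  choose V' hx hV U hU using hloc
  -- The local inverses agree pointwise, because inverses are unique.
  have huniq : ∀ (x : V) (x' : V' x), (U ⟨x', hV x x'.2⟩).map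
      (cmap (evX ι (V' ⟨x', hV x x'.2⟩) ⟨x', hx _⟩)).toRingHom =
      (U x).map (cmap (evX ι (V' x) x')).toRingHom := fun x x' =>
    left_inv_eq_right_inv (hU ⟨x', hV x x'.2⟩ ⟨x', hx _⟩).2 (hU x x').1
  have hglue := fun a b => exists_glue_complex hι
    (fun x : V => (U x).map (cmap (evX ι (V' x) ⟨x, hx x⟩)).toRingHom a b)
    fun x => ⟨V' x, hx x, hV x, U x a b, fun x' => congrFun (congrFun (huniq x x') a) b⟩
  choose N hN using hglue
  have hev : ∀ x, (Matrix.of N).map (cmap (evX ι V x)).toRingHom =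
      (U x).map (cmap (evX ι (V' x) ⟨x, hx x⟩)).toRingHom := fun x => by
    ext a b
    exact hN a b x
  have hext : ∀ A B : Matrix n n (ℂ ⊗[ℝ] 𝒪 V),
      (∀ x, A.map (cmap (evX ι V x)).toRingHom * B.map (cmap (evX ι V x)).toRingHom = 1) →
        A * B = 1 := by
    intro A B hAB
    ext a b
    refine ext_cmap_evX fun x => ?_
    have h1 : (A * B).map (cmap (evX ι V x)).toRingHom =
        (1 : Matrix n n (ℂ ⊗[ℝ] 𝒪 V)).map (cmap (evX ι V x)).toRingHom := by
      rw [Matrix.map_mul, hAB, Matrix.map_one _ (map_zero _) (map_one _)]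
    exact congrFun (congrFun h1 a) b
  refine isUnit_iff_exists.mpr ⟨Matrix.of N, hext _ _ fun x => ?_, hext _ _ fun x => ?_⟩
  · rw [hev]; exact (hU x ⟨x, hx x⟩).1
  · rw [hev]; exact (hU x ⟨x, hx x⟩).2

variable {Ω : ∀ y : Y, (TangentSpace 𝓘(ℂ, CE m) y) [⋀^Fin m]→ₗ[ℂ] ℂ} {hΩ : IsHolomorphicForm Ω}
  {c : CChart m Y} {hc : c ∈ atlas (CE m) Y}

lemma cmap_resX_hco {V V' : Opens X} (hV : V' ≤ V) (hVc : V ≤ pre ι (dom c)) (b : Fin m ⊕ Fin m) :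
    cmap (resX ι hV) ((holDataX ι hΩ hc hVc).hco b) = (holDataX ι hΩ hc (hV.trans hVc)).hco b := by
  cases b <;> exact cmap_cpx _ _ _

lemma jac_resX {V V' : Opens X} (hV : V' ≤ V) (hVc : V ≤ pre ι (dom c))
    {q : SuperCoords (𝒪 V) (parityX ι V) m}
    {q' : SuperCoords (𝒪 V') (parityX ι V') m}
    (hq : ∀ a b, q'.d a (resX ι hV b) = resX ι hV (q.d a b)) :
    ((holDataX ι hΩ hc hVc).jac q.dx q.dξ).map (cmap (resX ι hV)).toRingHom =
      (holDataX ι hΩ hc (hV.trans hVc)).jac q'.dx q'.dξ := by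
  ext a b
  rw [Matrix.map_apply, show (holDataX ι hΩ hc hVc).jac q.dx q.dξ a b = _ from
    HolData.jac_apply _ q.d a b, show (holDataX ι hΩ hc (hV.trans hVc)).jac q'.dx q'.dξ a b = _ from
    HolData.jac_apply _ q'.d a b, ← cmap_resX_hco hV hVc b]
  refine (cmap_baseChange (φ := resX ι hV) (w := q.d a) (φ' := AlgHom.id ℝ _) (w' := q'.d a)
    (ψ := resX ι hV) (fun b => (hq a b).symm) _).trans ?_
  rw [← cpx_re_im ((q'.d a).baseChange ℂ _), cmap_cpx]
  rfl

section Slice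

/-- `X` is a real slice on which the nowhere vanishing form `Ω` is real. -/
structure IsSpecialSlice (ι : C(X, Y)) (Ω : ∀ y : Y, (TangentSpace 𝓘(ℂ, CE m) y) [⋀^Fin m]→ₗ[ℂ] ℂ) :
    Prop where
  slice : IsRealSlice (m := m) ι
  ne_zero : ∀ y, Ω y ≠ 0
  im_eq_zero : ∀ (x : X) (u : Fin m → TangentSpace 𝓘(ℝ, RE m) x),
    (Ω (ι x) fun k => diff (m := m) ι x (u k)).im = 0

/-- The slice `𝒳` is a real slice, in arbitrary supercoordinates. -/
lemma isUnit_jac_holDataX (hS : IsSpecialSlice ι Ω) {V : Opens X} (hVc : V ≤ pre ι (dom c))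
    (q : SuperCoords (𝒪 V) (parityX ι V) m) :
    IsUnit ((holDataX ι hΩ hc hVc).jac q.dx q.dξ) := by
  refine isUnit_matrix_of_local hS.slice _ fun x hx => ?_
  have hk : chartAt (RE m) x ∈ atlas (RE m) X := chart_mem_atlas _ _
  refine ⟨V ⊓ domX (chartAt (RE m) x), ⟨hx, mem_chart_source _ _⟩, inf_le_left, ?_⟩
  obtain ⟨q', -, hq'⟩ := exists_resCoords hS.slice (inf_le_left : V ⊓ domX (chartAt (RE m) x) ≤ V) q
  rw [jac_resX _ hVc hq']
  exact ((adapted_slice hΩ hc hS.slice hk inf_le_right (inf_le_left.trans hVc) hS.ne_zero hS.im_eq_zero).exists_compare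
    (isSuperCommX ι _) q').1

lemma cmap_resX_density (hS : IsSpecialSlice ι Ω) {V V' : Opens X} (hV : V' ≤ V)
    (hVc : V ≤ pre ι (dom c)) {q : SuperCoords (𝒪 V) (parityX ι V) m}
    {q' : SuperCoords (𝒪 V') (parityX ι V') m}
    (hq : ∀ a b, q'.d a (resX ι hV b) = resX ι hV (q.d a b)) :
    cmap (resX ι hV) ((holDataX ι hΩ hc hVc).density q.dx q.dξ) =
      (holDataX ι hΩ hc (hV.trans hVc)).density q'.dx q'.dξ := by
  have h1 := isUnit_jac_holDataX (hΩ := hΩ) (hc := hc) hS hVc q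
  have h2 : IsEvenSM (cmap (parityX ι V)) ((holDataX ι hΩ hc hVc).jac q.dx q.dξ) :=
    HolData.isEvenSM_jac (D := q.d) (isHomogeneous_holDataX hΩ hc hVc) q.parity_d
  have h3 := map_ber (isSuperCommX ι V).complexify (cmap (resX ι hV)).toRingHom h2 h1
  have h4 : cmap (resX ι hV) (holDataX ι hΩ hc hVc).coeff = (holDataX ι hΩ hc (hV.trans hVc)).coeff :=
    cmap_cpx _ _ _
  rw [HolData.density, HolData.density, map_mul, map_pow, ← jac_resX hV hVc hq, h4]
  exact congrArg (_ * ·) h3.symm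

/-- The holomorphic volume form restricts to a real volume form on `𝒳`. -/
lemma density_holDataX (hS : IsSpecialSlice ι Ω) {V : Opens X} (hVc : V ≤ pre ι (dom c))
    (q : SuperCoords (𝒪 V) (parityX ι V) m) :
    (holDataX ι hΩ hc hVc).density q.dx q.dξ = 1 ⊗ₜ rho ι hΩ hc hVc q := by
  have h0 : imPart ((holDataX ι hΩ hc hVc).density q.dx q.dξ) = 0 := by
    refine ext_resX_chart fun k hk V' hV hVk => ?_
    obtain ⟨q', -, hq'⟩ := exists_resCoords hS.slice hV q
    obtain ⟨-, κ, hκ, -⟩ := (adapted_slice hΩ hc hS.slice hk hVk (hV.trans hVc) hS.ne_zero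
      hS.im_eq_zero).exists_compare (isSuperCommX ι _) q'
    rw [← imPart_cmap, cmap_resX_density hS _ hVc hq', hκ, imPart_one_tmul, map_zero]
  rw [← cpx_re_im ((holDataX ι hΩ hc hVc).density q.dx q.dξ), h0, cpx_zero_right]
  rfl

lemma resX_rho (hS : IsSpecialSlice ι Ω) {V V' : Opens X} (hV : V' ≤ V)
    (hVc : V ≤ pre ι (dom c)) {q : SuperCoords (𝒪 V) (parityX ι V) m}
    {q' : SuperCoords (𝒪 V') (parityX ι V') m}
    (hq : ∀ a b, q'.d a (resX ι hV b) = resX ι hV (q.d a b)) :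
    resX ι hV (rho ι hΩ hc hVc q) = rho ι hΩ hc (hV.trans hVc) q' := by
  rw [rho, rho, ← rePart_cmap, cmap_resX_density hS hV hVc hq]

lemma resX_bvDiv {V V' : Opens X} (hV : V' ≤ V)
    {q : SuperCoords (𝒪 V) (parityX ι V) m}
    {q' : SuperCoords (𝒪 V') (parityX ι V') m}
    (hco : ∀ a, q'.co a = resX ι hV (q.co a))
    (hq : ∀ a b, q'.d a (resX ι hV b) = resX ι hV (q.d a b)) (ρ : 𝒪 V)
    {H : 𝒪 V →ₗ[ℝ] 𝒪 V} {H' : 𝒪 V' →ₗ[ℝ] 𝒪 V'}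
    (hH : ∀ b, H' (resX ι hV b) = resX ι hV (H b)) :
    resX ι hV (q.bvDiv ρ H) = q'.bvDiv (resX ι hV ρ) H' := by
  rw [SuperCoords.bvDiv, SuperCoords.bvDiv, map_add, map_sum, map_sum]
  congr 1
  · refine sum_congr rfl fun i _ => ?_
    rw [show q'.x i = _ from hco (Sum.inl i), hH, ← map_mul]
    exact (hq (Sum.inl i) _).symm
  · refine sum_congr rfl fun i _ => ?_
    rw [show q'.ξ i = _ from hco (Sum.inr i), hH, ← resX_parity, ← map_mul]
    exact (hq (Sum.inr i) _).symm

end Slice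

end Local

/-! ### The Batalin–Vilkovisky operator -/

section BVAlgebra

variable {B : Type*} [Ring B] [Algebra ℝ B] {σ : B →ₐ[ℝ] B} {m : ℕ}

namespace SuperCoords

lemma bvDiv_smul (q : SuperCoords B σ m) (ρ : B) (r : ℝ) (H : B →ₗ[ℝ] B) :
    q.bvDiv ρ (r • H) = r • q.bvDiv ρ H := by
  simp only [bvDiv, LinearMap.smul_apply, map_smul, smul_mul_assoc, smul_add, smul_sum]

/-- The operator `f ↦ ½ div H_f` of the symplectic form `d (∑ dx ξ)` and the volume form
`ρ D^*(dx, dξ)`. -/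
def bvOp (t : SuperCoords B σ m) (ρ : B) : B →ₗ[ℝ] B where
  toFun f := Ring.inverse ρ * ((1 / 2 : ℝ) • t.bvDiv ρ (t.ham f))
  map_add' f f' := by rw [ham_add, bvDiv_add, smul_add, mul_add]
  map_smul' r f := by
    rw [ham_smul, bvDiv_smul, smul_comm (1 / 2 : ℝ) r, mul_smul_comm, RingHom.id_apply]

lemma bvOp_apply (t : SuperCoords B σ m) (ρ f : B) :
    t.bvOp ρ f = Ring.inverse ρ * ((1 / 2 : ℝ) • t.bvDiv ρ (t.ham f)) := rfl

lemma bvOp_one (t : SuperCoords B σ m) (ρ : B) : t.bvOp ρ 1 = 0 := by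
  have h : t.ham 1 = 0 := by
    ext b
    simp [ham_apply, fun i => (t.dξ_isVF i).map_one, fun i => (t.dx_isVF i).map_one]
  rw [bvOp_apply, h, bvDiv]
  simp

/-- The sum of the homogeneous parts of the Hamiltonian vector field. -/
lemma exists_ham_eq_add (hB : IsSuperComm σ) (t : SuperCoords B σ m) (f : B) :
    ∃ H₀ H₁, IsVF σ 0 H₀ ∧ IsVF σ 1 H₁ ∧ t.ham f = H₀ + H₁ := by
  obtain ⟨f₀, f₁, h₀, h₁, rfl⟩ := exists_even_add_odd hB f
  refine ⟨t.ham f₁, t.ham f₀, t.ham_isVF hB (by simp [h₁]), t.ham_isVF hB (by simp [h₀]), ?_⟩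
  rw [ham_add, add_comm]

lemma ham_eq_sum (t : SuperCoords B σ m) (f b : B) :
    t.ham f b = ∑ a, t.ham f (t.co a) * t.d a b := by
  rw [Fintype.sum_sum_type]
  simp only [co, d, Sum.elim_inl, Sum.elim_inr, ham_x, ham_ξ, neg_mul, Finset.sum_neg_distrib]
  rw [ham_apply, sub_eq_add_neg]

/-- Coordinate vector fields are determined by the coordinates. -/
lemma d_eq_of_co_eq {t t' : SuperCoords B σ m} (h : ∀ a, t.co a = t'.co a) (a : Fin m ⊕ Fin m) :
    t.d a = t'.d a :=
  t.ext_vf (t.d_isVF a) (t'.d_isVF a) fun b => by rw [t.d_co, h b, t'.d_co]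

end SuperCoords

namespace Adapted

variable {t : SuperCoords B σ m} {h : HolData m B} {g : B}

lemma etaC_add_right (h : HolData m B) (w v v' : B →ₗ[ℝ] B) :
    h.etaC σ w (v + v') = h.etaC σ w v + h.etaC σ w v' := by
  simp only [HolData.etaC, LinearMap.baseChange_add, LinearMap.add_apply, map_add, mul_add,
    ← sum_add_distrib]
  refine sum_congr rfl fun α _ => ?_
  abel

lemma _root_.SpecialSlice.HolData.cmap_etaC {B' L : Type*} [Ring B'] [Algebra ℝ B'] [Ring L]
    [Algebra ℝ L] {σ' : B' →ₐ[ℝ] B'} {τ : L →ₐ[ℝ] L} (h : HolData m B) {φ : B →ₐ[ℝ] L}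
    {φ' : B' →ₐ[ℝ] L} {ψ : B →ₐ[ℝ] B'} {w v : B →ₗ[ℝ] B} {w' v' : B' →ₗ[ℝ] B'}
    (hw : ∀ b, φ (w b) = φ' (w' (ψ b))) (hv : ∀ b, φ (v b) = φ' (v' (ψ b)))
    (hσ : ∀ b, φ (σ b) = τ (φ b)) (hσ' : ∀ b, φ' (σ' b) = τ (φ' b)) :
    cmap φ (h.etaC σ w v) = cmap φ' ((h.map ψ).etaC σ' w' v') := by
  have hz : ∀ α, cmap ψ (h.z α) = (h.map ψ).z α := fun α => cmap_cpx _ _ _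
  have hζ : ∀ α, cmap ψ (h.ζ α) = (h.map ψ).ζ α := fun α => cmap_cpx _ _ _
  have e1 : ∀ u, cmap φ (σ.toLinearMap.baseChange ℂ u) = cmap τ (cmap φ u) := fun u => by
    rw [← cpx_re_im u]
    simp only [baseChange_cpx, cmap_cpx, AlgHom.toLinearMap_apply, hσ]
  have e2 : ∀ u, cmap φ' (σ'.toLinearMap.baseChange ℂ u) = cmap τ (cmap φ' u) := fun u => by
    rw [← cpx_re_im u]
    simp only [baseChange_cpx, cmap_cpx, AlgHom.toLinearMap_apply, hσ']
  rw [HolData.etaC, HolData.etaC, map_sum, map_sum]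
  refine sum_congr rfl fun α _ => ?_
  rw [map_sub, map_sub, map_mul, map_mul, map_mul, map_mul, e1, e2, ← hz, ← hζ,
    cmap_baseChange hw, cmap_baseChange hw, cmap_baseChange hv, cmap_baseChange hv]

lemma etaC_eq' (hB : IsSuperComm σ) (ht : Adapted t h g) {s : Fin 2} {w v : B →ₗ[ℝ] B}
    (hw : IsVF σ s w) (hv : ∃ v₀ v₁, IsVF σ 0 v₀ ∧ IsVF σ 1 v₁ ∧ v = v₀ + v₁) :
    h.etaC σ w v = 1 ⊗ₜ t.canonEta w v := by
  obtain ⟨v₀, v₁, h₀, h₁, rfl⟩ := hv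
  rw [etaC_add_right, ht.etaC_eq hB hw h₀, ht.etaC_eq hB hw h₁, t.canonEta_add,
    TensorProduct.tmul_add]

/-- A Hamiltonian vector field is the one computed in adapted coordinates. -/
lemma eq_ham (hB : IsSuperComm σ) (ht : Adapted t h g) {H : B →ₗ[ℝ] B} {f : B}
    (hH : ∃ H₀ H₁, IsVF σ 0 H₀ ∧ IsVF σ 1 H₁ ∧ H = H₀ + H₁)
    (hf : ∀ (s : Fin 2) (w : B →ₗ[ℝ] B), IsVF σ s w → h.etaC σ w H = 1 ⊗ₜ w f) : H = t.ham f := by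
  have h1 : ∀ a, H (t.co a) = t.ham f (t.co a) := t.co_eq_of_canonEta hB fun s w hw =>
    one_tmul_injective (by
      show (1 : ℂ) ⊗ₜ[ℝ] t.canonEta w H = 1 ⊗ₜ w f
      rw [← ht.etaC_eq' hB hw hH, hf s w hw])
  obtain ⟨H₀, H₁, h₀, h₁, rfl⟩ := hH
  ext b
  rw [t.ham_eq_sum]
  simp only [← h1, LinearMap.add_apply, add_mul, sum_add_distrib]
  rw [← t.span' h₀, ← t.span' h₁]

/-- The Batalin–Vilkovisky operator computed in arbitrary supercoordinates. -/
lemma bvOp_eq (hB : IsSuperComm σ) (ht : Adapted t h g) (q : SuperCoords B σ m) (f : B) :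
    rePart (h.density q.dx q.dξ) * t.bvOp (g ^ 2) f =
      (1 / 2 : ℝ) • q.bvDiv (rePart (h.density q.dx q.dξ)) (t.ham f) := by
  obtain ⟨-, κ, hκ, hdiv⟩ := ht.exists_compare hB q
  obtain ⟨H₀, H₁, h₀, h₁, hH⟩ := t.exists_ham_eq_add hB f
  rw [hκ, rePart_one_tmul, SuperCoords.bvOp_apply, mul_assoc, ← mul_assoc (g ^ 2),
    Ring.mul_inverse_cancel _ (ht.isUnit.pow 2), one_mul, mul_smul_comm]
  congr 1
  rw [hH, SuperCoords.bvDiv_add, SuperCoords.bvDiv_add, mul_add, hdiv 0 _ h₀, hdiv 1 _ h₁]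

end Adapted

end BVAlgebra

section BV

lemma sliceCoords_resX (hι : IsRealSlice (m := m) ι) {k : RChart m X}
    (hk : k ∈ atlas (RE m) X) {V V' : Opens X} (hV : V' ≤ V) (hVk : V ≤ domX k) :
    (∀ a, (sliceCoords hι hk (hV.trans hVk)).co a = resX ι hV ((sliceCoords hι hk hVk).co a)) ∧
    ∀ a b, (sliceCoords hι hk (hV.trans hVk)).d a (resX ι hV b) =
      resX ι hV ((sliceCoords hι hk hVk).d a b) := by
  have hco : ∀ a, (sliceCoords hι hk (hV.trans hVk)).co a =
      resX ι hV ((sliceCoords hι hk hVk).co a) := fun a => by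
    refine ext_evX fun x => ?_
    rw [evX_resX]
    cases a with
    | inl i =>
      exact (evX_scalX hι hk (hV.trans hVk) _ (contDiff_coord (stdBasis m) i).contDiffOn x).trans
        (evX_scalX hι hk hVk _ (contDiff_coord (stdBasis m) i).contDiffOn ⟨x, hV x.2⟩).symm
    | inr i =>
      exact (evX_sliceCoords_ξ hι hk (hV.trans hVk) i x).trans
        (evX_sliceCoords_ξ hι hk hVk i ⟨x, hV x.2⟩).symm
  refine ⟨hco, fun a b => ?_⟩
  obtain ⟨q', hq', hq⟩ := exists_resCoords hι hV (sliceCoords hι hk hVk)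
  rw [SuperCoords.d_eq_of_co_eq (t' := q') (fun a => (hco a).trans (hq' a).symm), hq]

lemma densX_resX (hΩ : IsHolomorphicForm Ω) (hι : IsRealSlice (m := m) ι)
    {k : RChart m X} (hk : k ∈ atlas (RE m) X) {V V' : Opens X} (hV : V' ≤ V)
    (hVk : V ≤ domX k) :
    densX hΩ hι hk (hV.trans hVk) = resX ι hV (densX hΩ hι hk hVk) := ext_evX fun x => by
  rw [evX_resX, densX, densX, evX_scalX, evX_scalX]

/-- The Batalin–Vilkovisky operator over a chart domain. -/
def bvLoc (hΩ : IsHolomorphicForm Ω) (hι : IsRealSlice (m := m) ι)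
    {k : RChart m X} (hk : k ∈ atlas (RE m) X) {V : Opens X}
    (hVk : V ≤ domX k) : 𝒪 V →ₗ[ℝ] 𝒪 V :=
  (sliceCoords hι hk hVk).bvOp (densX hΩ hι hk hVk ^ 2)

lemma resX_ham (hι : IsRealSlice (m := m) ι)
    {k : RChart m X} (hk : k ∈ atlas (RE m) X) {V V' : Opens X}
    (hV : V' ≤ V) (hVk : V ≤ domX k) (f b : 𝒪 V) :
    (sliceCoords hι hk (hV.trans hVk)).ham (resX ι hV f) (resX ι hV b) =
      resX ι hV ((sliceCoords hι hk hVk).ham f b) := by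
  have h := (sliceCoords_resX hι hk hV hVk).2
  have hx := fun i b => h (Sum.inl i) b
  have hξ := fun i b => h (Sum.inr i) b
  simp only [SuperCoords.d, Sum.elim_inl, Sum.elim_inr] at hx hξ
  rw [SuperCoords.ham_apply, SuperCoords.ham_apply, map_sub, map_sum, map_sum]
  simp only [hx, hξ, ← resX_parity, map_mul]

lemma resX_bvLoc (hΩ : IsHolomorphicForm Ω) (hS : IsSpecialSlice ι Ω)
    {k : RChart m X} (hk : k ∈ atlas (RE m) X) {V V' : Opens X} (hV : V' ≤ V)
    (hVk : V ≤ domX k) (f : 𝒪 V) :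
    resX ι hV (bvLoc hΩ hS.slice hk hVk f) = bvLoc hΩ hS.slice hk (hV.trans hVk) (resX ι hV f) := by
  have hu : IsUnit (densX hΩ hS.slice hk hVk ^ 2) :=
    (isUnit_densX hΩ hS.slice hk hVk hS.ne_zero hS.im_eq_zero).pow 2
  have h1 := map_ringInverse (resX ι hV).toRingHom hu
  have h2 := sliceCoords_resX hS.slice hk hV hVk
  have h3 := resX_bvDiv hV h2.1 h2.2 (densX hΩ hS.slice hk hVk ^ 2)
    (resX_ham hS.slice hk hV hVk f)
  have h4 : resX ι hV (densX hΩ hS.slice hk hVk ^ 2) =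
    densX hΩ hS.slice hk (hV.trans hVk) ^ 2 := by rw [map_pow, ← densX_resX]
  rw [bvLoc, bvLoc, SuperCoords.bvOp_apply, SuperCoords.bvOp_apply, map_mul]
  refine congrArg₂ (· * ·) (h1.trans (congrArg _ h4)) ?_
  refine (LinearMap.map_smul (resX ι hV).toLinearMap (1 / 2 : ℝ) _).trans (congrArg _ ?_)
  refine h3.trans ?_
  rw [h4]

section Operator

variable {hΩ : IsHolomorphicForm Ω} {c : CChart m Y} {hc : c ∈ atlas (CE m) Y}
  {k : RChart m X} {hk : k ∈ atlas (RE m) X}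

lemma adapted (hS : IsSpecialSlice ι Ω) (hk : k ∈ atlas (RE m) X) {V : Opens X} (hVk : V ≤ domX k)
    (hVc : V ≤ pre ι (dom c)) :
    Adapted (sliceCoords hS.slice hk hVk) (holDataX ι hΩ hc hVc) (densX hΩ hS.slice hk hVk) :=
  adapted_slice hΩ hc hS.slice hk hVk hVc hS.ne_zero hS.im_eq_zero

lemma isHamiltonian_ham (hS : IsSpecialSlice ι Ω) (hk : k ∈ atlas (RE m) X) {V : Opens X}
    (hVk : V ≤ domX k) (hVc : V ≤ pre ι (dom c)) (f : 𝒪 V) :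
    IsHamiltonian ι hΩ hc hVc f ((sliceCoords hS.slice hk hVk).ham f) := by
  have hH := (sliceCoords hS.slice hk hVk).exists_ham_eq_add (isSuperCommX ι V) f
  refine ⟨hH, fun s w hw => ?_⟩
  rw [(adapted (hΩ := hΩ) (hc := hc) hS hk hVk hVc).etaC_eq' (isSuperCommX ι V) hw hH,
    SuperCoords.canonEta_ham _ (isSuperCommX ι V) hw]

/-- The divergence of a Hamiltonian vector field, in arbitrary supercoordinates. -/
lemma rho_mul_bvLoc (hS : IsSpecialSlice ι Ω) (hk : k ∈ atlas (RE m) X) {V : Opens X}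
    (hVk : V ≤ domX k) (hVc : V ≤ pre ι (dom c)) (q : SuperCoords (𝒪 V) (parityX ι V) m)
    {f : 𝒪 V} {H : 𝒪 V →ₗ[ℝ] 𝒪 V}
    (hH : IsHamiltonian ι hΩ hc hVc f H) :
    rho ι hΩ hc hVc q * bvLoc hΩ hS.slice hk hVk f =
      (1 / 2 : ℝ) • q.bvDiv (rho ι hΩ hc hVc q) H := by
  have ht := adapted (hΩ := hΩ) (hc := hc) hS hk hVk hVc
  rw [ht.eq_ham (isSuperCommX ι V) hH.1 hH.2]
  exact ht.bvOp_eq (isSuperCommX ι V) q f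

lemma rho_sliceCoords (hS : IsSpecialSlice ι Ω) (hk : k ∈ atlas (RE m) X) {V : Opens X}
    (hVk : V ≤ domX k) (hVc : V ≤ pre ι (dom c)) :
    rho ι hΩ hc hVc (sliceCoords hS.slice hk hVk) = densX hΩ hS.slice hk hVk ^ 2 := by
  rw [rho, (adapted hS hk hVk hVc).density_eq (isSuperCommX ι V), rePart_one_tmul]

/-- The value of the operator is determined by the slice coordinates. -/
lemma eq_bvLoc (hS : IsSpecialSlice ι Ω) (hk : k ∈ atlas (RE m) X) {V : Opens X}
    (hVk : V ≤ domX k) (hVc : V ≤ pre ι (dom c)) {f u : 𝒪 V}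
    (hu : rho ι hΩ hc hVc (sliceCoords hS.slice hk hVk) * u = (1 / 2 : ℝ) •
      (sliceCoords hS.slice hk hVk).bvDiv (rho ι hΩ hc hVc (sliceCoords hS.slice hk hVk))
        ((sliceCoords hS.slice hk hVk).ham f)) :
    u = bvLoc hΩ hS.slice hk hVk f := by
  rw [← rho_mul_bvLoc hS hk hVk hVc _ (isHamiltonian_ham hS hk hVk hVc f),
    rho_sliceCoords hS hk hVk hVc] at hu
  exact ((isUnit_densX hΩ hS.slice hk hVk hS.ne_zero hS.im_eq_zero).pow 2).mul_left_cancel hu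

lemma bvLoc_congr_chart (hS : IsSpecialSlice ι Ω) (hk : k ∈ atlas (RE m) X)
    {k' : RChart m X} (hk' : k' ∈ atlas (RE m) X) {V : Opens X}
    (hVk : V ≤ domX k) (hVk' : V ≤ domX k') (hc : c ∈ atlas (CE m) Y) (hVc : V ≤ pre ι (dom c))
    (f : 𝒪 V) : bvLoc hΩ hS.slice hk hVk f = bvLoc hΩ hS.slice hk' hVk' f :=
  eq_bvLoc (hc := hc) hS hk' hVk' hVc
    (rho_mul_bvLoc hS hk hVk hVc _ (isHamiltonian_ham hS hk' hVk' hVc f))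

lemma evX_bvLoc_congr (hS : IsSpecialSlice ι Ω) (hk : k ∈ atlas (RE m) X)
    {k' : RChart m X} (hk' : k' ∈ atlas (RE m) X) {V V' : Opens X}
    (hVk : V ≤ domX k) (hVk' : V' ≤ domX k') (f : GammaX (m := m) ι) (x : X) (hx : x ∈ V)
    (hx' : x ∈ V') : evX ι V ⟨x, hx⟩ (bvLoc hΩ hS.slice hk hVk (resX ι le_top f)) =
      evX ι V' ⟨x, hx'⟩ (bvLoc hΩ hS.slice hk' hVk' (resX ι le_top f)) := by
  set c := chartAt (CE m) (ι x)
  set W : Opens X := V ⊓ V' ⊓ pre ι (dom c)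
  have hW : W ≤ V := inf_le_left.trans inf_le_left
  have hW' : W ≤ V' := inf_le_left.trans inf_le_right
  have hxW : x ∈ W := ⟨⟨hx, hx'⟩, mem_chart_source (CE m) (ι x)⟩
  have h := bvLoc_congr_chart (hΩ := hΩ) (c := c) hS hk hk' (hW.trans hVk) (hW'.trans hVk')
    (chart_mem_atlas _ _) inf_le_right (resX ι le_top f)
  have h1 := (resX_bvLoc hΩ hS hk hW hVk (resX ι le_top f)).trans
    (h.trans (resX_bvLoc hΩ hS hk' hW' hVk' (resX ι le_top f)).symm)
  exact congrArg (evX ι W ⟨x, hxW⟩) h1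

/-- The value of the Batalin–Vilkovisky operator at a point. -/
def bvAt (hΩ : IsHolomorphicForm Ω) (hS : IsSpecialSlice ι Ω) (x : X) :
    GammaX (m := m) ι →ₗ[ℝ] ExteriorAlgebra ℝ (NX (m := m) ι x) :=
  (evX ι (domX (chartAt (RE m) x)) ⟨x, mem_chart_source _ _⟩).toLinearMap ∘ₗ
    bvLoc hΩ hS.slice (chart_mem_atlas _ _) le_rfl ∘ₗ
      (resX ι (le_top : domX (chartAt (RE m) x) ≤ ⊤)).toLinearMap

/-- The global Batalin–Vilkovisky operator on functions. -/
def bvGlobal (hΩ : IsHolomorphicForm Ω) (hS : IsSpecialSlice ι Ω) :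
    GammaX (m := m) ι →ₗ[ℝ] GammaX (m := m) ι where
  toFun f := ⟨fun x => bvAt hΩ hS (x : X) f,
    isNormalSection_of_local hS.slice fun x => ⟨domX (chartAt (RE m) (x : X)), mem_chart_source _ _,
      bvLoc hΩ hS.slice (chart_mem_atlas _ _) le_rfl (resX ι le_top f), fun x' hx' =>
        evX_bvLoc_congr hS (chart_mem_atlas _ _) (chart_mem_atlas _ _) le_rfl le_rfl f x' _ hx'⟩⟩
  map_add' f f' := ext_evX fun x => map_add (bvAt hΩ hS (x : X)) f f'
  map_smul' r f := ext_evX fun x => map_smul (bvAt hΩ hS (x : X)) r f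

lemma resX_bvGlobal (hS : IsSpecialSlice ι Ω) (hk : k ∈ atlas (RE m) X) {V : Opens X}
    (hVk : V ≤ domX k) (f : GammaX (m := m) ι) :
    resX ι le_top (bvGlobal hΩ hS f) = bvLoc hΩ hS.slice hk hVk (resX ι le_top f) :=
  ext_evX fun x =>
    evX_bvLoc_congr hS (chart_mem_atlas _ _) hk le_rfl hVk f x (mem_chart_source _ _) x.2

/-- The Batalin–Vilkovisky operator on functions modulo constants. -/
def bvOperator (hΩ : IsHolomorphicForm Ω) (hS : IsSpecialSlice ι Ω) :
    (GammaX (m := m) ι ⧸ constants (m := m) ι) →ₗ[ℝ] GammaX (m := m) ι :=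
  (constants (m := m) ι).liftQ (bvGlobal hΩ hS) (by
    rw [constants, Submodule.span_singleton_le_iff_mem, LinearMap.mem_ker]
    refine ext_evX fun x => ?_
    have h1 : bvLoc hΩ hS.slice (chart_mem_atlas _ (x : X)) le_rfl (resX ι le_top 1) = 0 := by
      rw [map_one (resX ι _), bvLoc, SuperCoords.bvOp_one]
    exact congrArg (evX ι (domX (chartAt (RE m) (x : X))) ⟨x, mem_chart_source _ _⟩) h1)

/-- The restriction of a Hamiltonian vector field to an open subset is Hamiltonian. -/
lemma IsHamiltonian.exists_resX (hι : IsRealSlice (m := m) ι) {V V' : Opens X} (hV : V' ≤ V)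
    {hVc : V ≤ pre ι (dom c)} {f : 𝒪 V}
    {H : 𝒪 V →ₗ[ℝ] 𝒪 V} (hH : IsHamiltonian ι hΩ hc hVc f H) :
    ∃ H' : 𝒪 V' →ₗ[ℝ] 𝒪 V', (∀ b, H' (resX ι hV b) = resX ι hV (H b)) ∧
      IsHamiltonian ι hΩ hc (hV.trans hVc) (resX ι hV f) H' := by
  obtain ⟨⟨H₀, H₁, h₀, h₁, rfl⟩, h⟩ := hH
  obtain ⟨H₀', h₀', hr₀, -⟩ := exists_resDer hι hV h₀
  obtain ⟨H₁', h₁', hr₁, -⟩ := exists_resDer hι hV h₁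
  have hr : ∀ b, (H₀' + H₁') (resX ι hV b) = resX ι hV ((H₀ + H₁) b) := fun b => by
    rw [LinearMap.add_apply, LinearMap.add_apply, map_add, hr₀, hr₁]
  refine ⟨H₀' + H₁', hr, ⟨_, _, h₀', h₁', rfl⟩, fun s w hw => ext_cmap_evX fun x => ?_⟩
  -- The test field `w` is cut off near `x` and extended by zero to `V`.
  obtain ⟨χ, hχ, hsupp, W, hxW, hW⟩ := exists_bump (m := m) (X := X) x.2
  have hEx : ∀ d, evX ι V ⟨x, hV x.2⟩ (extX hι χ hχ hsupp V d) = evX ι V' x d := fun d => by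
    rw [evX_extX hι hχ hsupp d ⟨x, hV x.2⟩ x.2]
    exact (congrArg (· • evX ι V' x d) (hW _ hxW)).trans (one_smul _ _)
  have h1 := congrArg (cmap (evX ι V ⟨x, hV x.2⟩)) (h s _ (isVF_extX hι hχ hsupp hV hw))
  rw [cmap_tmul] at h1
  have h2 : evX ι V ⟨x, hV x.2⟩ ((extX hι χ hχ hsupp V ∘ₗ w ∘ₗ (resX ι hV).toLinearMap) f) =
      evX ι V' x (w (resX ι hV f)) := hEx _
  rw [cmap_tmul, ← h2, ← h1]
  exact (HolData.cmap_etaC (σ := parityX ι V) (σ' := parityX ι V') (τ := extParity _)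
    (holDataX ι hΩ hc hVc) (ψ := resX ι hV) (fun d => hEx _)
    (fun d => (congrArg (evX ι V' x) (hr d)).symm) (fun _ => rfl) fun _ => rfl).symm

/-- In any supercoordinates, `Δ f` is half the divergence of the Hamiltonian vector field of `f`. -/
theorem isBVOperator_bvOperator (hΩ : IsHolomorphicForm Ω) (hS : IsSpecialSlice ι Ω) :
    IsBVOperator ι hΩ (bvOperator hΩ hS) := by
  intro f c hc V hVc q H hH
  show _ = (1 / 2 : ℝ) • q.bvDiv (rho ι hΩ hc hVc q) H
  refine ext_resX_chart fun k hk V' hV hVk => ?_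
  obtain ⟨q', hco, hq⟩ := exists_resCoords hS.slice hV q
  obtain ⟨H', hr, hH'⟩ := hH.exists_resX hS.slice hV
  have h1 := rho_mul_bvLoc hS hk hVk (hV.trans hVc) q' hH'
  have h2 : resX ι hV (resX ι le_top (bvOperator hΩ hS ((constants (m := m) ι).mkQ f))) =
      bvLoc hΩ hS.slice hk hVk (resX ι hV (resX ι le_top f)) :=
    resX_bvGlobal hS hk hVk f
  have h3 := resX_bvDiv hV hco hq (rho ι hΩ hc hVc q) hr
  have h4 := resX_rho (hΩ := hΩ) (hc := hc) hS hV hVc hq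
  rw [map_mul, h2, h4, h1]
  refine Eq.trans ?_ (LinearMap.map_smul (resX ι hV).toLinearMap (1 / 2 : ℝ) _).symm
  refine congrArg _ (Eq.trans ?_ h3.symm)
  rw [h4]

theorem eq_bvOperator (hΩ : IsHolomorphicForm Ω) (hS : IsSpecialSlice ι Ω)
    {Δ : (GammaX (m := m) ι ⧸ constants (m := m) ι) →ₗ[ℝ] GammaX (m := m) ι}
    (hΔ : IsBVOperator ι hΩ Δ) : Δ = bvOperator hΩ hS := by
  ext f
  refine ext_resX_charts fun c hc k hk V hVc hVk => ?_
  have h1 := hΔ f c hc V hVc (sliceCoords hS.slice hk hVk) _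
    (isHamiltonian_ham hS hk hVk hVc (resX ι le_top f))
  exact (eq_bvLoc hS hk hVk hVc h1).trans (resX_bvGlobal hS hk hVk f).symm

end Operator

end BV

end Slice

/-! ### Superderivations of `𝒪_𝒴` at a point of the slice -/

section PointDer

variable {m : ℕ} {Y : Type*} [TopologicalSpace Y] [ChartedSpace (CE m) Y]
  [IsManifold 𝓘(ℂ, CE m) ω Y]

/-- The real basis `∂/∂x^α`, `∂/∂x'^α` of `ℂ^m`. -/
def reBasis (m : ℕ) : Module.Basis (Fin m ⊕ Fin m) ℝ (CE m) :=
  Module.Basis.ofEquivFun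
    { toFun := fun e => Sum.elim (fun α => (e α).re) fun α => (e α).im
      map_add' := fun e f => by ext a; cases a <;> simp
      map_smul' := fun r e => by ext a; cases a <;> simp
      invFun := fun f => WithLp.toLp 2 fun α => ⟨f (Sum.inl α), f (Sum.inr α)⟩
      left_inv := fun e => by ext α; rfl
      right_inv := fun f => by ext a; cases a <;> rfl }

lemma reBasis_coord_inl (α : Fin m) (e : CE m) : (reBasis m).coord (Sum.inl α) e = (e α).re := rfl

lemma reBasis_coord_inr (α : Fin m) (e : CE m) : (reBasis m).coord (Sum.inr α) e = (e α).im := rfl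

lemma reBasis_inl (α : Fin m) : reBasis m (Sum.inl α) = EuclideanSpace.single α 1 := by
  apply (reBasis m).repr.injective
  ext a
  rw [Module.Basis.repr_self, ← Module.Basis.coord_apply]
  cases a with
  | inl β =>
    rw [reBasis_coord_inl]
    by_cases h : β = α
    · simp [h]
    · simp [h]
  | inr β =>
    rw [reBasis_coord_inr]
    by_cases h : β = α <;> simp [h]

lemma reBasis_inr (α : Fin m) : reBasis m (Sum.inr α) = EuclideanSpace.single α Complex.I := by
  apply (reBasis m).repr.injective
  ext a
  rw [Module.Basis.repr_self, ← Module.Basis.coord_apply]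
  cases a with
  | inl β =>
    rw [reBasis_coord_inl]
    by_cases h : β = α <;> simp [h]
  | inr β =>
    rw [reBasis_coord_inr]
    by_cases h : β = α
    · simp [h]
    · simp [h]

/-- Evaluation of sections of `Λ TY` at a point. -/
def evY (U : Opens Y) (y : U) : OY m U →ₐ[ℝ] ExteriorAlgebra ℝ (TY m (y : Y)) :=
  (Pi.evalAlgHom ℝ (fun y : U => ExteriorAlgebra ℝ (TY m (y : Y))) y).comp (sectionsY m U).val

lemma ext_evY {U : Opens Y} {s t : OY m U} (h : ∀ y, evY U y s = evY U y t) : s = t :=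
  Subtype.ext (funext h)

lemma ext_cmap_evY {U : Opens Y} {u v : ℂ ⊗[ℝ] OY m U}
    (h : ∀ y, cmap (evY U y) u = cmap (evY U y) v) : u = v := by
  rw [← cpx_re_im u, ← cpx_re_im v] at h ⊢
  simp only [cmap_cpx, cpx_inj] at h ⊢
  exact ⟨ext_evY fun x => (h x).1, ext_evY fun x => (h x).2⟩

variable {U : Opens Y} {c : CChart m Y} (hc : c ∈ atlas (CE m) Y)
  (hU : U ≤ dom c)

/-- A smooth function of the coordinates of the chart `c`, as an element of `𝒪_𝒴(U)`. -/
def scalY (φ : CE m → ℝ) (hφ : ContDiffOn ℝ ∞ φ (img c U)) : OY m U :=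
  (trivY hc hU).symm (smoothExt.scalar φ hφ)

lemma evY_scalY (φ : CE m → ℝ) (hφ : ContDiffOn ℝ ∞ φ (img c U)) (y : U) :
    evY U y (scalY hc hU φ hφ) = algebraMap ℝ _ (φ (c (y : Y))) :=
  (trivY_symm_apply hc hU _ y).trans (AlgHom.commutes _ _)

/-- The coordinate vector fields of the chart `c` over `U`. -/
def vectY (e : CE m) : OY m U := (trivY hc hU).symm (smoothExt.const _ (ExteriorAlgebra.ι ℝ e))

lemma evY_vectY (e : CE m) (y : U) :
    evY U y (vectY hc hU e) = ExteriorAlgebra.ι ℝ (ofChart c (y : Y) e) :=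
  (trivY_symm_apply hc hU _ y).trans (ExteriorAlgebra.map_apply_ι _ _)

lemma trivY_symm_parity (a : smoothExt (CE m) (img c U)) :
    (trivY hc hU).symm (smoothExt.parity _ a) = parityY U ((trivY hc hU).symm a) := by
  apply (trivY hc hU).injective
  rw [trivY_parity, AlgEquiv.apply_symm_apply, AlgEquiv.apply_symm_apply]

/-- The holomorphic coordinates over `U`. -/
def holDataY {Ω : ∀ y : Y, (TangentSpace 𝓘(ℂ, CE m) y) [⋀^Fin m]→ₗ[ℂ] ℂ} (hΩ : IsHolomorphicForm Ω)
    (hc : c ∈ atlas (CE m) Y) (hU : U ≤ dom c) : HolData m (OY m U) := (holData hΩ hc).map (resY hU)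

variable {Ω : ∀ y : Y, (TangentSpace 𝓘(ℂ, CE m) y) [⋀^Fin m]→ₗ[ℂ] ℂ} (hΩ : IsHolomorphicForm Ω)

lemma holDataY_x (α : Fin m) : (holDataY hΩ hc hU).x α =
    scalY hc hU _ (contDiff_coord (reBasis m) (Sum.inl α)).contDiffOn :=
  ext_evY fun y => by rw [evY_scalY]; rfl

lemma holDataY_x' (α : Fin m) : (holDataY hΩ hc hU).x' α =
    scalY hc hU _ (contDiff_coord (reBasis m) (Sum.inr α)).contDiffOn :=
  ext_evY fun y => by rw [evY_scalY]; rfl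

lemma holDataY_ψ (α : Fin m) : (holDataY hΩ hc hU).ψ α = vectY hc hU (reBasis m (Sum.inl α)) :=
  ext_evY fun y => by rw [evY_vectY, reBasis_inl]; rfl

lemma holDataY_ψ' (α : Fin m) : (holDataY hΩ hc hU).ψ' α = vectY hc hU (reBasis m (Sum.inr α)) :=
  ext_evY fun y => by rw [evY_vectY, reBasis_inr]; rfl

variable {X : Type*} [TopologicalSpace X] [ChartedSpace (RE m) X] {ι : C(X, Y)}

/-- Evaluation of functions on `𝒴` at a point of `𝒳`. -/
def atX (ι : C(X, Y)) (U : Opens Y) (x : X) (hx : ι x ∈ U) :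
    OY m U →ₐ[ℝ] ExteriorAlgebra ℝ (NX (m := m) ι x) :=
  (toNormal ι x).comp (evY U ⟨ι x, hx⟩)

lemma atX_parity {x : X} (hx : ι x ∈ U) (a : OY m U) :
    atX ι U x hx (parityY U a) = extParity _ (atX ι U x hx a) := map_extParity _ _

section Der

variable {x : X} {hx : ι x ∈ U} {s : Fin 2} {δ δ' : OY m U →ₗ[ℝ] ExteriorAlgebra ℝ (NX (m := m) ι x)}

lemma isSuperDer_trivY (hδ : IsSuperDer (parityY U) (extParity _) (atX ι U x hx) s δ) :
    IsSuperDer (smoothExt.parity _) (extParity _) ((atX ι U x hx).comp (trivY hc hU).symm.toAlgHom) s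
      (δ ∘ₗ (trivY hc hU).symm.toAlgHom.toLinearMap) :=
  hδ.comp_right _ (trivY_symm_parity hc hU)

lemma atX_scalY (φ : CE m → ℝ) (hφ : ContDiffOn ℝ ∞ φ (img c U)) :
    atX ι U x hx (scalY hc hU φ hφ) = algebraMap ℝ _ (φ (c (ι x))) := by
  rw [atX, AlgHom.comp_apply, evY_scalY, AlgHom.commutes]

lemma der_scalY (hδ : IsSuperDer (parityY U) (extParity _) (atX ι U x hx) s δ) (φ : CE m → ℝ)
    (hφ : ContDiffOn ℝ ∞ φ (img c U)) : δ (scalY hc hU φ hφ) =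
      ∑ a, fderiv ℝ φ (c (ι x)) (reBasis m a) •
        δ (scalY hc hU _ (contDiff_coord (reBasis m) a).contDiffOn) :=
  smoothExt.der_scalar (p := ⟨c (ι x), mem_img (hU hx) hx⟩) (isSuperDer_trivY hc hU hδ)
    (fun φ hφ => atX_scalY hc hU φ hφ) (reBasis m)
    (fun a => (contDiff_coord (reBasis m) a).contDiffOn) hφ

/-- A superderivation at a point is determined by its values on holomorphic coordinates. -/
lemma der_ext_hco (hδ : IsSuperDer (parityY U) (extParity _) (atX ι U x hx) s δ)
    (hδ' : IsSuperDer (parityY U) (extParity _) (atX ι U x hx) s δ')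
    (h : ∀ b, δ.baseChange ℂ ((holDataY hΩ hc hU).hco b) =
      δ'.baseChange ℂ ((holDataY hΩ hc hU).hco b)) : δ = δ' := by
  have h1 := fun α => h (Sum.inl α)
  have h2 := fun α => h (Sum.inr α)
  simp only [HolData.hco, Sum.elim_inl, Sum.elim_inr, HolData.z, HolData.ζ, baseChange_cpx, cpx_inj,
    holDataY_x, holDataY_x', holDataY_ψ, holDataY_ψ'] at h1 h2
  ext t
  have key : ∀ {d : OY m U →ₗ[ℝ] ExteriorAlgebra ℝ (NX (m := m) ι x)},
      IsSuperDer (parityY U) (extParity _) (atX ι U x hx) s d → d t = _ := fun {d} hd => by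
    have := smoothExt.der_eq_sum (p := ⟨c (ι x), mem_img (hU hx) hx⟩) isSuperComm_ext
      (fun a => by
        show atX ι U x hx ((trivY hc hU).symm _) = extParity _ (atX ι U x hx ((trivY hc hU).symm _))
        rw [trivY_symm_parity, atX_parity]) (isSuperDer_trivY hc hU hd)
      (fun φ hφ => atX_scalY hc hU φ hφ) (reBasis m)
      (fun a => (contDiff_coord (reBasis m) a).contDiffOn) (reBasis m) (trivY hc hU t)
    refine Eq.trans ?_ this
    exact congrArg d ((trivY hc hU).symm_apply_apply t).symm
  rw [key hδ, key hδ']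
  congr 1
  · refine sum_congr rfl fun a _ => ?_
    congr 1
    cases a with
    | inl α => exact (h1 α).1
    | inr α => exact (h1 α).2
  · refine sum_congr rfl fun a _ => ?_
    congr 1
    cases a with
    | inl α => exact (h2 α).2
    | inr α => exact (h2 α).1

/-- The contraction of a vector at a point with the Liouville form does not depend on the chart. -/
lemma liouville_congr {c' : CChart m Y} (hc' : c' ∈ atlas (CE m) Y)
    (hU' : U ≤ dom c') (hδ : IsSuperDer (parityY U) (extParity _) (atX ι U x hx) s δ) :
    ∑ α, (δ ((holDataY hΩ hc hU).x α) * atX ι U x hx ((holDataY hΩ hc hU).ψ α) +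
      δ ((holDataY hΩ hc hU).x' α) * atX ι U x hx ((holDataY hΩ hc hU).ψ' α)) =
    ∑ α, (δ ((holDataY hΩ hc' hU').x α) * atX ι U x hx ((holDataY hΩ hc' hU').ψ α) +
      δ ((holDataY hΩ hc' hU').x' α) * atX ι U x hx ((holDataY hΩ hc' hU').ψ' α)) := by
  have hsum : ∀ {c₁ : CChart m Y} (hc₁ : c₁ ∈ atlas (CE m) Y) (hU₁ : U ≤ dom c₁),
      ∑ α, (δ ((holDataY hΩ hc₁ hU₁).x α) * atX ι U x hx ((holDataY hΩ hc₁ hU₁).ψ α) +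
        δ ((holDataY hΩ hc₁ hU₁).x' α) * atX ι U x hx ((holDataY hΩ hc₁ hU₁).ψ' α)) =
      ∑ a, δ (scalY hc₁ hU₁ _ (contDiff_coord (reBasis m) a).contDiffOn) *
        atX ι U x hx (vectY hc₁ hU₁ (reBasis m a)) := fun hc₁ hU₁ => by
    rw [Fintype.sum_sum_type, ← sum_add_distrib]
    simp only [holDataY_x, holDataY_x', holDataY_ψ, holDataY_ψ']
  rw [hsum hc hU, hsum hc' hU']
  have hy : ι x ∈ c.source := hU hx
  have hy' : ι x ∈ c'.source := hU' hx
  set G : CE m →L[ℝ] CE m := fderiv ℝ (c' ∘ c.symm) (c (ι x)) with hG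
  have hsm : ∀ b, ContDiffOn ℝ ∞ (fun e => (reBasis m).coord b ((c' ∘ c.symm) e)) (img c U) :=
    fun b => (contDiff_coord (reBasis m) b).comp_contDiffOn ((contDiffOn_transition hc hc').mono
      fun e he => ⟨he.1, hU' he.2⟩)
  have hcoord : ∀ b, δ (scalY hc' hU' _ (contDiff_coord (reBasis m) b).contDiffOn) =
      ∑ a, (reBasis m).coord b (G (reBasis m a)) •
        δ (scalY hc hU _ (contDiff_coord (reBasis m) a).contDiffOn) := fun b => by
    have h1 : scalY hc' hU' _ (contDiff_coord (reBasis m) b).contDiffOn =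
        scalY hc hU _ (hsm b) := ext_evY fun y => by
      rw [evY_scalY, evY_scalY, Function.comp_apply, c.left_inv (hU y.2)]
    rw [h1, der_scalY hc hU hδ]
    refine sum_congr rfl fun a _ => ?_
    congr 1
    have h2 : HasFDerivAt (fun e => (reBasis m).coord b ((c' ∘ c.symm) e)) _ (c (ι x)) :=
      (LinearMap.toContinuousLinearMap ((reBasis m).coord b)).hasFDerivAt.comp _
        (hasFDerivAt_transition hc hc' hy hy').differentiableAt.hasFDerivAt
    rw [h2.fderiv]
    rfl
  have hvect : ∀ a, atX ι U x hx (vectY hc hU (reBasis m a)) =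
      ∑ b, (reBasis m).coord b (G (reBasis m a)) • atX ι U x hx (vectY hc' hU' (reBasis m b)) :=
    fun a => by
    have h1 : ∀ {c₁ : CChart m Y} (hc₁ : c₁ ∈ atlas (CE m) Y) (hU₁ : U ≤ dom c₁)
        (e : CE m), atX ι U x hx (vectY hc₁ hU₁ e) =
          (toNormal ι x).toLinearMap (ExteriorAlgebra.ι ℝ (ofChartL c₁ (ι x) e)) :=
      fun hc₁ hU₁ e => congrArg (toNormal ι x) (evY_vectY hc₁ hU₁ e ⟨ι x, hx⟩)
    simp only [h1]
    have h2 : ofChartL c (ι x) (reBasis m a) = ofChartL c' (ι x) (G (reBasis m a)) := by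
      rw [hG, ← toChart_ofChart hc hc' hy hy', ofChartL_apply, ofChartL_apply,
        ofChart_toChart hc' hy']
    rw [h2]
    conv_lhs => rw [← (reBasis m).sum_repr (G (reBasis m a))]
    simp only [map_sum, map_smul, Module.Basis.coord_apply]
  simp only [hcoord, hvect, mul_sum, sum_mul, smul_mul_assoc, mul_smul_comm]
  rw [sum_comm]

end Der

end PointDer

/-! ### Complex derivations and changes of holomorphic coordinates -/

section Holomorphic

lemma complex_smul_cpx {R : Type*} [Ring R] [Algebra ℝ R] (z : ℂ) (a b : R) :
    z • cpx a b = cpx (z.re • a - z.im • b) (z.re • b + z.im • a) := by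
  have h : z • cpx a b = (z ⊗ₜ[ℝ] (1 : R)) * cpx a b := by
    rw [← one_mul (cpx a b), ← smul_mul_assoc, Algebra.TensorProduct.one_def,
      TensorProduct.smul_tmul', smul_eq_mul, mul_one, ← mul_assoc,
      Algebra.TensorProduct.tmul_mul_tmul, mul_one, mul_one]
  rw [h, tmul_eq_cpx, cpx_mul]
  simp

lemma cder_mul {A B : Type*} [Ring A] [Algebra ℝ A] [Ring B] [Algebra ℝ B] {σA : A →ₐ[ℝ] A}
    {σB : B →ₐ[ℝ] B} {r : A →ₐ[ℝ] B} {s : Fin 2} {δ₁ δ₂ : A →ₗ[ℝ] B}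
    (h₁ : IsSuperDer σA σB r s δ₁) (h₂ : IsSuperDer σA σB r s δ₂) (u v : ℂ ⊗[ℝ] A) :
    cder δ₁ δ₂ (u * v) = cder δ₁ δ₂ u * cmap r v +
      (cmap σB ^ (s : ℕ)) (cmap r u) * cder δ₁ δ₂ v := by
  have e₁ := h₁.baseChange.1 u v
  have e₂ := h₂.baseChange.1 u v
  simp only [LinearMap.coe_restrictScalars] at e₁ e₂
  simp only [cder, LinearMap.add_apply, LinearMap.smul_apply, e₁, e₂, smul_add, add_mul, mul_add,
    smul_mul_assoc, mul_smul_comm]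
  abel

variable {m : ℕ} {Y : Type*} [TopologicalSpace Y] [ChartedSpace (CE m) Y]
  [IsManifold 𝓘(ℂ, CE m) ω Y]

lemma single_I (α : Fin m) : (EuclideanSpace.single α Complex.I : CE m) =
    Complex.I • EuclideanSpace.single α (1 : ℂ) := by
  ext β; by_cases h : β = α <;> simp [h]

variable {U : Opens Y} {c : CChart m Y} (hc : c ∈ atlas (CE m) Y)
  (hU : U ≤ dom c)

lemma contDiffOn_re_of_complex {F : CE m → ℂ} {O : Set (CE m)} (hF : ContDiffOn ℂ ω F O) :
    ContDiffOn ℝ ∞ (fun e => (F e).re) O :=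
  Complex.reCLM.contDiff.comp_contDiffOn ((hF.restrict_scalars ℝ).of_le le_top)

lemma contDiffOn_im_of_complex {F : CE m → ℂ} {O : Set (CE m)} (hF : ContDiffOn ℂ ω F O) :
    ContDiffOn ℝ ∞ (fun e => (F e).im) O :=
  Complex.imCLM.contDiff.comp_contDiffOn ((hF.restrict_scalars ℝ).of_le le_top)

/-- A holomorphic function of the coordinates of the chart `c`, as a complex function on `𝒴`. -/
def cfnY (F : CE m → ℂ) (hF : ContDiffOn ℂ ω F (img c U)) : ℂ ⊗[ℝ] OY m U :=
  cpx (scalY hc hU _ (contDiffOn_re_of_complex hF)) (scalY hc hU _ (contDiffOn_im_of_complex hF))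

lemma cmap_evY_cfnY (F : CE m → ℂ) (hF : ContDiffOn ℂ ω F (img c U)) (y : U) :
    cmap (evY U y) (cfnY hc hU F hF) =
      cpx (algebraMap ℝ _ (F (c (y : Y))).re) (algebraMap ℝ _ (F (c (y : Y))).im) := by
  rw [cfnY, cmap_cpx, evY_scalY, evY_scalY]

variable {Ω : ∀ y : Y, (TangentSpace 𝓘(ℂ, CE m) y) [⋀^Fin m]→ₗ[ℂ] ℂ} (hΩ : IsHolomorphicForm Ω)
  {c' : CChart m Y} (hc' : c' ∈ atlas (CE m) Y) (hU' : U ≤ dom c')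

lemma contDiffOn_transition_coord (β : Fin m) (hc : c ∈ atlas (CE m) Y)
    (hc' : c' ∈ atlas (CE m) Y) (hU' : U ≤ dom c') :
    ContDiffOn ℂ ω (fun e => (c' ∘ c.symm) e β) (img c U) :=
  (PiLp.proj (𝕜 := ℂ) 2 (fun _ : Fin m => ℂ) β).contDiff.comp_contDiffOn
    ((analyticOn_transition hc hc').mono fun e he => by
      rw [OpenPartialHomeomorph.trans_source]; exact ⟨he.1, hU' he.2⟩)

lemma contDiffOn_transition_deriv (α β : Fin m) (hc : c ∈ atlas (CE m) Y)
    (hc' : c' ∈ atlas (CE m) Y) (hU' : U ≤ dom c') :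
    ContDiffOn ℂ ω (fun e => fderiv ℂ (c ∘ c'.symm) ((c' ∘ c.symm) e)
      (EuclideanSpace.single β 1) α) (img c U) := by
  have h1 : ContDiffOn ℂ ω (fderiv ℂ (c ∘ c'.symm)) (c'.symm.trans c).source :=
    (analyticOn_transition hc' hc).fderiv_of_isOpen (c'.symm.trans c).open_source le_rfl
  have h2 : ContDiffOn ℂ ω (c' ∘ c.symm) (img c U) := (analyticOn_transition hc hc').mono
    fun e he => by rw [OpenPartialHomeomorph.trans_source]; exact ⟨he.1, hU' he.2⟩
  have h3 := h1.comp h2 fun e he => by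
    have h4 : c (c.symm e) ∈ c.target := by rw [c.right_inv he.1]; exact he.1
    simp only [Function.comp_apply]
    exact mem_transition_source (hU' he.2) (c.map_target he.1)
  exact (PiLp.proj (𝕜 := ℂ) 2 (fun _ : Fin m => ℂ) α).contDiff.comp_contDiffOn
    (h3.clm_apply contDiffOn_const)

lemma z_eq_cfnY (β : Fin m) : (holDataY hΩ hc' hU').z β =
    cfnY hc hU _ (contDiffOn_transition_coord β hc hc' hU') := by
  rw [HolData.z, cfnY, cpx_inj]
  refine ⟨ext_evY fun y => ?_, ext_evY fun y => ?_⟩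
  · rw [evY_scalY, Function.comp_apply, c.left_inv (hU y.2)]; rfl
  · rw [evY_scalY, Function.comp_apply, c.left_inv (hU y.2)]; rfl

lemma contDiffOn_coef_complex (hΩ : IsHolomorphicForm Ω) (hc : c ∈ atlas (CE m) Y) (U : Opens Y) :
    ContDiffOn ℂ ω (fun e => coef Ω c (c.symm e)) (img c U) :=
  ((hΩ c hc).contDiffOn c.open_target.uniqueDiffOn).mono fun _ he => he.1

lemma coeff_eq_cfnY : (holDataY hΩ hc hU).coeff =
    cfnY hc hU _ (contDiffOn_coef_complex hΩ hc U) := by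
  rw [HolData.coeff, cfnY, cpx_inj]
  refine ⟨ext_evY fun y => ?_, ext_evY fun y => ?_⟩
  · rw [evY_scalY]; rfl
  · rw [evY_scalY]; rfl

/-- The odd coordinates transform by the inverse Jacobian matrix of the holomorphic change of
coordinates. -/
lemma ζ_eq_sum (β : Fin m) : (holDataY hΩ hc' hU').ζ β =
    ∑ α, cfnY hc hU _ (contDiffOn_transition_deriv α β hc hc' hU') * (holDataY hΩ hc hU).ζ α := by
  refine ext_cmap_evY fun y => ?_
  have hy : (y : Y) ∈ c.source := hU y.2
  have hy' : (y : Y) ∈ c'.source := hU' y.2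
  set T : CE m →L[ℂ] CE m := fderiv ℂ (c ∘ c'.symm) (c' (y : Y)) with hT
  have hTe : ∀ e : CE m, ofChart c' (y : Y) e = ofChart c (y : Y) (T e) := fun e => by
    have h := toChart_ofChart hc' hc hy' hy e
    rw [(hasFDerivAt_transition hc' hc hy' hy).fderiv] at h
    exact (ofChart_toChart hc hy _).symm.trans (congrArg (ofChart c (y : Y)) h)
  have hexp : ∀ e : CE m, ExteriorAlgebra.ι ℝ (ofChart c' (y : Y) e) =
      ∑ α, ((T e α).re • ExteriorAlgebra.ι ℝ (ofChart c (y : Y) (EuclideanSpace.single α 1)) +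
        (T e α).im • ExteriorAlgebra.ι ℝ (ofChart c (y : Y) (EuclideanSpace.single α Complex.I))) :=
    fun e => by
    rw [hTe, ← ofChartL_apply]
    conv_lhs => rw [← (reBasis m).sum_repr (T e)]
    rw [Fintype.sum_sum_type, ← sum_add_distrib, map_sum, map_sum]
    refine sum_congr rfl fun α _ => ?_
    rw [map_add, map_add, LinearMap.map_smul, LinearMap.map_smul, LinearMap.map_smul,
      LinearMap.map_smul, reBasis_inl, reBasis_inr]
    rfl
  have hg : ∀ α, fderiv ℂ (c ∘ c'.symm) ((c' ∘ c.symm) (c (y : Y))) (EuclideanSpace.single β 1) α =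
      T (EuclideanSpace.single β 1) α := fun α => by
    rw [Function.comp_apply, c.left_inv hy]
  have hTI : ∀ α, T (EuclideanSpace.single β Complex.I) α =
      Complex.I * T (EuclideanSpace.single β 1) α := fun α => by
    rw [single_I, map_smul]; rfl
  rw [map_sum]
  simp only [map_mul, cmap_evY_cfnY, hg]
  have hζ : ∀ {c₁ : CChart m Y} (hc₁ : c₁ ∈ atlas (CE m) Y) (hU₁ : U ≤ dom c₁)
      (γ : Fin m), cmap (evY U y) ((holDataY hΩ hc₁ hU₁).ζ γ) =
      cpx (ExteriorAlgebra.ι ℝ (ofChart c₁ (y : Y) (EuclideanSpace.single γ Complex.I)))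
        (ExteriorAlgebra.ι ℝ (ofChart c₁ (y : Y) (EuclideanSpace.single γ 1))) :=
    fun hc₁ hU₁ γ => cmap_cpx _ _ _
  simp only [hζ, cpx_mul, cpx_sum, ← Algebra.smul_def]
  rw [hexp, hexp, cpx_inj]
  constructor
  · refine sum_congr rfl fun α _ => ?_
    rw [hTI]
    simp only [Complex.mul_re, Complex.mul_im, Complex.I_re, Complex.I_im, zero_mul, one_mul,
      zero_sub, zero_add, neg_smul]
    abel
  · rfl

variable {X : Type*} [TopologicalSpace X] [ChartedSpace (RE m) X] {ι : C(X, Y)}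
  {x : X} {hx : ι x ∈ U} {s : Fin 2}
  {δ δ₁ δ₂ : OY m U →ₗ[ℝ] ExteriorAlgebra ℝ (NX (m := m) ι x)}

/-- The Cauchy–Riemann equations: a derivation acts on holomorphic functions through their complex
differential. -/
lemma baseChange_cfnY (hδ : IsSuperDer (parityY U) (extParity _) (atX ι U x hx) s δ)
    (F : CE m → ℂ) (hF : ContDiffOn ℂ ω F (img c U)) :
    δ.baseChange ℂ (cfnY hc hU F hF) = ∑ α, fderiv ℂ F (c (ι x)) (EuclideanSpace.single α 1) •
      δ.baseChange ℂ ((holDataY hΩ hc hU).z α) := by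
  have hd : HasFDerivAt F ((fderiv ℂ F (c (ι x))).restrictScalars ℝ) (c (ι x)) :=
    ((hF.contDiffAt ((img c U).isOpen.mem_nhds (mem_img (hU hx) hx))).differentiableAt
      (by simp)).hasFDerivAt.restrictScalars ℝ
  have hre : ∀ v, fderiv ℝ (fun e => (F e).re) (c (ι x)) v = (fderiv ℂ F (c (ι x)) v).re := fun v => by
    have h : HasFDerivAt (fun e => (F e).re) _ (c (ι x)) := Complex.reCLM.hasFDerivAt.comp _ hd
    rw [h.fderiv]; rfl
  have him : ∀ v, fderiv ℝ (fun e => (F e).im) (c (ι x)) v = (fderiv ℂ F (c (ι x)) v).im := fun v => by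
    have h : HasFDerivAt (fun e => (F e).im) _ (c (ι x)) := Complex.imCLM.hasFDerivAt.comp _ hd
    rw [h.fderiv]; rfl
  rw [cfnY, baseChange_cpx, der_scalY hc hU hδ, der_scalY hc hU hδ]
  simp only [HolData.z, baseChange_cpx, complex_smul_cpx, cpx_sum, hre, him, Fintype.sum_sum_type,
    ← sum_add_distrib, reBasis_inl, reBasis_inr, single_I, map_smul, smul_eq_mul,
    Complex.mul_re, Complex.mul_im, Complex.I_re, Complex.I_im, zero_mul, one_mul, zero_sub,
    zero_add, neg_smul, holDataY_x, holDataY_x']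
  rw [cpx_inj]
  refine ⟨sum_congr rfl fun α _ => (sub_eq_add_neg _ _).symm,
    sum_congr rfl fun α _ => add_comm _ _⟩

lemma cder_cfnY (h₁ : IsSuperDer (parityY U) (extParity _) (atX ι U x hx) s δ₁)
    (h₂ : IsSuperDer (parityY U) (extParity _) (atX ι U x hx) s δ₂)
    (h0 : ∀ b, cder δ₁ δ₂ ((holDataY hΩ hc hU).hco b) = 0)
    (F : CE m → ℂ) (hF : ContDiffOn ℂ ω F (img c U)) : cder δ₁ δ₂ (cfnY hc hU F hF) = 0 := by
  have h : cder δ₁ δ₂ (cfnY hc hU F hF) = ∑ α, fderiv ℂ F (c (ι x)) (EuclideanSpace.single α 1) •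
      cder δ₁ δ₂ ((holDataY hΩ hc hU).z α) := by
    simp only [cder, LinearMap.add_apply, LinearMap.smul_apply, baseChange_cfnY hc hU hΩ h₁,
      baseChange_cfnY hc hU hΩ h₂, smul_add, sum_add_distrib, smul_sum]
    congr 1
    exact sum_congr rfl fun α _ => smul_comm _ _ _
  rw [h]
  refine sum_eq_zero fun α _ => ?_
  have := h0 (Sum.inl α)
  simp only [HolData.hco, Sum.elim_inl] at this
  rw [this, smul_zero]

/-- A complex derivation that annihilates the holomorphic coordinates of one chart annihilates
those of all charts. -/
lemma cder_hco_transition (h₁ : IsSuperDer (parityY U) (extParity _) (atX ι U x hx) s δ₁)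
    (h₂ : IsSuperDer (parityY U) (extParity _) (atX ι U x hx) s δ₂)
    (h0 : ∀ b, cder δ₁ δ₂ ((holDataY hΩ hc hU).hco b) = 0) (b : Fin m ⊕ Fin m) :
    cder δ₁ δ₂ ((holDataY hΩ hc' hU').hco b) = 0 := by
  cases b with
  | inl β =>
    show cder δ₁ δ₂ ((holDataY hΩ hc' hU').z β) = 0
    rw [z_eq_cfnY hc hU hΩ hc' hU']
    exact cder_cfnY hc hU hΩ h₁ h₂ h0 _ _
  | inr β =>
    show cder δ₁ δ₂ ((holDataY hΩ hc' hU').ζ β) = 0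
    rw [ζ_eq_sum hc hU hΩ hc' hU', map_sum]
    refine sum_eq_zero fun α _ => ?_
    have := h0 (Sum.inr α)
    simp only [HolData.hco, Sum.elim_inr] at this
    rw [cder_mul h₁ h₂, this, cder_cfnY hc hU hΩ h₁ h₂ h0, zero_mul, mul_zero, add_zero]

lemma cder_coeff (h₁ : IsSuperDer (parityY U) (extParity _) (atX ι U x hx) s δ₁)
    (h₂ : IsSuperDer (parityY U) (extParity _) (atX ι U x hx) s δ₂)
    (h0 : ∀ b, cder δ₁ δ₂ ((holDataY hΩ hc hU).hco b) = 0) :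
    cder δ₁ δ₂ ((holDataY hΩ hc hU).coeff) = 0 := by
  rw [coeff_eq_cfnY hc hU hΩ]
  exact cder_cfnY hc hU hΩ h₁ h₂ h0 _ _

end Holomorphic

section Slice

variable {m : ℕ} {Y : Type*} [TopologicalSpace Y] [T2Space Y] [ChartedSpace (CE m) Y]
  [IsManifold 𝓘(ℂ, CE m) ω Y]
  {X : Type*} [TopologicalSpace X] [T2Space X] [CompactSpace X] [ChartedSpace (RE m) X]
  [IsManifold 𝓘(ℝ, RE m) ∞ X] {ι : C(X, Y)}
  {Ω : ∀ y : Y, (TangentSpace 𝓘(ℂ, CE m) y) [⋀^Fin m]→ₗ[ℂ] ℂ}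

local notation "𝒪" => OX (m := m) ι

/-! ### Vector fields along the slice rotated by the complex structure -/

section Rotate

/-- The restriction `𝒪_𝒴(U) → 𝒪_𝒳(V)` for `V ⊆ ι⁻¹ U`. -/
def restrTo (ι : C(X, Y)) {U : Opens Y} {V : Opens X} (hV : V ≤ pre ι U) :
    OY m U →ₐ[ℝ] OX (m := m) ι V := (resX ι hV).comp (restr ι U)

lemma restrTo_parity {U : Opens Y} {V : Opens X} (hV : V ≤ pre ι U) (t : OY m U) :
    restrTo ι hV (parityY U t) = parityX ι V (restrTo ι hV t) :=
  ext_evX fun _ => map_extParity _ _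

section Exists

variable {U : Opens Y} {c : CChart m Y} (hc : c ∈ atlas (CE m) Y)
  (hU : U ≤ dom c) (hΩ : IsHolomorphicForm Ω)

lemma trivY_scalY {φ : CE m → ℝ} (hφ : ContDiffOn ℝ ∞ φ (img c U)) :
    trivY hc hU (scalY hc hU φ hφ) = smoothExt.scalar φ hφ := AlgEquiv.apply_symm_apply _ _

lemma trivY_vectY (e : CE m) :
    trivY hc hU (vectY hc hU e) = smoothExt.const _ (ExteriorAlgebra.ι ℝ e) :=
  AlgEquiv.apply_symm_apply _ _

lemma deriv_scalar_coord (a b : Fin m ⊕ Fin m) (O : Opens (CE m)) :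
    smoothExt.deriv O (reBasis m a) (smoothExt.scalar (W := CE m) _
      (contDiff_coord (reBasis m) b).contDiffOn) = if a = b then 1 else 0 := by
  refine Subtype.ext (funext fun e => ?_)
  rw [smoothExt.deriv_scalar]
  have h : HasFDerivAt (fun e => (reBasis m).coord b e)
      (LinearMap.toContinuousLinearMap ((reBasis m).coord b)) (e : CE m) :=
    (LinearMap.toContinuousLinearMap ((reBasis m).coord b)).hasFDerivAt
  rw [h.fderiv]
  have h2 : LinearMap.toContinuousLinearMap ((reBasis m).coord b) (reBasis m a) =
      if a = b then (1 : ℝ) else 0 := by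
    show (reBasis m).coord b (reBasis m a) = _
    rw [Module.Basis.coord_apply, Module.Basis.repr_self, Finsupp.single_apply]
  rw [h2]
  split_ifs
  · exact map_one _
  · exact map_zero _

lemma contract_const_basis (a b : Fin m ⊕ Fin m) (O : Opens (CE m)) :
    smoothExt.contract O ((reBasis m).coord a) (smoothExt.const O
      (ExteriorAlgebra.ι ℝ (reBasis m b))) = if b = a then 1 else 0 := by
  refine Subtype.ext (funext fun e => ?_)
  refine (CliffordAlgebra.contractLeft_ι (Q := 0) ((reBasis m).coord a) (reBasis m b)).trans ?_
  rw [Module.Basis.coord_apply, Module.Basis.repr_self, Finsupp.single_apply]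
  split_ifs
  · exact map_one _
  · exact map_zero _

/-- Vector fields along the slice with prescribed values on holomorphic coordinates exist. -/
lemma exists_derY {V : Opens X} (hV : V ≤ pre ι U) {p : Fin 2}
    {E : Fin m ⊕ Fin m → ℂ ⊗[ℝ] 𝒪 V}
    (hE : ∀ b, cmap (parityX ι V) (E b) = ((-1 : ℝ) ^ (p : ℕ) * sg b) • E b) :
    ∃ J : OY m U →ₗ[ℝ] 𝒪 V,
      IsSuperDer (parityY U) (parityX ι V) (restrTo ι hV) p J ∧
      ∀ b, J.baseChange ℂ ((holDataY hΩ hc hU).hco b) = E b := by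
  set O := img c U
  set T := trivY hc hU
  set r := restrTo (m := m) ι hV
  have hB := isSuperCommX (m := m) ι V
  set e : Fin m ⊕ Fin m → 𝒪 V :=
    Sum.elim (fun α => rePart (E (Sum.inl α))) (fun α => imPart (E (Sum.inl α))) with he
  set o : Fin m ⊕ Fin m → 𝒪 V :=
    Sum.elim (fun α => imPart (E (Sum.inr α))) (fun α => rePart (E (Sum.inr α))) with ho
  have hpar : ∀ b, parityX ι V (rePart (E b)) = ((-1 : ℝ) ^ (p : ℕ) * sg b) • rePart (E b) ∧
      parityX ι V (imPart (E b)) = ((-1 : ℝ) ^ (p : ℕ) * sg b) • imPart (E b) := fun b => by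
    have h := hE b
    rwa [← cpx_re_im (E b), cmap_cpx, smul_cpx, cpx_inj] at h
  have hpe : ∀ a, parityX ι V (e a) = (-1 : ℝ) ^ (p : ℕ) • e a := fun a => by
    have h := fun α => hpar (Sum.inl α)
    simp only [sg_inl, mul_one] at h
    cases a
    exacts [(h _).1, (h _).2]
  have hsgn : (-1 : ℝ) ^ (p : ℕ) * (-1) = (-1 : ℝ) ^ ((p + 1 : Fin 2) : ℕ) := by
    fin_cases p <;> simp
  have hpo : ∀ a, parityX ι V (o a) = (-1 : ℝ) ^ ((p + 1 : Fin 2) : ℕ) • o a := fun a => by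
    have h := fun α => hpar (Sum.inr α)
    simp only [sg_inr, hsgn] at h
    cases a
    exacts [(h _).2, (h _).1]
  set de : Fin m ⊕ Fin m → OY m U →ₗ[ℝ] 𝒪 V := fun a =>
    r.toLinearMap ∘ₗ (T.symm.toLinearMap ∘ₗ smoothExt.deriv O (reBasis m a) ∘ₗ T.toLinearMap)
  set dO : Fin m ⊕ Fin m → OY m U →ₗ[ℝ] 𝒪 V := fun a =>
    r.toLinearMap ∘ₗ (T.symm.toLinearMap ∘ₗ smoothExt.contract O ((reBasis m).coord a) ∘ₗ
      T.toLinearMap)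
  have hde : ∀ a, IsSuperDer (parityY U) (parityX ι V) r 0 (de a) := fun a =>
    IsSuperDer.comp_left (IsSuperDer.conj T (trivY_parity hc hU) (smoothExt.deriv_isVF _)) r
      (restrTo_parity hV)
  have hdO : ∀ a, IsSuperDer (parityY U) (parityX ι V) r 1 (dO a) := fun a =>
    IsSuperDer.comp_left (IsSuperDer.conj T (trivY_parity hc hU) (smoothExt.contract_isVF _)) r
      (restrTo_parity hV)
  have hp2 : p + 1 + 1 = p := by fin_cases p <;> rfl
  refine ⟨∑ a, LinearMap.mulLeft ℝ (e a) ∘ₗ de a + ∑ a, LinearMap.mulLeft ℝ (o a) ∘ₗ dO a,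
    (IsSuperDer.sum _ fun a _ => ?_).add (IsSuperDer.sum _ fun a _ => ?_), ?_⟩
  · simpa using IsSuperDer.mul_left hB (hde a) (hpe a)
  · have := IsSuperDer.mul_left hB (hdO a) (hpo a)
    rwa [hp2] at this
  have hdex : ∀ a b, de a (scalY hc hU _ (contDiff_coord (reBasis m) b).contDiffOn) =
      if a = b then 1 else 0 := fun a b => by
    show r (T.symm (smoothExt.deriv O (reBasis m a) (T (scalY hc hU _ _)))) = _
    rw [trivY_scalY, deriv_scalar_coord]
    split_ifs
    · rw [map_one, map_one]
    · rw [map_zero, map_zero]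
  have hdOx : ∀ a b, dO a (scalY hc hU _ (contDiff_coord (reBasis m) b).contDiffOn) = 0 :=
    fun a b => by
    show r (T.symm (smoothExt.contract O ((reBasis m).coord a) (T (scalY hc hU _ _)))) = _
    rw [trivY_scalY, smoothExt.contract_scalar, map_zero, map_zero]
  have hdev : ∀ a b, de a (vectY hc hU (reBasis m b)) = 0 := fun a b => by
    show r (T.symm (smoothExt.deriv O (reBasis m a) (T (vectY hc hU _)))) = _
    rw [trivY_vectY, smoothExt.deriv_const, map_zero, map_zero]
  have hdOv : ∀ a b, dO a (vectY hc hU (reBasis m b)) = if b = a then 1 else 0 := fun a b => by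
    show r (T.symm (smoothExt.contract O ((reBasis m).coord a) (T (vectY hc hU _)))) = _
    rw [trivY_vectY, contract_const_basis]
    split_ifs
    · rw [map_one, map_one]
    · rw [map_zero, map_zero]
  clear_value de dO
  intro b
  cases b with
  | inl α =>
    show LinearMap.baseChange ℂ _ (cpx ((holDataY hΩ hc hU).x α) ((holDataY hΩ hc hU).x' α)) = _
    rw [baseChange_cpx, holDataY_x, holDataY_x', ← cpx_re_im (E (Sum.inl α)), cpx_inj]
    simp only [LinearMap.add_apply, LinearMap.sum_apply, LinearMap.comp_apply,
      LinearMap.mulLeft_apply, hdex, hdOx, mul_zero, Finset.sum_const_zero, add_zero, mul_ite,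
      mul_one, Finset.sum_ite_eq', Finset.mem_univ, if_true]
    exact ⟨rfl, rfl⟩
  | inr α =>
    show LinearMap.baseChange ℂ _ (cpx ((holDataY hΩ hc hU).ψ' α) ((holDataY hΩ hc hU).ψ α)) = _
    rw [baseChange_cpx, holDataY_ψ, holDataY_ψ', ← cpx_re_im (E (Sum.inr α)), cpx_inj]
    simp only [LinearMap.add_apply, LinearMap.sum_apply, LinearMap.comp_apply,
      LinearMap.mulLeft_apply, hdev, hdOv, mul_zero, Finset.sum_const_zero, zero_add, mul_ite,
      mul_one, Finset.sum_ite_eq, Finset.mem_univ, if_true]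
    exact ⟨rfl, rfl⟩

end Exists

/-- The Hamiltonian vector field does not depend on the chart of the slice, and is local. -/
lemma ham_congr (hΩ : IsHolomorphicForm Ω) (hS : IsSpecialSlice ι Ω)
    {c : CChart m Y} (hc : c ∈ atlas (CE m) Y)
    {k k' : RChart m X} (hk : k ∈ atlas (RE m) X) (hk' : k' ∈ atlas (RE m) X)
    {V V' : Opens X} (hVk : V ≤ domX k) (hVk' : V' ≤ domX k') (hVc : V ≤ pre ι (dom c))
    (hVc' : V' ≤ pre ι (dom c)) (f : GammaX (m := m) ι) (x : X) (hx : x ∈ V) (hx' : x ∈ V')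
    (b : Fin m ⊕ Fin m) :
    cmap (evX ι V ⟨x, hx⟩) (((sliceCoords hS.slice hk hVk).ham (resX ι le_top f)).baseChange ℂ
      ((holDataX ι hΩ hc hVc).hco b)) =
    cmap (evX ι V' ⟨x, hx'⟩) (((sliceCoords hS.slice hk' hVk').ham (resX ι le_top f)).baseChange ℂ
      ((holDataX ι hΩ hc hVc').hco b)) := by
  set W : Opens X := V ⊓ V'
  have h1 : ∀ {k₁ : RChart m X} (hk₁ : k₁ ∈ atlas (RE m) X) {V₁ : Opens X}
      (hV₁ : V₁ ≤ domX k₁) (hc₁ : V₁ ≤ pre ι (dom c)) (hW : W ≤ V₁) (hx₁ : x ∈ V₁),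
      cmap (evX ι V₁ ⟨x, hx₁⟩) (((sliceCoords hS.slice hk₁ hV₁).ham (resX ι le_top f)).baseChange ℂ
        ((holDataX ι hΩ hc hc₁).hco b)) =
      cmap (evX ι W ⟨x, ⟨hx, hx'⟩⟩) (((sliceCoords hS.slice hk₁ (hW.trans hV₁)).ham
        (resX ι le_top f)).baseChange ℂ ((holDataX ι hΩ hc (hW.trans hc₁)).hco b)) :=
    fun hk₁ V₁ hV₁ hc₁ hW hx₁ => by
    refine (cmap_baseChange (ψ := resX ι hW) (φ' := evX ι W ⟨x, ⟨hx, hx'⟩⟩)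
      (w' := (sliceCoords hS.slice hk₁ (hW.trans hV₁)).ham (resX ι le_top f)) (fun a => ?_) _).trans ?_
    · exact congrArg (evX ι W ⟨x, ⟨hx, hx'⟩⟩)
        (resX_ham hS.slice hk₁ hW hV₁ (resX ι le_top f) a).symm
    · rw [cmap_resX_hco hW hc₁]
  rw [h1 hk hVk hVc inf_le_left hx, h1 hk' hVk' hVc' inf_le_right hx']
  have h2 := isHamiltonian_ham (hΩ := hΩ) (hc := hc) hS hk (inf_le_left.trans hVk : W ≤ domX k)
    (inf_le_left.trans hVc) (resX ι le_top f)
  rw [(adapted (hΩ := hΩ) (hc := hc) hS hk' (inf_le_right.trans hVk' : W ≤ domX k')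
    (inf_le_left.trans hVc)).eq_ham (isSuperCommX ι W) h2.1 h2.2]

/-- The values at `x` of the Hamiltonian vector field of `f` on the holomorphic coordinates of the
chart `c`. -/
def hamAt (hΩ : IsHolomorphicForm Ω) (hS : IsSpecialSlice ι Ω)
    {c : CChart m Y} (hc : c ∈ atlas (CE m) Y) (f : GammaX (m := m) ι) (x : X)
    (hx : ι x ∈ dom c) (b : Fin m ⊕ Fin m) : ℂ ⊗[ℝ] ExteriorAlgebra ℝ (NX (m := m) ι x) :=
  cmap (evX ι (domX (chartAt (RE m) x) ⊓ pre ι (dom c)) ⟨x, mem_chart_source _ _, hx⟩)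
    (((sliceCoords hS.slice (chart_mem_atlas _ x) inf_le_left).ham (resX ι le_top f)).baseChange ℂ
      ((holDataX ι hΩ hc inf_le_right).hco b))

lemma cmap_evX_ham (hΩ : IsHolomorphicForm Ω) (hS : IsSpecialSlice ι Ω)
    {c : CChart m Y} (hc : c ∈ atlas (CE m) Y)
    {k : RChart m X} (hk : k ∈ atlas (RE m) X)
    {V : Opens X} (hVk : V ≤ domX k) (hVc : V ≤ pre ι (dom c)) (f : GammaX (m := m) ι) (x : V)
    (b : Fin m ⊕ Fin m) :
    cmap (evX ι V x) (((sliceCoords hS.slice hk hVk).ham (resX ι le_top f)).baseChange ℂ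
      ((holDataX ι hΩ hc hVc).hco b)) = hamAt hΩ hS hc f x (hVc x.2) b :=
  ham_congr hΩ hS hc hk (chart_mem_atlas _ _) hVk inf_le_left hVc inf_le_right f x x.2 _ b

/-- The derivation `δ` at `x` is the value of `i H_f`, where `H_f` is the Hamiltonian vector field of
`f` on the slice. -/
structure IsRotated (hΩ : IsHolomorphicForm Ω) (hS : IsSpecialSlice ι Ω) (p : Fin 2)
    (f : GammaX (m := m) ι) (U : Opens Y) (x : X) (hx : ι x ∈ U)
    (δ : OY m U →ₗ[ℝ] ExteriorAlgebra ℝ (NX (m := m) ι x)) : Prop where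
  isSuperDer : IsSuperDer (parityY U) (extParity _) (atX ι U x hx) p δ
  hco : ∀ (c : CChart m Y) (hc : c ∈ atlas (CE m) Y) (hU : U ≤ dom c) (b),
    δ.baseChange ℂ ((holDataY hΩ hc hU).hco b) = Complex.I • hamAt hΩ hS hc f x (hU hx) b

variable {hΩ : IsHolomorphicForm Ω} {hS : IsSpecialSlice ι Ω} {p : Fin 2} {f : GammaX (m := m) ι}

lemma IsRotated.unique {U : Opens Y} {x : X} {hx : ι x ∈ U}
    {δ δ' : OY m U →ₗ[ℝ] ExteriorAlgebra ℝ (NX (m := m) ι x)} (h : IsRotated hΩ hS p f U x hx δ)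
    (h' : IsRotated hΩ hS p f U x hx δ') {c : CChart m Y}
    (hc : c ∈ atlas (CE m) Y) (hU : U ≤ dom c) : δ = δ' :=
  der_ext_hco hc hU hΩ h.isSuperDer h'.isSuperDer fun b => by rw [h.hco c hc hU, h'.hco c hc hU]

lemma cmap_resY_hco {c : CChart m Y} (hc : c ∈ atlas (CE m) Y) {U U' : Opens Y}
    (hU : U ≤ dom c) (h : U' ≤ U) (b : Fin m ⊕ Fin m) :
    cmap (resY h) ((holDataY hΩ hc hU).hco b) = (holDataY hΩ hc (h.trans hU)).hco b := by
  cases b <;> exact cmap_cpx _ _ _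

lemma baseChange_comp {A A' B : Type*} [Ring A] [Algebra ℝ A] [Ring A'] [Algebra ℝ A'] [Ring B]
    [Algebra ℝ B] (δ : A' →ₗ[ℝ] B) (r : A →ₐ[ℝ] A') (u : ℂ ⊗[ℝ] A) :
    (δ ∘ₗ r.toLinearMap).baseChange ℂ u = δ.baseChange ℂ (cmap r u) := by
  rw [← cpx_re_im u, cmap_cpx, baseChange_cpx, baseChange_cpx]; rfl

lemma cder_neg_one_smul {A B : Type*} [Ring A] [Algebra ℝ A] [Ring B] [Algebra ℝ B]
    (δ δ' : A →ₗ[ℝ] B) (u : ℂ ⊗[ℝ] A) :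
    cder δ ((-1 : ℝ) • δ') u = δ.baseChange ℂ u - Complex.I • δ'.baseChange ℂ u := by
  rw [← cpx_re_im u, cder_cpx, baseChange_cpx, baseChange_cpx, I_smul_cpx, cpx_sub]
  simp [sub_eq_add_neg]

lemma IsRotated.comp_resY {U U' : Opens Y} (h : U' ≤ U) {x : X} {hx : ι x ∈ U'}
    {δ : OY m U' →ₗ[ℝ] ExteriorAlgebra ℝ (NX (m := m) ι x)} (hδ : IsRotated hΩ hS p f U' x hx δ) :
    IsRotated hΩ hS p f U x (h hx) (δ ∘ₗ (resY h).toLinearMap) where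
  isSuperDer := hδ.isSuperDer.comp_right (resY h) fun _ => rfl
  hco c hc hU b := by rw [baseChange_comp, cmap_resY_hco, hδ.hco]

lemma cmap_restrTo_hco {c : CChart m Y} (hc : c ∈ atlas (CE m) Y) {U : Opens Y}
    (hU : U ≤ dom c) {V : Opens X} (hV : V ≤ pre ι U) (b : Fin m ⊕ Fin m) :
    cmap (restrTo ι hV) ((holDataY hΩ hc hU).hco b) =
      (holDataX ι hΩ hc (hV.trans (Opens.comap_mono ι hU))).hco b := by
  cases b <;> exact cmap_cpx _ _ _

lemma IsSuperDer.cmap_baseChange {A B : Type*} [Ring A] [Algebra ℝ A] [Ring B] [Algebra ℝ B]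
    {σA : A →ₐ[ℝ] A} {σB : B →ₐ[ℝ] B} {r : A →ₐ[ℝ] B} {δ : A →ₗ[ℝ] B}
    (hδ : IsSuperDer σA σB r p δ) {u : ℂ ⊗[ℝ] A} {ε : ℝ} (hu : cmap σA u = ε • u) :
    cmap σB (δ.baseChange ℂ u) = ((-1 : ℝ) ^ (p : ℕ) * ε) • δ.baseChange ℂ u := by
  have h1 := hδ.baseChange.2 u
  simp only [LinearMap.coe_restrictScalars, hu] at h1
  rw [LinearMap.map_smul_of_tower] at h1
  rw [mul_smul, h1, smul_smul, ← mul_pow]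
  norm_num

lemma evX_baseChange {A : Type*} [Ring A] [Algebra ℝ A] {V : Opens X}
    (x : V) (L : A →ₗ[ℝ] 𝒪 V) (u : ℂ ⊗[ℝ] A) :
    ((evX ι V x).toLinearMap ∘ₗ L).baseChange ℂ u = cmap (evX ι V x) (L.baseChange ℂ u) := by
  rw [← cpx_re_im u, baseChange_cpx, baseChange_cpx, cmap_cpx]; rfl

/-- Over chart domains, `i H_f` is a vector field along the slice. -/
lemma exists_isRotated (hΩ : IsHolomorphicForm Ω) (hS : IsSpecialSlice ι Ω)
    (hf : parityX ι ⊤ f = -((-1 : ℝ) ^ (p : ℕ) • f))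
    {c : CChart m Y} (hc : c ∈ atlas (CE m) Y)
    {k : RChart m X} (hk : k ∈ atlas (RE m) X) {U : Opens Y} (hU : U ≤ dom c)
    {V : Opens X} (hVk : V ≤ domX k) (hV : V ≤ pre ι U) :
    ∃ J : OY m U →ₗ[ℝ] 𝒪 V,
      ∀ x : V, IsRotated hΩ hS p f U x (hV x.2) ((evX ι V x).toLinearMap ∘ₗ J) := by
  have hVc : V ≤ pre ι (dom c) := hV.trans (Opens.comap_mono ι hU)
  set f' : 𝒪 V := resX ι le_top f
  have hf' : parityX ι V f' = -((-1 : ℝ) ^ (p : ℕ) • f') := by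
    rw [← resX_parity, hf, map_neg]; rfl
  have hham : IsVF (parityX ι V) p ((sliceCoords hS.slice hk hVk).ham f') :=
    (sliceCoords hS.slice hk hVk).ham_isVF (isSuperCommX ι V) hf'
  set H := (sliceCoords hS.slice hk hVk).ham f' with hH
  have hhom := (adapted (hΩ := hΩ) (hc := hc) hS hk hVk hVc).homog
  have hpar : ∀ b, cmap (parityX ι V) (Complex.I • H.baseChange ℂ ((holDataX ι hΩ hc hVc).hco b)) =
      ((-1 : ℝ) ^ (p : ℕ) * sg b) • Complex.I • H.baseChange ℂ ((holDataX ι hΩ hc hVc).hco b) :=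
    fun b => by
    rw [cmap_smul, hham.cmap_baseChange (hhom.hco b), smul_comm]
  obtain ⟨J, hJ, hJE⟩ := exists_derY hc hU hΩ hV hpar
  refine ⟨J, fun x => ?_⟩
  have hJx : IsSuperDer (parityY U) (extParity _) (atX ι U (x : X) (hV x.2)) p
      ((evX ι V x).toLinearMap ∘ₗ J) := IsSuperDer.comp_left hJ (evX ι V x) fun _ => rfl
  have hHx : IsSuperDer (parityY U) (extParity _) (atX ι U (x : X) (hV x.2)) p
      ((evX ι V x).toLinearMap ∘ₗ (H ∘ₗ (restrTo ι hV).toLinearMap)) :=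
    IsSuperDer.comp_left (IsSuperDer.comp_right hham (restrTo ι hV) (restrTo_parity hV))
      (evX ι V x) fun _ => rfl
  have hHco : ∀ {c' : CChart m Y} (hc' : c' ∈ atlas (CE m) Y) (hU' : U ≤ dom c')
      (b : Fin m ⊕ Fin m), ((evX ι V x).toLinearMap ∘ₗ (H ∘ₗ (restrTo ι hV).toLinearMap)).baseChange ℂ
        ((holDataY hΩ hc' hU').hco b) = hamAt hΩ hS hc' f x (hU' (hV x.2)) b := fun hc' hU' b => by
    rw [evX_baseChange, baseChange_comp, cmap_restrTo_hco]
    exact cmap_evX_ham hΩ hS hc' hk hVk _ f x b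
  have hneg := hHx.smul (-1)
  refine ⟨hJx, fun c' hc' hU' b => ?_⟩
  have h0 := cder_hco_transition hc hU hΩ hc' hU' hJx hneg (fun b => by
    rw [cder_neg_one_smul, hHco, evX_baseChange, hJE, cmap_smul, cmap_evX_ham hΩ hS hc hk hVk hVc f x b, sub_self]) b
  rw [cder_neg_one_smul, sub_eq_zero, hHco] at h0
  exact h0

end Rotate

section RotateGlobal

variable {hΩ : IsHolomorphicForm Ω} {hS : IsSpecialSlice ι Ω} {p : Fin 2} {f : GammaX (m := m) ι}

lemma evX_parity_pow {V : Opens X} (x : V) (p : Fin 2) (b : 𝒪 V) :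
    evX ι V x ((parityX ι V ^ (p : ℕ)) b) = (extParity _ ^ (p : ℕ)) (evX ι V x b) := by
  fin_cases p <;> rfl

/-- A rotated derivation on any small neighbourhood of a point. -/
lemma exists_isRotated_at (hΩ : IsHolomorphicForm Ω) (hS : IsSpecialSlice ι Ω)
    (hf : parityX ι ⊤ f = -((-1 : ℝ) ^ (p : ℕ) • f))
    {c : CChart m Y} (hc : c ∈ atlas (CE m) Y) {U : Opens Y} (hU : U ≤ dom c)
    (x : X) (hx : ι x ∈ U) : ∃ δ, IsRotated hΩ hS p f U x hx δ := by
  obtain ⟨J, hJ⟩ := exists_isRotated hΩ hS hf hc (chart_mem_atlas (RE m) x) hU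
    (V := domX (chartAt (RE m) x) ⊓ pre ι U) inf_le_left inf_le_right
  exact ⟨_, hJ ⟨x, mem_chart_source _ _, hx⟩⟩

/-- Rotated derivations on different neighbourhoods agree. -/
lemma IsRotated.comp_resY_eq (hf : parityX ι ⊤ f = -((-1 : ℝ) ^ (p : ℕ) • f))
    {U U₁ U₂ : Opens Y} (h₁ : U₁ ≤ U) (h₂ : U₂ ≤ U)
    {x : X} {hx₁ : ι x ∈ U₁} {hx₂ : ι x ∈ U₂}
    {δ₁ : OY m U₁ →ₗ[ℝ] ExteriorAlgebra ℝ (NX (m := m) ι x)}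
    {δ₂ : OY m U₂ →ₗ[ℝ] ExteriorAlgebra ℝ (NX (m := m) ι x)}
    (hδ₁ : IsRotated hΩ hS p f U₁ x hx₁ δ₁) (hδ₂ : IsRotated hΩ hS p f U₂ x hx₂ δ₂)
    {c₁ c₂ : CChart m Y} (hc₁ : c₁ ∈ atlas (CE m) Y) (hU₁ : U₁ ≤ dom c₁)
    (hc₂ : c₂ ∈ atlas (CE m) Y) (hU₂ : U₂ ≤ dom c₂) (t : OY m U) :
    δ₁ (resY h₁ t) = δ₂ (resY h₂ t) := by
  obtain ⟨δ, hδ⟩ := exists_isRotated_at hΩ hS hf hc₁ (inf_le_left.trans hU₁ : U₁ ⊓ U₂ ≤ dom c₁) x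
    ⟨hx₁, hx₂⟩
  rw [hδ₁.unique (hδ.comp_resY inf_le_left) hc₁ hU₁, hδ₂.unique (hδ.comp_resY inf_le_right) hc₂ hU₂]
  rfl

lemma exists_rotatedAt (hΩ : IsHolomorphicForm Ω) (hS : IsSpecialSlice ι Ω)
    (hf : parityX ι ⊤ f = -((-1 : ℝ) ^ (p : ℕ) • f)) (U : Opens Y) (x : X) (hx : ι x ∈ U) :
    ∃ δ : OY m U →ₗ[ℝ] ExteriorAlgebra ℝ (NX (m := m) ι x), ∀ (U' : Opens Y) (h : U' ≤ U)
      (hx' : ι x ∈ U') (c : CChart m Y) (_ : c ∈ atlas (CE m) Y)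
      (_ : U' ≤ dom c) (δ'), IsRotated hΩ hS p f U' x hx' δ' → ∀ t, δ t = δ' (resY h t) := by
  obtain ⟨δ, hδ⟩ := exists_isRotated_at hΩ hS hf (chart_mem_atlas (CE m) (ι x))
    (inf_le_left : dom (chartAt (CE m) (ι x)) ⊓ U ≤ _) x ⟨mem_chart_source _ _, hx⟩
  exact ⟨δ ∘ₗ (resY inf_le_right).toLinearMap, fun U' h hx' c hc hU' δ' hδ' t =>
    hδ.comp_resY_eq hf inf_le_right h hδ' (chart_mem_atlas (CE m) (ι x)) inf_le_left hc hU' t⟩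

/-- The value at `x` of the rotated Hamiltonian vector field `i H_f`. -/
def rotatedAt (hΩ : IsHolomorphicForm Ω) (hS : IsSpecialSlice ι Ω)
    (hf : parityX ι ⊤ f = -((-1 : ℝ) ^ (p : ℕ) • f)) (U : Opens Y) (x : X) (hx : ι x ∈ U) :
    OY m U →ₗ[ℝ] ExteriorAlgebra ℝ (NX (m := m) ι x) :=
  (exists_rotatedAt hΩ hS hf U x hx).choose

lemma rotatedAt_eq (hf : parityX ι ⊤ f = -((-1 : ℝ) ^ (p : ℕ) • f)) {U U' : Opens Y} (h : U' ≤ U)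
    {x : X} (hx : ι x ∈ U') {c : CChart m Y} (hc : c ∈ atlas (CE m) Y)
    (hU' : U' ≤ dom c) {δ : OY m U' →ₗ[ℝ] ExteriorAlgebra ℝ (NX (m := m) ι x)}
    (hδ : IsRotated hΩ hS p f U' x hx δ) (t : OY m U) :
    rotatedAt hΩ hS hf U x (h hx) t = δ (resY h t) :=
  (exists_rotatedAt hΩ hS hf U x (h hx)).choose_spec U' h hx c hc hU' δ hδ t

lemma isSuperDer_rotatedAt (hf : parityX ι ⊤ f = -((-1 : ℝ) ^ (p : ℕ) • f)) (U : Opens Y) (x : X)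
    (hx : ι x ∈ U) : IsSuperDer (parityY U) (extParity _) (atX ι U x hx) p
      (rotatedAt hΩ hS hf U x hx) := by
  obtain ⟨δ, hδ⟩ := exists_isRotated_at hΩ hS hf (chart_mem_atlas (CE m) (ι x))
    (inf_le_left : dom (chartAt (CE m) (ι x)) ⊓ U ≤ _) x ⟨mem_chart_source _ _, hx⟩
  have h : rotatedAt hΩ hS hf U x hx = δ ∘ₗ (resY inf_le_right).toLinearMap :=
    LinearMap.ext fun t => rotatedAt_eq hf inf_le_right _ (chart_mem_atlas (CE m) (ι x))
      inf_le_left hδ t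
  rw [h]
  exact hδ.isSuperDer.comp_right (resY inf_le_right) fun _ => rfl

/-- The rotated Hamiltonian vector field `i H_f` on sections over `U`. -/
def rotatedOn (hΩ : IsHolomorphicForm Ω) (hS : IsSpecialSlice ι Ω)
    (hf : parityX ι ⊤ f = -((-1 : ℝ) ^ (p : ℕ) • f)) (U : Opens Y) :
    OY m U →ₗ[ℝ] 𝒪 (pre ι U) where
  toFun t := ⟨fun x => rotatedAt hΩ hS hf U x x.2 t, isNormalSection_of_local hS.slice fun x => by
    obtain ⟨J, hJ⟩ := exists_isRotated hΩ hS hf (chart_mem_atlas (CE m) (ι x))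
      (chart_mem_atlas (RE m) (x : X)) (inf_le_left : dom (chartAt (CE m) (ι x)) ⊓ U ≤ _)
      (V := domX (chartAt (RE m) (x : X)) ⊓ pre ι (dom (chartAt (CE m) (ι x)) ⊓ U))
      inf_le_left inf_le_right
    exact ⟨domX (chartAt (RE m) (x : X)) ⊓ pre ι (dom (chartAt (CE m) (ι x)) ⊓ U),
      ⟨mem_chart_source _ _, mem_chart_source _ _, x.2⟩, J (resY inf_le_right t),
      fun x' hx' => rotatedAt_eq hf inf_le_right hx'.2 (chart_mem_atlas (CE m) (ι x)) inf_le_left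
        (hJ ⟨x', hx'⟩) t⟩⟩
  map_add' s t := ext_evX fun x => map_add (rotatedAt hΩ hS hf U x x.2) s t
  map_smul' r t := ext_evX fun x => map_smul (rotatedAt hΩ hS hf U x x.2) r t

/-- The rotated Hamiltonian vector field `i H_f` along the slice. -/
def rotated (hΩ : IsHolomorphicForm Ω) (hS : IsSpecialSlice ι Ω)
    (hf : parityX ι ⊤ f = -((-1 : ℝ) ^ (p : ℕ) • f)) : VFAlong (m := m) ι p :=
  ⟨rotatedOn hΩ hS hf, by
    refine ⟨fun U => ⟨fun a b => ext_evX fun x => ?_, fun a => ext_evX fun x => ?_⟩,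
      fun U U' h t => ext_evX fun x => ?_⟩
    · have h := (isSuperDer_rotatedAt (hΩ := hΩ) (hS := hS) hf U (x : X) x.2).1 a b
      refine h.trans ?_
      rw [evX_add, evX_mul, evX_mul, evX_parity_pow]
      rfl
    · have h := (isSuperDer_rotatedAt (hΩ := hΩ) (hS := hS) hf U (x : X) x.2).2 a
      rw [evX_smul]
      exact h
    · obtain ⟨δ, hδ⟩ := exists_isRotated_at hΩ hS hf (chart_mem_atlas (CE m) (ι x))
        (inf_le_left : dom (chartAt (CE m) (ι x)) ⊓ U' ≤ _) (x : X) ⟨mem_chart_source _ _, x.2⟩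
      exact (rotatedAt_eq hf inf_le_right _ (chart_mem_atlas (CE m) (ι x)) inf_le_left hδ
        (resY h t)).trans (rotatedAt_eq hf (inf_le_right.trans h) _
          (chart_mem_atlas (CE m) (ι x)) inf_le_left hδ t).symm⟩

/-- In holomorphic coordinates, the rotated vector field is `i H_f`. -/
lemma rotated_hco (hf : parityX ι ⊤ f = -((-1 : ℝ) ^ (p : ℕ) • f))
    {c : CChart m Y} (hc : c ∈ atlas (CE m) Y)
    {k : RChart m X} (hk : k ∈ atlas (RE m) X) {V : Opens X}
    (hVk : V ≤ domX k) (hVc : V ≤ pre ι (dom c)) (b : Fin m ⊕ Fin m) :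
    ((resX ι hVc).toLinearMap ∘ₗ (rotated hΩ hS hf).1 (dom c)).baseChange ℂ
      ((holData hΩ hc).hco b) = Complex.I • ((sliceCoords hS.slice hk hVk).ham
        (resX ι le_top f)).baseChange ℂ ((holDataX ι hΩ hc hVc).hco b) := by
  refine ext_cmap_evX fun x => ?_
  obtain ⟨δ, hδ⟩ := exists_isRotated_at hΩ hS hf hc le_rfl (x : X) (hVc x.2)
  rw [cmap_smul, cmap_evX_ham hΩ hS hc hk hVk hVc f x b]
  refine Eq.trans ?_ (hδ.hco c hc le_rfl b)
  have h : ∀ t, evX ι V x (resX ι hVc ((rotated hΩ hS hf).1 (dom c) t)) = δ t := fun t =>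
    rotatedAt_eq hf le_rfl (hVc x.2) hc le_rfl hδ t
  rw [← cpx_re_im ((holData hΩ hc).hco b), baseChange_cpx, cmap_cpx]
  have h2 : (holDataY hΩ hc le_rfl).hco b = (holData hΩ hc).hco b := rfl
  rw [h2, ← cpx_re_im ((holData hΩ hc).hco b), baseChange_cpx, cpx_re_im]
  exact cpx_inj.mpr ⟨h _, h _⟩

end RotateGlobal

/-! ### First-order families and the volume form -/

section Split

variable {hΩ : IsHolomorphicForm Ω} {p : Fin 2} {D : VFAlong (m := m) ι p}

/-- A vector field along the slice, as a derivation `𝒪_𝒴(U) → 𝒪_𝒳(V)`. -/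
def VFAlong.over (D : VFAlong (m := m) ι p) {U : Opens Y} {V : Opens X} (hV : V ≤ pre ι U) :
    OY m U →ₗ[ℝ] 𝒪 V := (resX ι hV).toLinearMap ∘ₗ D.1 U

lemma VFAlong.over_isSuperDer (D : VFAlong (m := m) ι p) {U : Opens Y} {V : Opens X}
    (hV : V ≤ pre ι U) : IsSuperDer (parityY U) (parityX ι V) (restrTo ι hV) p (D.over hV) :=
  IsSuperDer.comp_left (D.2.1 U) (resX ι hV) fun _ => rfl

lemma VFAlong.over_resY (D : VFAlong (m := m) ι p) {U U' : Opens Y} (h : U' ≤ U) {V : Opens X}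
    (hV : V ≤ pre ι U') (t : OY m U) :
    D.over hV (resY h t) = D.over (hV.trans (Opens.comap_mono ι h)) t :=
  congrArg (resX ι hV) (D.2.2 U U' h t)

lemma isHomogeneous_holData (hΩ : IsHolomorphicForm Ω) {c : CChart m Y}
    (hc : c ∈ atlas (CE m) Y) : (holData hΩ hc).IsHomogeneous (parityY (dom c)) where
  x _ := Subtype.ext (funext fun _ => AlgHom.commutes _ _)
  x' _ := Subtype.ext (funext fun _ => AlgHom.commutes _ _)
  ψ _ := Subtype.ext (funext fun _ => extParity_ι _)
  ψ' _ := Subtype.ext (funext fun _ => extParity_ι _)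
  a := Subtype.ext (funext fun _ => AlgHom.commutes _ _)
  a' := Subtype.ext (funext fun _ => AlgHom.commutes _ _)

/-- The vector field `D` along the slice is `W₁ + i W₂` with vector fields `W₁`, `W₂` on the slice,
under the isomorphism of `ℂ ⊗ 𝒯𝒳` with `𝒯_c 𝒴|_𝒳`. -/
structure IsSplitting (hΩ : IsHolomorphicForm Ω) (D : VFAlong (m := m) ι p)
    {c : CChart m Y} (hc : c ∈ atlas (CE m) Y) {V : Opens X}
    (hVc : V ≤ pre ι (dom c)) (W₁ W₂ : 𝒪 V →ₗ[ℝ] 𝒪 V) : Prop where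
  left : IsVF (parityX ι V) p W₁
  right : IsVF (parityX ι V) p W₂
  hco : ∀ b, cder W₁ W₂ ((holDataX ι hΩ hc hVc).hco b) =
    (D.over hVc).baseChange ℂ ((holData hΩ hc).hco b)

variable {c : CChart m Y} {hc : c ∈ atlas (CE m) Y} {V : Opens X}
  {hVc : V ≤ pre ι (dom c)} {W₁ W₂ : OX (m := m) ι V →ₗ[ℝ] OX (m := m) ι V}

lemma exists_isSplitting (hΩ : IsHolomorphicForm Ω) (hS : IsSpecialSlice ι Ω)
    (D : VFAlong (m := m) ι p) (hc : c ∈ atlas (CE m) Y) (hVc : V ≤ pre ι (dom c))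
    (q : SuperCoords (𝒪 V) (parityX ι V) m) :
    ∃ W₁ W₂, IsSplitting hΩ D hc hVc W₁ W₂ := by
  have hE : ∀ b, cmap (parityX ι V) ((D.over hVc).baseChange ℂ ((holData hΩ hc).hco b)) =
      ((-1 : ℝ) ^ (p : ℕ) * sg b) • (D.over hVc).baseChange ℂ ((holData hΩ hc).hco b) := fun b => by
    exact (D.over_isSuperDer hVc).cmap_baseChange ((isHomogeneous_holData hΩ hc).hco b)
  obtain ⟨W₁, W₂, h₁, h₂, h⟩ := exists_cder (isSuperCommX ι V) q (isHomogeneous_holDataX hΩ hc hVc)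
    (isUnit_jac_holDataX hS hVc q) hE
  exact ⟨W₁, W₂, h₁, h₂, h⟩

lemma cmap_restrTo_dom (b : Fin m ⊕ Fin m) :
    cmap (restrTo ι hVc) ((holData hΩ hc).hco b) = (holDataX ι hΩ hc hVc).hco b := by
  cases b <;> exact cmap_cpx _ _ _

lemma cder_sub_comp {A B L : Type*} [Ring A] [Algebra ℝ A] [Ring B] [Algebra ℝ B] [Ring L]
    [Algebra ℝ L] (ev : B →ₐ[ℝ] L) (r : A →ₐ[ℝ] B) (T : A →ₗ[ℝ] B) (W₁ W₂ : B →ₗ[ℝ] B)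
    (u : ℂ ⊗[ℝ] A) :
    cder (ev.toLinearMap ∘ₗ T + (-1 : ℝ) • (ev.toLinearMap ∘ₗ (W₁ ∘ₗ r.toLinearMap)))
      ((-1 : ℝ) • (ev.toLinearMap ∘ₗ (W₂ ∘ₗ r.toLinearMap))) u =
    cmap ev (T.baseChange ℂ u) - cmap ev (cder W₁ W₂ (cmap r u)) := by
  rw [← cpx_re_im u, cder_cpx, baseChange_cpx, cmap_cpx, cmap_cpx, cder_cpx, cmap_cpx, cpx_sub]
  simp only [LinearMap.add_apply, LinearMap.smul_apply, LinearMap.comp_apply,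
    AlgHom.toLinearMap_apply, neg_smul, one_smul, map_sub, map_add]
  congr 1 <;> abel

/-- A splitting also computes the derivative of the coefficient of the holomorphic form. -/
lemma IsSplitting.coeff (h : IsSplitting hΩ D hc hVc W₁ W₂) :
    cder W₁ W₂ (holDataX ι hΩ hc hVc).coeff =
      (D.over hVc).baseChange ℂ (holData hΩ hc).coeff := by
  refine ext_cmap_evX fun x => ?_
  have hD : IsSuperDer (parityY (dom c)) (extParity _) (atX ι (dom c) (x : X) (hVc x.2)) p
      ((evX ι V x).toLinearMap ∘ₗ D.over hVc) :=
    IsSuperDer.comp_left (D.over_isSuperDer hVc) (evX ι V x) fun _ => rfl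
  have hW : ∀ {W : 𝒪 V →ₗ[ℝ] 𝒪 V}, IsVF (parityX ι V) p W →
      IsSuperDer (parityY (dom c)) (extParity _) (atX ι (dom c) (x : X) (hVc x.2)) p
        ((evX ι V x).toLinearMap ∘ₗ (W ∘ₗ (restrTo ι hVc).toLinearMap)) := fun hW =>
    IsSuperDer.comp_left (IsSuperDer.comp_right hW (restrTo ι hVc) (restrTo_parity hVc))
      (evX ι V x) fun _ => rfl
  have h0 := cder_coeff hc le_rfl hΩ (hD.add ((hW h.left).smul (-1))) ((hW h.right).smul (-1))
    (fun b => by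
      rw [cder_sub_comp]
      refine sub_eq_zero.mpr (congrArg (cmap (evX ι V x)) ?_)
      refine (h.hco b).symm.trans ?_
      rw [← cmap_restrTo_dom (hc := hc)]
      rfl)
  rw [cder_sub_comp, sub_eq_zero] at h0
  refine Eq.trans ?_ h0.symm
  refine congrArg (fun u => cmap (evX ι V x) (cder W₁ W₂ u)) ?_
  exact (cmap_cpx _ _ _).symm

lemma IsSplitting.exists_resX (hι : IsRealSlice (m := m) ι) (h : IsSplitting hΩ D hc hVc W₁ W₂)
    {V' : Opens X} (hV : V' ≤ V) : ∃ W₁' W₂', IsSplitting hΩ D hc (hV.trans hVc) W₁' W₂' ∧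
      ∀ b, W₂' (resX ι hV b) = resX ι hV (W₂ b) := by
  obtain ⟨W₁', h₁', hr₁, -⟩ := exists_resDer hι hV h.left
  obtain ⟨W₂', h₂', hr₂, -⟩ := exists_resDer hι hV h.right
  refine ⟨W₁', W₂', ⟨h₁', h₂', fun b => ?_⟩, hr₂⟩
  have h1 : ∀ u, cder W₁' W₂' (cmap (resX ι hV) u) = cmap (resX ι hV) (cder W₁ W₂ u) := fun u => by
    rw [← cpx_re_im u, cmap_cpx, cder_cpx, cder_cpx, cmap_cpx, hr₁, hr₁, hr₂, hr₂, map_sub, map_add]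
  rw [← cmap_resX_hco hV hVc, h1, h.hco, ← cpx_re_im ((holData hΩ hc).hco b), baseChange_cpx,
    baseChange_cpx, cmap_cpx]
  rfl

lemma density_family (hS : IsSpecialSlice ι Ω) (h : IsSplitting hΩ D hc hVc W₁ W₂)
    (q : SuperCoords (𝒪 V) (parityX ι V) m) :
    IsUnit (((holData hΩ hc).map (family D hVc)).jac
      (fun i => Thick.lift (parityX ι V) p 0 (q.dx i))
      (fun j => Thick.lift (parityX ι V) p 1 (q.dξ j))) ∧
    familyDensity hΩ D hc hVc q = cInl (parityX ι V) p (1 ⊗ₜ rho ι hΩ hc hVc q) +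
      cEps (parityX ι V) p (cpx (q.bvDiv (rho ι hΩ hc hVc q) W₁)
        (q.bvDiv (rho ι hΩ hc hVc q) W₂)) := by
  have hfam : ∀ a b : OY m (dom c), cpx (family D hVc a) (family D hVc b) =
      cInl (parityX ι V) p (cpx (restrTo ι hVc a) (restrTo ι hVc b)) +
        cEps (parityX ι V) p ((D.over hVc).baseChange ℂ (cpx a b)) := fun a b => by
    rw [baseChange_cpx]
    exact cpx_thick _ _
  refine density_flow (isSuperCommX ι V) q (isHomogeneous_holDataX hΩ hc hVc)
    (isUnit_jac_holDataX hS hVc q) (density_holDataX hS hVc q) h.left h.right (fun b => ?_) ?_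
  · rw [cflow_apply, h.hco b, ← cmap_restrTo_dom (hc := hc)]
    cases b <;> exact (hfam _ _).trans (by rw [← cmap_cpx]; rfl)
  · rw [cflow_apply, h.coeff]
    exact hfam _ _

/-- First-order deformations of real slices are real slices. -/
lemma isRealSliceFamily (hΩ : IsHolomorphicForm Ω) (hS : IsSpecialSlice ι Ω)
    (D : VFAlong (m := m) ι p) : IsRealSliceFamily ι hΩ D := fun c hc V hV q => by
  obtain ⟨W₁, W₂, h⟩ := exists_isSplitting hΩ hS D hc hV q
  exact (density_family hS h q).1

lemma imPart_familyDensity (hS : IsSpecialSlice ι Ω) (h : IsSplitting hΩ D hc hVc W₁ W₂)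
    (q : SuperCoords (𝒪 V) (parityX ι V) m) :
    imPart (familyDensity hΩ D hc hVc q) = ⟨0, q.bvDiv (rho ι hΩ hc hVc q) W₂⟩ := by
  rw [(density_family hS h q).2, ← cpx_zero_right, cInl_cpx, cEps_cpx, cpx_add, imPart_cpx]
  ext
  · exact zero_add _
  · exact zero_add _

end Split

/-! ### Vector fields along the slice that represent differentials -/

section Represent

variable {hΩ : IsHolomorphicForm Ω} {p : Fin 2} {D : VFAlong (m := m) ι p} {f : GammaX (m := m) ι}

/-- The homogeneous vector field `D` along the slice satisfies `η(w, D) = w(f)` for all vector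
fields `w` on the slice. -/
def Represents (hΩ : IsHolomorphicForm Ω) (f : GammaX (m := m) ι) (D : VFAlong (m := m) ι p) : Prop :=
  ∀ (c : CChart m Y) (hc : c ∈ atlas (CE m) Y) (V : Opens X)
    (hV : V ≤ pre ι (dom c)) (s : Fin 2) (w : 𝒪 V →ₗ[ℝ] 𝒪 V),
    IsVF (parityX ι V) s w →
    (holData hΩ hc).eta (parityX ι V) (fun t => resX ι hV (restr ι (dom c) t)) w (D.over hV) =
      w (resX ι le_top f)

variable {c : CChart m Y} {hc : c ∈ atlas (CE m) Y} {V : Opens X}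
  {hVc : V ≤ pre ι (dom c)} {W₁ W₂ : OX (m := m) ι V →ₗ[ℝ] OX (m := m) ι V}

/-- `η = Im η_c`, so that `η(w, W₁ + i W₂) = η_c(w, W₂)`. -/
lemma IsSplitting.eta_eq (hS : IsSpecialSlice ι Ω) (h : IsSplitting hΩ D hc hVc W₁ W₂)
    {k : RChart m X} (hk : k ∈ atlas (RE m) X) (hVk : V ≤ domX k) {s : Fin 2}
    {w : 𝒪 V →ₗ[ℝ] 𝒪 V} (hw : IsVF (parityX ι V) s w) :
    (holData hΩ hc).eta (parityX ι V) (fun t => resX ι hVc (restr ι (dom c) t)) w (D.over hVc) =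
      (sliceCoords hS.slice hk hVk).canonEta w W₂ := by
  have ht := adapted (hΩ := hΩ) (hc := hc) hS hk hVk hVc
  have hB := isSuperCommX (m := m) ι V
  set S : ℂ ⊗[ℝ] 𝒪 V := ∑ α,
    (w.baseChange ℂ ((holDataX ι hΩ hc hVc).ζ α) *
      (parityX ι V).toLinearMap.baseChange ℂ (cder W₁ W₂ ((holDataX ι hΩ hc hVc).z α)) -
    w.baseChange ℂ ((holDataX ι hΩ hc hVc).z α) * cder W₁ W₂ ((holDataX ι hΩ hc hVc).ζ α)) with hSdef
  have h1 : S = cpx ((sliceCoords hS.slice hk hVk).canonEta w W₁)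
      ((sliceCoords hS.slice hk hVk).canonEta w W₂) := by
    have e1 := ht.etaC_eq hB hw h.left
    have e2 := ht.etaC_eq hB hw h.right
    have e3 : S = (holDataX ι hΩ hc hVc).etaC (parityX ι V) w W₁ +
        Complex.I • (holDataX ι hΩ hc hVc).etaC (parityX ι V) w W₂ := by
      rw [HolData.etaC, HolData.etaC, smul_sum, ← sum_add_distrib]
      refine sum_congr rfl fun α _ => ?_
      simp only [cder, LinearMap.add_apply, LinearMap.smul_apply, map_add, map_smul, mul_add,
        smul_sub, mul_smul_comm]
      abel
    rw [e3, e1, e2, ← cpx_zero_right, ← cpx_zero_right, I_smul_cpx, cpx_add]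
    simp
  have hz : ∀ α, cder W₁ W₂ ((holDataX ι hΩ hc hVc).z α) = cpx (D.over hVc ((holData hΩ hc).x α))
      (D.over hVc ((holData hΩ hc).x' α)) := fun α =>
    (h.hco (Sum.inl α)).trans (baseChange_cpx _ _ _)
  have hζ : ∀ α, cder W₁ W₂ ((holDataX ι hΩ hc hVc).ζ α) = cpx (D.over hVc ((holData hΩ hc).ψ' α))
      (D.over hVc ((holData hΩ hc).ψ α)) := fun α =>
    (h.hco (Sum.inr α)).trans (baseChange_cpx _ _ _)
  have h3 : imPart S = (holData hΩ hc).eta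
      (parityX ι V) (fun t => resX ι hVc (restr ι (dom c) t)) w (D.over hVc) := by
    have hab : ∀ a b d e : 𝒪 V, a + b - (d + e) = b - d + (a - e) :=
      fun a b d e => by abel
    rw [hSdef]
    simp only [hz, hζ]
    simp only [HolData.z, HolData.ζ, baseChange_cpx, cpx_mul, cpx_sub, cpx_sum, imPart_cpx]
    rw [HolData.eta]
    exact sum_congr rfl fun α _ => hab _ _ _ _
  rw [← h3, h1, imPart_cpx]

/-- `η(w, D)` is compatible with restriction to open subsets. -/
lemma resX_eta {V' : Opens X} (hV : V' ≤ V) (hVc : V ≤ pre ι (dom c)) (hc : c ∈ atlas (CE m) Y)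
    (D : VFAlong (m := m) ι p)
    {w : 𝒪 V →ₗ[ℝ] 𝒪 V} {w' : 𝒪 V' →ₗ[ℝ] 𝒪 V'}
    (hw : ∀ b, w' (resX ι hV b) = resX ι hV (w b)) :
    resX ι hV ((holData hΩ hc).eta (parityX ι V) (fun t => resX ι hVc (restr ι (dom c) t)) w
      (D.over hVc)) =
    (holData hΩ hc).eta (parityX ι V') (fun t => resX ι (hV.trans hVc) (restr ι (dom c) t)) w'
      (D.over (hV.trans hVc)) := by
  have hw2 : ∀ b : OY m (dom c), resX ι hV (w (resX ι hVc (restr ι (dom c) b))) =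
      w' (resX ι (hV.trans hVc) (restr ι (dom c) b)) := fun b => (hw _).symm
  rw [HolData.eta, HolData.eta, map_sum]
  refine sum_congr rfl fun α _ => ?_
  rw [map_add, map_sub, map_sub, map_mul, map_mul, map_mul, map_mul, hw2, hw2, hw2, hw2]
  rfl

/-- If `D = W₁ + i W₂` represents the differential of `f`, then `W₂` is the Hamiltonian vector
field of `f`. -/
lemma Represents.right_eq_ham (hS : IsSpecialSlice ι Ω) (hD : Represents hΩ f D)
    (h : IsSplitting hΩ D hc hVc W₁ W₂) {k : RChart m X}
    (hk : k ∈ atlas (RE m) X) (hVk : V ≤ domX k) :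
    W₂ = (sliceCoords hS.slice hk hVk).ham (resX ι le_top f) := by
  set t := sliceCoords hS.slice hk hVk
  have h1 : ∀ a, W₂ (t.co a) = t.ham (resX ι le_top f) (t.co a) :=
    t.co_eq_of_canonEta (isSuperCommX ι V) fun s w hw => by
      rw [← h.eta_eq hS hk hVk hw]
      exact hD c hc V hVc s w hw
  ext b
  rw [t.span' h.right, t.ham_eq_sum]
  simp only [h1]

lemma represents_of_isSplitting (hS : IsSpecialSlice ι Ω)
    (h : ∀ (c : CChart m Y) (hc : c ∈ atlas (CE m) Y)
      (k : RChart m X) (hk : k ∈ atlas (RE m) X) (V : Opens X)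
      (hVk : V ≤ domX k) (hVc : V ≤ pre ι (dom c)), ∃ W₁, IsSplitting hΩ D hc hVc W₁
        ((sliceCoords hS.slice hk hVk).ham (resX ι le_top f))) : Represents hΩ f D := by
  intro c hc V hVc s w hw
  refine ext_resX_chart fun k hk V' hV hVk => ?_
  obtain ⟨w', hw', hr, -⟩ := exists_resDer hS.slice hV hw
  obtain ⟨W₁, hW⟩ := h c hc k hk V' hVk (hV.trans hVc)
  rw [resX_eta hV hVc hc D hr, hW.eta_eq hS hk hVk hw',
    SuperCoords.canonEta_ham _ (isSuperCommX ι _) hw', ← hr]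
  rfl

lemma resX_smul {V V' : Opens X} (h : V' ≤ V) (r : ℝ) (b : 𝒪 V) :
    resX ι h (r • b) = r • resX ι h b := rfl

/-- The rotated Hamiltonian vector field of `f` represents the differential of `f`. -/
lemma represents_rotated (hΩ : IsHolomorphicForm Ω) (hS : IsSpecialSlice ι Ω)
    (hf : parityX ι ⊤ f = -((-1 : ℝ) ^ (p : ℕ) • f)) : Represents hΩ f (rotated hΩ hS hf) :=
  represents_of_isSplitting hS fun c hc k hk V hVk hVc => ⟨0, .zero,
    (sliceCoords hS.slice hk hVk).ham_isVF (isSuperCommX ι V) (by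
      rw [← resX_parity, hf, map_neg, resX_smul]), fun b => by
      refine Eq.trans ?_ (rotated_hco hf hc hk hVk hVc b).symm
      rw [cder, LinearMap.baseChange_zero, zero_add]
      rfl⟩

/-- A deformation that represents the differential of `f` is special if and only if `Δ f = 0`. -/
lemma Represents.isSpecialFamily_iff (hS : IsSpecialSlice ι Ω) (hD : Represents hΩ f D) :
    IsSpecialFamily ι hΩ D ↔ bvGlobal hΩ hS f = 0 := by
  constructor
  · intro h
    refine ext_resX_charts fun c hc k hk V hVc hVk => ?_
    set t := sliceCoords hS.slice hk hVk
    obtain ⟨W₁, W₂, hW⟩ := exists_isSplitting hΩ hS D hc hVc t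
    have h1 := h _ hc V hVc t
    rw [imPart_familyDensity hS hW] at h1
    have h2 : t.bvDiv (rho ι hΩ hc hVc t) W₂ = 0 := congrArg Thick.snd h1
    rw [hD.right_eq_ham hS hW hk hVk] at h2
    have h3 := rho_mul_bvLoc (hΩ := hΩ) (hc := hc) hS hk hVk hVc t (isHamiltonian_ham hS hk hVk hVc (resX ι le_top f))
    rw [h2, smul_zero, rho_sliceCoords hS hk hVk hVc] at h3
    rw [resX_bvGlobal hS hk hVk, map_zero]
    exact ((isUnit_densX hΩ hS.slice hk hVk hS.ne_zero hS.im_eq_zero).pow 2).mul_right_eq_zero.mp h3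
  · intro h c hc V hVc q
    obtain ⟨W₁, W₂, hW⟩ := exists_isSplitting hΩ hS D hc hVc q
    rw [imPart_familyDensity hS hW]
    suffices h0 : q.bvDiv (rho ι hΩ hc hVc q) W₂ = 0 by rw [h0]; rfl
    refine ext_resX_chart fun k hk V' hV hVk => ?_
    obtain ⟨q', hco, hq⟩ := exists_resCoords hS.slice hV q
    obtain ⟨W₁', W₂', hW', hr⟩ := hW.exists_resX hS.slice hV
    rw [resX_bvDiv hV hco hq _ hr, resX_rho hS hV hVc hq, hD.right_eq_ham hS hW' hk hVk,
      map_zero]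
    have h3 := rho_mul_bvLoc (hΩ := hΩ) (hc := hc) hS hk hVk (hV.trans hVc) q'
      (isHamiltonian_ham hS hk hVk (hV.trans hVc) (resX ι le_top f))
    rw [← resX_bvGlobal hS hk hVk, h, map_zero, mul_zero] at h3
    exact (smul_eq_zero.mp h3.symm).resolve_left (by norm_num)

end Represent

/-! ### Vector fields tangent to the slice -/

section Tangential

variable {hΩ : IsHolomorphicForm Ω} {p : Fin 2} {D : VFAlong (m := m) ι p} {f : GammaX (m := m) ι}

/-- The section `t` over `U` restricts to `b` on `ι⁻¹(U) ∩ V`. -/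
def IsLift {V : Opens X} (b : 𝒪 V) {U : Opens Y} (t : OY m U) : Prop :=
  pre ι U ≤ V ∧ ∀ (x : X) (hU : ι x ∈ U) (hV : x ∈ V),
    evX ι (pre ι U) ⟨x, hU⟩ (restr ι U t) = evX ι V ⟨x, hV⟩ b

lemma exists_isLift (hι : IsRealSlice (m := m) ι) {V : Opens X} (b : 𝒪 V) (x : V) :
    ∃ (U : Opens Y) (t : OY m U), ι x ∈ U ∧ IsLift b t := by
  obtain ⟨U, t, hU, ht⟩ := b.2 x
  obtain ⟨U₁, hU₁⟩ := exists_pre_eq hι V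
  have hmem : ∀ x' : X, ι x' ∈ U₁ ↔ x' ∈ V := fun x' => by rw [← hU₁]; rfl
  exact ⟨U ⊓ U₁, resY inf_le_left t, ⟨hU, (hmem x).mpr x.2⟩, fun x' hx' => (hmem x').mp hx'.2,
    fun x' hx' hV => (ht ⟨x', hV⟩ hx'.1).symm⟩

section Lift

variable {V : Opens X} {a b : OX (m := m) ι V} {U U' : Opens Y} {t : OY m U} {t' : OY m U'}

lemma IsLift.add (ht : IsLift a t) (ht' : IsLift b t') :
    IsLift (a + b) (resY (inf_le_left : U ⊓ U' ≤ U) t + resY (inf_le_right : U ⊓ U' ≤ U') t') :=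
  ⟨fun _ hx => ht.1 hx.1, fun x hx hV =>
    (congrArg (evX ι (pre ι (U ⊓ U')) ⟨x, hx⟩) ((restr ι (U ⊓ U')).map_add _ _)).trans
      (congrArg₂ (· + ·) (ht.2 x hx.1 hV) (ht'.2 x hx.2 hV))⟩

lemma IsLift.mul (ht : IsLift a t) (ht' : IsLift b t') :
    IsLift (a * b) (resY (inf_le_left : U ⊓ U' ≤ U) t * resY (inf_le_right : U ⊓ U' ≤ U') t') :=
  ⟨fun _ hx => ht.1 hx.1, fun x hx hV =>
    (congrArg (evX ι (pre ι (U ⊓ U')) ⟨x, hx⟩) ((restr ι (U ⊓ U')).map_mul _ _)).trans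
      (congrArg₂ (· * ·) (ht.2 x hx.1 hV) (ht'.2 x hx.2 hV))⟩

lemma IsLift.smul (ht : IsLift b t) (r : ℝ) : IsLift (r • b) (r • t) :=
  ⟨ht.1, fun x hx hV =>
    (congrArg (evX ι (pre ι U) ⟨x, hx⟩) ((restr ι U).toLinearMap.map_smul r _)).trans
      (congrArg (r • ·) (ht.2 x hx hV))⟩

lemma IsLift.parity (ht : IsLift b t) : IsLift (parityX ι V b) (parityY U t) :=
  ⟨ht.1, fun x hx hV => (map_extParity _ _).trans (congrArg (extParity _) (ht.2 x hx hV))⟩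

lemma evX_add_of_resY (D : VFAlong (m := m) ι p) (t : OY m U) (t' : OY m U') {x : X} (hx : ι x ∈ U)
    (hx' : ι x ∈ U') : evX ι (pre ι (U ⊓ U')) ⟨x, hx, hx'⟩
      (D.1 _ (resY (inf_le_left : U ⊓ U' ≤ U) t + resY (inf_le_right : U ⊓ U' ≤ U') t')) =
    evX ι (pre ι U) ⟨x, hx⟩ (D.1 U t) + evX ι (pre ι U') ⟨x, hx'⟩ (D.1 U' t') := by
  rw [map_add (D.1 _), D.2.2, D.2.2]
  rfl

lemma evX_mul_of_resY (D : VFAlong (m := m) ι p) (t : OY m U) (t' : OY m U') {x : X} (hx : ι x ∈ U)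
    (hx' : ι x ∈ U') : evX ι (pre ι (U ⊓ U')) ⟨x, hx, hx'⟩
      (D.1 _ (resY (inf_le_left : U ⊓ U' ≤ U) t * resY (inf_le_right : U ⊓ U' ≤ U') t')) =
    evX ι (pre ι U) ⟨x, hx⟩ (D.1 U t) * evX ι (pre ι U') ⟨x, hx'⟩ (restr ι U' t') +
      (extParity _ ^ (p : ℕ)) (evX ι (pre ι U) ⟨x, hx⟩ (restr ι U t)) *
        evX ι (pre ι U') ⟨x, hx'⟩ (D.1 U' t') := by
  rw [(D.2.1 _).1, evX_add, evX_mul, evX_mul, evX_parity_pow, D.2.2 U _ inf_le_left,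
    D.2.2 U' _ inf_le_right]
  rfl

end Lift

/-- Vector fields tangent to the slice act on functions on the slice through their lifts. -/
lemma tangential_eq_of_isLift (hD : D ∈ tangential (m := m) ι p) {V : Opens X}
    {b : 𝒪 V} {U U' : Opens Y} {t : OY m U} {t' : OY m U'} (ht : IsLift b t)
    (ht' : IsLift b t') {x : X} (hx : ι x ∈ U) (hx' : ι x ∈ U') :
    evX ι (pre ι U) ⟨x, hx⟩ (D.1 U t) = evX ι (pre ι U') ⟨x, hx'⟩ (D.1 U' t') := by
  have h0 : restr ι (U ⊓ U') (resY inf_le_left t - resY inf_le_right t') = 0 := ext_evX fun x₁ => by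
    rw [map_sub (restr ι _), map_sub (evX ι _ _), map_zero, sub_eq_zero]
    exact (ht.2 x₁ x₁.2.1 (ht.1 x₁.2.1)).trans (ht'.2 x₁ x₁.2.2 (ht.1 x₁.2.1)).symm
  have h1 := hD (U ⊓ U') _ h0
  rw [map_sub, sub_eq_zero, D.2.2 _ _ inf_le_left, D.2.2 _ _ inf_le_right] at h1
  exact congrArg (evX ι (pre ι (U ⊓ U')) ⟨x, hx, hx'⟩) h1

lemma exists_tangValue (hι : IsRealSlice (m := m) ι) (hD : D ∈ tangential (m := m) ι p)
    {V : Opens X} (b : 𝒪 V) (x : V) : ∃ v : ExteriorAlgebra ℝ (NX (m := m) ι (x : X)),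
      ∀ (U : Opens Y) (t : OY m U), IsLift b t → ∀ hU : ι (x : X) ∈ U,
        v = evX ι (pre ι U) ⟨x, hU⟩ (D.1 U t) := by
  obtain ⟨U, t, hx, ht⟩ := exists_isLift hι b x
  exact ⟨_, fun U' t' ht' hU' => tangential_eq_of_isLift hD ht ht' hx hU'⟩

/-- The value at `x` of the action on `b` of a vector field tangent to the slice. -/
def tangValue (hι : IsRealSlice (m := m) ι) (hD : D ∈ tangential (m := m) ι p)
    {V : Opens X} (b : 𝒪 V) (x : V) : ExteriorAlgebra ℝ (NX (m := m) ι (x : X)) :=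
  (exists_tangValue hι hD b x).choose

section Value

variable {hι : IsRealSlice (m := m) ι} {hD : D ∈ tangential (m := m) ι p} {V : Opens X}

lemma tangValue_eq {b : 𝒪 V} {U : Opens Y} {t : OY m U} (ht : IsLift b t) (x : V)
    (hU : ι (x : X) ∈ U) : tangValue hι hD b x = evX ι (pre ι U) ⟨x, hU⟩ (D.1 U t) :=
  (exists_tangValue hι hD b x).choose_spec U t ht hU

lemma isNormalSection_tangValue (b : 𝒪 V) :
    IsNormalSection ι (tangValue hι hD b) := isNormalSection_of_local hι fun x => by
  obtain ⟨U, t, hx, ht⟩ := exists_isLift hι b x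
  exact ⟨pre ι U, hx, D.1 U t, fun x' hx' => tangValue_eq ht x' hx'⟩

lemma tangValue_add (a b : 𝒪 V) (x : V) :
    tangValue hι hD (a + b) x = tangValue hι hD a x + tangValue hι hD b x := by
  obtain ⟨U, t, hx, ht⟩ := exists_isLift hι a x
  obtain ⟨U', t', hx', ht'⟩ := exists_isLift hι b x
  rw [tangValue_eq ht x hx, tangValue_eq ht' x hx', tangValue_eq (ht.add ht') x ⟨hx, hx'⟩]
  exact evX_add_of_resY D t t' hx hx'

lemma tangValue_smul (r : ℝ) (b : 𝒪 V) (x : V) :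
    tangValue hι hD (r • b) x = r • tangValue hι hD b x := by
  obtain ⟨U, t, hx, ht⟩ := exists_isLift hι b x
  rw [tangValue_eq ht x hx, tangValue_eq (ht.smul r) x hx]
  exact congrArg (evX ι (pre ι U) ⟨x, hx⟩) ((D.1 U).map_smul r t)

lemma tangValue_mul (a b : 𝒪 V) (x : V) :
    tangValue hι hD (a * b) x = tangValue hι hD a x * evX ι V x b +
      (extParity _ ^ (p : ℕ)) (evX ι V x a) * tangValue hι hD b x := by
  obtain ⟨U, t, hx, ht⟩ := exists_isLift hι a x
  obtain ⟨U', t', hx', ht'⟩ := exists_isLift hι b x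
  rw [tangValue_eq ht x hx, tangValue_eq ht' x hx', tangValue_eq (ht.mul ht') x ⟨hx, hx'⟩]
  refine (evX_mul_of_resY D t t' hx hx').trans ?_
  rw [ht.2 x hx x.2, ht'.2 x hx' x.2]

lemma tangValue_parity (b : 𝒪 V) (x : V) :
    tangValue hι hD (parityX ι V b) x = (-1 : ℝ) ^ (p : ℕ) • extParity _ (tangValue hι hD b x) := by
  obtain ⟨U, t, hx, ht⟩ := exists_isLift hι b x
  rw [tangValue_eq ht x hx, tangValue_eq ht.parity x hx]
  exact congrArg (evX ι (pre ι U) ⟨x, hx⟩) ((D.2.1 U).2 t)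

/-- The vector field on `V` given by a vector field along the slice that is tangent to the slice. -/
def tangDer (hι : IsRealSlice (m := m) ι) (hD : D ∈ tangential (m := m) ι p) (V : Opens X) :
    𝒪 V →ₗ[ℝ] 𝒪 V where
  toFun b := ⟨tangValue hι hD b, isNormalSection_tangValue b⟩
  map_add' a b := ext_evX fun x => tangValue_add (hι := hι) (hD := hD) a b x
  map_smul' r b := ext_evX fun x => tangValue_smul (hι := hι) (hD := hD) r b x

lemma tangDer_isVF : IsVF (parityX ι V) p (tangDer hι hD V) := by
  refine ⟨fun a b => ext_evX fun x => (tangValue_mul (hι := hι) (hD := hD) a b x).trans ?_,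
    fun b => ext_evX fun x => tangValue_parity (hι := hι) (hD := hD) b x⟩
  rw [← evX_parity_pow]
  rfl

end Value

lemma SuperCoords.ham_zero {B : Type*} [Ring B] [Algebra ℝ B] {σ : B →ₐ[ℝ] B}
    (q : SuperCoords B σ m) : q.ham 0 = 0 := by
  ext b
  rw [SuperCoords.ham_apply]
  simp

/-- A vector field along the slice is tangent to the slice if and only if it represents `0`. -/
lemma mem_tangential_iff (hΩ : IsHolomorphicForm Ω) (hS : IsSpecialSlice ι Ω) :
    D ∈ tangential (m := m) ι p ↔ Represents hΩ 0 D := by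
  constructor
  · intro hD
    refine represents_of_isSplitting hS fun c hc k hk V hVk hVc => ?_
    rw [map_zero, SuperCoords.ham_zero]
    have hD2 : ∀ t : OY m (dom c), tangDer hS.slice hD V (restrTo ι hVc t) = D.over hVc t := fun t => ext_evX fun x => by
      obtain ⟨U₁, hU₁⟩ := exists_pre_eq hS.slice V
      have hmem : ∀ x' : X, ι x' ∈ U₁ ↔ x' ∈ V := fun x' => by rw [← hU₁]; rfl
      have hl : IsLift (restrTo ι hVc t) (resY (inf_le_left : dom c ⊓ U₁ ≤ _) t) :=
        ⟨fun x' hx' => (hmem x').mp hx'.2, fun x' hx' hV => rfl⟩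
      refine (tangValue_eq (hι := hS.slice) (hD := hD) hl x ⟨hVc x.2, (hmem x).mpr x.2⟩).trans ?_
      rw [D.2.2]
      rfl
    refine ⟨tangDer hS.slice hD V, tangDer_isVF, .zero, fun b => ?_⟩
    rw [cder, LinearMap.baseChange_zero, smul_zero, add_zero, ← cmap_restrTo_dom (hc := hc),
      ← baseChange_comp]
    exact congrArg (fun L => LinearMap.baseChange ℂ L ((holData hΩ hc).hco b)) (LinearMap.ext hD2)
  · intro hD U t ht
    refine ext_evX fun x => ?_
    set c := chartAt (CE m) (ι (x : X))
    have hc : c ∈ atlas (CE m) Y := chart_mem_atlas _ _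
    set k := chartAt (RE m) (x : X)
    have hk : k ∈ atlas (RE m) X := chart_mem_atlas _ _
    set U' : Opens Y := dom c ⊓ U
    have hU' : U' ≤ dom c := inf_le_left
    set V : Opens X := domX k ⊓ pre ι U'
    have hVU : V ≤ pre ι U' := inf_le_right
    have hVc : V ≤ pre ι (dom c) := hVU.trans (Opens.comap_mono ι hU')
    have hVk : V ≤ domX k := inf_le_left
    have hxV : (x : X) ∈ V := ⟨mem_chart_source _ _, mem_chart_source _ _, x.2⟩
    obtain ⟨W₁, W₂, hW⟩ := exists_isSplitting hΩ hS D hc hVc (sliceCoords hS.slice hk hVk)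
    have hW2 := hD.right_eq_ham hS hW hk hVk
    rw [map_zero, SuperCoords.ham_zero] at hW2
    have h1 : IsSuperDer (parityY U') (extParity _) (atX ι U' (x : X) (hVU hxV)) p
        ((evX ι V ⟨x, hxV⟩).toLinearMap ∘ₗ D.over hVU) :=
      IsSuperDer.comp_left (D.over_isSuperDer hVU) (evX ι V ⟨x, hxV⟩) fun _ => rfl
    have h2 : IsSuperDer (parityY U') (extParity _) (atX ι U' (x : X) (hVU hxV)) p
        ((evX ι V ⟨x, hxV⟩).toLinearMap ∘ₗ (W₁ ∘ₗ (restrTo ι hVU).toLinearMap)) :=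
      IsSuperDer.comp_left (IsSuperDer.comp_right hW.left (restrTo ι hVU) (restrTo_parity hVU))
        (evX ι V ⟨x, hxV⟩) fun _ => rfl
    have h3 := der_ext_hco hc hU' hΩ h1 h2 fun b => by
      rw [evX_baseChange, evX_baseChange, baseChange_comp, cmap_restrTo_hco]
      refine congrArg (cmap (evX ι V ⟨x, hxV⟩)) ?_
      have h4 := hW.hco b
      rw [hW2, cder, LinearMap.baseChange_zero, smul_zero, add_zero] at h4
      refine Eq.trans ?_ h4.symm
      rw [← cmap_resY_hco hc le_rfl hU', ← baseChange_comp]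
      exact congrArg (fun L => LinearMap.baseChange ℂ L ((holData hΩ hc).hco b))
        (LinearMap.ext fun t => D.over_resY hU' hVU t)
    have h5 := LinearMap.congr_fun h3 (resY inf_le_right t)
    have h6 : restrTo ι hVU (resY inf_le_right t) = 0 :=
      ext_evX fun x' => congrArg (evX ι (pre ι U) ⟨x', x'.2.2.2⟩) ht
    refine Eq.trans ?_ (h5.trans ?_)
    · exact (congrArg (evX ι V ⟨x, hxV⟩) (D.over_resY inf_le_right hVU t)).symm
    · show evX ι V ⟨x, hxV⟩ (W₁ (restrTo ι hVU (resY inf_le_right t))) = _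
      rw [h6, map_zero, map_zero, map_zero]

end Tangential

/-! ### The Liouville form on first-order families -/

section LiouvilleAlgebra

variable {B : Type*} [Ring B] [Algebra ℝ B] {σ : B →ₐ[ℝ] B} {p s : Fin 2}

lemma IsSuperComm.pow_mul_swap (hB : IsSuperComm σ) {a u : B} (ha : σ a = (-1 : ℝ) ^ (p : ℕ) • a)
    (hu : σ u = -((-1 : ℝ) ^ (s : ℕ) • u)) : (σ ^ (s : ℕ)) a * u = u * σ a := by
  have h1 : ∀ a : B, (σ ^ ((1 : Fin 2) : ℕ)) a = σ a := fun a => by simp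
  have h0 : ∀ a : B, (σ ^ ((0 : Fin 2) : ℕ)) a = a := fun a => by simp
  match p, s with
  | 0, 0 =>
    simp only [Fin.val_zero, pow_zero, one_smul] at ha
    rw [h0, ha, hB.even_comm a u ha]
  | 0, 1 =>
    simp only [Fin.val_zero, pow_zero, one_smul] at ha
    rw [h1, ha, hB.even_comm a u ha]
  | 1, 0 =>
    simp only [Fin.val_one, pow_one, neg_smul, one_smul] at ha
    simp only [Fin.val_zero, pow_zero, one_smul] at hu
    rw [h0, ha, hB.odd_comm a u ha, hu, mul_neg, neg_mul]
  | 1, 1 =>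
    simp only [Fin.val_one, pow_one, neg_smul, one_smul] at ha
    simp only [Fin.val_one, pow_one, neg_smul, one_smul, neg_neg] at hu
    rw [h1, ha, neg_mul, hB.odd_comm a u ha, hu, mul_neg]

/-- The `ε`-part of a term `dx ψ` of the Liouville form on a first-order family. -/
lemma snd_liouville_term (hB : IsSuperComm σ) {w : B →ₗ[ℝ] B} (hw : IsVF σ s w) {x ψ a u : B}
    (hx : σ x = x) (hψ : σ ψ = -ψ) (ha : σ a = (-1 : ℝ) ^ (p : ℕ) • a) :
    (Thick.lift σ p s w ⟨x, a⟩ * (⟨ψ, u⟩ : Thick B σ p)).snd =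
      (-1 : ℝ) ^ ((p : ℕ) * (s : ℕ)) • (w (a * ψ) - (w ψ * σ a - w x * u)) := by
  have h1 : σ (w ψ) = -((-1 : ℝ) ^ (s : ℕ) • w ψ) := by
    have h := hw.2 ψ
    rw [hψ, map_neg] at h
    rw [← smul_neg, h, smul_smul, ← mul_pow]
    norm_num
  have h2 : (σ ^ (p : ℕ)) (w x) = (-1 : ℝ) ^ ((p : ℕ) * (s : ℕ)) • w x := by
    have h := hw.2 x
    rw [hx] at h
    have h3 : σ (w x) = (-1 : ℝ) ^ (s : ℕ) • w x := by
      conv_rhs => rw [h]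
      rw [smul_smul, ← mul_pow]
      norm_num
    fin_cases p
    · simp
    · simpa using h3
  rw [Thick.snd_mul, Thick.snd_lift, Thick.fst_lift, h2, hw.1, AlgHom.id_apply, AlgHom.id_apply,
    hB.pow_mul_swap ha h1]
  simp only [smul_mul_assoc, smul_sub, smul_add]
  abel

end LiouvilleAlgebra

section Exact

variable {hΩ : IsHolomorphicForm Ω} {p : Fin 2} {D : VFAlong (m := m) ι p} {f : GammaX (m := m) ι}
  {c : CChart m Y} {hc : c ∈ atlas (CE m) Y} {V : Opens X}
  {hVc : V ≤ pre ι (dom c)}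

/-- The contraction `⟨D, θ⟩` in the coordinates of a chart. -/
def thetaLoc (hΩ : IsHolomorphicForm Ω) (D : VFAlong (m := m) ι p) (hc : c ∈ atlas (CE m) Y)
    (hVc : V ≤ pre ι (dom c)) : 𝒪 V :=
  ∑ α, (D.over hVc ((holData hΩ hc).x α) * restrTo ι hVc ((holData hΩ hc).ψ α) +
    D.over hVc ((holData hΩ hc).x' α) * restrTo ι hVc ((holData hΩ hc).ψ' α))

lemma evX_thetaLoc_congr {c' : CChart m Y} (hc : c ∈ atlas (CE m) Y)
    (hc' : c' ∈ atlas (CE m) Y) {V V' : Opens X}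
    (hVc : V ≤ pre ι (dom c)) (hVc' : V' ≤ pre ι (dom c')) (x : X) (hx : x ∈ V) (hx' : x ∈ V') :
    evX ι V ⟨x, hx⟩ (thetaLoc hΩ D hc hVc) = evX ι V' ⟨x, hx'⟩ (thetaLoc hΩ D hc' hVc') := by
  set U : Opens Y := dom c ⊓ dom c'
  have hxU : ι x ∈ U := ⟨hVc hx, hVc' hx'⟩
  set δ : OY m U →ₗ[ℝ] ExteriorAlgebra ℝ (NX (m := m) ι x) :=
    (evX ι (pre ι U) ⟨x, hxU⟩).toLinearMap ∘ₗ D.1 U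
  have hδ : IsSuperDer (parityY U) (extParity _) (atX ι U x hxU) p δ :=
    IsSuperDer.comp_left (D.2.1 U) (evX ι (pre ι U) ⟨x, hxU⟩) fun _ => rfl
  have key : ∀ {c₁ : CChart m Y} (hc₁ : c₁ ∈ atlas (CE m) Y) (hU : U ≤ dom c₁)
      {V₁ : Opens X} (hV₁ : V₁ ≤ pre ι (dom c₁)) (hx₁ : x ∈ V₁),
      evX ι V₁ ⟨x, hx₁⟩ (thetaLoc hΩ D hc₁ hV₁) =
        ∑ α, (δ ((holDataY hΩ hc₁ hU).x α) * atX ι U x hxU ((holDataY hΩ hc₁ hU).ψ α) +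
          δ ((holDataY hΩ hc₁ hU).x' α) * atX ι U x hxU ((holDataY hΩ hc₁ hU).ψ' α)) :=
    fun hc₁ hU V₁ hV₁ hx₁ => by
    have h1 : ∀ t, δ (resY hU t) = evX ι V₁ ⟨x, hx₁⟩ (D.over hV₁ t) := fun t =>
      congrArg (evX ι (pre ι U) ⟨x, hxU⟩) (D.2.2 _ U hU t)
    rw [thetaLoc, map_sum]
    refine sum_congr rfl fun α _ => ?_
    rw [map_add, map_mul, map_mul]
    exact congrArg₂ (· + ·) (congrArg (· * _) (h1 _).symm) (congrArg (· * _) (h1 _).symm)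
  rw [key hc inf_le_left hVc hx, key hc' inf_le_right hVc' hx']
  exact liouville_congr hc inf_le_left hΩ hc' inf_le_right hδ

/-- The value at a point of the contraction `⟨D, θ⟩`. -/
def thetaAt (hΩ : IsHolomorphicForm Ω) (D : VFAlong (m := m) ι p) (x : X) :
    ExteriorAlgebra ℝ (NX (m := m) ι x) :=
  evX ι (pre ι (dom (chartAt (CE m) (ι x)))) ⟨x, mem_chart_source _ _⟩
    (thetaLoc hΩ D (chart_mem_atlas _ _) le_rfl)

lemma thetaAt_eq (hc : c ∈ atlas (CE m) Y) (hVc : V ≤ pre ι (dom c)) (x : X) (hx : x ∈ V) :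
    thetaAt hΩ D x = evX ι V ⟨x, hx⟩ (thetaLoc hΩ D hc hVc) :=
  evX_thetaLoc_congr (chart_mem_atlas _ _) hc le_rfl hVc x _ hx

lemma isNormalSection_thetaAt (hΩ : IsHolomorphicForm Ω) (hι : IsRealSlice (m := m) ι)
    (D : VFAlong (m := m) ι p) :
    IsNormalSection ι (V := ⊤) fun x => thetaAt hΩ D (x : X) := by
  refine isNormalSection_of_local hι fun x => ?_
  have hc : chartAt (CE m) (ι (x : X)) ∈ atlas (CE m) Y := chart_mem_atlas _ _
  set c := chartAt (CE m) (ι (x : X))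
  have hx : (x : X) ∈ pre ι (dom c) := mem_chart_source (CE m) (ι (x : X))
  refine ⟨pre ι (dom c), hx, thetaLoc hΩ D hc le_rfl, fun x' hx' => ?_⟩
  exact thetaAt_eq hc le_rfl (x' : X) hx'

/-- The contraction `⟨D, θ⟩` as a global function on the slice. -/
def theta (hΩ : IsHolomorphicForm Ω) (hι : IsRealSlice (m := m) ι) (D : VFAlong (m := m) ι p) :
    GammaX (m := m) ι :=
  ⟨fun x => thetaAt hΩ D (x : X), isNormalSection_thetaAt hΩ hι D⟩

lemma resX_theta (hΩ : IsHolomorphicForm Ω) (hι : IsRealSlice (m := m) ι)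
    (D : VFAlong (m := m) ι p) (hc : c ∈ atlas (CE m) Y) (hVc : V ≤ pre ι (dom c)) :
    resX ι le_top (theta hΩ hι D) = thetaLoc hΩ D hc hVc :=
  ext_evX fun x => thetaAt_eq hc hVc x x.2

/-- The Liouville form vanishes on the slice. -/
lemma liouville_holDataX (hS : IsSpecialSlice ι Ω) {s : Fin 2}
    {w : 𝒪 V →ₗ[ℝ] 𝒪 V} (hw : IsVF (parityX ι V) s w) :
    (holDataX ι hΩ hc hVc).liouville w = 0 := by
  refine ext_resX_chart fun k hk V' hV hVk => ?_
  obtain ⟨w', hw', hr, -⟩ := exists_resDer hS.slice hV hw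
  have h := congrArg imPart
    ((adapted (hΩ := hΩ) (hc := hc) hS hk hVk (hV.trans hVc)).liouville hw')
  simp only [HolData.z, HolData.ζ, baseChange_cpx, cpx_mul, cpx_sum, imPart_cpx,
    imPart_one_tmul] at h
  rw [map_zero, ← h, HolData.liouville, map_sum]
  refine sum_congr rfl fun α _ => ?_
  rw [map_add, map_mul, map_mul, ← hr, ← hr]
  rfl

/-- The Liouville form on the first-order family given by `D`: its `ε`-part is
`d⟨D, θ⟩ - η(·, D)`. -/
lemma liouville_family (hS : IsSpecialSlice ι Ω) {s : Fin 2}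
    {w : 𝒪 V →ₗ[ℝ] 𝒪 V} (hw : IsVF (parityX ι V) s w) :
    ((holData hΩ hc).map (family D hVc)).liouville (Thick.lift (parityX ι V) p s w) =
      ⟨0, (-1 : ℝ) ^ ((p : ℕ) * (s : ℕ)) • (w (thetaLoc hΩ D hc hVc) -
        (holData hΩ hc).eta (parityX ι V) (fun t => resX ι hVc (restr ι (dom c) t)) w
          (D.over hVc))⟩ := by
  have hB := isSuperCommX (m := m) ι V
  have hh := isHomogeneous_holDataX hΩ hc hVc
  have hpar : ∀ {t : OY m (dom c)}, parityY (dom c) t = t →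
      parityX ι V (D.over hVc t) = (-1 : ℝ) ^ (p : ℕ) • D.over hVc t := fun {t} ht => by
    have h := (D.over_isSuperDer hVc).2 t
    rw [ht] at h
    conv_rhs => rw [h]
    rw [smul_smul, ← mul_pow]
    norm_num
  have hhY := isHomogeneous_holData hΩ hc
  ext
  · refine Eq.trans ?_ (liouville_holDataX (hΩ := hΩ) (hc := hc) (hVc := hVc) hS hw)
    rw [HolData.liouville, Thick.fst_sum]
    rfl
  · rw [HolData.liouville, Thick.snd_sum]
    have h1 : ∀ α, (Thick.lift (parityX ι V) p s w (((holData hΩ hc).map (family D hVc)).x α) *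
        ((holData hΩ hc).map (family D hVc)).ψ α).snd = _ := fun α =>
      snd_liouville_term hB hw (hh.x α) (hh.ψ α) (hpar (hhY.x α))
        (u := D.over hVc ((holData hΩ hc).ψ α))
    have h2 : ∀ α, (Thick.lift (parityX ι V) p s w (((holData hΩ hc).map (family D hVc)).x' α) *
        ((holData hΩ hc).map (family D hVc)).ψ' α).snd = _ := fun α =>
      snd_liouville_term hB hw (hh.x' α) (hh.ψ' α) (hpar (hhY.x' α))
        (u := D.over hVc ((holData hΩ hc).ψ' α))
    simp only [Thick.snd_add, h1, h2, ← smul_add, ← smul_sum]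
    refine congrArg ((-1 : ℝ) ^ ((p : ℕ) * (s : ℕ)) • ·) ?_
    rw [thetaLoc, map_sum, HolData.eta, ← sum_sub_distrib]
    refine sum_congr rfl fun α _ => ?_
    rw [map_add]
    have hab : ∀ a b d e : 𝒪 V, a - b + (d - e) = a + d - (b + e) := fun a b d e => by
      abel
    exact hab _ _ _ _

/-- Exact Lagrangian deformations are those that represent differentials. -/
lemma isExactLagrangian_iff (hS : IsSpecialSlice ι Ω) :
    IsExactLagrangian ι hΩ D ↔ ∃ f, Represents hΩ f D := by
  have hsgn : ∀ s : Fin 2, ((-1 : ℝ) ^ ((p : ℕ) * (s : ℕ))) ≠ 0 := fun s => by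
    exact pow_ne_zero _ (by norm_num)
  constructor
  · rintro ⟨F, hF⟩
    refine ⟨theta hΩ hS.slice D - F.snd, fun c hc V hVc s w hw => ?_⟩
    have h := hF c hc V hVc s w hw
    rw [liouville_family hS hw] at h
    have h2 := smul_right_injective _ (hsgn s) (congrArg Thick.snd h)
    rw [map_sub, map_sub, resX_theta hΩ hS.slice D hc hVc, ← h2, sub_sub_cancel]
  · rintro ⟨f, hf⟩
    refine ⟨⟨0, theta hΩ hS.slice D - f⟩, fun c hc V hVc s w hw => ?_⟩
    rw [liouville_family hS hw, hf c hc V hVc s w hw]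
    ext
    · show 0 = w (resX ι le_top 0)
      rw [map_zero, map_zero]
    · show _ = (-1 : ℝ) ^ ((p : ℕ) * (s : ℕ)) • w (resX ι le_top (theta hΩ hS.slice D - f))
      rw [map_sub, map_sub, resX_theta hΩ hS.slice D hc hVc]

end Exact

/-! ### Functions with vanishing differential -/

section Euler

variable {W J : Type*} [AddCommGroup W] [Module ℝ W] [Fintype J] (β : Module.Basis J ℝ W)

/-- The Euler operator acts on `Λⁿ` as multiplication by `n`. -/
lemma sum_ι_mul_contr {n : ℕ} {a : ExteriorAlgebra ℝ W} (ha : a ∈ ⋀[ℝ]^n W) :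
    ∑ j, ExteriorAlgebra.ι ℝ (β j) * contr (β.coord j) a = (n : ℝ) • a := by
  induction ha using Submodule.pow_induction_on_left' with
  | algebraMap r => simp [contr]
  | add x y i hx hy hx' hy' => simp only [map_add, mul_add, sum_add_distrib, hx', hy', smul_add]
  | mem_mul v hv i x hx h =>
    obtain ⟨v, rfl⟩ := hv
    have h1 : ∀ j, ExteriorAlgebra.ι ℝ (β j) * contr (β.coord j) (ExteriorAlgebra.ι ℝ v * x) =
        ExteriorAlgebra.ι ℝ (β.coord j v • β j) * x +
          ExteriorAlgebra.ι ℝ v * (ExteriorAlgebra.ι ℝ (β j) * contr (β.coord j) x) := fun j => by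
      have h2 : contr (β.coord j) (ExteriorAlgebra.ι ℝ v * x) =
          β.coord j v • x - ExteriorAlgebra.ι ℝ v * contr (β.coord j) x :=
        CliffordAlgebra.contractLeft_ι_mul (Q := 0) _ _ _
      have h3 : ExteriorAlgebra.ι ℝ (β j) * ExteriorAlgebra.ι ℝ v =
          -(ExteriorAlgebra.ι ℝ v * ExteriorAlgebra.ι ℝ (β j)) :=
        eq_neg_of_add_eq_zero_left (ExteriorAlgebra.ι_add_mul_swap _ _)
      rw [h2, mul_sub, ← mul_assoc, h3, map_smul, smul_mul_assoc, mul_smul_comm, neg_mul,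
        sub_neg_eq_add, mul_assoc]
    rw [sum_congr rfl fun j _ => h1 j, sum_add_distrib, ← mul_sum, h,
      ← sum_mul, ← map_sum, Nat.cast_succ, add_smul, one_smul, mul_smul_comm, add_comm]
    congr 3
    exact β.sum_repr v

/-- An element of an exterior algebra all of whose contractions vanish is a scalar. -/
lemma exists_scalar_of_contr {a : ExteriorAlgebra ℝ W} (h : ∀ j, contr (β.coord j) a = 0) :
    ∃ r : ℝ, a = algebraMap ℝ _ r := by
  set A : ℕ → Submodule ℝ (ExteriorAlgebra ℝ W) := fun n => ⋀[ℝ]^n W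
  have key : ∀ (b : ExteriorAlgebra ℝ W) (n : ℕ), (DirectSum.decompose A
      (∑ j, ExteriorAlgebra.ι ℝ (β j) * contr (β.coord j) b) n : ExteriorAlgebra ℝ W) =
      (n : ℝ) • (DirectSum.decompose A b n : ExteriorAlgebra ℝ W) := fun b n => by
    induction b using DirectSum.Decomposition.inductionOn A with
    | zero => simp
    | @homogeneous i b =>
      rw [sum_ι_mul_contr β b.2, DirectSum.decompose_smul, DirectSum.smul_apply, Submodule.coe_smul]
      by_cases hi : i = n
      · simp only [hi]
      · rw [DirectSum.decompose_of_mem_ne A b.2 hi, smul_zero, smul_zero]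
    | add b b' hb hb' =>
      simp only [map_add, mul_add, sum_add_distrib, DirectSum.decompose_add,
        DirectSum.add_apply, Submodule.coe_add, hb, hb', smul_add]
  have h0 : ∀ n : ℕ, n ≠ 0 → (DirectSum.decompose A a n : ExteriorAlgebra ℝ W) = 0 := fun n hn => by
    have h1 := key a n
    simp only [h, mul_zero, Finset.sum_const_zero, DirectSum.decompose_zero, DirectSum.zero_apply,
      Submodule.coe_zero] at h1
    exact (smul_eq_zero.mp h1.symm).resolve_left (Nat.cast_ne_zero.mpr hn)
  have h1 : a = DirectSum.decompose A a 0 := by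
    apply (DirectSum.decompose A).injective
    rw [DirectSum.decompose_coe]
    ext n
    by_cases hn : n = 0
    · subst hn
      rw [DirectSum.of_eq_same]
    · rw [h0 n hn, DirectSum.of_eq_of_ne _ _ _ hn]
      rfl
  have h2 : (DirectSum.decompose A a 0 : ExteriorAlgebra ℝ W) ∈ A 0 := SetLike.coe_mem _
  rw [← h1] at h2
  obtain ⟨r, hr⟩ := Submodule.mem_one.mp (show a ∈ (1 : Submodule ℝ (ExteriorAlgebra ℝ W)) from h2)
  exact ⟨r, hr.symm⟩

end Euler

section Constant

/-- A function on a coordinate domain of the slice all of whose partial derivatives vanish is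
locally a real constant. -/
lemma exists_locally_const (hι : IsRealSlice (m := m) ι) {k : RChart m X}
    (hk : k ∈ atlas (RE m) X) {V : Opens X} (hV : V ≤ domX k) {b : 𝒪 V}
    (hx : ∀ i, (sliceCoords hι hk hV).dx i b = 0) (hξ : ∀ i, (sliceCoords hι hk hV).dξ i b = 0)
    (x : V) : ∃ (r : ℝ) (V' : Opens X), (x : X) ∈ V' ∧
      ∀ (x' : V), (x' : X) ∈ V' → evX ι V x' b = algebraMap ℝ _ r := by
  obtain ⟨s, rfl⟩ := (trivX hι hk hV).symm.surjective b
  have hx' : ∀ i, smoothExt.deriv _ (stdBasis m i) s = 0 := fun i => by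
    have h1 := (trivX hι hk hV).symm.injective ((hx i).trans (map_zero _).symm)
    exact (congrArg (smoothExt.deriv _ (stdBasis m i)) ((trivX hι hk hV).apply_symm_apply s).symm).trans h1
  have hξ' : ∀ i, smoothExt.contract _ ((stdBasis m).coord i) s = 0 := fun i => by
    have h1 := (trivX hι hk hV).symm.injective ((hξ i).trans (map_zero _).symm)
    exact (congrArg (smoothExt.contract _ ((stdBasis m).coord i))
      ((trivX hι hk hV).apply_symm_apply s).symm).trans h1
  let := extNorm (W := RE m)
  let := extNormedSpace (W := RE m)
  have hkx : k x ∈ img k V := mem_img (hV x.2) x.2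
  obtain ⟨r, hr⟩ := exists_scalar_of_contr (stdBasis m) (a := s.1 ⟨k x, hkx⟩) fun i =>
    congrFun (congrArg Subtype.val (hξ' i)) ⟨k x, hkx⟩
  have hopen : IsOpen ((img k V : Set (RE m)) ∩ zext s.1 ⁻¹' {algebraMap ℝ _ r}) := by
    refine (img k V).isOpen.isOpen_inter_preimage_of_fderiv_eq_zero (𝕜 := ℝ)
      (fun e he => (differentiableAt_zext s ⟨e, he⟩).differentiableWithinAt) (fun e he => ?_) _
    refine ContinuousLinearMap.coe_injective ((stdBasis m).ext fun i => ?_)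
    exact congrFun (congrArg Subtype.val (hx' i)) ⟨e, he⟩
  refine ⟨r, ⟨k.source ∩ k ⁻¹' ((img k V : Set (RE m)) ∩ zext s.1 ⁻¹' {algebraMap ℝ _ r}),
    k.isOpen_inter_preimage hopen⟩, ⟨hV x.2, hkx, ?_⟩, fun x' hx' => ?_⟩
  · show zext s.1 (k x) = _
    exact (zext_of_mem s.1 ⟨k x, hkx⟩).trans hr
  · obtain ⟨-, he, hz⟩ := hx'
    have hz' : s.1 ⟨k x', he⟩ = algebraMap ℝ _ r := (zext_of_mem s.1 ⟨k x', he⟩).symm.trans hz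
    rw [evX_apply, trivX_symm_apply]
    exact (congrArg _ hz').trans (AlgHom.commutes _ _)

/-- On a connected slice, a function with vanishing differential is a constant. -/
lemma mem_constants_of_der_eq_zero [ConnectedSpace X] (hι : IsRealSlice (m := m) ι)
    {f : GammaX (m := m) ι}
    (h : ∀ x : X, ∃ (k : RChart m X) (hk : k ∈ atlas (RE m) X) (V : Opens X)
      (hV : V ≤ domX k), x ∈ V ∧ ∀ a, (sliceCoords hι hk hV).d a (resX ι le_top f) = 0) :
    f ∈ constants (m := m) ι := by
  have hloc : ∀ x : X, ∃ (r : ℝ) (U : Opens X), x ∈ U ∧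
      ∀ x' ∈ U, evX ι ⊤ ⟨x', trivial⟩ f = algebraMap ℝ _ r := fun x => by
    obtain ⟨k, hk, V, hV, hxV, hd⟩ := h x
    obtain ⟨r, V', hx', hr⟩ := exists_locally_const hι hk hV (fun i => hd (Sum.inl i))
      (fun i => hd (Sum.inr i)) ⟨x, hxV⟩
    exact ⟨r, V ⊓ V', ⟨hxV, hx'⟩, fun x' hx' => hr ⟨x', hx'.1⟩ hx'.2⟩
  choose g U hU hg using hloc
  have hgl : IsLocallyConstant g := (IsLocallyConstant.iff_exists_open g).2 fun x =>
    ⟨U x, (U x).isOpen, hU x, fun x' hx' => (ExteriorAlgebra.algebraMap_leftInverse _).injective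
      ((hg x' x' (hU x')).symm.trans (hg x x' hx'))⟩
  obtain ⟨r, rfl⟩ := hgl.exists_eq_const
  refine Submodule.mem_span_singleton.mpr ⟨r, ext_evX fun x => ?_⟩
  rw [evX_smul, map_one, ← Algebra.algebraMap_eq_smul_one]
  exact (hg (x : X) x (hU x)).symm

end Constant

/-! ### Parity -/

section Parity

variable {B : Type*} [Ring B] [Algebra ℝ B] {σ : B →ₐ[ℝ] B} {m : ℕ} {p s : Fin 2}

/-- The component of parity `1 - p` of an element of a superalgebra. -/
def oppPart (σ : B →ₐ[ℝ] B) (p : Fin 2) : B →ₗ[ℝ] B :=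
  (1 / 2 : ℝ) • (LinearMap.id - (-1 : ℝ) ^ (p : ℕ) • σ.toLinearMap)

lemma oppPart_apply (p : Fin 2) (b : B) :
    oppPart σ p b = (1 / 2 : ℝ) • (b - (-1 : ℝ) ^ (p : ℕ) • σ b) := rfl

lemma neg_one_pow_mul_self (p : ℕ) : (-1 : ℝ) ^ p * (-1 : ℝ) ^ p = 1 := by
  rw [← mul_pow]; norm_num

lemma parity_oppPart (hσ : IsSuperComm σ) (p : Fin 2) (b : B) :
    σ (oppPart σ p b) = -((-1 : ℝ) ^ (p : ℕ) • oppPart σ p b) := by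
  rw [oppPart_apply, map_smul, map_sub, map_smul, hσ.invol,
    smul_comm ((-1 : ℝ) ^ (p : ℕ)) (1 / 2 : ℝ), ← smul_neg]
  congr 1
  rw [smul_sub, smul_smul, neg_one_pow_mul_self, one_smul, neg_sub]

lemma oppPart_eq_self {b : B} (h : σ b = -((-1 : ℝ) ^ (p : ℕ) • b)) : oppPart σ p b = b := by
  rw [oppPart_apply, h, smul_neg, smul_smul, neg_one_pow_mul_self, one_smul, sub_neg_eq_add,
    ← two_smul ℝ b, smul_smul]
  norm_num

lemma oppPart_eq_zero {q : Fin 2} (hpq : q ≠ p) {b : B} (h : σ b = -((-1 : ℝ) ^ (q : ℕ) • b)) :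
    oppPart σ p b = 0 := by
  have h1 : (-1 : ℝ) ^ (p : ℕ) * (-1 : ℝ) ^ (q : ℕ) = -1 := by
    fin_cases p <;> fin_cases q <;> simp_all
  rw [oppPart_apply, h, smul_neg, smul_smul, h1, neg_smul, one_smul, neg_neg, sub_self, smul_zero]

lemma oppPart_add (b : B) : oppPart σ 0 b + oppPart σ 1 b = b := by
  rw [oppPart_apply, oppPart_apply, ← smul_add]
  simp only [Fin.val_zero, Fin.val_one, pow_zero, pow_one, neg_smul, one_smul, sub_neg_eq_add]
  rw [sub_add_add_cancel, ← two_smul ℝ b, smul_smul]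
  norm_num

lemma IsVF.parity_apply {w : B →ₗ[ℝ] B} (hw : IsVF σ p w) (b : B) :
    σ (w b) = (-1 : ℝ) ^ (p : ℕ) • w (σ b) := by
  rw [hw.2, smul_smul, neg_one_pow_mul_self, one_smul]

lemma IsVF.apply_oppPart {w : B →ₗ[ℝ] B} (hw : IsVF σ s w) {b : B}
    (h : σ (w b) = -((-1 : ℝ) ^ ((s : ℕ) + p) • w b)) : w (oppPart σ p b) = w b := by
  have h1 : w (σ b) = -((-1 : ℝ) ^ (p : ℕ) • w b) := by
    rw [hw.2, h, smul_neg, smul_smul, pow_add, ← mul_assoc, neg_one_pow_mul_self, one_mul]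
  rw [oppPart_apply, map_smul, map_sub, map_smul, h1, smul_neg, smul_smul, neg_one_pow_mul_self,
    one_smul, sub_neg_eq_add, ← two_smul ℝ (w b), smul_smul]
  norm_num

/-- `η(w, v)` has the parity opposite to that of `w v`. -/
lemma HolData.parity_eta {S : Type*} [Ring S] [Algebra ℝ S] {τ : S →ₐ[ℝ] S} {h : HolData m S}
    (hh : h.IsHomogeneous τ) {r : S → B} (hr : ∀ t, σ (r t) = r (τ t)) (hr0 : ∀ t, r (-t) = -r t)
    {w : B →ₗ[ℝ] B} (hw : IsVF σ s w) {v : S →ₗ[ℝ] B}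
    (hv : ∀ t, v (τ t) = (-1 : ℝ) ^ (p : ℕ) • σ (v t)) :
    σ (h.eta σ r w v) = -((-1 : ℝ) ^ ((s : ℕ) + p) • h.eta σ r w v) := by
  have hv' : ∀ t, σ (v t) = (-1 : ℝ) ^ (p : ℕ) • v (τ t) := fun t => by
    rw [hv, smul_smul, neg_one_pow_mul_self, one_smul]
  have key : ∀ {x ψ : S}, τ x = x → τ ψ = -ψ →
      σ (w (r ψ) * σ (v x) - w (r x) * v ψ) =
        -((-1 : ℝ) ^ ((s : ℕ) + p) • (w (r ψ) * σ (v x) - w (r x) * v ψ)) := fun {x ψ} hx hψ => by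
    rw [map_sub, map_mul, map_mul, hw.parity_apply, hw.parity_apply, hr, hr, hx, hψ, hr0, hv' x, hx,
      hv' ψ, hψ, map_neg, map_neg, map_smul, hv' x, hx, pow_add]
    simp only [smul_mul_assoc, mul_smul_comm, smul_smul, smul_sub, smul_neg, neg_mul, mul_neg,
      neg_sub, sub_neg_eq_add, mul_assoc]
    rw [neg_add_eq_sub, ← mul_assoc, neg_one_pow_mul_self, one_mul, mul_comm, mul_one]
  rw [HolData.eta, map_sum, smul_sum, ← Finset.sum_neg_distrib]
  refine sum_congr rfl fun α _ => ?_
  rw [map_add, key (hh.x α) (hh.ψ α), key (hh.x' α) (hh.ψ' α), smul_add, neg_add]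

lemma SuperCoords.parity_bvDiv (hσ : IsSuperComm σ) (q : SuperCoords B σ m) {ρ : B} (hρ : σ ρ = ρ)
    {H : B →ₗ[ℝ] B} (hH : IsVF σ p H) :
    σ (q.bvDiv ρ H) = (-1 : ℝ) ^ (p : ℕ) • q.bvDiv ρ H := by
  rw [SuperCoords.bvDiv, map_add, map_sum, map_sum, smul_add, smul_sum, smul_sum]
  congr 1
  · refine sum_congr rfl fun i _ => ?_
    rw [(q.dx_isVF i).parity_apply, map_mul, hH.parity_apply, q.x_even, hρ, smul_mul_assoc,
      map_smul]
    simp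
  · refine sum_congr rfl fun j _ => ?_
    rw [(q.dξ_isVF j).parity_apply, map_mul, hσ.invol, hρ, hH.parity_apply, q.ξ_odd, map_neg,
      smul_neg, neg_mul, map_neg, smul_mul_assoc, map_smul, Fin.val_one, pow_one, neg_smul, one_smul,
      smul_neg, smul_smul, neg_one_pow_mul_self, one_smul]

end Parity

section BVParity

variable {hΩ : IsHolomorphicForm Ω} {p : Fin 2} {f : GammaX (m := m) ι}

/-- The Batalin–Vilkovisky operator is odd. -/
lemma parity_bvGlobal (hS : IsSpecialSlice ι Ω) (hf : parityX ι ⊤ f = -((-1 : ℝ) ^ (p : ℕ) • f)) :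
    parityX ι ⊤ (bvGlobal hΩ hS f) = (-1 : ℝ) ^ (p : ℕ) • bvGlobal hΩ hS f := by
  refine ext_resX_charts fun c hc k hk V hVc hVk => ?_
  have hB := isSuperCommX (m := m) ι V
  have hg : parityX ι V (densX hΩ hS.slice hk hVk ^ 2) = densX hΩ hS.slice hk hVk ^ 2 := by
    rw [map_pow, (adapted (hΩ := hΩ) (hc := hc) hS hk hVk hVc).even_g hB]
  have hf' : parityX ι V (resX ι le_top f) = -((-1 : ℝ) ^ (p : ℕ) • resX ι le_top f) := by
    rw [← resX_parity, hf, map_neg, resX_smul]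
  have hu : IsUnit (densX hΩ hS.slice hk hVk ^ 2) :=
    (isUnit_densX hΩ hS.slice hk hVk hS.ne_zero hS.im_eq_zero).pow 2
  have h1 := (map_ringInverse (parityX ι V).toRingHom hu).trans (congrArg Ring.inverse hg)
  rw [resX_parity, resX_smul, resX_bvGlobal hS hk hVk, bvLoc, SuperCoords.bvOp_apply, map_mul,
    map_smul, SuperCoords.parity_bvDiv hB _ hg ((sliceCoords hS.slice hk hVk).ham_isVF hB hf'),
    smul_comm, mul_smul_comm]
  exact congrArg (fun u => (-1 : ℝ) ^ (p : ℕ) • (u * _)) h1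

lemma bvGlobal_oppPart (hS : IsSpecialSlice ι Ω) (hf : bvGlobal hΩ hS f = 0) (p : Fin 2) :
    bvGlobal hΩ hS (oppPart (parityX ι ⊤) p f) = 0 := by
  have hB := isSuperCommX (m := m) ι ⊤
  have h0 := parity_bvGlobal (hΩ := hΩ) hS (parity_oppPart hB 0 f)
  have h1 := parity_bvGlobal (hΩ := hΩ) hS (parity_oppPart hB 1 f)
  have h : bvGlobal hΩ hS (oppPart (parityX ι ⊤) 0 f) = -bvGlobal hΩ hS (oppPart (parityX ι ⊤) 1 f) := by
    rw [eq_neg_iff_add_eq_zero, ← map_add, oppPart_add, hf]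
  rw [h, map_neg, h1] at h0
  simp only [Fin.val_zero, Fin.val_one, pow_zero, pow_one, neg_smul, one_smul, neg_neg] at h0
  have h2 : bvGlobal hΩ hS (oppPart (parityX ι ⊤) 1 f) = 0 := by
    have h3 : (2 : ℝ) • bvGlobal hΩ hS (oppPart (parityX ι ⊤) 1 f) = 0 := by
      rw [two_smul]
      nth_rewrite 1 [h0]
      exact neg_add_cancel _
    exact (smul_eq_zero.mp h3).resolve_left two_ne_zero
  fin_cases p
  · exact h.trans (by rw [h2, neg_zero])
  · exact h2

end BVParity

/-! ### Special Lagrangian deformations and the kernel of `Δ` -/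

section Eta

variable {R S : Type*} [Ring R] [Algebra ℝ R] [Ring S] [Algebra ℝ S] {m : ℕ} (h : HolData m S)
  (σ : R →ₐ[ℝ] R) (r : S → R) (w : R →ₗ[ℝ] R)

lemma HolData.eta_add (v v' : S →ₗ[ℝ] R) :
    h.eta σ r w (v + v') = h.eta σ r w v + h.eta σ r w v' := by
  rw [HolData.eta, HolData.eta, HolData.eta, ← sum_add_distrib]
  refine sum_congr rfl fun α _ => ?_
  simp only [LinearMap.add_apply, map_add, mul_add]
  abel

lemma HolData.eta_smul (t : ℝ) (v : S →ₗ[ℝ] R) : h.eta σ r w (t • v) = t • h.eta σ r w v := by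
  rw [HolData.eta, HolData.eta, smul_sum]
  refine sum_congr rfl fun α _ => ?_
  simp only [LinearMap.smul_apply, map_smul, mul_smul_comm, smul_add, smul_sub]

end Eta

section Moduli

variable {hΩ : IsHolomorphicForm Ω} {p : Fin 2} {D D' : VFAlong (m := m) ι p} {f f' : GammaX (m := m) ι}

lemma Represents.add (h : Represents hΩ f D) (h' : Represents hΩ f' D') :
    Represents hΩ (f + f') (D + D') := fun c hc V hVc s w hw => by
  have h1 : (D + D').over hVc = D.over hVc + D'.over hVc :=
    LinearMap.ext fun t => map_add (resX ι hVc) _ _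
  rw [h1, HolData.eta_add, h c hc V hVc s w hw, h' c hc V hVc s w hw, map_add, map_add]

lemma Represents.smul (r : ℝ) (h : Represents hΩ f D) : Represents hΩ (r • f) (r • D) :=
  fun c hc V hVc s w hw => by
  have h1 : (r • D).over hVc = r • D.over hVc := LinearMap.ext fun t => rfl
  rw [h1, HolData.eta_smul, h c hc V hVc s w hw, resX_smul, map_smul]

lemma Represents.sub (h : Represents hΩ f D) (h' : Represents hΩ f' D') :
    Represents hΩ (f - f') (D - D') := by
  have h1 := h.add (h'.smul (-1))
  rwa [neg_smul, neg_smul, one_smul, one_smul, ← sub_eq_add_neg, ← sub_eq_add_neg] at h1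

lemma represents_one (hΩ : IsHolomorphicForm Ω) (p : Fin 2) :
    Represents hΩ (1 : GammaX (m := m) ι) (0 : VFAlong (m := m) ι p) := fun c hc V hVc s w hw => by
  have h1 : (0 : VFAlong (m := m) ι p).over hVc = (0 : ℝ) • 0 := by
    rw [zero_smul]
    exact LinearMap.ext fun t => map_zero (resX ι hVc)
  rw [h1, HolData.eta_smul, zero_smul, map_one, hw.map_one]

/-- On a connected slice, the zero vector field represents the constants only. -/
lemma represents_zero_iff [ConnectedSpace X] (hι : IsRealSlice (m := m) ι) :
    Represents hΩ f (0 : VFAlong (m := m) ι p) ↔ f ∈ constants (m := m) ι := by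
  constructor
  · intro h
    refine mem_constants_of_der_eq_zero hι fun x => ?_
    have hk : chartAt (RE m) x ∈ atlas (RE m) X := chart_mem_atlas _ _
    have hc : chartAt (CE m) (ι x) ∈ atlas (CE m) Y := chart_mem_atlas _ _
    set V : Opens X := domX (chartAt (RE m) x) ⊓ pre ι (dom (chartAt (CE m) (ι x)))
    have hVk : V ≤ domX (chartAt (RE m) x) := inf_le_left
    have hVc : V ≤ pre ι (dom (chartAt (CE m) (ι x))) := inf_le_right
    refine ⟨_, hk, V, hVk, ⟨mem_chart_source _ _, mem_chart_source _ _⟩, fun a => ?_⟩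
    have h1 : (0 : VFAlong (m := m) ι p).over hVc = (0 : ℝ) • 0 := by
      rw [zero_smul]
      exact LinearMap.ext fun t => map_zero (resX ι hVc)
    rw [← h _ hc V hVc _ _ ((sliceCoords hι hk hVk).d_isVF a), h1, HolData.eta_smul, zero_smul]
  · intro h
    obtain ⟨r, rfl⟩ := Submodule.mem_span_singleton.mp h
    have h1 := (represents_one (ι := ι) hΩ p).smul r
    rwa [smul_zero] at h1

/-- A vector field of parity `p` sees only the component of parity `1 - p` of its potential. -/
lemma Represents.opp (h : Represents hΩ f D) : Represents hΩ (oppPart (parityX ι ⊤) p f) D :=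
  fun c hc V hVc s w hw => by
  have h0 := h c hc V hVc s w hw
  have h1 : resX ι le_top (oppPart (parityX ι ⊤) p f) =
      oppPart (parityX ι V) p (resX ι le_top f) := by
    rw [oppPart_apply, oppPart_apply, resX_smul, map_sub, resX_smul, resX_parity]
  have h2 := HolData.parity_eta (isHomogeneous_holData hΩ hc)
    (r := fun t => resX ι hVc (restr ι (dom c) t)) (fun t => (restrTo_parity hVc t).symm)
    (fun t => by rw [map_neg, map_neg]) hw (D.over_isSuperDer hVc).2
  rw [h0] at h2
  rw [h0, h1, IsVF.apply_oppPart hw h2]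

/-- The deformation of parity `p` given by a function: the class of `i H_f`, where `f` is replaced
by its component of parity `1 - p`. -/
def deform (hΩ : IsHolomorphicForm Ω) (hS : IsSpecialSlice ι Ω) (p : Fin 2)
    (f : GammaX (m := m) ι) : NormalSections (m := m) ι p :=
  (tangential (m := m) ι p).mkQ (rotated hΩ hS (parity_oppPart (isSuperCommX ι ⊤) p f))

/-- Vector fields along the slice are determined, modulo tangential ones, by their potential. -/
lemma mkQ_eq_deform_iff (hΩ : IsHolomorphicForm Ω) (hS : IsSpecialSlice ι Ω) :
    (tangential (m := m) ι p).mkQ D = deform hΩ hS p f ↔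
      Represents hΩ (oppPart (parityX ι ⊤) p f) D := by
  have h1 := represents_rotated hΩ hS (parity_oppPart (isSuperCommX (m := m) ι ⊤) p f)
  refine ⟨fun h => ?_, fun h => ?_⟩
  · have h2 := ((mem_tangential_iff hΩ hS).mp ((Submodule.Quotient.eq _).mp h)).add h1
    rwa [zero_add, sub_add_cancel] at h2
  · refine (Submodule.Quotient.eq _).mpr ((mem_tangential_iff hΩ hS).mpr ?_)
    have h2 := h.sub h1
    rwa [sub_self] at h2

/-- The map `f ↦ i H_f` from functions to normal sections of parity `p`. -/
def deformL (hΩ : IsHolomorphicForm Ω) (hS : IsSpecialSlice ι Ω) (p : Fin 2) :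
    GammaX (m := m) ι →ₗ[ℝ] NormalSections (m := m) ι p where
  toFun := deform hΩ hS p
  map_add' f f' := by
    have h := ((mkQ_eq_deform_iff hΩ hS (p := p) (f := f)).mp rfl).add
      ((mkQ_eq_deform_iff hΩ hS (f := f')).mp rfl)
    rw [← map_add (oppPart (parityX ι ⊤) p)] at h
    exact ((mkQ_eq_deform_iff hΩ hS).mpr h).symm
  map_smul' r f := by
    have h := ((mkQ_eq_deform_iff hΩ hS (p := p) (f := f)).mp rfl).smul r
    rw [← map_smul (oppPart (parityX ι ⊤) p)] at h
    exact ((mkQ_eq_deform_iff hΩ hS).mpr h).symm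

lemma deformL_eq_zero_iff [ConnectedSpace X] (hΩ : IsHolomorphicForm Ω) (hS : IsSpecialSlice ι Ω) :
    deformL hΩ hS p f = 0 ↔ oppPart (parityX ι ⊤) p f ∈ constants (m := m) ι := by
  rw [← represents_zero_iff (hΩ := hΩ) (p := p) hS.slice, ← mkQ_eq_deform_iff hΩ hS, map_zero]
  exact eq_comm

/-- The map `f ↦ i H_f` from functions modulo constants to normal sections of parity `p`. -/
def deformQ [ConnectedSpace X] (hΩ : IsHolomorphicForm Ω) (hS : IsSpecialSlice ι Ω) (p : Fin 2) :
    (GammaX (m := m) ι ⧸ constants (m := m) ι) →ₗ[ℝ] NormalSections (m := m) ι p :=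
  (constants (m := m) ι).liftQ (deformL hΩ hS p) fun f hf => by
    have h := (represents_zero_iff (hΩ := hΩ) (p := p) hS.slice).mpr hf
    exact (deformL_eq_zero_iff hΩ hS).mpr ((represents_zero_iff hS.slice).mp h.opp)

/-- The special Lagrangian deformations of parity `p` are the classes of `i H_f` with `Δ f = 0`. -/
lemma mem_map_deformQ_iff [ConnectedSpace X] (hΩ : IsHolomorphicForm Ω) (hS : IsSpecialSlice ι Ω)
    (n : NormalSections (m := m) ι p) :
    n ∈ (LinearMap.ker (bvOperator hΩ hS)).map (deformQ hΩ hS p) ↔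
      IsSpecialLagrangianDeformation ι hΩ n := by
  constructor
  · rintro ⟨q, hq, rfl⟩
    obtain ⟨f, rfl⟩ := (constants (m := m) ι).mkQ_surjective q
    have h1 := represents_rotated hΩ hS (parity_oppPart (isSuperCommX (m := m) ι ⊤) p f)
    exact ⟨_, rfl, (isExactLagrangian_iff hS).mpr ⟨_, h1⟩, isRealSliceFamily hΩ hS _,
      (h1.isSpecialFamily_iff hS).mpr (bvGlobal_oppPart hS hq p)⟩
  · rintro ⟨D, rfl, hL, -, hD⟩
    obtain ⟨f, hf⟩ := (isExactLagrangian_iff hS).mp hL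
    exact ⟨(constants (m := m) ι).mkQ f, (hf.isSpecialFamily_iff hS).mp hD,
      ((mkQ_eq_deform_iff hΩ hS).mpr hf.opp).symm⟩

/-- The map `f ↦ i H_f` from the kernel of `Δ` to special Lagrangian deformations of both
parities. -/
def deformKer [ConnectedSpace X] (hΩ : IsHolomorphicForm Ω) (hS : IsSpecialSlice ι Ω) :
    LinearMap.ker (bvOperator hΩ hS) →ₗ[ℝ] ∀ p : Fin 2,
      (LinearMap.ker (bvOperator hΩ hS)).map (deformQ (m := m) (ι := ι) hΩ hS p) :=
  LinearMap.pi fun p => ((deformQ hΩ hS p).domRestrict _).codRestrict _ fun q =>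
    Submodule.mem_map_of_mem q.2

lemma bijective_deformKer [ConnectedSpace X] (hΩ : IsHolomorphicForm Ω) (hS : IsSpecialSlice ι Ω) :
    Function.Bijective (deformKer hΩ hS) := by
  have hB := isSuperCommX (m := m) ι ⊤
  constructor
  · refine (injective_iff_map_eq_zero _).mpr fun ⟨q, hq⟩ h => Subtype.ext ?_
    obtain ⟨f, rfl⟩ := (constants (m := m) ι).mkQ_surjective q
    have h1 : ∀ p, deformL hΩ hS p f = 0 := fun p => congrArg Subtype.val (congrFun h p)
    refine (Submodule.Quotient.mk_eq_zero _).mpr ?_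
    rw [← oppPart_add (σ := parityX ι ⊤) f]
    exact add_mem ((deformL_eq_zero_iff hΩ hS).mp (h1 0)) ((deformL_eq_zero_iff hΩ hS).mp (h1 1))
  · intro n
    have h : ∀ p, ∃ f : GammaX (m := m) ι, bvGlobal hΩ hS f = 0 ∧ deformL hΩ hS p f = (n p).1 :=
      fun p => by
      obtain ⟨q, hq, hqn⟩ := (n p).2
      obtain ⟨f, rfl⟩ := (constants (m := m) ι).mkQ_surjective q
      exact ⟨f, hq, hqn⟩
    choose f hf hfn using h
    set g := oppPart (parityX ι ⊤) 0 (f 0) + oppPart (parityX ι ⊤) 1 (f 1)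
    have hg : bvGlobal hΩ hS g = 0 := by
      rw [map_add, bvGlobal_oppPart hS (hf 0), bvGlobal_oppPart hS (hf 1), add_zero]
    have hgp : ∀ p, oppPart (parityX ι ⊤) p g =
        oppPart (parityX ι ⊤) p (f p) := fun p => by
      fin_cases p
      · exact (map_add _ _ _).trans ((congrArg₂ (· + ·) (oppPart_eq_self (parity_oppPart hB 0 _))
          (oppPart_eq_zero one_ne_zero (parity_oppPart hB 1 _))).trans (add_zero _))
      · exact (map_add _ _ _).trans ((congrArg₂ (· + ·)
          (oppPart_eq_zero zero_ne_one (parity_oppPart hB 0 _))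
          (oppPart_eq_self (parity_oppPart hB 1 _))).trans (zero_add _))
    refine ⟨⟨(constants (m := m) ι).mkQ g, hg⟩, funext fun p => Subtype.ext ?_⟩
    refine Eq.trans ?_ (hfn p)
    refine ((mkQ_eq_deform_iff hΩ hS).mpr ?_).symm
    rw [hgp]
    exact (mkQ_eq_deform_iff hΩ hS).mp rfl

/-- The homogeneous components of a deformation together represent the differential of `f`. -/
lemma representsDifferential_of_mkQ_eq [ConnectedSpace X] (hΩ : IsHolomorphicForm Ω)
    (hS : IsSpecialSlice ι Ω) (f : GammaX (m := m) ι) (D : ∀ p : Fin 2, VFAlong (m := m) ι p)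
    (hD : ∀ p, (tangential (m := m) ι p).mkQ (D p) = deformL hΩ hS p f) :
    RepresentsDifferential ι hΩ f D := fun c hc V hVc s w hw => by
  have h0 := (mkQ_eq_deform_iff hΩ hS).mp (hD 0) c hc V hVc s w hw
  have h1 := (mkQ_eq_deform_iff hΩ hS).mp (hD 1) c hc V hVc s w hw
  have h2 : (resX ι hVc).toLinearMap ∘ₗ ((D 0).1 (dom c) + (D 1).1 (dom c)) =
      (D 0).over hVc + (D 1).over hVc := LinearMap.comp_add _ _ _
  rw [h2, HolData.eta_add, h0, h1, ← map_add, ← map_add, oppPart_add]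

end Moduli

end Slice

end SpecialSlice

end

theorem mainTheorem3 (m : ℕ)
    (Y : Type*) [TopologicalSpace Y] [T2Space Y] [ChartedSpace (EuclideanSpace ℂ (Fin m)) Y]
    [IsManifold 𝓘(ℂ, EuclideanSpace ℂ (Fin m)) ω Y]
    (X : Type*) [TopologicalSpace X] [T2Space X] [CompactSpace X] [ConnectedSpace X]
    [ChartedSpace (EuclideanSpace ℝ (Fin m)) X]
    [IsManifold 𝓘(ℝ, EuclideanSpace ℝ (Fin m)) ∞ X]
    (ι : C(X, Y)) (hι : SpecialSlice.IsRealSlice (m := m) ι)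
    (Ω : ∀ y : Y, (TangentSpace 𝓘(ℂ, EuclideanSpace ℂ (Fin m)) y) [⋀^Fin m]→ₗ[ℂ] ℂ)
    (hΩ : SpecialSlice.IsHolomorphicForm Ω) (hΩ0 : ∀ y, Ω y ≠ 0)
    (hIm : ∀ (x : X) (u : Fin m → TangentSpace 𝓘(ℝ, EuclideanSpace ℝ (Fin m)) x),
      (Ω (ι x) fun k => SpecialSlice.diff (m := m) ι x (u k)).im = 0) :
    ∃ Δ : (SpecialSlice.GammaX (m := m) ι ⧸ SpecialSlice.constants (m := m) ι) →ₗ[ℝ]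
        SpecialSlice.GammaX (m := m) ι,
      SpecialSlice.IsBVOperator ι hΩ Δ ∧
      (∀ Δ', SpecialSlice.IsBVOperator ι hΩ Δ' → Δ' = Δ) ∧
      ∃ T : ∀ p : Fin 2, Submodule ℝ (SpecialSlice.NormalSections (m := m) ι p),
        (∀ p n, n ∈ T p ↔ SpecialSlice.IsSpecialLagrangianDeformation ι hΩ n) ∧
        ∃ e : LinearMap.ker Δ ≃ₗ[ℝ] (∀ p : Fin 2, T p),
          ∀ (f : SpecialSlice.GammaX (m := m) ι)
            (hf : (SpecialSlice.constants (m := m) ι).mkQ f ∈ LinearMap.ker Δ)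
            (D : ∀ p : Fin 2, SpecialSlice.VFAlong (m := m) ι p),
            (∀ p, (SpecialSlice.tangential (m := m) ι p).mkQ (D p) =
              (e ⟨(SpecialSlice.constants (m := m) ι).mkQ f, hf⟩ p :
                SpecialSlice.NormalSections (m := m) ι p)) →
            SpecialSlice.RepresentsDifferential ι hΩ f D := by
  have hS : SpecialSlice.IsSpecialSlice ι Ω := ⟨hι, hΩ0, hIm⟩
  refine ⟨SpecialSlice.bvOperator hΩ hS, SpecialSlice.isBVOperator_bvOperator hΩ hS,
    fun Δ' => SpecialSlice.eq_bvOperator hΩ hS,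
    fun p => (LinearMap.ker (SpecialSlice.bvOperator hΩ hS)).map (SpecialSlice.deformQ hΩ hS p),
    fun p n => SpecialSlice.mem_map_deformQ_iff hΩ hS n,
    LinearEquiv.ofBijective (SpecialSlice.deformKer hΩ hS) (SpecialSlice.bijective_deformKer hΩ hS),
    fun f hf D hD => SpecialSlice.representsDifferential_of_mkQ_eq hΩ hS f D hD⟩
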